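/- Let $k$ be a field of characteristic zero and $H$ a cocommutative Hopf algebra over $k$ with bijective antipode $S$, $\Delta(h)=h^{(1)}\otimes h^{(2)}$. Let $M$ be a left-left stable anti-Yetter--Drinfeld (SAYD) module: a left $H$-module with a (coassociative, counital) left coaction $\varphi_M(m)=m^{(-1)}\otimes m^{(0)}$ such that $\varphi_M(hm)=h^{(1)}m^{(-1)}S^{-1}(h^{(3)})\otimes h^{(2)}m^{(0)}$ and $m^{(-1)}m^{(0)}=m$. Let $\psi:M\to M\otimes M$ be a linear map with $$\psi(h\cdot m)=\Delta(h)\cdot\psi(m),\qquad (\Delta\otimes\psi)\circ\varphi_M=\varphi_{M\otimes M}\circ\psi ,$$ where $M\otimes M$ is the $H\otimes H$-module and comodule with $(a\otimes b)(m\otimes m')=am\otimes bm'$ and $\varphi_{M\otimes M}(m\otimes m')=(m^{(-1)}\otimes m'^{(-1)})\otimes(m^{(0)}\otimes m'^{(0)})$. Let $C=\widetilde C(H,M)$ be the cyclic module $C_n=H^{\otimes n+1}\,\square_H\,M$ (with the diagonal right coaction on $H^{\otimes n+1}$), with $$\delta_i(h_0\otimes\dots\otimes h_n\otimes m)=h_0\otimes\dots\otimes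 h_ih_{i+1}\otimes\dots\otimes h_n\otimes m\ (0\le i<n),\qquad \delta_n=\delta_0\tau_n,$$ $$\tau_n(h_0\otimes\dots\otimes h_n\otimes m)=h_n^{(1)}\otimes h_0\otimes\dots\otimes h_{n-1}\otimes h_n^{(2)}m,$$ and with $\sigma_i$ inserting $1$ after $h_i$ $(0\le i\le n)$. Write $\bar C$ for its normalized mixed complex $(\bar C,b,B)$. Dual Hopf Hochschild, cyclic and periodic cyclic homology $\widetilde{HH}_n(H,M)$, $\widetilde{HC}_n(H,M)$, $\widetilde{HP}_\epsilon(H,M)$ ($\epsilon\in\mathbb Z/2$) are the homologies of $(\bar C,b)$, of $\mathrm{Tot}_n=\bar C_n\oplus\bar C_{n-2}\oplus\cdots$ with $b+B$, and of $\prod_{m\equiv\epsilon}\bar C_m$ with $b+B$. Tensor products of complexes and of mixed complexes carry the usual Koszul signs. Put $\Phi_n=\Delta^{\otimes n+1}\otimes\psi$ and $\Omega_n\big((h_0\otimes g_0)\otimes\dots\otimes(h_n\otimes g_n)\otimes(m\otimes m')\big)=(h_0\otimes\dots\otimes h_n\otimes m)\otimes(g_0\otimes\dots\otimes g_n\otimes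 m')$. Let $AW=\sum_{p+q=n}\delta_{p+1}\cdots\delta_n\otimes\delta_0\cdots\delta_0:C_n\otimes C_n\to\bigoplus_{p+q=n}\bar C_p\otimes\bar C_q$ (with $p$ factors $\delta_0$). Let $\varphi_n:C_n\otimes C_n\to C_{n+1}\otimes C_{n+1}$ be $$\varphi_n=\sum(-1)^{r+\sum_i(\alpha_i-i+1)}\,s_{\beta_q+r}\cdots s_{\beta_1+r}s_{r-1}\delta_{n-q+1}\cdots\delta_n\otimes s_{\alpha_{p+1}+r}\cdots s_{\alpha_1+r}\delta_r\cdots\delta_{n-q-1},\qquad r=n-p-q,$$ where $s_i=\sigma_i$, the sum is over $0\le q\le n-1$, $0\le p\le n-q-1$ and the partitions of $\{0,\dots,p+q\}$ into $\alpha_1<\dots<\alpha_{p+1}$ and $\beta_1<\dots<\beta_q$; and let $\widetilde{AW}=\sum_{a\ge0}AW\circ(-B\varphi)^a$ (the $a$-th term raises the degree by $2a$, $B$ being that of the product cyclic module $n\mapsto C_n\otimes C_n$). Then $\Phi_n$ maps $C_n$ into $(H\otimes H)^{\otimes n+1}\,\square_{H\otimes H}\,(M\otimes M)$, and $\Omega_n\Phi_n$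 maps $C_n$ into $C_n\otimes C_n$. Moreover: 1. $AW\,\Omega\,\Phi$ induces a map of complexes $(\bar C,b)\to(\bar C,b)\otimes(\bar C,b)$; the Künneth map $[\alpha]\otimes[\beta]\mapsto[\alpha\otimes\beta]$ is bijective; and $(AW\,\Omega\,\Phi)_*$ followed by its inverse is a well-defined coproduct $\sqcup:\widetilde{HH}_n(H,M)\to\bigoplus_{p+q=n}\widetilde{HH}_p(H,M)\otimes\widetilde{HH}_q(H,M)$ for all $n\ge0$. 2. $\widetilde{AW}\,\Omega\,\Phi$, applied to all components of $\mathrm{Tot}$, induces a map of complexes $\mathrm{Tot}(\bar C)\to\mathrm{Tot}(\bar C\otimes\bar C)$. Composing the map it induces on homology with the map induced by $\mathcal I:\mathrm{Tot}(\bar C\otimes\bar C)\to\mathrm{Tot}(\bar C)\otimes\mathrm{Tot}(\bar C)$, $v^n(x\otimes y)\mapsto\sum_{i+j=n}u^ix\otimes u'^jy$, and with the inverse of the (bijective) Künneth map gives a well-defined coproduct $\sqcup:\widetilde{HC}_n(H,M)\to\bigoplus_{p+q=n}\widetilde{HC}_p(H,M)\otimes\widetilde{HC}_q(H,M)$ for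 all $n\ge0$. 3. Suppose that for every $n$ the images of $S^a:\widetilde{HC}_{n+2a}(H,M)\to\widetilde{HC}_n(H,M)$ ($S$ Connes' periodicity map) are stationary for large $a$ (Mittag-Leffler condition) and that $\widetilde{HP}_*(H,M)$ is finite dimensional. Then $\widetilde{AW}\,\Omega\,\Phi$ induces a map of supercomplexes $\prod_m\bar C_m\to\prod_m(\bar C\otimes\bar C)_m$; the map $\nabla:\bigoplus_{\epsilon'+\epsilon''=\epsilon}\widetilde{HP}_{\epsilon'}(H,M)\otimes\widetilde{HP}_{\epsilon''}(H,M)\to HP_\epsilon(\bar C\otimes\bar C)$ induced by $\{\xi_i\}\otimes\{\xi'_j\}\mapsto\{\sum_{i+j=n}\xi_i\otimes\xi'_j\}_n$ is bijective; and $(\widetilde{AW}\,\Omega\,\Phi)_*$ followed by its inverse is a well-defined coproduct $\sqcup:\widetilde{HP}_\epsilon(H,M)\to\bigoplus_{\epsilon'+\epsilon''=\epsilon}\widetilde{HP}_{\epsilon'}(H,M)\otimes\widetilde{HP}_{\epsilon''}(H,M)$ for $\epsilon=0,1$. -/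

import Mathlib

open scoped TensorProduct

universe u v

namespace HopfCyc

/-- A cyclic module over `k`: faces `d n i : C (n+1) → C n` (`i ≤ n + 1`), degeneracies
`s n i : C n → C (n+1)` (`i ≤ n`) and cyclic operators `t n : C n → C n`. Indices are natural
numbers; the values outside of the indicated range are irrelevant and are never used. -/
structure CyclicModule (k : Type u) [Field k] where
  C : ℕ → Type v
  [acg : ∀ n, AddCommGroup (C n)]
  [mod : ∀ n, Module k (C n)]
  d : ∀ n (_ : ℕ), C (n + 1) →ₗ[k] C n
  s : ∀ n (_ : ℕ), C n →ₗ[k] C (n + 1)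
  t : ∀ n, C n →ₗ[k] C n
  d_d : ∀ n i j, i < j → j ≤ n + 2 → ∀ x, d n i (d (n + 1) j x) = d n (j - 1) (d (n + 1) i x)
  s_s : ∀ n i j, i ≤ j → j ≤ n → ∀ x, s (n + 1) i (s n j x) = s (n + 1) (j + 1) (s n i x)
  d_s_lt : ∀ n i j, i < j → j ≤ n + 1 → ∀ x,
    d (n + 1) i (s (n + 1) j x) = s n (j - 1) (d n i x)
  d_s_self : ∀ n i, i ≤ n → ∀ x, d n i (s n i x) = x
  d_s_succ : ∀ n i, i ≤ n → ∀ x, d n (i + 1) (s n i x) = x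
  d_s_gt : ∀ n i j, j + 1 < i → i ≤ n + 2 → ∀ x,
    d (n + 1) i (s (n + 1) j x) = s n j (d n (i - 1) x)
  t_pow : ∀ n x, (t n ^ (n + 1)) x = x
  d_zero_t : ∀ n x, d n 0 (t (n + 1) x) = d n (n + 1) x
  d_succ_t : ∀ n i, i ≤ n → ∀ x, d n (i + 1) (t (n + 1) x) = t n (d n i x)
  s_zero_t : ∀ n x, s n 0 (t n x) = t (n + 1) (t (n + 1) (s n n x))
  s_succ_t : ∀ n i, i + 1 ≤ n → ∀ x, s n (i + 1) (t n x) = t (n + 1) (s n i x)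

attribute [instance] CyclicModule.acg CyclicModule.mod

/-- A mixed complex over `k`. -/
structure MixedComplex (k : Type u) [Field k] where
  X : ℕ → Type v
  [acg : ∀ n, AddCommGroup (X n)]
  [mod : ∀ n, Module k (X n)]
  b : ∀ n, X (n + 1) →ₗ[k] X n
  B : ∀ n, X n →ₗ[k] X (n + 1)
  b_b : ∀ n x, b n (b (n + 1) x) = 0
  B_B : ∀ n x, B (n + 1) (B n x) = 0
  b_B_zero : ∀ x, b 0 (B 0 x) = 0
  b_B : ∀ n x, b (n + 1) (B (n + 1) x) + B n (b n x) = 0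

attribute [instance] MixedComplex.acg MixedComplex.mod

namespace CyclicModule

variable {k : Type u} [Field k] (C : CyclicModule.{u, v} k)

/-- The signed cyclic operator `(-1)^n t_n`. -/
def τ (n : ℕ) : C.C n →ₗ[k] C.C n := ((-1 : k) ^ n) • C.t n

/-- The norm operator `N = 1 + τ + ⋯ + τ^n` on `C_n`. -/
def norm (n : ℕ) : C.C n →ₗ[k] C.C n := ∑ j ∈ Finset.range (n + 1), C.τ n ^ j

/-- The extra degeneracy `t_{n+1} s_n`. -/
def extra (n : ℕ) : C.C n →ₗ[k] C.C (n + 1) := C.t (n + 1) ∘ₗ C.s n n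

/-- The Hochschild differential `b = ∑ (-1)^i d_i`. -/
def b (n : ℕ) : C.C (n + 1) →ₗ[k] C.C n := ∑ i ∈ Finset.range (n + 2), ((-1 : k) ^ i) • C.d n i

/-- The differential `b'`, where the last face is left out. -/
def b' (n : ℕ) : C.C (n + 1) →ₗ[k] C.C n := ∑ i ∈ Finset.range (n + 1), ((-1 : k) ^ i) • C.d n i

/-- Connes' operator `B = (1 - τ) s N`, where `s` is the extra degeneracy. -/
def B (n : ℕ) : C.C n →ₗ[k] C.C (n + 1) :=
  (LinearMap.id - C.τ (n + 1)) ∘ₗ C.extra n ∘ₗ C.norm n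

/-- The submodule of degenerate chains. -/
def degen : ∀ n, Submodule k (C.C n)
  | 0 => ⊥
  | n + 1 => ⨆ i : Fin (n + 1), LinearMap.range (C.s n i)

lemma s_mem_degen {n i : ℕ} (hi : i ≤ n) (x : C.C n) : C.s n i x ∈ C.degen (n + 1) :=
  Submodule.mem_iSup_of_mem (⟨i, by omega⟩ : Fin (n + 1)) ⟨x, rfl⟩

lemma degen_succ_le {n : ℕ} {P : Submodule k (C.C (n + 1))}
    (h : ∀ i ≤ n, ∀ x, C.s n i x ∈ P) : C.degen (n + 1) ≤ P := by
  refine iSup_le fun i => ?_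
  rintro _ ⟨x, rfl⟩
  exact h i (by omega) x

lemma b_b (n : ℕ) (x : C.C (n + 2)) : C.b n (C.b (n + 1) x) = 0 := by
  simp only [b, LinearMap.sum_apply, LinearMap.smul_apply, map_sum, map_smul, Finset.smul_sum]
  rw [← Finset.sum_product']
  refine Finset.sum_involution (s := Finset.range (n + 3) ×ˢ Finset.range (n + 2))
    (fun p _ => if p.2 < p.1 then (p.2, p.1 - 1) else (p.2 + 1, p.1)) ?_ ?_ ?_ ?_
  · rintro ⟨j, i⟩ h
    simp only [Finset.mem_product, Finset.mem_range] at h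
    simp only [smul_smul]
    split_ifs with hij
    · rw [C.d_d n i j hij (by omega)]
      obtain ⟨j, rfl⟩ : ∃ a, j = a + 1 := ⟨j - 1, by omega⟩
      simp only [Nat.add_sub_cancel, ← add_smul]
      rw [pow_succ]; ring_nf; simp
    · rw [C.d_d n j (i + 1) (by omega) (by omega)]
      simp only [Nat.add_sub_cancel, ← add_smul]
      rw [pow_succ]; ring_nf; simp
  · rintro ⟨j, i⟩ h _ h'
    split_ifs at h' with hij <;> simp only [Prod.mk.injEq] at h' <;> omega
  · rintro ⟨j, i⟩ h
    simp only [Finset.mem_product, Finset.mem_range] at h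
    by_cases hij : i < j
    · simp only [if_pos hij, Finset.mem_product, Finset.mem_range]
      omega
    · simp only [if_neg hij, Finset.mem_product, Finset.mem_range]
      omega
  · rintro ⟨j, i⟩ h
    simp only [Finset.mem_product, Finset.mem_range] at h
    by_cases hij : i < j
    · simp only [if_pos hij]
      rw [if_neg (by omega)]
      simp only [Prod.mk.injEq, and_true]
      omega
    · simp only [if_neg hij]
      rw [if_pos (by omega)]
      simp

lemma b_degen (n : ℕ) : C.degen (n + 1) ≤ (C.degen n).comap (C.b n) := by
  refine C.degen_succ_le fun i hi x => ?_
  rw [Submodule.mem_comap]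
  let c : ℕ → C.C n := fun j => if j = i then (-1 : k) ^ j • x else
    if j = i + 1 then (-1 : k) ^ j • x else 0
  have hc : ∑ j ∈ Finset.range (n + 2), c j = 0 := by
    have h2 : ∀ j, c j = (if j = i then (-1 : k) ^ i • x else 0) +
        (if j = i + 1 then (-1 : k) ^ (i + 1) • x else 0) := by
      intro j
      simp only [c]
      split_ifs <;> first | omega | simp_all
    simp only [h2, Finset.sum_add_distrib, Finset.sum_ite_eq', Finset.mem_range]
    rw [if_pos (by omega), if_pos (by omega), pow_succ]
    simp
  have : C.b n (C.s n i x) =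
      ∑ j ∈ Finset.range (n + 2), ((-1 : k) ^ j • C.d n j (C.s n i x) - c j) := by
    rw [Finset.sum_sub_distrib, hc, sub_zero]
    simp [b]
  rw [this]
  refine Submodule.sum_mem _ fun j hj => ?_
  rw [Finset.mem_range] at hj
  simp only [c]
  by_cases h1 : j = i
  · subst h1
    simp [C.d_s_self n j hi]
  rw [if_neg h1]
  by_cases h2 : j = i + 1
  · subst h2
    simp [C.d_s_succ n i hi]
  rw [if_neg h2, sub_zero]
  refine Submodule.smul_mem _ _ ?_
  obtain _ | n := n
  · omega
  rcases lt_or_gt_of_ne h1 with h | h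
  · rw [C.d_s_lt n j i h (by omega)]
    exact C.s_mem_degen (by omega) _
  · rw [C.d_s_gt n j i (by omega) (by omega)]
    exact C.s_mem_degen (by omega) _

lemma τ_apply (n : ℕ) (x : C.C n) : C.τ n x = ((-1 : k) ^ n) • C.t n x := rfl

lemma τ_pow (n : ℕ) : C.τ n ^ (n + 1) = 1 := by
  ext x
  rw [τ, smul_pow, LinearMap.smul_apply, C.t_pow, ← pow_mul, mul_comm, Even.neg_one_pow]
  · simp
  · rw [mul_comm]; exact Nat.even_mul_succ_self n

lemma norm_eq (n : ℕ) : C.norm n = ∑ j ∈ Finset.range (n + 1), C.τ n ^ j := rfl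

lemma τ_mul_norm (n : ℕ) : C.τ n * C.norm n = C.norm n := by
  rw [norm_eq, Finset.mul_sum]
  simp only [← pow_succ']
  rw [Finset.sum_range_succ, τ_pow, Finset.sum_range_succ' (fun j => C.τ n ^ j) n, pow_zero]

lemma norm_mul_τ (n : ℕ) : C.norm n * C.τ n = C.norm n := by
  rw [norm_eq, Finset.sum_mul]
  simp only [← pow_succ]
  rw [Finset.sum_range_succ, τ_pow, Finset.sum_range_succ' (fun j => C.τ n ^ j) n, pow_zero]

lemma τ_norm (n : ℕ) (x : C.C n) : C.τ n (C.norm n x) = C.norm n x :=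
  congrArg (fun f => f x) (C.τ_mul_norm n)

lemma norm_τ (n : ℕ) (x : C.C n) : C.norm n (C.τ n x) = C.norm n x :=
  congrArg (fun f => f x) (C.norm_mul_τ n)

lemma norm_τ_pow (n j : ℕ) (x : C.C n) : C.norm n ((C.τ n ^ j) x) = C.norm n x := by
  induction j with
  | zero => simp
  | succ j ih => rw [pow_succ', Module.End.mul_apply, norm_τ, ih]

lemma τ_pow_norm (n j : ℕ) (x : C.C n) : (C.τ n ^ j) (C.norm n x) = C.norm n x := by
  induction j with
  | zero => simp
  | succ j ih => rw [pow_succ', Module.End.mul_apply, ih, τ_norm]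

lemma norm_apply (n : ℕ) (x : C.C n) :
    C.norm n x = ∑ j ∈ Finset.range (n + 1), (C.τ n ^ j) x := by
  rw [norm_eq, LinearMap.sum_apply]

lemma d_τ_succ (n i : ℕ) (hi : i ≤ n) (x : C.C (n + 1)) :
    C.d n (i + 1) (C.τ (n + 1) x) = - C.τ n (C.d n i x) := by
  rw [τ_apply, τ_apply, map_smul, C.d_succ_t n i hi, pow_succ]
  simp

lemma d_τ_pow (n i : ℕ) (hi : i ≤ n + 1) (x : C.C (n + 1)) :
    ((-1 : k) ^ i) • C.d n i ((C.τ (n + 1) ^ i) x) = (C.τ n ^ i) (C.d n 0 x) := by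
  induction i generalizing x with
  | zero => simp
  | succ i ih =>
    rw [pow_succ' (C.τ (n + 1)), Module.End.mul_apply, d_τ_succ _ _ _ (by omega),
      pow_succ' (C.τ n), Module.End.mul_apply, ← ih (by omega), map_smul, pow_succ]
    simp

lemma b_eq (n : ℕ) (x : C.C (n + 1)) :
    C.b n x = C.b' n x + ((-1 : k) ^ (n + 1)) • C.d n (n + 1) x := by
  rw [b, b', Finset.sum_range_succ]; rfl

lemma b_one_sub_τ (n : ℕ) (x : C.C (n + 1)) :
    C.b n (x - C.τ (n + 1) x) = C.b' n x - C.τ n (C.b' n x) := by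
  have h : C.b n (C.τ (n + 1) x) =
      ((-1 : k) ^ (n + 1)) • C.d n (n + 1) x + C.τ n (C.b' n x) := by
    rw [b, Finset.sum_range_succ', add_comm (Finset.sum _ _)]
    simp only [LinearMap.add_apply, LinearMap.sum_apply, LinearMap.smul_apply, pow_zero, one_smul,
      b', map_sum, map_smul]
    congr 1
    · rw [τ_apply, map_smul, C.d_zero_t]
    · refine Finset.sum_congr rfl fun i hi => ?_
      rw [Finset.mem_range] at hi
      rw [d_τ_succ _ _ _ (by omega), pow_succ]
      simp
  rw [map_sub, h, b_eq]
  abel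

lemma b'_norm (n : ℕ) (x : C.C (n + 1)) :
    C.b' n (C.norm (n + 1) x) = C.norm n (C.d n 0 (C.norm (n + 1) x)) := by
  rw [b', C.norm_apply n, LinearMap.sum_apply]
  refine Finset.sum_congr rfl fun i hi => ?_
  rw [Finset.mem_range] at hi
  rw [← C.d_τ_pow n i (by omega), τ_pow_norm]
  rfl

lemma norm_b (n : ℕ) (x : C.C (n + 1)) :
    C.norm n (C.b n x) = C.norm n (C.d n 0 (C.norm (n + 1) x)) := by
  have h : ∀ i ∈ Finset.range (n + 2), C.norm n (((-1 : k) ^ i) • C.d n i x) =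
      C.norm n (C.d n 0 ((C.τ (n + 1) ^ (n + 2 - i)) x)) := by
    intro i hi
    rw [Finset.mem_range] at hi
    have := C.d_τ_pow n i (by omega) ((C.τ (n + 1) ^ (n + 2 - i)) x)
    rw [← Module.End.mul_apply, ← pow_add, show i + (n + 2 - i) = n + 1 + 1 by omega, τ_pow,
      Module.End.one_apply] at this
    rw [this, norm_τ_pow]
  rw [b, LinearMap.sum_apply, map_sum]
  simp only [LinearMap.smul_apply]
  rw [Finset.sum_congr rfl h, ← C.norm_τ (n + 1) x, C.norm_apply (n + 1), map_sum, map_sum,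
    ← Finset.sum_range_reflect]
  refine Finset.sum_congr rfl fun i hi => ?_
  rw [Finset.mem_range] at hi
  rw [← Module.End.mul_apply, ← pow_succ, show n + 2 - (n + 2 - 1 - i) = i + 1 by omega]

lemma extra_apply (n : ℕ) (x : C.C n) : C.extra n x = C.t (n + 1) (C.s n n x) := rfl

lemma b'_extra_zero (x : C.C 0) : C.b' 0 (C.extra 0 x) = x := by
  simp [b', extra_apply, C.d_zero_t, C.d_s_succ]

lemma b'_extra (n : ℕ) (x : C.C (n + 1)) :
    C.b' (n + 1) (C.extra (n + 1) x) = x - C.extra n (C.b' n x) := by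
  rw [b', Finset.sum_range_succ', add_comm (Finset.sum _ _)]
  simp only [LinearMap.add_apply, LinearMap.sum_apply, LinearMap.smul_apply, pow_zero, one_smul,
      b', map_sum, map_smul, sub_eq_add_neg, ← Finset.sum_neg_distrib]
  congr 1
  · rw [extra_apply, C.d_zero_t, C.d_s_succ _ _ le_rfl]
  · refine Finset.sum_congr rfl fun i hi => ?_
    rw [Finset.mem_range] at hi
    rw [extra_apply, C.d_succ_t _ _ (by omega), C.d_s_lt n i (n + 1) (by omega) le_rfl, pow_succ]
    simp [extra_apply]

lemma B_apply (n : ℕ) (x : C.C n) : C.B n x =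
    C.extra n (C.norm n x) - C.τ (n + 1) (C.extra n (C.norm n x)) := rfl

lemma norm_B (n : ℕ) (x : C.C n) : C.norm (n + 1) (C.B n x) = 0 := by
  rw [B_apply, map_sub, norm_τ, sub_self]

lemma B_B (n : ℕ) (x : C.C n) : C.B (n + 1) (C.B n x) = 0 := by
  rw [C.B_apply (n + 1), norm_B]; simp

lemma b_B_zero (x : C.C 0) : C.b 0 (C.B 0 x) = 0 := by
  rw [B_apply, b_one_sub_τ, b'_extra_zero, τ_norm, sub_self]

lemma b_B (n : ℕ) (x : C.C (n + 1)) : C.b (n + 1) (C.B (n + 1) x) + C.B n (C.b n x) = 0 := by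
  rw [B_apply, b_one_sub_τ, b'_extra, B_apply, norm_b, ← b'_norm, map_sub, τ_norm]
  abel

lemma t_extra (n : ℕ) (x : C.C n) : C.t (n + 1) (C.extra n x) = C.s n 0 (C.t n x) := by
  rw [extra_apply, C.s_zero_t]

/-- The sum of the degenerate chains and the image of the extra degeneracy. -/
def degen' (n : ℕ) : Submodule k (C.C (n + 1)) := C.degen (n + 1) ⊔ LinearMap.range (C.extra n)

lemma t_degen' (n : ℕ) : C.degen' n ≤ (C.degen' n).comap (C.t (n + 1)) := by
  refine sup_le (C.degen_succ_le fun i hi x => ?_) ?_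
  · rw [Submodule.mem_comap]
    rcases hi.lt_or_eq with hi | rfl
    · rw [← C.s_succ_t n i hi]
      exact Submodule.mem_sup_left (C.s_mem_degen hi _)
    · exact Submodule.mem_sup_right ⟨x, rfl⟩
  · rintro _ ⟨x, rfl⟩
    rw [Submodule.mem_comap, t_extra]
    exact Submodule.mem_sup_left (C.s_mem_degen (by omega) _)

lemma τ_pow_degen' (n j : ℕ) : C.degen' n ≤ (C.degen' n).comap (C.τ (n + 1) ^ j) := by
  intro x hx
  rw [Submodule.mem_comap]
  induction j with
  | zero => simpa using hx
  | succ j ih =>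
    rw [pow_succ', Module.End.mul_apply, τ_apply]
    exact Submodule.smul_mem _ _ (C.t_degen' n ih)

lemma extra_degen' (n : ℕ) : C.degen' n ≤ (C.degen (n + 2)).comap (C.extra (n + 1)) := by
  refine sup_le (C.degen_succ_le fun i hi x => ?_) ?_
  · rw [Submodule.mem_comap, extra_apply, ← C.s_s n i n hi le_rfl, ← C.s_succ_t _ _ (by omega)]
    exact C.s_mem_degen (by omega) _
  · rintro _ ⟨x, rfl⟩
    rw [Submodule.mem_comap, extra_apply, extra_apply, C.s_succ_t _ _ (by omega),
      C.s_s n n n le_rfl le_rfl, ← C.s_zero_t]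
    exact C.s_mem_degen (by omega) _

lemma B_degen (n : ℕ) : C.degen n ≤ (C.degen (n + 1)).comap (C.B n) := by
  obtain _ | n := n
  · exact bot_le
  intro x hx
  rw [Submodule.mem_comap, B_apply]
  have h : C.norm (n + 1) x ∈ C.degen' n := by
    rw [norm_apply]
    exact Submodule.sum_mem _ fun j _ => C.τ_pow_degen' n j (Submodule.mem_sup_left hx)
  refine Submodule.sub_mem _ (C.extra_degen' n h) ?_
  rw [τ_apply, t_extra]
  exact Submodule.smul_mem _ _ (C.s_mem_degen (by omega) _)

/-- The normalized mixed complex of a cyclic module: the chains modulo the degenerate ones. -/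
def normalized : MixedComplex.{u, v} k where
  X n := C.C n ⧸ C.degen n
  b n := Submodule.mapQ _ _ (C.b n) (C.b_degen n)
  B n := Submodule.mapQ _ _ (C.B n) (C.B_degen n)
  b_b n x := by
    obtain ⟨x, rfl⟩ := Submodule.mkQ_surjective _ x
    simp [C.b_b]
  B_B n x := by
    obtain ⟨x, rfl⟩ := Submodule.mkQ_surjective _ x
    simp [C.B_B]
  b_B_zero x := by
    obtain ⟨x, rfl⟩ := Submodule.mkQ_surjective _ x
    simp [C.b_B_zero]
  b_B n x := by
    obtain ⟨x, rfl⟩ := Submodule.mkQ_surjective _ x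
    simp [← Submodule.Quotient.mk_add, C.b_B]

/-- The projection of the chains to the normalized chains. -/
def toNormalized (n : ℕ) : C.C n →ₗ[k] C.normalized.X n := (C.degen n).mkQ

end CyclicModule

/-- The index sets of the gradings that are used below: `ℕ` and `ℤ/2`, with the sign `(-1)^i`. -/
class GradingIndex (ι : Type) extends AddCommMonoidWithOne ι where
  sgn : ι → ℤˣ
  sgn_succ : ∀ i, sgn (i + 1) = - sgn i
  succ_inj : ∀ i j : ι, i + 1 = j + 1 → i = j
  [dec : DecidableEq ι]
  [fin : ∀ n : ι, Fintype {p : ι × ι // p.1 + p.2 = n}]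

attribute [reducible, instance] GradingIndex.dec GradingIndex.fin

instance : GradingIndex ℕ where
  sgn i := (-1) ^ i
  sgn_succ i := by rw [pow_succ]; simp
  succ_inj i j h := by omega
  fin n := Fintype.subtype (Finset.HasAntidiagonal.antidiagonal n) (by simp)

instance : GradingIndex (ZMod 2) where
  sgn i := (-1) ^ i.val
  sgn_succ := by decide
  succ_inj := by decide

/-- A chain complex graded by `ι` (a chain complex for `ι = ℕ`, a supercomplex for `ι = ℤ/2`).
The differential lowers the degree by one. -/
structure GrComplex (k : Type u) [Field k] (ι : Type) [GradingIndex ι] where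
  X : ι → Type v
  [acg : ∀ n, AddCommGroup (X n)]
  [mod : ∀ n, Module k (X n)]
  d : ∀ i j, j + 1 = i → (X i →ₗ[k] X j)
  d_d : ∀ i j l (h : j + 1 = i) (h' : l + 1 = j) x, d j l h' (d i j h x) = 0

attribute [instance] GrComplex.acg GrComplex.mod

namespace GrComplex

variable {k : Type u} [Field k] {ι : Type} [GradingIndex ι]

/-- The cycles of degree `i`; in degree `0` of an `ℕ`-graded complex every chain is a cycle. -/
def cycles (X : GrComplex.{u, v} k ι) (i : ι) : Submodule k (X.X i) :=
  ⨅ j, ⨅ h : j + 1 = i, LinearMap.ker (X.d i j h)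

/-- The boundaries of degree `i`. -/
def boundaries (X : GrComplex.{u, v} k ι) (i : ι) : Submodule k (X.X i) :=
  LinearMap.range (X.d (i + 1) i rfl)

/-- The homology in degree `i`. -/
abbrev Homology (X : GrComplex.{u, v} k ι) (i : ι) : Type v :=
  X.cycles i ⧸ (X.boundaries i).comap (X.cycles i).subtype

lemma mem_cycles {X : GrComplex.{u, v} k ι} {i : ι} {x : X.X i} :
    x ∈ X.cycles i ↔ ∀ j h, X.d i j h x = 0 := by
  simp [cycles]

/-- The map on homology induced by a linear map that preserves cycles and boundaries. -/
def mapHomology {X Y : GrComplex.{u, v} k ι} {i j : ι} (f : X.X i →ₗ[k] Y.X j)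
    (hZ : ∀ x ∈ X.cycles i, f x ∈ Y.cycles j) (hB : ∀ x ∈ X.boundaries i, f x ∈ Y.boundaries j) :
    X.Homology i →ₗ[k] Y.Homology j :=
  Submodule.mapQ _ _ (f.restrict hZ) fun x hx => hB x hx

/-- Maps of complexes. -/
@[ext]
structure Hom (X Y : GrComplex.{u, v} k ι) where
  f : ∀ i, X.X i →ₗ[k] Y.X i
  comm : ∀ i j h x, f j (X.d i j h x) = Y.d i j h (f i x)

/-- The map on homology induced by a map of complexes. -/
def Hom.onHomology {X Y : GrComplex.{u, v} k ι} (F : Hom X Y) (i : ι) :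
    X.Homology i →ₗ[k] Y.Homology i :=
  mapHomology (F.f i)
    (fun x hx => mem_cycles.2 fun j h => by rw [← F.comm, mem_cycles.1 hx j h, map_zero])
    (by rintro _ ⟨x, rfl⟩; exact ⟨F.f _ x, (F.comm _ _ _ x).symm⟩)

/-- The sign `(-1)^p` as an element of `k`. -/
def sign (k : Type u) [Field k] {ι : Type} [GradingIndex ι] (p : ι) : k :=
  ((GradingIndex.sgn p : ℤˣ) : ℤ)

lemma sign_succ (p : ι) : sign k (p + 1) = - sign k p := by
  simp [sign, GradingIndex.sgn_succ]

lemma sign_mul_self (p : ι) : sign k p * sign k p = 1 := by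
  rw [sign, ← Int.cast_mul, ← Units.val_mul, Int.units_mul_self]; simp

lemma idx_left {i j : ι} (h : j + 1 = i) (e : {p : ι × ι // p.1 + p.2 = j}) :
    (e.1.1 + 1) + e.1.2 = i := by
  rw [add_right_comm, e.2, h]

lemma idx_right {i j : ι} (h : j + 1 = i) (e : {p : ι × ι // p.1 + p.2 = j}) :
    e.1.1 + (e.1.2 + 1) = i := by
  rw [← add_assoc, e.2, h]

/-- The pairs `(p, q)` with `p + q = n`. -/
abbrev TensorIdx (n : ι) : Type := {p : ι × ι // p.1 + p.2 = n}

/-- The degree `n` part `⨁_{p+q=n} X_p ⊗ Y_q` of the tensor product (a finite sum). -/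
abbrev TensorX (X Y : GrComplex.{u, v} k ι) (n : ι) : Type v :=
  ∀ e : TensorIdx n, X.X e.1.1 ⊗[k] Y.X e.1.2

/-- The projection to the summand `X_p ⊗ Y_q`. -/
abbrev projTensor (X Y : GrComplex.{u, v} k ι) {n : ι} (e : TensorIdx n) :
    TensorX X Y n →ₗ[k] X.X e.1.1 ⊗[k] Y.X e.1.2 := LinearMap.proj e

/-- The tensor product of complexes: `(X ⊗ Y)_n = ⨁_{p+q=n} X_p ⊗ Y_q` (a finite sum), with the
differential `d ⊗ 1 + (-1)^p 1 ⊗ d` on `X_p ⊗ Y_q`. -/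
abbrev tensor (X Y : GrComplex.{u, v} k ι) : GrComplex.{u, v} k ι where
  X := TensorX X Y
  d i j h := LinearMap.pi fun e =>
    (X.d (e.1.1 + 1) e.1.1 rfl).rTensor _ ∘ₗ projTensor X Y ⟨(e.1.1 + 1, e.1.2), idx_left h e⟩ +
    sign k e.1.1 • (Y.d (e.1.2 + 1) e.1.2 rfl).lTensor _ ∘ₗ
      projTensor X Y ⟨(e.1.1, e.1.2 + 1), idx_right h e⟩
  d_d i j l h h' x := by
    have hX : ∀ p, X.d (p + 1) p rfl ∘ₗ X.d (p + 1 + 1) (p + 1) rfl = 0 := fun p => by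
      ext x; exact X.d_d _ _ _ _ _ x
    have hY : ∀ p, Y.d (p + 1) p rfl ∘ₗ Y.d (p + 1 + 1) (p + 1) rfl = 0 := fun p => by
      ext x; exact Y.d_d _ _ _ _ _ x
    refine funext fun e => ?_
    simp only [LinearMap.pi_apply, LinearMap.add_apply, LinearMap.comp_apply, LinearMap.proj_apply,
      LinearMap.smul_apply, map_add, map_smul, smul_add, smul_smul, sign_succ]
    simp only [← LinearMap.comp_apply, ← LinearMap.rTensor_comp, ← LinearMap.lTensor_comp, hX, hY,
      LinearMap.rTensor_zero, LinearMap.lTensor_zero, LinearMap.rTensor_comp_lTensor,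
      LinearMap.lTensor_comp_rTensor]
    simp

/-- The inclusion of the summand `X_p ⊗ Y_q`. -/
def single (X Y : GrComplex.{u, v} k ι) {n : ι} (e : TensorIdx n) :
    X.X e.1.1 ⊗[k] Y.X e.1.2 →ₗ[k] TensorX X Y n :=
  LinearMap.single k (fun e : TensorIdx n => X.X e.1.1 ⊗[k] Y.X e.1.2) e

lemma single_self (X Y : GrComplex.{u, v} k ι) {n : ι} (e : TensorIdx n)
    (x : X.X e.1.1 ⊗[k] Y.X e.1.2) : single X Y e x e = x := by
  simp [single]

lemma single_ne (X Y : GrComplex.{u, v} k ι) {n : ι} {e e' : TensorIdx n}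
    (h : e' ≠ e) (x : X.X e.1.1 ⊗[k] Y.X e.1.2) : single X Y e x e' = 0 := by
  simp [single, h]

lemma tensor_d (X Y : GrComplex.{u, v} k ι) {i j : ι} (h : j + 1 = i) (x : TensorX X Y i)
    (e : TensorIdx j) : ((tensor X Y).d i j h x : TensorX X Y j) e =
    (X.d (e.1.1 + 1) e.1.1 rfl).rTensor _ (x ⟨(e.1.1 + 1, e.1.2), idx_left h e⟩) +
    sign k e.1.1 • (Y.d (e.1.2 + 1) e.1.2 rfl).lTensor _
      (x ⟨(e.1.1, e.1.2 + 1), idx_right h e⟩) := rfl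

/-- `d ⊗ 1` vanishes on a summand generated by a cycle on the left. -/
lemma rTensor_single_cycle (X Y : GrComplex.{u, v} k ι) {n : ι}
    (e : TensorIdx n) {a : X.X e.1.1} (ha : a ∈ X.cycles e.1.1) (b : Y.X e.1.2)
    (p q : ι) (h : (p + 1) + q = n) :
    (X.d (p + 1) p rfl).rTensor _ (single X Y e (a ⊗ₜ b) ⟨(p + 1, q), h⟩) = 0 := by
  by_cases he : (⟨(p + 1, q), h⟩ : TensorIdx n) = e
  · subst he
    rw [single_self, LinearMap.rTensor_tmul, mem_cycles.1 ha, TensorProduct.zero_tmul]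
  · rw [single_ne _ _ he, map_zero]

lemma lTensor_single_cycle (X Y : GrComplex.{u, v} k ι) {n : ι}
    (e : TensorIdx n) (a : X.X e.1.1) {b : Y.X e.1.2} (hb : b ∈ Y.cycles e.1.2)
    (p q : ι) (h : p + (q + 1) = n) :
    (Y.d (q + 1) q rfl).lTensor _ (single X Y e (a ⊗ₜ b) ⟨(p, q + 1), h⟩) = 0 := by
  by_cases he : (⟨(p, q + 1), h⟩ : TensorIdx n) = e
  · subst he
    rw [single_self, LinearMap.lTensor_tmul, mem_cycles.1 hb, TensorProduct.tmul_zero]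
  · rw [single_ne _ _ he, map_zero]

lemma single_mem_cycles (X Y : GrComplex.{u, v} k ι) {n : ι} (e : TensorIdx n)
    {a : X.X e.1.1} (ha : a ∈ X.cycles e.1.1) {b : Y.X e.1.2} (hb : b ∈ Y.cycles e.1.2) :
    single X Y e (a ⊗ₜ b) ∈ (tensor X Y).cycles n := by
  refine mem_cycles.2 fun j h => ?_
  refine funext fun e' => ?_
  rw [tensor_d, rTensor_single_cycle X Y e ha, lTensor_single_cycle X Y e a hb, smul_zero, add_zero]
  rfl

lemma single_left_mem_boundaries (X Y : GrComplex.{u, v} k ι) {n : ι}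
    (e : TensorIdx n) {a : X.X e.1.1} (ha : a ∈ X.boundaries e.1.1)
    {b : Y.X e.1.2} (hb : b ∈ Y.cycles e.1.2) :
    single X Y e (a ⊗ₜ b) ∈ (tensor X Y).boundaries n := by
  obtain ⟨y, rfl⟩ := ha
  refine ⟨single X Y (n := n + 1) ⟨(e.1.1 + 1, e.1.2), idx_left rfl e⟩ (y ⊗ₜ b), ?_⟩
  refine funext fun e' => ?_
  rw [tensor_d, lTensor_single_cycle X Y ⟨(e.1.1 + 1, e.1.2), idx_left rfl e⟩ y hb, smul_zero, add_zero]
  by_cases he : e' = e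
  · subst he
    rw [single_self, single_self]; rfl
  · rw [single_ne _ _ he, single_ne, map_zero]
    intro h
    apply he
    rw [Subtype.mk.injEq, Prod.mk.injEq] at h
    exact Subtype.ext (Prod.ext (GradingIndex.succ_inj _ _ h.1) h.2)

lemma single_right_mem_boundaries (X Y : GrComplex.{u, v} k ι) {n : ι}
    (e : TensorIdx n) {a : X.X e.1.1} (ha : a ∈ X.cycles e.1.1)
    {b : Y.X e.1.2} (hb : b ∈ Y.boundaries e.1.2) :
    single X Y e (a ⊗ₜ b) ∈ (tensor X Y).boundaries n := by
  obtain ⟨y, rfl⟩ := hb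
  refine ⟨sign k e.1.1 •
    single X Y (n := n + 1) ⟨(e.1.1, e.1.2 + 1), idx_right rfl e⟩ (a ⊗ₜ y), ?_⟩
  rw [map_smul]
  refine funext fun e' => ?_
  rw [Pi.smul_apply, tensor_d, rTensor_single_cycle X Y ⟨(e.1.1, e.1.2 + 1), idx_right rfl e⟩ ha, zero_add]
  by_cases he : e' = e
  · subst he
    rw [single_self, single_self, smul_smul, sign_mul_self, one_smul]; rfl
  · rw [single_ne _ _ he, single_ne, map_zero, smul_zero, smul_zero]
    intro h
    apply he
    rw [Subtype.mk.injEq, Prod.mk.injEq] at h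
    exact Subtype.ext (Prod.ext h.1 (GradingIndex.succ_inj _ _ h.2))

/-- The bilinear map `(α, β) ↦ [α ⊗ β]` on cycles. -/
def crossCycles (X Y : GrComplex.{u, v} k ι) {n : ι} (e : TensorIdx n) :
    X.cycles e.1.1 →ₗ[k] Y.cycles e.1.2 →ₗ[k] (tensor X Y).Homology n :=
  LinearMap.mk₂ k
    (fun a b => Submodule.Quotient.mk ⟨single X Y e (a.1 ⊗ₜ b.1), single_mem_cycles X Y e a.2 b.2⟩)
    (fun a a' b => by
      rw [← Submodule.Quotient.mk_add]; congr 1; ext1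
      simp [TensorProduct.add_tmul])
    (fun c a b => by
      rw [← Submodule.Quotient.mk_smul]; congr 1; ext1
      simp [← TensorProduct.smul_tmul'])
    (fun a b b' => by
      rw [← Submodule.Quotient.mk_add]; congr 1; ext1
      simp [TensorProduct.tmul_add])
    (fun c a b => by
      rw [← Submodule.Quotient.mk_smul]; congr 1; ext1
      simp)

/-- The map `H_p(X) ⊗ H_q(Y) → H_n(X ⊗ Y)`, `[α] ⊗ [β] ↦ [α ⊗ β]`. -/
def cross (X Y : GrComplex.{u, v} k ι) {n : ι} (e : TensorIdx n) :
    X.Homology e.1.1 ⊗[k] Y.Homology e.1.2 →ₗ[k] (tensor X Y).Homology n :=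
  TensorProduct.lift <| Submodule.liftQ _
    (LinearMap.flip <| Submodule.liftQ _ (crossCycles X Y e).flip (by
      intro b hb
      rw [LinearMap.mem_ker]
      ext a
      exact (Submodule.Quotient.mk_eq_zero _).2 (single_right_mem_boundaries X Y e a.2 hb))) (by
    intro a ha
    rw [LinearMap.mem_ker]
    ext b
    exact (Submodule.Quotient.mk_eq_zero _).2 (single_left_mem_boundaries X Y e ha b.2))

/-- The Künneth map `⨁_{p+q=n} H_p(X) ⊗ H_q(Y) → H_n(X ⊗ Y)`, `[α] ⊗ [β] ↦ [α ⊗ β]`. -/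
def kunneth (X Y : GrComplex.{u, v} k ι) (n : ι) :
    (∀ e : TensorIdx n, X.Homology e.1.1 ⊗[k] Y.Homology e.1.2) →ₗ[k]
      (tensor X Y).Homology n :=
  ∑ e, cross X Y e ∘ₗ LinearMap.proj e

end GrComplex

/-- The shape of a total complex of the `(b, B)`-bicomplex: `mem i m` says that the mixed complex
contributes its degree `m` part to the degree `i` part of the total complex. -/
structure TotalShape (ι : Type) [GradingIndex ι] where
  mem : ι → ℕ → Prop
  up : ∀ {i j m}, j + 1 = i → mem j m → mem i (m + 1)
  down : ∀ {i j m}, j + 1 = i → mem j (m + 1) → mem i m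
  down_two : ∀ {i m}, mem i (m + 2) → mem i m

/-- The shape of the cyclic complex `Tot_n = X_n ⊕ X_{n-2} ⊕ X_{n-4} ⊕ ⋯`. -/
def cyclicShape : TotalShape ℕ where
  mem n m := m ≤ n ∧ m % 2 = n % 2
  up := by intros; omega
  down := by intros; omega
  down_two := by intros; omega

/-- The shape of the periodic complex `∏_n X_{2n} ⇄ ∏_n X_{2n+1}`. -/
def periodicShape : TotalShape (ZMod 2) where
  mem ε m := (m : ZMod 2) = ε
  up := by rintro i j m rfl rfl; push_cast; rfl
  down := by
    intro i j m h h'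
    rw [← h, ← h', Nat.cast_add, Nat.cast_one, add_assoc]
    exact (add_zero _).symm
  down_two := by
    intro i m h
    rw [← h, Nat.cast_add]
    exact (add_zero _).symm

namespace MixedComplex

variable {k : Type u} [Field k]

/-- The Hochschild complex `(X, b)` of a mixed complex. -/
abbrev hochschild (M : MixedComplex.{u, v} k) : GrComplex.{u, v} k ℕ where
  X := M.X
  d i j h := h ▸ M.b j
  d_d := by rintro _ _ l rfl rfl x; exact M.b_b l x

variable {ι : Type} [GradingIndex ι]

/-- The degree `i` part of the total complex. -/
abbrev TotX (M : MixedComplex.{u, v} k) (S : TotalShape ι) (i : ι) : Type v :=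
  ∀ m : {m : ℕ // S.mem i m}, M.X m.1

/-- The projection to the component `X_m`. -/
abbrev projTot (M : MixedComplex.{u, v} k) (S : TotalShape ι) {i : ι} (m : ℕ) (h : S.mem i m) :
    M.TotX S i →ₗ[k] M.X m := LinearMap.proj (⟨m, h⟩ : {m : ℕ // S.mem i m})

/-- The contribution `B x_{m-1}` to the component of degree `m` (zero for `m = 0`). -/
def BPart (M : MixedComplex.{u, v} k) (S : TotalShape ι) {i j : ι} (h : j + 1 = i) :
    ∀ m, S.mem j m → (M.TotX S i →ₗ[k] M.X m)
  | 0, _ => 0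
  | m + 1, hm => M.B m ∘ₗ M.projTot S m (S.down h hm)

/-- The total complex of the `(b, B)`-bicomplex with differential `b + B`. -/
abbrev total (M : MixedComplex.{u, v} k) (S : TotalShape ι) : GrComplex.{u, v} k ι where
  X := M.TotX S
  d i j h := LinearMap.pi fun m => M.b m.1 ∘ₗ M.projTot S (m.1 + 1) (S.up h m.2) +
    M.BPart S h m.1 m.2
  d_d i j l h h' x := by
    refine funext fun ⟨m, hm⟩ => ?_
    obtain _ | _ | m := m
    · simp [BPart, M.b_b, M.b_B_zero]
    · simp [BPart, M.b_b, M.b_B]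
    · simp [BPart, M.b_b, M.b_B, M.B_B]

/-- Hochschild homology of a mixed complex. -/
abbrev HH (M : MixedComplex.{u, v} k) (n : ℕ) : Type v := M.hochschild.Homology n

/-- Cyclic homology of a mixed complex. -/
abbrev HC (M : MixedComplex.{u, v} k) (n : ℕ) : Type v := (M.total cyclicShape).Homology n

/-- Periodic cyclic homology of a mixed complex. -/
abbrev HP (M : MixedComplex.{u, v} k) (ε : ZMod 2) : Type v := (M.total periodicShape).Homology ε

lemma cyclicShape_mem_add {n m : ℕ} (a : ℕ) (h : cyclicShape.mem n m) :
    cyclicShape.mem (n + 2 * a) m := by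
  obtain ⟨h1, h2⟩ := h
  exact ⟨by omega, by omega⟩

/-- The `a`-fold iterate `Tot_{n+2a} → Tot_n` of Connes' periodicity map, which leaves out the
components of degree greater than `n`. -/
def periodicityChain (M : MixedComplex.{u, v} k) (n a : ℕ) :
    M.TotX cyclicShape (n + 2 * a) →ₗ[k] M.TotX cyclicShape n :=
  LinearMap.pi fun m => M.projTot cyclicShape m.1 (cyclicShape_mem_add a m.2)

lemma periodicityChain_d (M : MixedComplex.{u, v} k) (n j a : ℕ) (h : j + 1 = n)
    (h' : j + 2 * a + 1 = n + 2 * a)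
    (x : M.TotX cyclicShape (n + 2 * a)) :
    M.periodicityChain j a ((M.total cyclicShape).d (n + 2 * a) (j + 2 * a) h' x) =
      (M.total cyclicShape).d n j h (M.periodicityChain n a x) := by
  refine funext fun ⟨m, hm⟩ => ?_
  obtain _ | m := m <;> rfl

/-- The `a`-fold iterate `S^a : HC_{n+2a} → HC_n` of Connes' periodicity map. -/
def periodicity (M : MixedComplex.{u, v} k) (n a : ℕ) : M.HC (n + 2 * a) →ₗ[k] M.HC n :=
  GrComplex.mapHomology (M.periodicityChain n a)
    (fun x hx => GrComplex.mem_cycles.2 fun j h => by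
      rw [← M.periodicityChain_d n j a h (by omega), GrComplex.mem_cycles.1 hx, map_zero])
    (by
      rintro _ ⟨x, rfl⟩
      refine ⟨fun m => x ⟨m.1, ?_⟩, funext fun ⟨m, hm⟩ => ?_⟩
      · obtain ⟨h1, h2⟩ := m.2
        exact ⟨by omega, by omega⟩
      · obtain _ | m := m <;> rfl)

/-- The inverse system `(HC[-2m], S)_m` satisfies the Mittag-Leffler condition: for each `n` the
images of the maps `S^a : HC_{n+2a} → HC_n` become stationary. -/
def MittagLeffler (M : MixedComplex.{u, v} k) : Prop :=
  ∀ n, ∃ a₀, ∀ a ≥ a₀, LinearMap.range (M.periodicity n a) = LinearMap.range (M.periodicity n a₀)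

/-- The contribution of `B ⊗ 1` to the summand `M_p ⊗ N_q`. -/
def tensorBLeft (M N : MixedComplex.{u, v} k) {n : ℕ} : ∀ p q, p + q = n + 1 →
    (GrComplex.TensorX M.hochschild N.hochschild n →ₗ[k] M.X p ⊗[k] N.X q)
  | 0, _, _ => 0
  | p + 1, q, h => (M.B p).rTensor _ ∘ₗ
      GrComplex.projTensor M.hochschild N.hochschild ⟨(p, q), by dsimp only; omega⟩

/-- The contribution of `(-1)^p 1 ⊗ B` to the summand `M_p ⊗ N_q`. -/
def tensorBRight (M N : MixedComplex.{u, v} k) {n : ℕ} : ∀ p q, p + q = n + 1 →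
    (GrComplex.TensorX M.hochschild N.hochschild n →ₗ[k] M.X p ⊗[k] N.X q)
  | _, 0, _ => 0
  | p, q + 1, h => GrComplex.sign k p • (N.B q).lTensor _ ∘ₗ
      GrComplex.projTensor M.hochschild N.hochschild ⟨(p, q), by dsimp only; omega⟩

section

variable {V V' V'' W W' W'' : Type v} [AddCommGroup V] [Module k V] [AddCommGroup V'] [Module k V']
  [AddCommGroup V''] [Module k V''] [AddCommGroup W] [Module k W] [AddCommGroup W'] [Module k W']
  [AddCommGroup W''] [Module k W'']

lemma rTensor_lTensor (f : V →ₗ[k] V') (g : W →ₗ[k] W') (x : V ⊗[k] W) :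
    f.rTensor W' (g.lTensor V x) = TensorProduct.map f g x := by
  rw [← LinearMap.comp_apply, LinearMap.rTensor_comp_lTensor]

lemma lTensor_rTensor (f : V →ₗ[k] V') (g : W →ₗ[k] W') (x : V ⊗[k] W) :
    g.lTensor V' (f.rTensor W x) = TensorProduct.map f g x := by
  rw [← LinearMap.comp_apply, LinearMap.lTensor_comp_rTensor]

lemma rTensor_rTensor (f : V →ₗ[k] V') (g : V' →ₗ[k] V'') (x : V ⊗[k] W) :
    g.rTensor W (f.rTensor W x) = (g ∘ₗ f).rTensor W x := by
  rw [LinearMap.rTensor_comp, LinearMap.comp_apply]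

lemma lTensor_lTensor (f : W →ₗ[k] W') (g : W' →ₗ[k] W'') (x : V ⊗[k] W) :
    g.lTensor V (f.lTensor V x) = (g ∘ₗ f).lTensor V x := by
  rw [LinearMap.lTensor_comp, LinearMap.comp_apply]

end

lemma BB (M : MixedComplex.{u, v} k) (n : ℕ) : M.B (n + 1) ∘ₗ M.B n = 0 :=
  LinearMap.ext (M.B_B n)

lemma bB_zero (M : MixedComplex.{u, v} k) : M.b 0 ∘ₗ M.B 0 = 0 :=
  LinearMap.ext M.b_B_zero

lemma bB (M : MixedComplex.{u, v} k) (n : ℕ) :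
    M.b (n + 1) ∘ₗ M.B (n + 1) = - (M.B n ∘ₗ M.b n) :=
  LinearMap.ext fun x => eq_neg_of_add_eq_zero_left (M.b_B n x)

/-- The operator `B ⊗ 1 + (-1)^p 1 ⊗ B` on the tensor product. -/
def tensorB (M N : MixedComplex.{u, v} k) (n : ℕ) :
    GrComplex.TensorX M.hochschild N.hochschild n →ₗ[k]
      GrComplex.TensorX M.hochschild N.hochschild (n + 1) :=
  LinearMap.pi fun e => M.tensorBLeft N e.1.1 e.1.2 e.2 + M.tensorBRight N e.1.1 e.1.2 e.2

lemma tensorB_apply (M N : MixedComplex.{u, v} k) (n : ℕ) (x) (e : GrComplex.TensorIdx (n + 1)) :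
    M.tensorB N n x e = M.tensorBLeft N e.1.1 e.1.2 e.2 x + M.tensorBRight N e.1.1 e.1.2 e.2 x :=
  rfl

lemma sign_one : GrComplex.sign k (1 : ℕ) = - GrComplex.sign k (0 : ℕ) :=
  GrComplex.sign_succ (0 : ℕ)

lemma tensorB_tensorB (M N : MixedComplex.{u, v} k) (n : ℕ) (x) :
    M.tensorB N (n + 1) (M.tensorB N n x) = 0 := by
  refine funext fun ⟨⟨p, q⟩, h⟩ => ?_
  obtain _ | _ | p := p <;> obtain _ | _ | q := q <;>
  simp [tensorB_apply, tensorBLeft, tensorBRight, rTensor_rTensor, lTensor_lTensor,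
    rTensor_lTensor, lTensor_rTensor, BB, GrComplex.sign_succ, sign_one]

lemma tensorb_tensorB_zero (M N : MixedComplex.{u, v} k) (x) :
    (GrComplex.tensor M.hochschild N.hochschild).d 1 0 rfl (M.tensorB N 0 x) = 0 := by
  refine funext fun ⟨⟨p, q⟩, h⟩ => ?_
  obtain rfl : p = 0 := by dsimp only at h; omega
  obtain rfl : q = 0 := by dsimp only at h; omega
  change _ = (0 : M.X 0 ⊗[k] N.X 0)
  simp [tensorB_apply, tensorBLeft, tensorBRight, rTensor_rTensor, lTensor_lTensor, bB_zero]

lemma tensorb_tensorB (M N : MixedComplex.{u, v} k) (n : ℕ) (x) :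
    (GrComplex.tensor M.hochschild N.hochschild).d (n + 2) (n + 1) rfl (M.tensorB N (n + 1) x) +
    M.tensorB N n ((GrComplex.tensor M.hochschild N.hochschild).d (n + 1) n rfl x) = 0 := by
  refine funext fun ⟨⟨p, q⟩, h⟩ => ?_
  change _ = (0 : M.X p ⊗[k] N.X q)
  obtain _ | p := p <;> obtain _ | q := q <;>
  simp [sign_one, tensorB_apply, tensorBLeft, tensorBRight, rTensor_rTensor, lTensor_lTensor, smul_smul,
    rTensor_lTensor, lTensor_rTensor, bB_zero, bB, GrComplex.sign_succ, GrComplex.sign_mul_self]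
  all_goals abel

/-- The tensor product of mixed complexes, with `b ⊗ 1 + (-1)^p 1 ⊗ b` and
`B ⊗ 1 + (-1)^p 1 ⊗ B` on `M_p ⊗ N_q`. -/
abbrev tensor (M N : MixedComplex.{u, v} k) : MixedComplex.{u, v} k where
  X := GrComplex.TensorX M.hochschild N.hochschild
  b n := (GrComplex.tensor M.hochschild N.hochschild).d (n + 1) n rfl
  B n := M.tensorB N n
  b_b n x := (GrComplex.tensor M.hochschild N.hochschild).d_d _ _ _ _ _ x
  B_B n x := M.tensorB_tensorB N n x
  b_B_zero x := M.tensorb_tensorB_zero N x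
  b_B n x := M.tensorb_tensorB N n x

end MixedComplex

namespace MixedComplex

variable {k : Type u} [Field k] {ι : Type} [GradingIndex ι]

/-- The component in `M_p ⊗ N_q` of an element of the total complex of `M ⊗ N`. -/
def comp (M N : MixedComplex.{u, v} k) (S : TotalShape ι) {i : ι} (p q : ℕ)
    (h : S.mem i (p + q)) : (M.tensor N).TotX S i →ₗ[k] M.X p ⊗[k] N.X q :=
  GrComplex.projTensor M.hochschild N.hochschild ⟨(p, q), rfl⟩ ∘ₗ (M.tensor N).projTot S (p + q) h

lemma comp_eq (M N : MixedComplex.{u, v} k) (S : TotalShape ι) {i : ι} (p q m : ℕ) (hm : p + q = m)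
    (h : S.mem i m) (x : (M.tensor N).TotX S i) :
    x ⟨m, h⟩ ⟨(p, q), hm⟩ = M.comp N S p q (by rwa [hm]) x := by
  subst hm; rfl

/-- The component of `(B ⊗ 1) x` in `M_p ⊗ N_q`. -/
def compBLeft (M N : MixedComplex.{u, v} k) (S : TotalShape ι) {i j : ι} (h : j + 1 = i) :
    ∀ p q, S.mem j (p + q) → ((M.tensor N).TotX S i →ₗ[k] M.X p ⊗[k] N.X q)
  | 0, _, _ => 0
  | p + 1, q, hm => (M.B p).rTensor _ ∘ₗ
      M.comp N S p q (S.down h (by rwa [add_right_comm] at hm))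

/-- The component of `(1 ⊗ B) x` in `M_p ⊗ N_q`. -/
def compBRight (M N : MixedComplex.{u, v} k) (S : TotalShape ι) {i j : ι} (h : j + 1 = i) :
    ∀ p q, S.mem j (p + q) → ((M.tensor N).TotX S i →ₗ[k] M.X p ⊗[k] N.X q)
  | _, 0, _ => 0
  | p, q + 1, hm => (N.B q).lTensor _ ∘ₗ M.comp N S p q (S.down h hm)

lemma BPart_tensor (M N : MixedComplex.{u, v} k) (S : TotalShape ι) {i j : ι} (h : j + 1 = i)
    (p q m : ℕ) (e : p + q = m) (hm : S.mem j m) (x : (M.tensor N).TotX S i) :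
    ((M.tensor N).BPart S h m hm x : GrComplex.TensorX M.hochschild N.hochschild m) ⟨(p, q), e⟩ =
      M.compBLeft N S h p q (by rwa [e]) x +
        GrComplex.sign k p • M.compBRight N S h p q (by rwa [e]) x := by
  obtain _ | m := m
  · obtain rfl : p = 0 := by omega
    obtain rfl : q = 0 := by omega
    change (0 : M.X 0 ⊗[k] N.X 0) = _
    simp [compBLeft, compBRight]
  · change M.tensorB N m (x ⟨m, S.down h hm⟩) ⟨(p, q), e⟩ = _
    rw [tensorB_apply]
    congr 1
    · obtain _ | p := p
      · rfl
      · change (M.B p).rTensor _ (x ⟨m, S.down h hm⟩ ⟨(p, q), _⟩) = _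
        rw [M.comp_eq N S p q m (by omega) (S.down h hm) x]; rfl
    · obtain _ | q := q
      · simp [tensorBRight, compBRight]
      · change GrComplex.sign k p • (N.B q).lTensor _ (x ⟨m, S.down h hm⟩ ⟨(p, q), _⟩) = _
        rw [M.comp_eq N S p q m (by omega) (S.down h hm) x]; rfl

lemma total_tensor_d (M N : MixedComplex.{u, v} k) (S : TotalShape ι) {i j : ι} (h : j + 1 = i)
    (p q : ℕ) (hm : S.mem j (p + q)) (x : (M.tensor N).TotX S i) :
    M.comp N S p q hm (((M.tensor N).total S).d i j h x) =
      (M.b p).rTensor _ (M.comp N S (p + 1) q (by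
        rw [add_right_comm]; exact S.up h hm) x) +
      GrComplex.sign k p • (N.b q).lTensor _ (M.comp N S p (q + 1) (S.up h hm) x) +
      (M.compBLeft N S h p q hm x + GrComplex.sign k p • M.compBRight N S h p q hm x) := by
  rw [← M.comp_eq N S (p + 1) q (p + q + 1) (by omega) (S.up h hm),
    ← M.comp_eq N S p (q + 1) (p + q + 1) (by omega) (S.up h hm), ← M.BPart_tensor N S h p q _ rfl]
  rfl

/-- The component in `M_p ⊗ N_q` of an element of `Tot(M)_i ⊗ Tot(N)_l`. -/
abbrev projProj (M N : MixedComplex.{u, v} k) (S : TotalShape ι) {i l : ι} (p q : ℕ)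
    (hp : S.mem i p) (hq : S.mem l q) :
    M.TotX S i ⊗[k] N.TotX S l →ₗ[k] M.X p ⊗[k] N.X q :=
  TensorProduct.map (M.projTot S p hp) (N.projTot S q hq)

lemma projProj_rTensor (M N : MixedComplex.{u, v} k) (S : TotalShape ι) {i j l : ι}
    (h : j + 1 = i) (p q : ℕ) (hp : S.mem j p) (hq : S.mem l q)
    (z : M.TotX S i ⊗[k] N.TotX S l) :
    M.projProj N S p q hp hq (((M.total S).d i j h).rTensor _ z) =
      (M.b p).rTensor _ (M.projProj N S (p + 1) q (S.up h hp) hq z) +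
      (match p, hp with
        | 0, _ => 0
        | p + 1, hp => (M.B p).rTensor _ (M.projProj N S p q (S.down h hp) hq z)) := by
  induction z using TensorProduct.induction_on with
  | zero => obtain _ | p := p <;> simp
  | tmul x y =>
    obtain _ | p := p <;> simp [BPart, TensorProduct.add_tmul]
  | add x y hx hy =>
    simp only [map_add, hx, hy]
    obtain _ | p := p <;> simp <;> abel

lemma projProj_lTensor (M N : MixedComplex.{u, v} k) (S : TotalShape ι) {i j l : ι}
    (h : j + 1 = i) (p q : ℕ) (hp : S.mem l p) (hq : S.mem j q)
    (z : M.TotX S l ⊗[k] N.TotX S i) :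
    M.projProj N S p q hp hq (((N.total S).d i j h).lTensor _ z) =
      (N.b q).lTensor _ (M.projProj N S p (q + 1) hp (S.up h hq) z) +
      (match q, hq with
        | 0, _ => 0
        | q + 1, hq => (N.B q).lTensor _ (M.projProj N S p q hp (S.down h hq) z)) := by
  induction z using TensorProduct.induction_on with
  | zero => obtain _ | q := q <;> simp
  | tmul x y =>
    obtain _ | q := q <;> simp [BPart, TensorProduct.tmul_add]
  | add x y hx hy =>
    simp only [map_add, hx, hy]
    obtain _ | q := q <;> simp <;> abel

instance (n : ℕ) : Fintype {m : ℕ // cyclicShape.mem n m} :=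
  Fintype.subtype ((Finset.range (n + 1)).filter fun m => m % 2 = n % 2) (by
    intro m
    simp only [Finset.mem_filter, Finset.mem_range, Nat.lt_succ_iff]
    rfl)

/-- The inclusion of the component `X_m` of `Tot_i`. -/
abbrev singleTot (M : MixedComplex.{u, v} k) {n : ℕ} (m : {m : ℕ // cyclicShape.mem n m}) :
    M.X m.1 →ₗ[k] M.TotX cyclicShape n :=
  LinearMap.single k (fun m : {m : ℕ // cyclicShape.mem n m} => M.X m.1) m

lemma projProj_ext (M N : MixedComplex.{u, v} k) {i l : ℕ}
    {z z' : M.TotX cyclicShape i ⊗[k] N.TotX cyclicShape l}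
    (h : ∀ p q hp hq, M.projProj N cyclicShape p q hp hq z = M.projProj N cyclicShape p q hp hq z') :
    z = z' := by
  have key : ∀ z : M.TotX cyclicShape i ⊗[k] N.TotX cyclicShape l,
      z = ∑ p, ∑ q, TensorProduct.map (M.singleTot p) (N.singleTot q)
        (M.projProj N cyclicShape p.1 q.1 p.2 q.2 z) := by
    intro z
    induction z using TensorProduct.induction_on with
    | zero => simp
    | tmul x y =>
      simp only [TensorProduct.map_tmul, ← TensorProduct.tmul_sum, ← TensorProduct.sum_tmul]
      congr 1
      · exact (Finset.univ_sum_single x).symm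
      · exact (Finset.univ_sum_single y).symm
    | add x y hx hy =>
      simp only [map_add, Finset.sum_add_distrib, ← hx, ← hy]
  rw [key z, key z']
  simp only [h]

lemma cyclicShape_mem_tensor {i l n p q : ℕ} (h : i + l = n) (hp : cyclicShape.mem i p)
    (hq : cyclicShape.mem l q) : cyclicShape.mem n (p + q) := by
  obtain ⟨h1, h2⟩ := hp
  obtain ⟨h3, h4⟩ := hq
  exact ⟨by omega, by omega⟩

/-- The component in `Tot_i ⊗ Tot_l` of the Künneth map: it sends `v^c (x_p ⊗ y_q)` to
`∑_{a + b = c} u^a x_p ⊗ u^b y_q`, that is, for `p + 2 a = i` and `q + 2 b = l` the summand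
`x_p ⊗ y_q` of degree `p + q` of the total complex is put at the place `(p, q)`. -/
def kunnethComponent (M N : MixedComplex.{u, v} k) {n : ℕ}
    (e : GrComplex.TensorIdx n) :
    (M.tensor N).TotX cyclicShape n →ₗ[k]
      M.TotX cyclicShape e.1.1 ⊗[k] N.TotX cyclicShape e.1.2 :=
  ∑ p, ∑ q, TensorProduct.map (M.singleTot p) (N.singleTot q) ∘ₗ
    M.comp N cyclicShape p.1 q.1 (cyclicShape_mem_tensor e.2 p.2 q.2)

lemma projProj_kunnethComponent (M N : MixedComplex.{u, v} k) {n : ℕ}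
    (e : GrComplex.TensorIdx n) (p q : ℕ) (hp : cyclicShape.mem e.1.1 p)
    (hq : cyclicShape.mem e.1.2 q) (x : (M.tensor N).TotX cyclicShape n) :
    M.projProj N cyclicShape p q hp hq (M.kunnethComponent N e x) =
      M.comp N cyclicShape p q (cyclicShape_mem_tensor e.2 hp hq) x := by
  have h1 : ∀ (M : MixedComplex.{u, v} k) (n p : ℕ) (hp : cyclicShape.mem n p)
      (p' : {m : ℕ // cyclicShape.mem n m}), p' ≠ ⟨p, hp⟩ →
      M.projTot cyclicShape p hp ∘ₗ M.singleTot p' = 0 := by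
    intro M n p hp p' hne
    ext x
    simp [hne.symm]
  have h2 : ∀ (M : MixedComplex.{u, v} k) (n p : ℕ) (hp : cyclicShape.mem n p),
      M.projTot cyclicShape p hp ∘ₗ M.singleTot ⟨p, hp⟩ = LinearMap.id := by
    intro M n p hp
    ext x
    simp
  simp only [kunnethComponent, LinearMap.sum_apply, map_sum, LinearMap.comp_apply]
  rw [Finset.sum_eq_single ⟨p, hp⟩, Finset.sum_eq_single ⟨q, hq⟩]
  · rw [← LinearMap.comp_apply, ← TensorProduct.map_comp, h2, h2, TensorProduct.map_id]; rfl
  · intro q' _ hne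
    rw [← LinearMap.comp_apply, ← TensorProduct.map_comp, h1 N _ _ _ _ hne]; simp
  · simp
  · intro p' _ hne
    refine Finset.sum_eq_zero fun q' _ => ?_
    rw [← LinearMap.comp_apply, ← TensorProduct.map_comp, h1 M _ _ _ _ hne]; simp
  · simp

lemma sign_eq_of_mem {i p : ℕ} (h : cyclicShape.mem i p) :
    GrComplex.sign k i = GrComplex.sign k p := by
  have : (-1 : ℤˣ) ^ i = (-1) ^ p := by
    rw [Int.units_pow_eq_pow_mod_two, ← h.2, ← Int.units_pow_eq_pow_mod_two]
  change (((-1 : ℤˣ) ^ i : ℤˣ) : ℤ) = ((((-1 : ℤˣ) ^ p : ℤˣ) : ℤ) : k)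
  rw [this]

/-- The Künneth map `𝓘 : Tot(M ⊗ N) → Tot(M) ⊗ Tot(N)` as a map of complexes. -/
def kunnethCyclic (M N : MixedComplex.{u, v} k) :
    GrComplex.Hom ((M.tensor N).total cyclicShape)
      (GrComplex.tensor (M.total cyclicShape) (N.total cyclicShape)) where
  f _ := LinearMap.pi fun e => M.kunnethComponent N e
  comm i j h x := by
    refine funext fun e => M.projProj_ext N fun p q hp hq => ?_
    change M.projProj N cyclicShape p q hp hq (M.kunnethComponent N e _) =
      M.projProj N cyclicShape p q hp hq
        (((M.total cyclicShape).d (e.1.1 + 1) e.1.1 rfl).rTensor _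
          (M.kunnethComponent N ⟨(e.1.1 + 1, e.1.2), GrComplex.idx_left h e⟩ x) +
        GrComplex.sign k e.1.1 • ((N.total cyclicShape).d (e.1.2 + 1) e.1.2 rfl).lTensor _
          (M.kunnethComponent N ⟨(e.1.1, e.1.2 + 1), GrComplex.idx_right h e⟩ x))
    rw [projProj_kunnethComponent, total_tensor_d, map_add, map_smul, projProj_rTensor,
      projProj_lTensor, sign_eq_of_mem hp]
    have hL := fun p hp => M.projProj_kunnethComponent N
      ⟨(e.1.1 + 1, e.1.2), GrComplex.idx_left h e⟩ p q hp hq x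
    have hR := fun q hq => M.projProj_kunnethComponent N
      ⟨(e.1.1, e.1.2 + 1), GrComplex.idx_right h e⟩ p q hp hq x
    obtain _ | p := p <;> obtain _ | q := q <;>
      simp only [compBLeft, compBRight, hL, hR, LinearMap.comp_apply,
        LinearMap.zero_apply, smul_add, smul_zero] <;> abel

lemma sign_natCast (p : ℕ) : GrComplex.sign k (p : ZMod 2) = GrComplex.sign k p := by
  have : (-1 : ℤˣ) ^ (p : ZMod 2).val = (-1) ^ p := by
    rw [ZMod.val_natCast, ← Int.units_pow_eq_pow_mod_two]
  change ((((-1 : ℤˣ) ^ (p : ZMod 2).val : ℤˣ) : ℤ) : k) = ((((-1 : ℤˣ) ^ p : ℤˣ) : ℤ) : k)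
  rw [this]

lemma mem_nabla {ε : ZMod 2} (m : {m : ℕ // periodicShape.mem ε m}) (e : GrComplex.TensorIdx m.1) :
    (e.1.1 : ZMod 2) + (e.1.2 : ZMod 2) = ε := by
  have h' : ((e.1.1 + e.1.2 : ℕ) : ZMod 2) = (m.1 : ZMod 2) := by rw [e.2]
  rw [Nat.cast_add] at h'
  exact h'.trans m.2

/-- The chain level formula for `∇`: it sends `{ξ_p} ⊗ {ξ'_q}` to
`{∑_{p + q = m} ξ_p ⊗ ξ'_q}_m`. -/
def nablaMap (M N : MixedComplex.{u, v} k) (ε : ZMod 2) :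
    GrComplex.TensorX (M.total periodicShape) (N.total periodicShape) ε →ₗ[k]
      (M.tensor N).TotX periodicShape ε :=
  LinearMap.pi fun m => LinearMap.pi fun e =>
    M.projProj N periodicShape (i := (e.1.1 : ZMod 2)) (l := (e.1.2 : ZMod 2)) e.1.1 e.1.2 rfl rfl ∘ₗ
      GrComplex.projTensor (M.total periodicShape) (N.total periodicShape)
        ⟨((e.1.1 : ZMod 2), (e.1.2 : ZMod 2)), mem_nabla m e⟩

lemma comp_nablaMap (M N : MixedComplex.{u, v} k) {ε a b : ZMod 2} (h : a + b = ε) (p q : ℕ)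
    (hp : periodicShape.mem a p) (hq : periodicShape.mem b q) (hm : periodicShape.mem ε (p + q))
    (x : GrComplex.TensorX (M.total periodicShape) (N.total periodicShape) ε) :
    M.comp N periodicShape p q hm (M.nablaMap N ε x) =
      M.projProj N periodicShape p q hp hq (x ⟨(a, b), h⟩) := by
  cases hp; cases hq; rfl

/-- The map `∇` of supercomplexes from the tensor product of the periodic complexes to the periodic
complex of the tensor product. -/
def nabla (M N : MixedComplex.{u, v} k) :
    GrComplex.Hom (GrComplex.tensor (M.total periodicShape) (N.total periodicShape))
      ((M.tensor N).total periodicShape) where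
  f := M.nablaMap N
  comm i j h x := by
    refine funext fun ⟨m, hm⟩ => funext fun ⟨⟨p, q⟩, e⟩ => ?_
    dsimp only at e
    have hj : (p : ZMod 2) + (q : ZMod 2) = j := mem_nabla ⟨m, hm⟩ ⟨(p, q), e⟩
    let e' : GrComplex.TensorIdx j := ⟨((p : ZMod 2), (q : ZMod 2)), hj⟩
    have hp0 : periodicShape.mem (p : ZMod 2) p := rfl
    have hq0 : periodicShape.mem (q : ZMod 2) q := rfl
    have hp1 : periodicShape.mem ((p : ZMod 2) + 1) (p + 1) := periodicShape.up rfl rfl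
    have hq1 : periodicShape.mem ((q : ZMod 2) + 1) (q + 1) := periodicShape.up rfl rfl
    have hm' : periodicShape.mem j (p + q) := by rwa [e]
    rw [M.comp_eq N periodicShape p q m e hm (M.nablaMap N j _),
      M.comp_eq N periodicShape p q m e hm (((M.tensor N).total periodicShape).d i j h _),
      total_tensor_d, M.comp_nablaMap N hj p q hp0 hq0,
      M.comp_nablaMap N (GrComplex.idx_left h e') (p + 1) q hp1 hq0,
      M.comp_nablaMap N (GrComplex.idx_right h e') p (q + 1) hp0 hq1]
    change M.projProj N periodicShape p q hp0 hq0
        (((M.total periodicShape).d ((p : ZMod 2) + 1) p rfl).rTensor _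
          (x ⟨((p : ZMod 2) + 1, (q : ZMod 2)), GrComplex.idx_left h e'⟩) +
        GrComplex.sign k (p : ZMod 2) • ((N.total periodicShape).d ((q : ZMod 2) + 1) q rfl).lTensor _
          (x ⟨((p : ZMod 2), (q : ZMod 2) + 1), GrComplex.idx_right h e'⟩)) = _
    have E1 := M.projProj_rTensor N periodicShape (rfl : (p : ZMod 2) + 1 = (p : ZMod 2) + 1)
      p q hp0 hq0 (x ⟨((p : ZMod 2) + 1, (q : ZMod 2)), GrComplex.idx_left h e'⟩)
    have E2 := M.projProj_lTensor N periodicShape (rfl : (q : ZMod 2) + 1 = (q : ZMod 2) + 1)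
      p q hp0 hq0 (x ⟨((p : ZMod 2), (q : ZMod 2) + 1), GrComplex.idx_right h e'⟩)
    rw [map_add, map_smul, sign_natCast]
    refine (congrArg₂ (fun a b => a + GrComplex.sign k p • b) E1 E2).trans ?_
    have hL := fun p' hp hm => M.comp_nablaMap N (GrComplex.idx_left h e') p' q hp hq0 hm x
    have hR := fun q' hq hm => M.comp_nablaMap N (GrComplex.idx_right h e') p q' hp0 hq hm x
    obtain _ | p := p <;> obtain _ | q := q
    · simp only [compBLeft, compBRight, LinearMap.zero_apply, smul_add, smul_zero]
      abel
    · simp only [compBLeft, compBRight, LinearMap.zero_apply, smul_add, smul_zero,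
        LinearMap.comp_apply]
      rw [hR q (periodicShape.down rfl rfl)]; abel
    · simp only [compBLeft, compBRight, LinearMap.zero_apply, smul_add, smul_zero,
        LinearMap.comp_apply]
      rw [hL p (periodicShape.down rfl rfl)]; abel
    · simp only [compBLeft, compBRight, LinearMap.zero_apply, smul_add, smul_zero,
        LinearMap.comp_apply]
      rw [hL p (periodicShape.down rfl rfl), hR q (periodicShape.down rfl rfl)]; abel

end MixedComplex

/-- The identification of `X_m` and `X_n` for `m = n`. -/
def MixedComplex.castX {k : Type u} [Field k] (M : MixedComplex.{u, v} k) {m n : ℕ} (h : m = n) :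
    M.X m →ₗ[k] M.X n := h ▸ LinearMap.id

namespace CyclicModule

variable {k : Type u} [Field k]

lemma map_map_eq {V₁ V₂ V₂' V₃ W₁ W₂ W₂' W₃ : Type v} [AddCommGroup V₁] [Module k V₁]
    [AddCommGroup V₂] [Module k V₂] [AddCommGroup V₂'] [Module k V₂']
    [AddCommGroup V₃] [Module k V₃] [AddCommGroup W₁] [Module k W₁] [AddCommGroup W₂] [Module k W₂]
    [AddCommGroup W₂'] [Module k W₂'] [AddCommGroup W₃] [Module k W₃]
    {f : V₁ →ₗ[k] V₂} {g : V₂ →ₗ[k] V₃} {f' : V₁ →ₗ[k] V₂'} {g' : V₂' →ₗ[k] V₃}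
    {a : W₁ →ₗ[k] W₂} {b : W₂ →ₗ[k] W₃} {a' : W₁ →ₗ[k] W₂'} {b' : W₂' →ₗ[k] W₃}
    (h : ∀ x, g (f x) = g' (f' x)) (h' : ∀ x, b (a x) = b' (a' x)) (z : V₁ ⊗[k] W₁) :
    TensorProduct.map g b (TensorProduct.map f a z) =
      TensorProduct.map g' b' (TensorProduct.map f' a' z) := by
  induction z using TensorProduct.induction_on with
  | zero => simp
  | tmul x y => simp [h, h']
  | add x y hx hy => simp only [map_add, hx, hy]

lemma map_eq_of {V₁ V₃ V₂' W₁ W₃ W₂' : Type v} [AddCommGroup V₁] [Module k V₁]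
    [AddCommGroup V₂'] [Module k V₂'] [AddCommGroup W₂'] [Module k W₂']
    [AddCommGroup V₃] [Module k V₃] [AddCommGroup W₁] [Module k W₁] [AddCommGroup W₃] [Module k W₃]
    {h₁ : V₁ →ₗ[k] V₃} {f' : V₁ →ₗ[k] V₂'} {g' : V₂' →ₗ[k] V₃}
    {h₂ : W₁ →ₗ[k] W₃} {a' : W₁ →ₗ[k] W₂'} {b' : W₂' →ₗ[k] W₃}
    (h : ∀ x, g' (f' x) = h₁ x) (h' : ∀ x, b' (a' x) = h₂ x) (z : V₁ ⊗[k] W₁) :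
    TensorProduct.map g' b' (TensorProduct.map f' a' z) = TensorProduct.map h₁ h₂ z := by
  induction z using TensorProduct.induction_on with
  | zero => simp
  | tmul x y => simp [h, h']
  | add x y hx hy => simp only [map_add, hx, hy]

/-- The product (diagonal) cyclic module `(C × C')_n = C_n ⊗ C'_n`. -/
def prod (C C' : CyclicModule.{u, v} k) : CyclicModule.{u, v} k where
  C n := C.C n ⊗[k] C'.C n
  d n i := TensorProduct.map (C.d n i) (C'.d n i)
  s n i := TensorProduct.map (C.s n i) (C'.s n i)
  t n := TensorProduct.map (C.t n) (C'.t n)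
  d_d n i j h h' x := map_map_eq (C.d_d n i j h h') (C'.d_d n i j h h') x
  s_s n i j h h' x := map_map_eq (C.s_s n i j h h') (C'.s_s n i j h h') x
  d_s_lt n i j h h' x := map_map_eq (C.d_s_lt n i j h h') (C'.d_s_lt n i j h h') x
  d_s_self n i h x := (map_eq_of (h₁ := LinearMap.id) (h₂ := LinearMap.id)
    (C.d_s_self n i h) (C'.d_s_self n i h) x).trans (by simp)
  d_s_succ n i h x := (map_eq_of (h₁ := LinearMap.id) (h₂ := LinearMap.id)
    (C.d_s_succ n i h) (C'.d_s_succ n i h) x).trans (by simp)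
  d_s_gt n i j h h' x := map_map_eq (C.d_s_gt n i j h h') (C'.d_s_gt n i j h h') x
  t_pow n x := by
    have h : ∀ C : CyclicModule.{u, v} k, C.t n ^ (n + 1) = 1 := fun C => LinearMap.ext (C.t_pow n)
    rw [TensorProduct.map_pow, h, h, TensorProduct.map_one]; rfl
  d_zero_t n x := map_eq_of (C.d_zero_t n) (C'.d_zero_t n) x
  d_succ_t n i h x := map_map_eq (C.d_succ_t n i h) (C'.d_succ_t n i h) x
  s_zero_t n x := by
    have h := map_map_eq (f := C.t n) (a := C'.t n) (g := C.s n 0) (b := C'.s n 0)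
      (f' := C.t (n + 1) ∘ₗ C.s n n) (a' := C'.t (n + 1) ∘ₗ C'.s n n)
      (g' := C.t (n + 1)) (b' := C'.t (n + 1)) (C.s_zero_t n) (C'.s_zero_t n) x
    rwa [TensorProduct.map_comp, LinearMap.comp_apply] at h
  s_succ_t n i h x := map_map_eq (C.s_succ_t n i h) (C'.s_succ_t n i h) x

/-- The identification of `C_m` and `C_n` for `m = n`. -/
def cast (C : CyclicModule.{u, v} k) {m n : ℕ} (h : m = n) : C.C m →ₗ[k] C.C n :=
  h ▸ LinearMap.id

/-- The composite of faces `d_{f 0} d_{f 1} ⋯ d_{f (r-1)} : C_{m+r} → C_m`. -/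
def faces (C : CyclicModule.{u, v} k) (f : ℕ → ℕ) (m : ℕ) : ∀ r, C.C (m + r) →ₗ[k] C.C m
  | 0 => LinearMap.id
  | r + 1 => C.faces f m r ∘ₗ C.d (m + r) (f r)

/-- The composite of degeneracies `s_{g (r-1)} ⋯ s_{g 1} s_{g 0} : C_m → C_{m+r}`. -/
def degeneracies (C : CyclicModule.{u, v} k) (g : ℕ → ℕ) (m : ℕ) :
    ∀ r, C.C m →ₗ[k] C.C (m + r)
  | 0 => LinearMap.id
  | r + 1 => C.s (m + r) (g r) ∘ₗ C.degeneracies g m r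

/-- The Alexander-Whitney map `(C × C')_n → ⨁_{p+q=n} C_p ⊗ C'_q`, with the component
`d_{p+1} ⋯ d_n ⊗ d_0 ⋯ d_0` in `C_p ⊗ C'_q`, read in the normalized chains on the right. -/
def AW (C C' : CyclicModule.{u, v} k) (n : ℕ) :
    (C.prod C').C n →ₗ[k] (C.normalized.tensor C'.normalized).X n :=
  LinearMap.pi fun e => TensorProduct.map
    (C.toNormalized e.1.1 ∘ₗ C.faces (fun j => e.1.1 + 1 + j) e.1.1 e.1.2 ∘ₗ C.cast e.2.symm)
    (C'.toNormalized e.1.2 ∘ₗ C'.faces (fun _ => 0) e.1.2 e.1.1 ∘ₗ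
      C'.cast (e.2.symm.trans (add_comm _ _)))

/-- The Eilenberg-Mac Lane homotopy `φ_n : (C × C')_n → (C × C')_{n+1}`, in its explicit form: the
sum over `0 ≤ q ≤ n - 1`, `0 ≤ p ≤ n - q - 1` and over the `(p+1, q)`-shuffles `(α, β)`, that is, the
partitions of `{0, …, p+q}` in `α_1 < ⋯ < α_{p+1}` and `β_1 < ⋯ < β_q`, of the operators
`s_{β_q+r} ⋯ s_{β_1+r} s_{r-1} d_{n-q+1} ⋯ d_n ⊗ s_{α_{p+1}+r} ⋯ s_{α_1+r} d_r ⋯ d_{n-q-1}`,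
`r = n - p - q`, with the sign `(-1)^{r + ∑ (α_i - (i-1))}`. A shuffle is given by the set `A` of the
numbers `α_i`; `Nat.nth` enumerates `A` and its complement increasingly, beginning with index `0`. -/
noncomputable def phi (C C' : CyclicModule.{u, v} k) (n : ℕ) :
    (C.prod C').C n →ₗ[k] (C.prod C').C (n + 1) :=
  ∑ q : Fin n, ∑ p : Fin (n - q),
    ∑ A ∈ Finset.powersetCard (p + 1) (Finset.range (p + q + 1)),
      let r : ℕ := n - p - q
      let α : ℕ → ℕ := Nat.nth (· ∈ A)
      let β : ℕ → ℕ := Nat.nth (· ∉ A)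
      ((-1 : k) ^ (r + ∑ i ∈ Finset.range (p + 1), (α i - i))) • TensorProduct.map
        (C.cast (by omega) ∘ₗ
          C.degeneracies (fun j => if j = 0 then r - 1 else β (j - 1) + r) (n - q) (q + 1) ∘ₗ
          C.faces (fun j => n - q + 1 + j) (n - q) q ∘ₗ
          C.cast (by omega))
        (C'.cast (by omega) ∘ₗ
          C'.degeneracies (fun j => α j + r) (n - p) (p + 1) ∘ₗ
          C'.faces (fun j => r + j) (n - p) p ∘ₗ
          C'.cast (by omega))

/-- The operator `-B φ : (C × C')_n → (C × C')_{n+2}`. -/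
noncomputable def negBphi (C C' : CyclicModule.{u, v} k) (n : ℕ) :
    (C.prod C').C n →ₗ[k] (C.prod C').C (n + 2) :=
  - ((C.prod C').B (n + 1) ∘ₗ C.phi C' n)

/-- The iterate `(-B φ)^a : (C × C')_n → (C × C')_{n+2a}`. -/
noncomputable def negBphiPow (C C' : CyclicModule.{u, v} k) (n : ℕ) :
    ∀ a, (C.prod C').C n →ₗ[k] (C.prod C').C (n + 2 * a)
  | 0 => LinearMap.id
  | a + 1 => C.negBphi C' (n + 2 * a) ∘ₗ C.negBphiPow C' n a

/-- The component `AW^{(a)} = AW (-B φ)^a : (C × C')_n → (C ⊗ C')_{n+2a}` of the cyclic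
Alexander-Whitney map. -/
noncomputable def AWComponent (C C' : CyclicModule.{u, v} k) (n a : ℕ) :
    (C.prod C').C n →ₗ[k] (C.normalized.tensor C'.normalized).X (n + 2 * a) :=
  C.AW C' (n + 2 * a) ∘ₗ C.negBphiPow C' n a

lemma mem_sub {ι : Type} [GradingIndex ι] (S : TotalShape ι) {i : ι} {m : ℕ} (a : ℕ)
    (h : S.mem i (m + 2 * a)) : S.mem i m := by
  induction a with
  | zero => exact h
  | succ a ih => exact ih (S.down_two h)

/-- The cyclic Alexander-Whitney map `∑_a u^a AW^{(a)}` on the total complexes: the component of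
degree `m` of the image of `x` is the (finite) sum of the `AW^{(a)} x_{m-2a}`. -/
noncomputable def AWTotal (C C' : CyclicModule.{u, v} k) {ι : Type} [GradingIndex ι] (S : TotalShape ι) (i : ι) :
    (∀ m : {m : ℕ // S.mem i m}, (C.prod C').C m.1) →ₗ[k]
      (C.normalized.tensor C'.normalized).TotX S i :=
  LinearMap.pi fun m => ∑ a : Fin (m.1 / 2 + 1),
    (C.normalized.tensor C'.normalized).castX (show m.1 - 2 * a + 2 * a = m.1 by omega) ∘ₗ
      C.AWComponent C' (m.1 - 2 * a) a ∘ₗ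
      LinearMap.proj (⟨m.1 - 2 * a, mem_sub S a (by
        rw [Nat.sub_add_cancel (by omega)]; exact m.2)⟩ : {m : ℕ // S.mem i m})

end CyclicModule

section Hopf

variable (k : Type u) [Field k] (H : Type v) [Ring H] [HopfAlgebra k H]
  (M : Type v) [AddCommGroup M] [Module k M]

/-- The inverse `S⁻¹` of a bijective antipode. -/
noncomputable def antipodeInv (hS : Function.Bijective (HopfAlgebra.antipode k (A := H))) :
    H →ₗ[k] H := (LinearEquiv.ofBijective _ hS).symm

/-- The action of `H` on a module as a linear map `h ↦ (m ↦ h m)`. -/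
noncomputable def actM [Module H M] [IsScalarTower k H M] : H →ₗ[k] M →ₗ[k] M :=
  (Algebra.lsmul k k M (A := H)).toLinearMap

/-- The linear map `h ↦ (g ⊗ m ↦ h⁽¹⁾ g S⁻¹(h⁽³⁾) ⊗ h⁽²⁾ m)`. -/
noncomputable def aydOp [Module H M] [IsScalarTower k H M]
    (hS : Function.Bijective (HopfAlgebra.antipode k (A := H))) :
    H →ₗ[k] H ⊗[k] M →ₗ[k] H ⊗[k] M :=
  TensorProduct.homTensorHomMap (RingHom.id k) H M H M ∘ₗ
    TensorProduct.map
      (TensorProduct.lift ((LinearMap.mul k (Module.End k H)).compl₁₂ (LinearMap.mul k H)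
        ((LinearMap.mul k H).flip ∘ₗ antipodeInv k H hS)))
      (actM k H M) ∘ₗ
    (TensorProduct.comm k H (H ⊗[k] H)).toLinearMap ∘ₗ
    (TensorProduct.leftComm k H H H).toLinearMap ∘ₗ
    LinearMap.lTensor H Coalgebra.comul ∘ₗ Coalgebra.comul

/-- The structure of a left-left stable anti-Yetter-Drinfeld module on an `H`-module `M`: a left
coaction `φ(m) = m⁽⁻¹⁾ ⊗ m⁽⁰⁾` with `φ(h m) = h⁽¹⁾ m⁽⁻¹⁾ S⁻¹(h⁽³⁾) ⊗ h⁽²⁾ m⁽⁰⁾` and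
`m⁽⁻¹⁾ m⁽⁰⁾ = m`. -/
structure SAYD [Module H M] [IsScalarTower k H M]
    (hS : Function.Bijective (HopfAlgebra.antipode k (A := H))) where
  coact : M →ₗ[k] H ⊗[k] M
  coassoc : ∀ m, TensorProduct.assoc k H H M (LinearMap.rTensor M Coalgebra.comul (coact m)) =
    LinearMap.lTensor H coact (coact m)
  counit : ∀ m, TensorProduct.lid k M (LinearMap.rTensor M Coalgebra.counit (coact m)) = m
  ayd : ∀ (h : H) (m : M), coact (h • m) = aydOp k H M hS h (coact m)
  stable : ∀ m, TensorProduct.lift (actM k H M) (coact m) = m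

/-- The recursive construction of the spaces `H ⊗ (H ⊗ ⋯ (H ⊗ M))`, with their vector space
structures. -/
def TensAux : ℕ → ModuleCat.{v} k
  | 0 => ModuleCat.of k M
  | n + 1 => ModuleCat.of k (H ⊗[k] TensAux n)

/-- The space `H^{⊗ n} ⊗ M = H ⊗ (H ⊗ ⋯ (H ⊗ M))` with `n` factors `H`. -/
def Tens (n : ℕ) : Type v := TensAux k H M n

instance (n : ℕ) : AddCommGroup (Tens k H M n) := inferInstanceAs (AddCommGroup (TensAux k H M n))

instance (n : ℕ) : Module k (Tens k H M n) := inferInstanceAs (Module k (TensAux k H M n))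

/-- The identification `H^{⊗ 0} ⊗ M = M`. -/
def Tens.zeroEquiv : M ≃ₗ[k] Tens k H M 0 := LinearEquiv.refl k M

/-- The identification `H ⊗ (H^{⊗ n} ⊗ M) = H^{⊗ (n+1)} ⊗ M`. -/
def Tens.succEquiv (n : ℕ) : H ⊗[k] Tens k H M n ≃ₗ[k] Tens k H M (n + 1) :=
  LinearEquiv.refl k (H ⊗[k] Tens k H M n)

/-- The map `1 ⊗ f`. -/
noncomputable def Tens.map {n m : ℕ} (f : Tens k H M n →ₗ[k] Tens k H M m) :
    Tens k H M (n + 1) →ₗ[k] Tens k H M (m + 1) :=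
  (succEquiv k H M m).toLinearMap ∘ₗ LinearMap.lTensor H f ∘ₗ
    (succEquiv k H M n).symm.toLinearMap

/-- The exchange of the first two factors `h ⊗ g ⊗ y ↦ g ⊗ h ⊗ y`. -/
noncomputable def Tens.swap (n : ℕ) : Tens k H M (n + 2) →ₗ[k] Tens k H M (n + 2) :=
  (succEquiv k H M (n + 1)).toLinearMap ∘ₗ LinearMap.lTensor H (succEquiv k H M n).toLinearMap ∘ₗ
    (TensorProduct.leftComm k H H (Tens k H M n)).toLinearMap ∘ₗ
    LinearMap.lTensor H (succEquiv k H M n).symm.toLinearMap ∘ₗ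
    (succEquiv k H M (n + 1)).symm.toLinearMap

/-- For `i ≤ n` the inner face that multiplies `h_i` and `h_{i+1}` in
`h₀ ⊗ ⋯ ⊗ h_{n+1} ⊗ m`. -/
noncomputable def dT : ∀ n (_ : ℕ), Tens k H M (n + 2) →ₗ[k] Tens k H M (n + 1)
  | n, 0 => (Tens.succEquiv k H M n).toLinearMap ∘ₗ
      LinearMap.rTensor (Tens k H M n) (LinearMap.mul' k H) ∘ₗ
      (TensorProduct.assoc k H H (Tens k H M n)).symm.toLinearMap ∘ₗ
      LinearMap.lTensor H (Tens.succEquiv k H M n).symm.toLinearMap ∘ₗ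
      (Tens.succEquiv k H M (n + 1)).symm.toLinearMap
  | 0, _ + 1 => 0
  | n + 1, i + 1 => Tens.map k H M (dT n i)

/-- For `i ≤ n` the degeneracy that inserts `1` after `h_i` in `h₀ ⊗ ⋯ ⊗ h_n ⊗ m`. -/
noncomputable def sT : ∀ n (_ : ℕ), Tens k H M (n + 1) →ₗ[k] Tens k H M (n + 2)
  | n, 0 => Tens.map k H M ((Tens.succEquiv k H M n).toLinearMap ∘ₗ
      TensorProduct.mk k H (Tens k H M n) 1)
  | 0, _ + 1 => 0
  | n + 1, i + 1 => Tens.map k H M (sT n i)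

/-- The diagonal right coaction on `H^{⊗ n}`, on `H^{⊗ n} ⊗ M`, with the new factor `H` in front:
`h₁ ⊗ ⋯ ⊗ h_n ⊗ m ↦ h₁⁽²⁾ ⋯ h_n⁽²⁾ ⊗ h₁⁽¹⁾ ⊗ ⋯ ⊗ h_n⁽¹⁾ ⊗ m`. -/
noncomputable def coactL : ∀ n, Tens k H M n →ₗ[k] H ⊗[k] Tens k H M n
  | 0 => TensorProduct.mk k H (Tens k H M 0) 1
  | n + 1 => TensorProduct.map (LinearMap.mul' k H) (Tens.succEquiv k H M n).toLinearMap ∘ₗ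
      (TensorProduct.tensorTensorTensorComm k H H H (Tens k H M n)).toLinearMap ∘ₗ
      TensorProduct.map ((TensorProduct.comm k H H).toLinearMap ∘ₗ Coalgebra.comul) (coactL n) ∘ₗ
      (Tens.succEquiv k H M n).symm.toLinearMap

variable {M} in
/-- The left coaction of `M`, on `H^{⊗ n} ⊗ M`, with the new factor `H` in front:
`h₁ ⊗ ⋯ ⊗ h_n ⊗ m ↦ m⁽⁻¹⁾ ⊗ h₁ ⊗ ⋯ ⊗ h_n ⊗ m⁽⁰⁾`. -/
noncomputable def coactR (φ : M →ₗ[k] H ⊗[k] M) : ∀ n, Tens k H M n →ₗ[k] H ⊗[k] Tens k H M n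
  | 0 => LinearMap.lTensor H (Tens.zeroEquiv k H M).toLinearMap ∘ₗ φ ∘ₗ
      (Tens.zeroEquiv k H M).symm.toLinearMap
  | n + 1 => LinearMap.lTensor H (Tens.succEquiv k H M n).toLinearMap ∘ₗ
      (TensorProduct.leftComm k H H (Tens k H M n)).toLinearMap ∘ₗ
      LinearMap.lTensor H (coactR φ n) ∘ₗ (Tens.succEquiv k H M n).symm.toLinearMap

variable {M} in
/-- The cotensor product `H^{⊗ (n+1)} □_H M` for a left coaction `φ` on `M`. -/
noncomputable def cotensor (φ : M →ₗ[k] H ⊗[k] M) (n : ℕ) : Submodule k (Tens k H M (n + 1)) :=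
  LinearMap.ker (coactL k H M (n + 1) - coactR k H φ (n + 1))

variable [Module H M] [IsScalarTower k H M]

/-- The action on the last factor, `h₁ ⊗ ⋯ ⊗ h_n ⊗ m ↦ h₁ ⊗ ⋯ ⊗ h_n ⊗ h m`. -/
noncomputable def actT : ∀ n, H →ₗ[k] Tens k H M n →ₗ[k] Tens k H M n
  | 0 => (actM k H M).compr₂ (Tens.zeroEquiv k H M).toLinearMap |>.compl₂
      (Tens.zeroEquiv k H M).symm.toLinearMap
  | n + 1 => ((LinearMap.lTensorHom H ∘ₗ actT n).compr₂
      (Tens.succEquiv k H M n).toLinearMap).compl₂ (Tens.succEquiv k H M n).symm.toLinearMap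

/-- `h₀ ⊗ ⋯ ⊗ h_n ⊗ m ↦ h_n⁽¹⁾ ⊗ h₀ ⊗ ⋯ ⊗ h_{n-1} ⊗ h_n⁽²⁾ m`. -/
noncomputable def tT : ∀ n, Tens k H M (n + 1) →ₗ[k] Tens k H M (n + 1)
  | 0 => (Tens.succEquiv k H M 0).toLinearMap ∘ₗ
      LinearMap.lTensor H (TensorProduct.lift (actT k H M 0)) ∘ₗ
      (TensorProduct.assoc k H H (Tens k H M 0)).toLinearMap ∘ₗ
      LinearMap.rTensor (Tens k H M 0) Coalgebra.comul ∘ₗ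
      (Tens.succEquiv k H M 0).symm.toLinearMap
  | n + 1 => Tens.swap k H M n ∘ₗ Tens.map k H M (tT n)

/-- The faces: the inner faces `h₀ ⊗ ⋯ ⊗ h_i h_{i+1} ⊗ ⋯ ⊗ h_{n+1} ⊗ m` for `i ≤ n`, and
`h_{n+1}⁽¹⁾ h₀ ⊗ h₁ ⊗ ⋯ ⊗ h_n ⊗ h_{n+1}⁽²⁾ m` for `i = n + 1`. -/
noncomputable def faceT (n i : ℕ) : Tens k H M (n + 2) →ₗ[k] Tens k H M (n + 1) :=
  if i ≤ n then dT k H M n i else dT k H M n 0 ∘ₗ tT k H M (n + 1)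

end Hopf

namespace Tens

variable {k : Type u} [Field k] {H : Type v} [Ring H] [HopfAlgebra k H]
  {M : Type v} [AddCommGroup M] [Module k M]

/-- The element `h ⊗ y`. -/
def cns {n : ℕ} (h : H) (y : Tens k H M n) : Tens k H M (n + 1) := succEquiv k H M n (h ⊗ₜ y)

lemma cns_add {n : ℕ} (h : H) (y z : Tens k H M n) : cns h (y + z) = cns h y + cns h z := by
  simp [cns, TensorProduct.tmul_add]

lemma cns_zero {n : ℕ} (h : H) : cns h (0 : Tens k H M n) = 0 := by
  simp [cns]

lemma ext {n : ℕ} {W : Type v} [AddCommGroup W] [Module k W] {f g : Tens k H M (n + 1) →ₗ[k] W}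
    (h : ∀ a y, f (cns a y) = g (cns a y)) (x) : f x = g x := by
  obtain ⟨x, rfl⟩ := (succEquiv k H M n).surjective x
  induction x using TensorProduct.induction_on with
  | zero => simp only [map_zero]
  | add x y hx hy => simp only [map_add, hx, hy]
  | tmul a y => exact h a y

@[elab_as_elim]
lemma ind {n : ℕ} {P : Tens k H M (n + 1) → Prop} (x : Tens k H M (n + 1)) (h0 : P 0)
    (h : ∀ a y, P (cns a y)) (hadd : ∀ x y, P x → P y → P (x + y)) : P x := by
  obtain ⟨x, rfl⟩ := (succEquiv k H M n).surjective x
  induction x using TensorProduct.induction_on with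
  | zero => rw [map_zero]; exact h0
  | add x y hx hy => rw [map_add]; exact hadd _ _ hx hy
  | tmul a y => exact h a y

@[simp] lemma succEquiv_symm_cns (n : ℕ) (h : H) (y : Tens k H M n) :
    (succEquiv k H M n).symm (cns h y) = h ⊗ₜ y := rfl

@[simp] lemma map_cns {n m : ℕ} (f : Tens k H M n →ₗ[k] Tens k H M m) (h : H) (y : Tens k H M n) :
    Tens.map k H M f (cns h y) = cns h (f y) := rfl

@[simp] lemma swap_cns (n : ℕ) (h g : H) (y : Tens k H M n) :
    swap k H M n (cns h (cns g y)) = cns g (cns h y) := rfl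

end Tens

open Tens

section lemmas

variable {k : Type u} [Field k] {H : Type v} [Ring H] [HopfAlgebra k H]
  {M : Type v} [AddCommGroup M] [Module k M]

@[simp] lemma dT_zero (n : ℕ) (h g : H) (y : Tens k H M n) :
    dT k H M n 0 (cns h (cns g y)) = cns (h * g) y := by
  cases n <;> rfl

@[simp] lemma dT_succ (n i : ℕ) (h : H) (y : Tens k H M (n + 2)) :
    dT k H M (n + 1) (i + 1) (cns h y) = cns h (dT k H M n i y) := rfl

@[simp] lemma sT_zero (n : ℕ) (h : H) (y : Tens k H M n) :
    sT k H M n 0 (cns h y) = cns h (cns 1 y) := by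
  cases n <;> rfl

@[simp] lemma sT_succ (n i : ℕ) (h : H) (y : Tens k H M (n + 1)) :
    sT k H M (n + 1) (i + 1) (cns h y) = cns h (sT k H M n i y) := rfl

@[simp] lemma dT_one (n : ℕ) (h g f : H) (y : Tens k H M n) :
    dT k H M (n + 1) 1 (cns h (cns g (cns f y))) = cns h (cns (g * f) y) := by
  rw [dT_succ, dT_zero]

@[simp] lemma sT_one (n : ℕ) (h g : H) (y : Tens k H M n) :
    sT k H M (n + 1) 1 (cns h (cns g y)) = cns h (cns g (cns 1 y)) := by
  rw [sT_succ, sT_zero]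

lemma dT_dT (n i j : ℕ) (hij : i ≤ j) (hj : j ≤ n) (x : Tens k H M (n + 3)) :
    dT k H M n i (dT k H M (n + 1) (j + 1) x) = dT k H M n j (dT k H M (n + 1) i x) := by
  induction n generalizing i j with
  | zero =>
    obtain rfl : j = 0 := by omega
    obtain rfl : i = 0 := by omega
    induction x using Tens.ind with
    | h0 => simp only [map_zero]
    | hadd x y hx hy => simp only [map_add, hx, hy]
    | h h x =>
    induction x using Tens.ind with
    | h0 => simp only [cns_zero, map_zero]
    | hadd x y hx hy => simp only [map_add, cns_add, hx, hy]
    | h g x =>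
    induction x using Tens.ind with
    | h0 => simp only [cns_zero, map_zero]
    | hadd x y hx hy => simp only [map_add, cns_add, hx, hy]
    | h f x => simp [mul_assoc]
  | succ n ih =>
    induction x using Tens.ind with
    | h0 => simp only [map_zero]
    | hadd x y hx hy => simp only [map_add, hx, hy]
    | h h x =>
    obtain _ | i := i
    · induction x using Tens.ind with
      | h0 => simp only [cns_zero, map_zero]
      | hadd x y hx hy => simp only [map_add, cns_add, hx, hy]
      | h g x =>
      obtain _ | j := j
      · induction x using Tens.ind with
        | h0 => simp only [cns_zero, map_zero]
        | hadd x y hx hy => simp only [map_add, cns_add, hx, hy]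
        | h f x => simp [mul_assoc]
      · simp
    · obtain _ | j := j
      · omega
      · simp only [dT_succ]
        rw [ih i j (by omega) (by omega)]

lemma sT_sT (n i j : ℕ) (hij : i ≤ j) (hj : j ≤ n) (x : Tens k H M (n + 1)) :
    sT k H M (n + 1) i (sT k H M n j x) = sT k H M (n + 1) (j + 1) (sT k H M n i x) := by
  induction n generalizing i j with
  | zero =>
    obtain rfl : j = 0 := by omega
    obtain rfl : i = 0 := by omega
    induction x using Tens.ind with
    | h0 => simp only [map_zero]
    | hadd x y hx hy => simp only [map_add, hx, hy]
    | h h x => simp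
  | succ n ih =>
    induction x using Tens.ind with
    | h0 => simp only [map_zero]
    | hadd x y hx hy => simp only [map_add, hx, hy]
    | h h x =>
    obtain _ | i := i
    · obtain _ | j := j <;> simp
    · obtain _ | j := j
      · omega
      · simp only [sT_succ]
        rw [ih i j (by omega) (by omega)]

lemma dT_sT_self (n i : ℕ) (hi : i ≤ n) (x : Tens k H M (n + 1)) :
    dT k H M n i (sT k H M n i x) = x := by
  induction n generalizing i with
  | zero =>
    obtain rfl : i = 0 := by omega
    induction x using Tens.ind with
    | h0 => simp only [map_zero]
    | hadd x y hx hy => simp only [map_add, hx, hy]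
    | h h x => simp
  | succ n ih =>
    induction x using Tens.ind with
    | h0 => simp only [map_zero]
    | hadd x y hx hy => simp only [map_add, hx, hy]
    | h h x =>
    obtain _ | i := i
    · simp
    · rw [sT_succ, dT_succ, ih i (by omega)]

lemma dT_sT_succ (n i : ℕ) (hi : i + 1 ≤ n) (x : Tens k H M (n + 1)) :
    dT k H M n (i + 1) (sT k H M n i x) = x := by
  induction n generalizing i with
  | zero => omega
  | succ n ih =>
    induction x using Tens.ind with
    | h0 => simp only [map_zero]
    | hadd x y hx hy => simp only [map_add, hx, hy]
    | h h x =>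
    obtain _ | i := i
    · induction x using Tens.ind with
      | h0 => simp only [cns_zero, map_zero]
      | hadd x y hx hy => simp only [map_add, cns_add, hx, hy]
      | h g x => simp
    · rw [sT_succ, dT_succ, ih i (by omega)]

lemma dT_sT_lt (n i j : ℕ) (hij : i ≤ j) (hj : j ≤ n) (x : Tens k H M (n + 2)) :
    dT k H M (n + 1) i (sT k H M (n + 1) (j + 1) x) = sT k H M n j (dT k H M n i x) := by
  induction n generalizing i j with
  | zero =>
    obtain rfl : j = 0 := by omega
    obtain rfl : i = 0 := by omega
    induction x using Tens.ind with
    | h0 => simp only [map_zero]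
    | hadd x y hx hy => simp only [map_add, hx, hy]
    | h h x =>
    induction x using Tens.ind with
    | h0 => simp only [cns_zero, map_zero]
    | hadd x y hx hy => simp only [map_add, cns_add, hx, hy]
    | h g x => simp
  | succ n ih =>
    induction x using Tens.ind with
    | h0 => simp only [map_zero]
    | hadd x y hx hy => simp only [map_add, hx, hy]
    | h h x =>
    obtain _ | i := i
    · induction x using Tens.ind with
      | h0 => simp only [cns_zero, map_zero]
      | hadd x y hx hy => simp only [map_add, cns_add, hx, hy]
      | h g x => obtain _ | j := j <;> simp
    · obtain _ | j := j
      · omega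
      · rw [sT_succ, dT_succ, dT_succ, sT_succ, ih i j (by omega) (by omega)]

lemma dT_sT_gt (n i j : ℕ) (hij : j + 1 ≤ i) (hi : i ≤ n) (x : Tens k H M (n + 2)) :
    dT k H M (n + 1) (i + 1) (sT k H M (n + 1) j x) = sT k H M n j (dT k H M n i x) := by
  induction n generalizing i j with
  | zero => omega
  | succ n ih =>
    induction x using Tens.ind with
    | h0 => simp only [map_zero]
    | hadd x y hx hy => simp only [map_add, hx, hy]
    | h h x =>
    obtain _ | i := i
    · omega
    obtain _ | j := j
    · induction x using Tens.ind with
      | h0 => simp only [cns_zero, map_zero]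
      | hadd x y hx hy => simp only [map_add, cns_add, hx, hy]
      | h g x => simp
    · rw [sT_succ, dT_succ, dT_succ, sT_succ, ih i j (by omega) (by omega)]

variable [Module H M] [IsScalarTower k H M]

lemma tT_succ (n : ℕ) (h : H) (y : Tens k H M (n + 1)) :
    tT k H M (n + 1) (cns h y) = swap k H M n (cns h (tT k H M n y)) := rfl

lemma sT_tT_succ (n i : ℕ) (hi : i + 1 ≤ n) (x : Tens k H M (n + 1)) :
    sT k H M n (i + 1) (tT k H M n x) = tT k H M (n + 1) (sT k H M n i x) := by
  induction n generalizing i with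
  | zero => omega
  | succ n ih =>
    induction x using Tens.ind with
    | h0 => simp only [map_zero]
    | hadd x y hx hy => simp only [map_add, hx, hy]
    | h h y =>
    obtain _ | i := i
    · rw [tT_succ, sT_zero, tT_succ, tT_succ]
      induction tT k H M n y using Tens.ind with
      | h0 => simp only [cns_zero, map_zero]
      | hadd x y hx hy => simp only [map_add, cns_add, hx, hy]
      | h g x => simp
    · rw [sT_succ, tT_succ, tT_succ, ← ih i (by omega)]
      obtain _ | n := n
      · omega
      induction tT k H M (n + 1) y using Tens.ind with
      | h0 => simp only [cns_zero, map_zero]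
      | hadd x y hx hy => simp only [map_add, cns_add, hx, hy]
      | h g x => simp

lemma dT_tT_succ (n i : ℕ) (hi : i + 1 ≤ n) (x : Tens k H M (n + 2)) :
    dT k H M n (i + 1) (tT k H M (n + 1) x) = tT k H M n (dT k H M n i x) := by
  induction n generalizing i with
  | zero => omega
  | succ n ih =>
    induction x using Tens.ind with
    | h0 => simp only [map_zero]
    | hadd x y hx hy => simp only [map_add, hx, hy]
    | h h y =>
    obtain _ | i := i
    · induction y using Tens.ind with
      | h0 => simp only [cns_zero, map_zero]
      | hadd x y hx hy => simp only [map_add, cns_add, hx, hy]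
      | h g y =>
      rw [tT_succ, dT_zero, tT_succ, tT_succ]
      induction tT k H M n y using Tens.ind with
      | h0 => simp only [cns_zero, map_zero]
      | hadd x y hx hy => simp only [map_add, cns_add, hx, hy]
      | h g x => simp
    · rw [dT_succ, tT_succ, tT_succ, ← ih i (by omega)]
      obtain _ | n := n
      · omega
      induction tT k H M (n + 1 + 1) y using Tens.ind with
      | h0 => simp only [cns_zero, map_zero]
      | hadd x y hx hy => simp only [map_add, cns_add, hx, hy]
      | h g x => simp

end lemmas

section lemmas

variable {k : Type u} [Field k] {H : Type v} [Ring H] [HopfAlgebra k H]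
  {M : Type v} [AddCommGroup M] [Module k M]

/-- The operator `g ⊗ y ↦ h⁽²⁾ g ⊗ (h⁽¹⁾ ⊗ y)`, for `u = h⁽¹⁾ ⊗ h⁽²⁾`. -/
noncomputable def consL (n : ℕ) (z : H ⊗[k] Tens k H M n) :
    H ⊗[k] H →ₗ[k] H ⊗[k] Tens k H M (n + 1) :=
  TensorProduct.map (LinearMap.mul' k H) (Tens.succEquiv k H M n).toLinearMap ∘ₗ
    (TensorProduct.tensorTensorTensorComm k H H H (Tens k H M n)).toLinearMap ∘ₗ
    (TensorProduct.mk k (H ⊗[k] H) (H ⊗[k] Tens k H M n)).flip z ∘ₗ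
    (TensorProduct.comm k H H).toLinearMap

lemma consL_zero (n : ℕ) (u) : consL n (0 : H ⊗[k] Tens k H M n) u = 0 := by simp [consL]

lemma consL_add (n : ℕ) (z z' : H ⊗[k] Tens k H M n) (u) :
    consL n (z + z') u = consL n z u + consL n z' u := by
  simp [consL]

@[simp] lemma consL_tmul (n : ℕ) (g : H) (y : Tens k H M n) (a b : H) :
    consL n (g ⊗ₜ[k] y) (a ⊗ₜ[k] b) = (b * g) ⊗ₜ[k] cns a y := rfl

lemma coactL_cns (n : ℕ) (h : H) (y : Tens k H M n) : coactL k H M (n + 1) (cns h y) =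
    consL n (coactL k H M n y) (Coalgebra.comul (R := k) h) := rfl

/-- The operator `g ⊗ y ↦ g ⊗ (h ⊗ y)`. -/
noncomputable def consR (n : ℕ) (h : H) : H ⊗[k] Tens k H M n →ₗ[k] H ⊗[k] Tens k H M (n + 1) :=
  LinearMap.lTensor H ((Tens.succEquiv k H M n).toLinearMap ∘ₗ TensorProduct.mk k H _ h)

@[simp] lemma consR_tmul (n : ℕ) (h g : H) (y : Tens k H M n) :
    consR n h (g ⊗ₜ[k] y) = g ⊗ₜ[k] cns h y := rfl

lemma coactR_cns (φ : M →ₗ[k] H ⊗[k] M) (n : ℕ) (h : H) (y : Tens k H M n) :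
    coactR k H φ (n + 1) (cns h y) = consR n h (coactR k H φ n y) := by
  simp only [coactR, LinearMap.comp_apply, LinearEquiv.coe_coe, succEquiv_symm_cns,
    LinearMap.lTensor_tmul]
  induction coactR k H φ n y using TensorProduct.induction_on with
  | zero => simp
  | add x y hx hy => simp only [map_add, TensorProduct.tmul_add, hx, hy]
  | tmul a b => rfl

/-- The insertion of `h` at the place `j`. -/
noncomputable def ins (h : H) : ∀ n (_ : ℕ), Tens k H M n →ₗ[k] Tens k H M (n + 1)
  | n, 0 => (Tens.succEquiv k H M n).toLinearMap ∘ₗ TensorProduct.mk k H _ h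
  | 0, _ + 1 => 0
  | n + 1, j + 1 => Tens.map k H M (ins h n j)

@[simp] lemma ins_zero (h : H) (n : ℕ) (y : Tens k H M n) : ins h n 0 y = cns h y := by
  cases n <;> rfl

@[simp] lemma ins_succ (h : H) (n j : ℕ) (a : H) (y : Tens k H M n) :
    ins h (n + 1) (j + 1) (cns a y) = cns a (ins h n j y) := rfl

variable [Module H M] [IsScalarTower k H M]

@[simp] lemma actT_cns (n : ℕ) (h a : H) (y : Tens k H M n) :
    actT k H M (n + 1) h (cns a y) = cns a (actT k H M n h y) := rfl

lemma actT_mul (n : ℕ) (h g : H) (y : Tens k H M n) :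
    actT k H M n (h * g) y = actT k H M n h (actT k H M n g y) := by
  induction n with
  | zero => exact mul_smul h g ((Tens.zeroEquiv k H M).symm y)
  | succ n ih =>
    induction y using Tens.ind with
    | h0 => simp only [map_zero]
    | hadd x y hx hy => simp only [map_add, hx, hy]
    | h a y => simp [ih]

lemma actT_one (n : ℕ) (y : Tens k H M n) : actT k H M n 1 y = y := by
  induction n with
  | zero => exact one_smul H ((Tens.zeroEquiv k H M).symm y)
  | succ n ih =>
    induction y using Tens.ind with
    | h0 => simp only [map_zero]
    | hadd x y hx hy => simp only [map_add, hx, hy]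
    | h a y => simp [ih]

/-- The map `a ⊗ b ↦ a ⊗ (b y)`. -/
noncomputable def spread (n : ℕ) (y : Tens k H M n) : H ⊗[k] H →ₗ[k] Tens k H M (n + 1) :=
  (succEquiv k H M n).toLinearMap ∘ₗ LinearMap.lTensor H ((actT k H M n).flip y)

@[simp] lemma spread_tmul (n : ℕ) (y : Tens k H M n) (a b : H) :
    spread n y (a ⊗ₜ[k] b) = cns a (actT k H M n b y) := rfl

lemma tT_zero (h : H) (y : Tens k H M 0) :
    tT k H M 0 (cns h y) = spread 0 y (Coalgebra.comul (R := k) h) := by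
  simp only [tT, LinearMap.comp_apply, LinearEquiv.coe_coe, succEquiv_symm_cns,
    LinearMap.rTensor_tmul]
  induction Coalgebra.comul (R := k) h using TensorProduct.induction_on with
  | zero => simp
  | add x y hx hy => simp only [map_add, TensorProduct.add_tmul, hx, hy]
  | tmul a b => rfl

lemma tT_sT_last (n : ℕ) (x : Tens k H M (n + 1)) :
    tT k H M (n + 1) (sT k H M n n x) = cns 1 x := by
  induction n with
  | zero =>
    induction x using Tens.ind with
    | h0 => simp only [map_zero, cns_zero]
    | hadd x y hx hy => simp only [map_add, hx, hy, cns_add]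
    | h h y =>
      rw [sT_zero, tT_succ, tT_zero, Bialgebra.comul_one, Algebra.TensorProduct.one_def,
        spread_tmul, actT_one, swap_cns]
  | succ n ih =>
    induction x using Tens.ind with
    | h0 => simp only [map_zero, cns_zero]
    | hadd x y hx hy => simp only [map_add, hx, hy, cns_add]
    | h h y => rw [sT_succ, tT_succ, ih, swap_cns]

lemma sT_tT_zero (n : ℕ) (x : Tens k H M (n + 1)) :
    sT k H M n 0 (tT k H M n x) = tT k H M (n + 1) (tT k H M (n + 1) (sT k H M n n x)) := by
  rw [tT_sT_last, tT_succ]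
  induction tT k H M n x using Tens.ind with
  | h0 => simp only [map_zero, cns_zero]
  | hadd x y hx hy => simp only [map_add, hx, hy, cns_add]
  | h h y => simp

lemma dT_tT_sT (n : ℕ) (x : Tens k H M (n + 1)) :
    dT k H M n 0 (tT k H M (n + 1) (sT k H M n n x)) = x := by
  rw [tT_sT_last]
  induction x using Tens.ind with
  | h0 => simp only [map_zero, cns_zero]
  | hadd x y hx hy => simp only [map_add, hx, hy, cns_add]
  | h h y => simp

lemma dT_swap_spread (a b : H) (u : H ⊗[k] H) (y : Tens k H M 0) :
    dT k H M 0 0 (swap k H M 0 (cns a (spread 0 (actT k H M 0 b y) u))) =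
      spread 0 y (u * (a ⊗ₜ[k] b)) := by
  induction u using TensorProduct.induction_on with
  | zero => simp only [map_zero, cns_zero, zero_mul]
  | add x y hx hy => simp only [map_add, hx, hy, cns_add, add_mul]
  | tmul c d => simp [actT_mul]

lemma dT_tT_swap_spread (h : H) (w : H ⊗[k] H) (y : Tens k H M 0) :
    dT k H M 0 0 (tT k H M 1 (swap k H M 0 (cns h (spread 0 y w)))) =
      spread 0 y (Coalgebra.comul (R := k) h * w) := by
  induction w using TensorProduct.induction_on with
  | zero => simp only [map_zero, cns_zero, mul_zero]
  | add x y hx hy => simp only [map_add, hx, hy, cns_add, mul_add]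
  | tmul c d => rw [spread_tmul, swap_cns, tT_succ, tT_zero, dT_swap_spread]

lemma dT_tT_tT (n : ℕ) (x : Tens k H M (n + 2)) :
    dT k H M n 0 (tT k H M (n + 1) (tT k H M (n + 1) x)) = tT k H M n (dT k H M n n x) := by
  induction n with
  | zero =>
    induction x using Tens.ind with
    | h0 => simp only [map_zero]
    | hadd x y hx hy => simp only [map_add, hx, hy]
    | h h x =>
    induction x using Tens.ind with
    | h0 => simp only [cns_zero, map_zero]
    | hadd x y hx hy => simp only [map_add, cns_add, hx, hy]
    | h g x => rw [tT_succ, tT_zero, dT_tT_swap_spread, dT_zero, tT_zero, Bialgebra.comul_mul]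
  | succ n ih =>
    induction x using Tens.ind with
    | h0 => simp only [map_zero]
    | hadd x y hx hy => simp only [map_add, hx, hy]
    | h h x =>
    rw [dT_succ, tT_succ, tT_succ, ← ih]
    induction tT k H M (n + 1) x using Tens.ind with
    | h0 => simp only [cns_zero, map_zero]
    | hadd x y hx hy => simp only [map_add, cns_add, hx, hy]
    | h a z =>
    rw [swap_cns, tT_succ, tT_succ, tT_succ]
    induction tT k H M n z using Tens.ind with
    | h0 => simp only [cns_zero, map_zero]
    | hadd x y hx hy => simp only [map_add, cns_add, hx, hy]
    | h b w => simp

/-- The action of the first factor on the last one. -/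
noncomputable def contract (n : ℕ) : H ⊗[k] Tens k H M n →ₗ[k] Tens k H M n :=
  TensorProduct.lift (actT k H M n)

@[simp] lemma contract_tmul (n : ℕ) (h : H) (y : Tens k H M n) :
    contract n (h ⊗ₜ[k] y) = actT k H M n h y := rfl

lemma tT_ins (h : H) (n j : ℕ) (hj : j ≤ n) (y : Tens k H M (n + 1)) :
    tT k H M (n + 1) (ins h (n + 1) j y) = ins h (n + 1) (j + 1) (tT k H M n y) := by
  induction n generalizing j with
  | zero =>
    obtain rfl : j = 0 := by omega
    rw [ins_zero, tT_succ]
    induction tT k H M 0 y using Tens.ind with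
    | h0 => simp only [cns_zero, map_zero]
    | hadd x y hx hy => simp only [map_add, cns_add, hx, hy]
    | h a z => simp
  | succ n ih =>
    obtain _ | j := j
    · rw [ins_zero, tT_succ]
      induction tT k H M (n + 1) y using Tens.ind with
      | h0 => simp only [cns_zero, map_zero]
      | hadd x y hx hy => simp only [map_add, cns_add, hx, hy]
      | h a z => simp
    · induction y using Tens.ind with
      | h0 => simp only [map_zero]
      | hadd x y hx hy => simp only [map_add, hx, hy]
      | h g y =>
      rw [ins_succ, tT_succ, ih j (by omega), tT_succ]
      induction tT k H M n y using Tens.ind with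
      | h0 => simp only [cns_zero, map_zero]
      | hadd x y hx hy => simp only [map_add, cns_add, hx, hy]
      | h a z => simp

lemma tT_ins_last (h : H) (n : ℕ) (y : Tens k H M n) :
    tT k H M n (ins h n n y) = spread n y (Coalgebra.comul (R := k) h) := by
  induction n with
  | zero => rw [ins_zero, tT_zero]
  | succ n ih =>
    induction y using Tens.ind with
    | h0 => rw [map_zero, map_zero]; simp [spread]
    | hadd x y hx hy => rw [map_add, map_add, hx, hy]; simp [spread]
    | h g y =>
    rw [ins_succ, tT_succ, ih]
    induction Coalgebra.comul (R := k) h using TensorProduct.induction_on with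
    | zero => simp only [cns_zero, map_zero]
    | add x y hx hy => simp only [map_add, cns_add, hx, hy]
    | tmul a b => simp

lemma tT_pow_ins (h : H) (n j : ℕ) (hj : j ≤ n + 1) (y : Tens k H M (n + 1)) :
    (tT k H M (n + 1) ^ j) (cns h y) = ins h (n + 1) j ((tT k H M n ^ j) y) := by
  induction j with
  | zero => simp
  | succ j ih =>
    rw [pow_succ', Module.End.mul_apply, ih (by omega), tT_ins _ _ _ (by omega), pow_succ',
      Module.End.mul_apply]

lemma contract_consL (n : ℕ) (z : H ⊗[k] Tens k H M n) (u : H ⊗[k] H) :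
    contract (n + 1) (consL n z u) = spread n (contract n z) u := by
  induction z using TensorProduct.induction_on with
  | zero => simp [consL_zero, spread]
  | add x y hx hy => simp only [map_add, hx, hy, consL_add]; simp [spread]
  | tmul g y =>
    induction u using TensorProduct.induction_on with
    | zero => simp
    | add x y hx hy => simp only [map_add, hx, hy]
    | tmul a b => simp [actT_mul]

lemma tT_pow (n : ℕ) (y : Tens k H M (n + 1)) :
    (tT k H M n ^ (n + 1)) y = contract (n + 1) (coactL k H M (n + 1) y) := by
  induction n with
  | zero =>
    induction y using Tens.ind with
    | h0 => simp only [map_zero]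
    | hadd x y hx hy => simp only [map_add, hx, hy]
    | h g y =>
      rw [coactL_cns, contract_consL, pow_succ', Module.End.mul_apply, pow_zero,
        Module.End.one_apply, tT_zero]
      congr 2
      exact (actT_one 0 y).symm
  | succ n ih =>
    induction y using Tens.ind with
    | h0 => simp only [map_zero]
    | hadd x y hx hy => simp only [map_add, hx, hy]
    | h g y =>
      rw [coactL_cns, contract_consL, pow_succ', Module.End.mul_apply, tT_pow_ins _ _ _ le_rfl,
        tT_ins_last, ih]

lemma contract_coactR (φ : M →ₗ[k] H ⊗[k] M)
    (hφ : ∀ m, TensorProduct.lift (actM k H M) (φ m) = m) (n : ℕ) (y : Tens k H M n) :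
    contract n (coactR k H φ n y) = y := by
  induction n with
  | zero =>
    have : ∀ z : H ⊗[k] M, contract 0 (LinearMap.lTensor H (Tens.zeroEquiv k H M).toLinearMap z) =
        Tens.zeroEquiv k H M (TensorProduct.lift (actM k H M) z) := by
      intro z
      induction z using TensorProduct.induction_on with
      | zero => simp
      | add x y hx hy => simp only [map_add, hx, hy]
      | tmul a b => rfl
    refine (this _).trans ?_
    rw [LinearMap.comp_apply, hφ]; rfl
  | succ n ih =>
    induction y using Tens.ind with
    | h0 => simp only [map_zero]
    | hadd x y hx hy => simp only [map_add, hx, hy]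
    | h g y =>
      rw [coactR_cns]
      have : ∀ z : H ⊗[k] Tens k H M n, contract (n + 1) (consR n g z) = cns g (contract n z) := by
        intro z
        induction z using TensorProduct.induction_on with
        | zero => simp [cns_zero]
        | add x y hx hy => simp only [map_add, hx, hy, cns_add]
        | tmul a b => simp
      rw [this, ih]

end lemmas

section ayd

variable {k : Type u} [Field k] {H : Type v} [Ring H] [HopfAlgebra k H]
  {M : Type v} [AddCommGroup M] [Module k M]
  (hS : Function.Bijective (HopfAlgebra.antipode k (A := H)))

lemma antipode_antipodeInv (h : H) :
    HopfAlgebra.antipode k (antipodeInv k H hS h) = h :=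
  (LinearEquiv.ofBijective _ hS).apply_symm_apply h

/-- The map `r ⊗ s ↦ s S⁻¹(r)`. -/
noncomputable def mulInv : H ⊗[k] H →ₗ[k] H :=
  TensorProduct.lift ((LinearMap.mul k H).flip ∘ₗ antipodeInv k H hS)

@[simp] lemma mulInv_tmul (r s : H) : mulInv hS (r ⊗ₜ[k] s) = s * antipodeInv k H hS r := rfl

lemma mulInv_comul (h : H) : mulInv hS (Coalgebra.comul (R := k) h) =
    Coalgebra.counit (R := k) h • 1 := by
  apply hS.1
  have : ∀ w : H ⊗[k] H, HopfAlgebra.antipode k (mulInv hS w) =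
      LinearMap.mul' k H ((HopfAlgebra.antipode k).lTensor H w) := by
    intro w
    induction w using TensorProduct.induction_on with
    | zero => simp
    | add x y hx hy => simp only [map_add, hx, hy]
    | tmul a b => simp [HopfAlgebra.antipode_mul_antidistrib, antipode_antipodeInv]
  rw [this, HopfAlgebra.mul_antipode_lTensor_comul_apply, map_smul, HopfAlgebra.antipode_one,
    Algebra.algebraMap_eq_smul_one]

variable [Module H M] [IsScalarTower k H M]

/-- The map `b ⊗ s ↦ s S⁻¹(b⁽²⁾) ⊗ b⁽¹⁾ m`. -/
noncomputable def aydAux (m : M) : H ⊗[k] H →ₗ[k] H ⊗[k] M :=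
  TensorProduct.map (mulInv hS) ((actM k H M).flip m) ∘ₗ
    (TensorProduct.comm k H (H ⊗[k] H)).toLinearMap ∘ₗ (TensorProduct.assoc k H H H).toLinearMap ∘ₗ
    LinearMap.rTensor H Coalgebra.comul

lemma aydAux_comul (m : M) (h : H) :
    aydAux hS m (Coalgebra.comul (R := k) h) = 1 ⊗ₜ actM k H M h m := by
  have : ∀ w : H ⊗[k] H, TensorProduct.map (mulInv hS) ((actM k H M).flip m)
      (TensorProduct.comm k H (H ⊗[k] H) (LinearMap.lTensor H Coalgebra.comul w)) =
      1 ⊗ₜ actM k H M (TensorProduct.rid k H (LinearMap.lTensor H Coalgebra.counit w)) m := by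
    intro w
    induction w using TensorProduct.induction_on with
    | zero => simp
    | add x y hx hy => simp only [map_add, hx, hy, LinearMap.add_apply, TensorProduct.tmul_add]
    | tmul a b => simp [mulInv_comul, TensorProduct.smul_tmul]
  have h2 := this (Coalgebra.comul h)
  rw [← Coalgebra.coassoc_apply, Coalgebra.lTensor_counit_comul] at h2
  simpa [aydAux] using h2

lemma aydOp_comul (x : H) (m : M) (h : H) :
    TensorProduct.lift ((aydOp k H M hS).compl₂
      ((TensorProduct.mk k H M).flip m ∘ₗ LinearMap.mulLeft k x)) (Coalgebra.comul h) =
    TensorProduct.map (LinearMap.mulRight k x) ((actM k H M).flip m) (Coalgebra.comul h) := by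
  set F : H ⊗[k] (H ⊗[k] H) →ₗ[k] H ⊗[k] M := LinearMap.rTensor M (LinearMap.mul' k H) ∘ₗ
    (TensorProduct.assoc k H H M).symm.toLinearMap ∘ₗ
      TensorProduct.map (LinearMap.mulRight k x) (aydAux hS m) with hF
  have h1 : ∀ w : H ⊗[k] H, TensorProduct.lift ((aydOp k H M hS).compl₂
      ((TensorProduct.mk k H M).flip m ∘ₗ LinearMap.mulLeft k x)) w =
      F (TensorProduct.assoc k H H H (LinearMap.rTensor H Coalgebra.comul w)) := by
    intro w
    induction w using TensorProduct.induction_on with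
    | zero => simp
    | add x y hx hy => simp only [map_add, hx, hy]
    | tmul c s =>
      simp only [TensorProduct.lift.tmul, LinearMap.compl₂_apply, LinearMap.comp_apply,
        LinearMap.rTensor_tmul, aydOp]
      induction Coalgebra.comul (R := k) c using TensorProduct.induction_on with
      | zero => simp
      | add x y hx hy => simp only [map_add, TensorProduct.add_tmul, LinearMap.add_apply, hx, hy]
      | tmul a b =>
        simp only [hF, LinearMap.lTensor_tmul, aydAux, LinearMap.comp_apply,
          LinearEquiv.coe_coe, TensorProduct.assoc_tmul, TensorProduct.map_tmul,
          LinearMap.rTensor_tmul]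
        induction Coalgebra.comul (R := k) b using TensorProduct.induction_on with
        | zero => simp
        | add x y hx hy =>
          simp only [map_add, TensorProduct.tmul_add, TensorProduct.add_tmul, LinearMap.add_apply,
            hx, hy]
        | tmul q r => simp [mul_assoc]
  have h2 : ∀ w : H ⊗[k] H, F (LinearMap.lTensor H Coalgebra.comul w) =
      TensorProduct.map (LinearMap.mulRight k x) ((actM k H M).flip m) w := by
    intro w
    induction w using TensorProduct.induction_on with
    | zero => simp
    | add x y hx hy => simp only [map_add, hx, hy]
    | tmul c s => simp [hF, aydAux_comul]
  rw [h1, Coalgebra.coassoc_apply, h2]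

end ayd

section inner

variable {k : Type u} [Field k] {H : Type v} [Ring H] [HopfAlgebra k H]
  {M : Type v} [AddCommGroup M] [Module k M] (φ : M →ₗ[k] H ⊗[k] M)

lemma lTensor_map_consL {n m : ℕ} (f : Tens k H M n →ₗ[k] Tens k H M m) (z : H ⊗[k] Tens k H M n)
    (u : H ⊗[k] H) :
    LinearMap.lTensor H (Tens.map k H M f) (consL n z u) = consL m (LinearMap.lTensor H f z) u := by
  induction z using TensorProduct.induction_on with
  | zero => simp [consL_zero]
  | add x y hx hy => simp only [map_add, consL_add, hx, hy]
  | tmul g y =>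
    induction u using TensorProduct.induction_on with
    | zero => simp
    | add x y hx hy => simp only [map_add, hx, hy]
    | tmul a b => simp

lemma lTensor_map_consR {n m : ℕ} (f : Tens k H M n →ₗ[k] Tens k H M m) (z : H ⊗[k] Tens k H M n)
    (h : H) :
    LinearMap.lTensor H (Tens.map k H M f) (consR n h z) = consR m h (LinearMap.lTensor H f z) := by
  induction z using TensorProduct.induction_on with
  | zero => simp
  | add x y hx hy => simp only [map_add, hx, hy]
  | tmul g y => simp

lemma lTensor_dT_consL (n : ℕ) (z : H ⊗[k] Tens k H M n) (u w : H ⊗[k] H) :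
    LinearMap.lTensor H (dT k H M n 0) (consL (n + 1) (consL n z w) u) = consL n z (u * w) := by
  induction z using TensorProduct.induction_on with
  | zero => simp [consL_zero]
  | add x y hx hy => simp only [map_add, consL_add, hx, hy]
  | tmul g y =>
    induction w using TensorProduct.induction_on with
    | zero => simp [consL_zero]
    | add x y hx hy => simp only [map_add, consL_add, mul_add, hx, hy]
    | tmul c d =>
      induction u using TensorProduct.induction_on with
      | zero => simp
      | add x y hx hy => simp only [map_add, add_mul, hx, hy]
      | tmul a b => simp [mul_assoc]

lemma lTensor_dT_consR (n : ℕ) (z : H ⊗[k] Tens k H M n) (h g : H) :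
    LinearMap.lTensor H (dT k H M n 0) (consR (n + 1) h (consR n g z)) = consR n (h * g) z := by
  induction z using TensorProduct.induction_on with
  | zero => simp
  | add x y hx hy => simp only [map_add, hx, hy]
  | tmul g y => simp

lemma consL_comul_one (n : ℕ) (z : H ⊗[k] Tens k H M n) :
    consL n z (1 ⊗ₜ 1) = consR n 1 z := by
  induction z using TensorProduct.induction_on with
  | zero => simp [consL_zero]
  | add x y hx hy => simp only [map_add, consL_add, hx, hy]
  | tmul g y => simp

lemma coactL_dT (n i : ℕ) (hi : i ≤ n) (x : Tens k H M (n + 2)) :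
    coactL k H M (n + 1) (dT k H M n i x) =
      LinearMap.lTensor H (dT k H M n i) (coactL k H M (n + 2) x) := by
  induction n generalizing i with
  | zero =>
    obtain rfl : i = 0 := by omega
    induction x using Tens.ind with
    | h0 => simp only [map_zero]
    | hadd x y hx hy => simp only [map_add, hx, hy]
    | h h x =>
    induction x using Tens.ind with
    | h0 => simp only [cns_zero, map_zero]
    | hadd x y hx hy => simp only [map_add, cns_add, hx, hy]
    | h g x =>
      rw [dT_zero, coactL_cns, coactL_cns, coactL_cns, lTensor_dT_consL, Bialgebra.comul_mul]
  | succ n ih =>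
    induction x using Tens.ind with
    | h0 => simp only [map_zero]
    | hadd x y hx hy => simp only [map_add, hx, hy]
    | h h x =>
    obtain _ | i := i
    · induction x using Tens.ind with
      | h0 => simp only [cns_zero, map_zero]
      | hadd x y hx hy => simp only [map_add, cns_add, hx, hy]
      | h g x =>
        rw [dT_zero, coactL_cns, coactL_cns, coactL_cns, lTensor_dT_consL, Bialgebra.comul_mul]
    · rw [dT_succ, coactL_cns, coactL_cns, ih i (by omega)]
      exact (lTensor_map_consL _ _ _).symm

lemma coactR_dT (n i : ℕ) (hi : i ≤ n) (x : Tens k H M (n + 2)) :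
    coactR k H φ (n + 1) (dT k H M n i x) =
      LinearMap.lTensor H (dT k H M n i) (coactR k H φ (n + 2) x) := by
  induction n generalizing i with
  | zero =>
    obtain rfl : i = 0 := by omega
    induction x using Tens.ind with
    | h0 => simp only [map_zero]
    | hadd x y hx hy => simp only [map_add, hx, hy]
    | h h x =>
    induction x using Tens.ind with
    | h0 => simp only [cns_zero, map_zero]
    | hadd x y hx hy => simp only [map_add, cns_add, hx, hy]
    | h g x => rw [dT_zero, coactR_cns, coactR_cns, coactR_cns, lTensor_dT_consR]
  | succ n ih =>
    induction x using Tens.ind with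
    | h0 => simp only [map_zero]
    | hadd x y hx hy => simp only [map_add, hx, hy]
    | h h x =>
    obtain _ | i := i
    · induction x using Tens.ind with
      | h0 => simp only [cns_zero, map_zero]
      | hadd x y hx hy => simp only [map_add, cns_add, hx, hy]
      | h g x => rw [dT_zero, coactR_cns, coactR_cns, coactR_cns, lTensor_dT_consR]
    · rw [dT_succ, coactR_cns, coactR_cns, ih i (by omega)]
      exact (lTensor_map_consR _ _ _).symm

lemma sT_zero_eq (n : ℕ) : sT k H M n 0 = Tens.map k H M (ins (k := k) (M := M) (1 : H) n 0) := by
  cases n <;> rfl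

lemma consR_eq_lTensor (n : ℕ) (h : H) (z : H ⊗[k] Tens k H M n) :
    consR n h z = LinearMap.lTensor H (ins h n 0) z := by
  cases n <;> rfl

lemma coactL_sT (n i : ℕ) (hi : i ≤ n) (x : Tens k H M (n + 1)) :
    coactL k H M (n + 2) (sT k H M n i x) =
      LinearMap.lTensor H (sT k H M n i) (coactL k H M (n + 1) x) := by
  induction n generalizing i with
  | zero =>
    obtain rfl : i = 0 := by omega
    induction x using Tens.ind with
    | h0 => simp only [map_zero]
    | hadd x y hx hy => simp only [map_add, hx, hy]
    | h h x =>
      rw [sT_zero, coactL_cns, coactL_cns, coactL_cns, Bialgebra.comul_one,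
        Algebra.TensorProduct.one_def, consL_comul_one, sT_zero_eq, lTensor_map_consL,
        consR_eq_lTensor]
  | succ n ih =>
    induction x using Tens.ind with
    | h0 => simp only [map_zero]
    | hadd x y hx hy => simp only [map_add, hx, hy]
    | h h x =>
    obtain _ | i := i
    · rw [sT_zero, coactL_cns, coactL_cns, coactL_cns, Bialgebra.comul_one,
        Algebra.TensorProduct.one_def, consL_comul_one, sT_zero_eq, lTensor_map_consL,
        consR_eq_lTensor]
    · rw [sT_succ, coactL_cns, coactL_cns, ih i (by omega)]
      exact (lTensor_map_consL _ _ _).symm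

lemma coactR_sT (n i : ℕ) (hi : i ≤ n) (x : Tens k H M (n + 1)) :
    coactR k H φ (n + 2) (sT k H M n i x) =
      LinearMap.lTensor H (sT k H M n i) (coactR k H φ (n + 1) x) := by
  induction n generalizing i with
  | zero =>
    obtain rfl : i = 0 := by omega
    induction x using Tens.ind with
    | h0 => simp only [map_zero]
    | hadd x y hx hy => simp only [map_add, hx, hy]
    | h h x =>
      rw [sT_zero, coactR_cns, coactR_cns, coactR_cns, sT_zero_eq, lTensor_map_consR,
        ← consR_eq_lTensor]
  | succ n ih =>
    induction x using Tens.ind with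
    | h0 => simp only [map_zero]
    | hadd x y hx hy => simp only [map_add, hx, hy]
    | h h x =>
    obtain _ | i := i
    · rw [sT_zero, coactR_cns, coactR_cns, coactR_cns, sT_zero_eq, lTensor_map_consR,
        ← consR_eq_lTensor]
    · rw [sT_succ, coactR_cns, coactR_cns, ih i (by omega)]
      exact (lTensor_map_consR _ _ _).symm

lemma mem_cotensor {n : ℕ} {x : Tens k H M (n + 1)} :
    x ∈ cotensor k H φ n ↔ coactL k H M (n + 1) x = coactR k H φ (n + 1) x := by
  rw [cotensor, LinearMap.mem_ker, LinearMap.sub_apply, sub_eq_zero]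

lemma lTensor_swap_consR_consR (n : ℕ) (z : H ⊗[k] Tens k H M n) (h g : H) :
    LinearMap.lTensor H (swap k H M n) (consR (n + 1) h (consR n g z)) =
      consR (n + 1) g (consR n h z) := by
  induction z using TensorProduct.induction_on with
  | zero => simp
  | add x y hx hy => simp only [map_add, hx, hy]
  | tmul g y => simp

lemma coactR_swap (n : ℕ) (x : Tens k H M (n + 2)) :
    coactR k H φ (n + 2) (swap k H M n x) =
      LinearMap.lTensor H (swap k H M n) (coactR k H φ (n + 2) x) := by
  induction x using Tens.ind with
  | h0 => simp only [map_zero]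
  | hadd x y hx hy => simp only [map_add, hx, hy]
  | h h x =>
  induction x using Tens.ind with
  | h0 => simp only [cns_zero, map_zero]
  | hadd x y hx hy => simp only [map_add, cns_add, hx, hy]
  | h g x =>
    rw [swap_cns, coactR_cns, coactR_cns, coactR_cns, coactR_cns, lTensor_swap_consR_consR]

/-- The inverse of `h ⊗ (g ⊗ y) ↦ g ⊗ (h ⊗ y)`. -/
noncomputable def unconsR (n : ℕ) : H ⊗[k] Tens k H M (n + 1) →ₗ[k] H ⊗[k] (H ⊗[k] Tens k H M n) :=
  (TensorProduct.leftComm k H H (Tens k H M n)).toLinearMap ∘ₗ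
    LinearMap.lTensor H (succEquiv k H M n).symm.toLinearMap

lemma unconsR_consR (n : ℕ) (h : H) (z : H ⊗[k] Tens k H M n) :
    unconsR n (consR n h z) = h ⊗ₜ z := by
  induction z using TensorProduct.induction_on with
  | zero => simp
  | add x y hx hy => simp only [map_add, hx, hy, TensorProduct.tmul_add]
  | tmul g y => simp [unconsR]

/-- The map `h ⊗ (g ⊗ y) ↦ g ⊗ (h ⊗ y)`. -/
noncomputable def consR' (n : ℕ) : H ⊗[k] (H ⊗[k] Tens k H M n) →ₗ[k] H ⊗[k] Tens k H M (n + 1) :=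
  LinearMap.lTensor H (succEquiv k H M n).toLinearMap ∘ₗ
    (TensorProduct.leftComm k H H (Tens k H M n)).toLinearMap

@[simp] lemma consR'_tmul (n : ℕ) (h : H) (z : H ⊗[k] Tens k H M n) :
    consR' n (h ⊗ₜ[k] z) = consR n h z := by
  induction z using TensorProduct.induction_on with
  | zero => simp
  | add x y hx hy => simp only [map_add, hx, hy, TensorProduct.tmul_add]
  | tmul g y => simp [consR']; rfl

/-- The operator `a ⊗ y ↦ a⁽²⁾ x g ⊗ (a⁽¹⁾ ⊗ y')`, where `g ⊗ y'` is the image of `y` under the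
first coaction. -/
noncomputable def coactLMul (n : ℕ) (x : H) : Tens k H M (n + 1) →ₗ[k] H ⊗[k] Tens k H M (n + 1) :=
  TensorProduct.map (LinearMap.mul' k H) (Tens.succEquiv k H M n).toLinearMap ∘ₗ
    (TensorProduct.tensorTensorTensorComm k H H H (Tens k H M n)).toLinearMap ∘ₗ
    TensorProduct.map ((TensorProduct.comm k H H).toLinearMap ∘ₗ Coalgebra.comul)
      (LinearMap.rTensor _ (LinearMap.mulLeft k x) ∘ₗ coactL k H M n) ∘ₗ
    (Tens.succEquiv k H M n).symm.toLinearMap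

lemma coactLMul_cns (n : ℕ) (x h : H) (y : Tens k H M n) : coactLMul n x (cns h y) =
    consL n (LinearMap.rTensor _ (LinearMap.mulLeft k x) (coactL k H M n y))
      (Coalgebra.comul (R := k) h) := rfl

lemma coactLMul_one (n : ℕ) (y : Tens k H M (n + 1)) :
    coactLMul n (1 : H) y = coactL k H M (n + 1) y := by
  simp only [coactLMul, coactL, LinearMap.mulLeft_one, LinearMap.rTensor_id, LinearMap.id_comp]

end inner

section cyclic

variable {k : Type u} [Field k] {H : Type v} [Ring H] [HopfAlgebra k H]
  {M : Type v} [AddCommGroup M] [Module k M] [Module H M] [IsScalarTower k H M]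
  (hS : Function.Bijective (HopfAlgebra.antipode k (A := H)))

/-- The anti-Yetter-Drinfeld operator on `H ⊗ (H^{⊗ 0} ⊗ M)`. -/
noncomputable def aydT : H →ₗ[k] H ⊗[k] Tens k H M 0 →ₗ[k] H ⊗[k] Tens k H M 0 :=
  ((aydOp k H M hS).compr₂ (LinearMap.lTensor H (zeroEquiv k H M).toLinearMap)).compl₂
    (LinearMap.lTensor H (zeroEquiv k H M).symm.toLinearMap)

/-- The map `a ⊗ b ↦ a ⊗ A_b(z)`, with the first factor moved to the second place. -/
noncomputable def spreadA (z : H ⊗[k] Tens k H M 0) : H ⊗[k] H →ₗ[k] H ⊗[k] Tens k H M 1 :=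
  consR' 0 ∘ₗ LinearMap.lTensor H ((aydT hS).flip z)

/-- The operator on `H ⊗ (H^{⊗ (n+1)} ⊗ M)` that corresponds to the cyclic operator. -/
noncomputable def cycOp : ∀ n, H ⊗[k] Tens k H M (n + 1) →ₗ[k] H ⊗[k] Tens k H M (n + 1)
  | 0 => consR' 0 ∘ₗ LinearMap.lTensor H (TensorProduct.lift (aydT hS)) ∘ₗ
      (TensorProduct.assoc k H H _).toLinearMap ∘ₗ LinearMap.rTensor _ Coalgebra.comul ∘ₗ unconsR 0
  | n + 1 => LinearMap.lTensor H (swap k H M n) ∘ₗ consR' (n + 1) ∘ₗ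
      LinearMap.lTensor H (cycOp n) ∘ₗ unconsR (n + 1)

lemma cycOp_zero (h : H) (z : H ⊗[k] Tens k H M 0) :
    cycOp hS 0 (consR 0 h z) = spreadA hS z (Coalgebra.comul (R := k) h) := by
  simp only [cycOp, LinearMap.comp_apply, unconsR_consR, spreadA, LinearMap.rTensor_tmul]
  congr 1
  induction Coalgebra.comul (R := k) h using TensorProduct.induction_on with
  | zero => simp
  | add x y hx hy => simp only [map_add, TensorProduct.add_tmul, hx, hy]
  | tmul a b => simp

lemma cycOp_succ (n : ℕ) (h : H) (z : H ⊗[k] Tens k H M (n + 1)) :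
    cycOp hS (n + 1) (consR (n + 1) h z) =
      LinearMap.lTensor H (swap k H M n) (consR (n + 1) h (cycOp hS n z)) := by
  simp only [cycOp, LinearMap.comp_apply, unconsR_consR, LinearMap.lTensor_tmul, consR'_tmul]

lemma coactR_tT (φ : M →ₗ[k] H ⊗[k] M)
    (hφ : ∀ (h : H) (m : M), φ (h • m) = aydOp k H M hS h (φ m)) (n : ℕ) (x : Tens k H M (n + 1)) :
    coactR k H φ (n + 1) (tT k H M n x) = cycOp hS n (coactR k H φ (n + 1) x) := by
  induction n with
  | zero =>
    induction x using Tens.ind with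
    | h0 => simp only [map_zero]
    | hadd x y hx hy => simp only [map_add, hx, hy]
    | h h x =>
      rw [tT_zero, coactR_cns, cycOp_zero]
      induction Coalgebra.comul (R := k) h using TensorProduct.induction_on with
      | zero => simp only [map_zero]
      | add x y hx hy => simp only [map_add, hx, hy]
      | tmul a b =>
        rw [spread_tmul, coactR_cns]
        have h1 : coactR k H φ 0 (actT k H M 0 b x) = aydT hS b (coactR k H φ 0 x) := by
          have h2 := congrArg (LinearMap.lTensor H (zeroEquiv k H M).toLinearMap)
            (hφ b ((zeroEquiv k H M).symm x))
          refine h2.trans ?_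
          simp only [aydT, coactR, LinearMap.compl₂_apply, LinearMap.compr₂_apply,
            LinearMap.comp_apply]
          congr 2
          rw [← LinearMap.comp_apply, ← LinearMap.lTensor_comp]
          simp
        rw [h1]
        simp [spreadA]
  | succ n ih =>
    induction x using Tens.ind with
    | h0 => simp only [map_zero]
    | hadd x y hx hy => simp only [map_add, hx, hy]
    | h h x => rw [tT_succ, coactR_swap, coactR_cns, ih, coactR_cns, cycOp_succ]

end cyclic

section cyclic

variable {k : Type u} [Field k] {H : Type v} [Ring H] [HopfAlgebra k H]
  {M : Type v} [AddCommGroup M] [Module k M]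

lemma mulLeft_consL (n : ℕ) (x a b : H) (z : H ⊗[k] Tens k H M n) :
    LinearMap.rTensor _ (LinearMap.mulLeft k x) (consL n z (a ⊗ₜ b)) =
      consR n a (LinearMap.rTensor _ (LinearMap.mulLeft k (x * b)) z) := by
  induction z using TensorProduct.induction_on with
  | zero => simp [consL_zero]
  | add x y hx hy => simp only [map_add, consL_add, hx, hy]
  | tmul g y => simp

lemma lTensor_swap_consR_consL (n : ℕ) (a : H) (z : H ⊗[k] Tens k H M n) (u : H ⊗[k] H) :
    LinearMap.lTensor H (swap k H M n) (consR (n + 1) a (consL n z u)) =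
      consL (n + 1) (consR n a z) u := by
  induction z using TensorProduct.induction_on with
  | zero => simp [consL_zero]
  | add x y hx hy => simp only [map_add, consL_add, hx, hy]
  | tmul g y =>
    induction u using TensorProduct.induction_on with
    | zero => simp
    | add x y hx hy => simp only [map_add, hx, hy]
    | tmul a b => simp

lemma consL_sum {ι : Type v} (s : Finset ι) (n : ℕ) (z : ι → H ⊗[k] Tens k H M n) (u : H ⊗[k] H) :
    consL n (∑ i ∈ s, z i) u = ∑ i ∈ s, consL n (z i) u := by
  simp [consL]

lemma coactLMul_swap (n : ℕ) (x h : H) (r : Coalgebra.Repr k h (H × H)) (w : Tens k H M (n + 1)) :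
    coactLMul (n + 1) x (swap k H M n (cns h w)) =
      ∑ i ∈ r.index, LinearMap.lTensor H (swap k H M n)
        (consR (n + 1) (r.left i) (coactLMul n (x * r.right i) w)) := by
  induction w using Tens.ind with
  | h0 => simp [cns_zero]
  | hadd y z hy hz => simp only [map_add, cns_add, hy, hz, Finset.sum_add_distrib]
  | h a v =>
    rw [swap_cns, coactLMul_cns, coactL_cns, ← r.eq, map_sum, map_sum, consL_sum]
    refine Finset.sum_congr rfl fun i _ => ?_
    rw [mulLeft_consL, coactLMul_cns, lTensor_swap_consR_consL]

variable [Module H M] [IsScalarTower k H M]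
  (hS : Function.Bijective (HopfAlgebra.antipode k (A := H)))

/-- The map `c ⊗ s ↦ A_c(x s ⊗ y)`. -/
noncomputable def aydLeft (x : H) (y : Tens k H M 0) : H ⊗[k] H →ₗ[k] H ⊗[k] Tens k H M 0 :=
  TensorProduct.lift ((aydT hS).compl₂
    ((TensorProduct.mk k H (Tens k H M 0)).flip y ∘ₗ LinearMap.mulLeft k x))

/-- The map `c ⊗ s ↦ c x ⊗ s y`. -/
noncomputable def aydRight (x : H) (y : Tens k H M 0) : H ⊗[k] H →ₗ[k] H ⊗[k] Tens k H M 0 :=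
  TensorProduct.map (LinearMap.mulRight k x) ((actT k H M 0).flip y)

lemma aydLeft_comul (x : H) (y : Tens k H M 0) (h : H) :
    aydLeft hS x y (Coalgebra.comul (R := k) h) = aydRight x y (Coalgebra.comul (R := k) h) := by
  have h0 := congrArg (LinearMap.lTensor H (zeroEquiv k H M).toLinearMap)
    (aydOp_comul hS x ((zeroEquiv k H M).symm y) h)
  have h1 : ∀ w : H ⊗[k] H, aydLeft hS x y w = LinearMap.lTensor H (zeroEquiv k H M).toLinearMap
      (TensorProduct.lift ((aydOp k H M hS).compl₂
        ((TensorProduct.mk k H M).flip ((zeroEquiv k H M).symm y) ∘ₗ LinearMap.mulLeft k x)) w) := by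
    intro w
    induction w using TensorProduct.induction_on with
    | zero => simp only [map_zero]
    | add x y hx hy => simp only [map_add, hx, hy]
    | tmul a b => simp [aydLeft, aydT]
  have h2 : ∀ w : H ⊗[k] H, aydRight x y w = LinearMap.lTensor H (zeroEquiv k H M).toLinearMap
      (TensorProduct.map (LinearMap.mulRight k x)
        ((actM k H M).flip ((zeroEquiv k H M).symm y)) w) := by
    intro w
    induction w using TensorProduct.induction_on with
    | zero => simp only [map_zero]
    | add x y hx hy => simp only [map_add, hx, hy]
    | tmul a b => rfl
  rw [h1, h2, h0]

lemma cycOp_zero_coactL (x : H) (y : Tens k H M 0) (w : H ⊗[k] H) :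
    cycOp hS 0 (LinearMap.rTensor _ (LinearMap.mulLeft k x) (consL 0 (coactL k H M 0 y) w)) =
      consR' 0 (LinearMap.lTensor H (aydLeft hS x y)
        (TensorProduct.assoc k H H H (LinearMap.rTensor H Coalgebra.comul w))) := by
  induction w using TensorProduct.induction_on with
  | zero => simp only [map_zero]
  | add x y hx hy => simp only [map_add, hx, hy]
  | tmul a b =>
    rw [mulLeft_consL, cycOp_zero, LinearMap.rTensor_tmul]
    induction Coalgebra.comul (R := k) a using TensorProduct.induction_on with
    | zero => simp
    | add x y hx hy => simp only [map_add, TensorProduct.add_tmul, hx, hy]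
    | tmul c d => simp [spreadA, coactL, aydLeft]

lemma coactLMul_spread (x : H) (y : Tens k H M 0) (w : H ⊗[k] H) :
    coactLMul 0 x (spread 0 y w) = consR' 0 (LinearMap.lTensor H (aydRight x y)
      (TensorProduct.assoc k H H H (LinearMap.rTensor H Coalgebra.comul w))) := by
  induction w using TensorProduct.induction_on with
  | zero => simp only [map_zero]
  | add x y hx hy => simp only [map_add, hx, hy]
  | tmul a b =>
    rw [spread_tmul, coactLMul_cns, LinearMap.rTensor_tmul]
    induction Coalgebra.comul (R := k) a using TensorProduct.induction_on with
    | zero => simp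
    | add x y hx hy => simp only [map_add, TensorProduct.add_tmul, hx, hy]
    | tmul c d => simp [coactL, aydRight]

lemma cycOp_coactL (n : ℕ) (x : H) (y : Tens k H M (n + 1)) :
    cycOp hS n (LinearMap.rTensor _ (LinearMap.mulLeft k x) (coactL k H M (n + 1) y)) =
      coactLMul n x (tT k H M n y) := by
  induction n generalizing x with
  | zero =>
    induction y using Tens.ind with
    | h0 => simp only [map_zero]
    | hadd x y hx hy => simp only [map_add, hx, hy]
    | h h y =>
      rw [tT_zero, coactL_cns, cycOp_zero_coactL, coactLMul_spread, Coalgebra.coassoc_apply]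
      congr 1
      rw [← LinearMap.lTensor_comp_apply, ← LinearMap.lTensor_comp_apply]
      congr 2
      exact LinearMap.ext (aydLeft_comul hS x y)
  | succ n ih =>
    induction y using Tens.ind with
    | h0 => simp only [map_zero]
    | hadd x y hx hy => simp only [map_add, hx, hy]
    | h h y =>
      rw [tT_succ, coactLMul_swap n x h (Coalgebra.Repr.arbitrary k h), coactL_cns,
        ← (Coalgebra.Repr.arbitrary k h).eq, map_sum, map_sum, map_sum]
      refine Finset.sum_congr rfl fun i _ => ?_
      rw [mulLeft_consL, cycOp_succ, ih]

lemma coactL_tT (n : ℕ) (y : Tens k H M (n + 1)) :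
    coactL k H M (n + 1) (tT k H M n y) = cycOp hS n (coactL k H M (n + 1) y) := by
  have := cycOp_coactL hS n 1 y
  rw [coactLMul_one] at this
  rw [← this, LinearMap.mulLeft_one, LinearMap.rTensor_id, LinearMap.id_apply]

variable {hS} (X : SAYD k H M hS)

lemma tT_mem {n : ℕ} {x : Tens k H M (n + 1)} (hx : x ∈ cotensor k H X.coact n) :
    tT k H M n x ∈ cotensor k H X.coact n := by
  rw [mem_cotensor] at hx ⊢
  rw [coactL_tT hS, coactR_tT hS X.coact X.ayd, hx]

lemma tT_pow_mem {n : ℕ} {x : Tens k H M (n + 1)} (hx : x ∈ cotensor k H X.coact n) :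
    (tT k H M n ^ (n + 1)) x = x := by
  rw [mem_cotensor] at hx
  rw [tT_pow, hx, contract_coactR _ X.stable]

lemma dT_mem {n i : ℕ} (hi : i ≤ n) {x : Tens k H M (n + 2)}
    (hx : x ∈ cotensor k H X.coact (n + 1)) : dT k H M n i x ∈ cotensor k H X.coact n := by
  rw [mem_cotensor] at hx ⊢
  rw [coactL_dT _ _ hi, coactR_dT _ _ _ hi, hx]

lemma sT_mem {n i : ℕ} {x : Tens k H M (n + 1)}
    (hx : x ∈ cotensor k H X.coact n) : sT k H M n i x ∈ cotensor k H X.coact (n + 1) := by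
  by_cases hi : i ≤ n
  · rw [mem_cotensor] at hx ⊢
    rw [coactL_sT _ _ hi, coactR_sT _ _ _ hi, hx]
  · have : sT k H M n i = 0 := by
      clear hx x
      induction n generalizing i with
      | zero =>
        obtain _ | i := i
        · omega
        · rfl
      | succ n ih =>
        obtain _ | i := i
        · omega
        · refine LinearMap.ext fun x => Tens.ext (g := 0) (fun a y => ?_) x
          rw [sT_succ, ih (by omega), LinearMap.zero_apply, cns_zero, LinearMap.zero_apply]
    rw [this]
    exact zero_mem _

lemma faceT_mem {n i : ℕ} {x : Tens k H M (n + 2)}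
    (hx : x ∈ cotensor k H X.coact (n + 1)) : faceT k H M n i x ∈ cotensor k H X.coact n := by
  rw [faceT]
  split_ifs with h
  · exact dT_mem X h hx
  · exact dT_mem X (Nat.zero_le n) (tT_mem X hx)

lemma faceT_inner {n i : ℕ} (hi : i ≤ n) (x : Tens k H M (n + 2)) :
    faceT k H M n i x = dT k H M n i x := by
  rw [faceT, if_pos hi]

lemma faceT_last (n : ℕ) (x : Tens k H M (n + 2)) :
    faceT k H M n (n + 1) x = dT k H M n 0 (tT k H M (n + 1) x) := by
  rw [faceT, if_neg (by omega)]; rfl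

lemma faceT_tT_succ (n i : ℕ) (hi : i ≤ n) (x : Tens k H M (n + 2)) :
    faceT k H M n (i + 1) (tT k H M (n + 1) x) = tT k H M n (faceT k H M n i x) := by
  rcases hi.lt_or_eq with hi | rfl
  · rw [faceT_inner hi, faceT_inner hi.le, dT_tT_succ n i hi]
  · rw [faceT_last, faceT_inner le_rfl, dT_tT_tT]

lemma faceT_faceT (n i j : ℕ) (hij : i < j) (hj : j ≤ n + 2) (x : Tens k H M (n + 3)) :
    faceT k H M n i (faceT k H M (n + 1) j x) =
      faceT k H M n (j - 1) (faceT k H M (n + 1) i x) := by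
  obtain ⟨j, rfl⟩ : ∃ a, j = a + 1 := ⟨j - 1, by omega⟩
  rw [Nat.add_sub_cancel]
  rcases (show j ≤ n ∨ j = n + 1 by omega) with h | rfl
  · rw [faceT_inner (n := n + 1) (i := j + 1) (by omega), faceT_inner (by omega : i ≤ n),
      faceT_inner h, faceT_inner (by omega : i ≤ n + 1), dT_dT n i j (by omega) h]
  · rw [faceT_last, faceT_last]
    rcases (show i ≤ n ∨ i = n + 1 by omega) with h | rfl
    · rw [faceT_inner h, ← dT_dT n 0 i (by omega) h, faceT_inner (by omega : i ≤ n + 1),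
        dT_tT_succ (n + 1) i (by omega)]
    · rw [faceT_last, faceT_inner le_rfl, ← dT_tT_tT,
        ← dT_tT_succ (n + 1) 0 (by omega), dT_dT n 0 0 le_rfl (by omega)]

lemma faceT_sT_lt (n i j : ℕ) (hij : i < j) (hj : j ≤ n + 1) (x : Tens k H M (n + 2)) :
    faceT k H M (n + 1) i (sT k H M (n + 1) j x) = sT k H M n (j - 1) (faceT k H M n i x) := by
  obtain ⟨j, rfl⟩ : ∃ a, j = a + 1 := ⟨j - 1, by omega⟩
  rw [Nat.add_sub_cancel, faceT_inner (by omega), faceT_inner (by omega),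
    dT_sT_lt n i j (by omega) (by omega)]

lemma faceT_sT_self (n i : ℕ) (hi : i ≤ n) (x : Tens k H M (n + 1)) :
    faceT k H M n i (sT k H M n i x) = x := by
  rw [faceT_inner hi, dT_sT_self n i hi]

lemma faceT_sT_succ (n i : ℕ) (hi : i ≤ n) (x : Tens k H M (n + 1)) :
    faceT k H M n (i + 1) (sT k H M n i x) = x := by
  rcases hi.lt_or_eq with hi | rfl
  · rw [faceT_inner hi, dT_sT_succ n i hi]
  · rw [faceT_last, dT_tT_sT]

lemma faceT_sT_gt (n i j : ℕ) (hij : j + 1 < i) (hi : i ≤ n + 2) (x : Tens k H M (n + 2)) :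
    faceT k H M (n + 1) i (sT k H M (n + 1) j x) = sT k H M n j (faceT k H M n (i - 1) x) := by
  obtain ⟨i, rfl⟩ : ∃ a, i = a + 1 := ⟨i - 1, by omega⟩
  rw [Nat.add_sub_cancel]
  rcases (show i ≤ n ∨ i = n + 1 by omega) with h | rfl
  · rw [faceT_inner (by omega), faceT_inner h, dT_sT_gt n i j (by omega) h]
  · rw [faceT_last, faceT_last, ← sT_tT_succ (n + 1) j (by omega),
      dT_sT_lt n 0 j (by omega) (by omega)]

/-- The cyclic module `n ↦ H^{⊗ (n+1)} □_H M` of a left-left stable anti-Yetter-Drinfeld module. -/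
noncomputable def hopfCyclic : CyclicModule.{u, v} k where
  C n := cotensor k H X.coact n
  d n i := (faceT k H M n i).restrict fun _ hx => faceT_mem X hx
  s n i := (sT k H M n i).restrict fun _ hx => sT_mem X hx
  t n := (tT k H M n).restrict fun _ hx => tT_mem X hx
  d_d n i j hij hj x := Subtype.ext (faceT_faceT n i j hij hj x.1)
  s_s n i j hij hj x := Subtype.ext (sT_sT n i j hij hj x.1)
  d_s_lt n i j hij hj x := Subtype.ext (faceT_sT_lt n i j hij hj x.1)
  d_s_self n i hi x := Subtype.ext (faceT_sT_self n i hi x.1)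
  d_s_succ n i hi x := Subtype.ext (faceT_sT_succ n i hi x.1)
  d_s_gt n i j hij hi x := Subtype.ext (faceT_sT_gt n i j hij hi x.1)
  t_pow n x := by
    refine Subtype.ext ?_
    rw [Module.End.pow_restrict]
    exact tT_pow_mem X x.2
  d_zero_t n x := Subtype.ext (by
    change faceT k H M n 0 (tT k H M (n + 1) x.1) = faceT k H M n (n + 1) x.1
    rw [faceT_last, faceT_inner (Nat.zero_le n)])
  d_succ_t n i hi x := Subtype.ext (faceT_tT_succ n i hi x.1)
  s_zero_t n x := Subtype.ext (sT_tT_zero n x.1)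
  s_succ_t n i hi x := Subtype.ext (sT_tT_succ n i hi x.1)

end cyclic

section coproduct

variable (k : Type u) [Field k] (H : Type v) [Ring H] [HopfAlgebra k H]
  {M : Type v} [AddCommGroup M] [Module k M]

/-- The action of `H ⊗ H` on `M ⊗ M`, `(a ⊗ b) (m ⊗ m') = a m ⊗ b m'`. -/
noncomputable def tensorAct [Module H M] [IsScalarTower k H M] :
    H ⊗[k] H →ₗ[k] M ⊗[k] M →ₗ[k] M ⊗[k] M :=
  TensorProduct.homTensorHomMap (RingHom.id k) M M M M ∘ₗ
    TensorProduct.map (actM k H M) (actM k H M)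

/-- The coaction of `H ⊗ H` on `M ⊗ M`,
`m ⊗ m' ↦ (m⁽⁻¹⁾ ⊗ m'⁽⁻¹⁾) ⊗ (m⁽⁰⁾ ⊗ m'⁽⁰⁾)`. -/
noncomputable def tensorCoact (φ : M →ₗ[k] H ⊗[k] M) :
    M ⊗[k] M →ₗ[k] (H ⊗[k] H) ⊗[k] (M ⊗[k] M) :=
  (TensorProduct.tensorTensorTensorComm k H M H M).toLinearMap ∘ₗ TensorProduct.map φ φ

/-- The map `Φ = Δ^{⊗ n} ⊗ ψ : H^{⊗ n} ⊗ M → (H ⊗ H)^{⊗ n} ⊗ (M ⊗ M)`. -/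
noncomputable def PhiT (ψ : M →ₗ[k] M ⊗[k] M) :
    ∀ n, Tens k H M n →ₗ[k] Tens k (H ⊗[k] H) (M ⊗[k] M) n
  | 0 => (Tens.zeroEquiv k (H ⊗[k] H) (M ⊗[k] M)).toLinearMap ∘ₗ ψ ∘ₗ
      (Tens.zeroEquiv k H M).symm.toLinearMap
  | n + 1 => (Tens.succEquiv k (H ⊗[k] H) (M ⊗[k] M) n).toLinearMap ∘ₗ
      TensorProduct.map Coalgebra.comul (PhiT ψ n) ∘ₗ (Tens.succEquiv k H M n).symm.toLinearMap

variable (M) in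
/-- The map `Ω : (H ⊗ H)^{⊗ n} ⊗ (M ⊗ M) → (H^{⊗ n} ⊗ M) ⊗ (H^{⊗ n} ⊗ M)`,
`(h₁ ⊗ g₁) ⊗ ⋯ ⊗ (h_n ⊗ g_n) ⊗ (m ⊗ m') ↦ (h₁ ⊗ ⋯ ⊗ h_n ⊗ m) ⊗ (g₁ ⊗ ⋯ ⊗ g_n ⊗ m')`. -/
noncomputable def OmegaT :
    ∀ n, Tens k (H ⊗[k] H) (M ⊗[k] M) n →ₗ[k] Tens k H M n ⊗[k] Tens k H M n
  | 0 => TensorProduct.map (Tens.zeroEquiv k H M).toLinearMap (Tens.zeroEquiv k H M).toLinearMap ∘ₗ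
      (Tens.zeroEquiv k (H ⊗[k] H) (M ⊗[k] M)).symm.toLinearMap
  | n + 1 => TensorProduct.map (Tens.succEquiv k H M n).toLinearMap
        (Tens.succEquiv k H M n).toLinearMap ∘ₗ
      (TensorProduct.tensorTensorTensorComm k H H (Tens k H M n) (Tens k H M n)).toLinearMap ∘ₗ
      LinearMap.lTensor (H ⊗[k] H) (OmegaT n) ∘ₗ
      (Tens.succEquiv k (H ⊗[k] H) (M ⊗[k] M) n).symm.toLinearMap

end coproduct

end HopfCyc

open HopfCyc

namespace HopfCyc

namespace GrComplex

variable {k : Type u} [Field k]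

section representatives

variable {ι : Type} [GradingIndex ι]

/-- The map `⨁ H_p(X) ⊗ H_q(Y) → (X ⊗ Y)_n` given by the choice of representing cycles. -/
def representative (X Y : GrComplex.{u, v} k ι) (q : ∀ i, X.Homology i →ₗ[k] X.cycles i)
    (q' : ∀ i, Y.Homology i →ₗ[k] Y.cycles i) (n : ι) :
    (∀ e : TensorIdx n, X.Homology e.1.1 ⊗[k] Y.Homology e.1.2) →ₗ[k] (tensor X Y).X n :=
  LinearMap.pi fun e => TensorProduct.map ((X.cycles e.1.1).subtype ∘ₗ q e.1.1)
    ((Y.cycles e.1.2).subtype ∘ₗ q' e.1.2) ∘ₗ LinearMap.proj e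

lemma representative_single (X Y : GrComplex.{u, v} k ι) (q : ∀ i, X.Homology i →ₗ[k] X.cycles i)
    (q' : ∀ i, Y.Homology i →ₗ[k] Y.cycles i) (n : ι) (e : TensorIdx n) (a : X.Homology e.1.1)
    (b : Y.Homology e.1.2) :
    representative X Y q q' n (Pi.single e (a ⊗ₜ b)) =
      single X Y e ((q _ a).1 ⊗ₜ (q' _ b).1) := by
  funext e'
  change TensorProduct.map _ _ ((Pi.single e (a ⊗ₜ b) :
    ∀ e : TensorIdx n, X.Homology e.1.1 ⊗[k] Y.Homology e.1.2) e') = _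
  by_cases h : e' = e
  · subst h
    rw [single_self]; simp
  · rw [single_ne _ _ h, Pi.single_eq_of_ne h, map_zero]

lemma representative_mem_cycles (X Y : GrComplex.{u, v} k ι)
    (q : ∀ i, X.Homology i →ₗ[k] X.cycles i) (q' : ∀ i, Y.Homology i →ₗ[k] Y.cycles i) (n : ι)
    (w : ∀ e : TensorIdx n, X.Homology e.1.1 ⊗[k] Y.Homology e.1.2) :
    representative X Y q q' n w ∈ (tensor X Y).cycles n := by
  rw [← Finset.univ_sum_single w, map_sum]
  refine Submodule.sum_mem _ fun e _ => ?_
  induction w e using TensorProduct.induction_on with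
  | zero => rw [Pi.single_zero, map_zero]; exact Submodule.zero_mem _
  | add x y hx hy => rw [Pi.single_add, map_add]; exact Submodule.add_mem _ hx hy
  | tmul a b =>
    rw [representative_single]
    exact single_mem_cycles X Y e (q _ a).2 (q' _ b).2

/-- Sections of the projections from the cycles to the homology compute the Künneth map. -/
lemma kunneth_eq_mk (X Y : GrComplex.{u, v} k ι)
    (q : ∀ i, X.Homology i →ₗ[k] X.cycles i) (hq : ∀ i c, Submodule.Quotient.mk (q i c) = c)
    (q' : ∀ i, Y.Homology i →ₗ[k] Y.cycles i) (hq' : ∀ i c, Submodule.Quotient.mk (q' i c) = c)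
    (n : ι) (w : ∀ e : TensorIdx n, X.Homology e.1.1 ⊗[k] Y.Homology e.1.2) :
    kunneth X Y n w = Submodule.Quotient.mk
      ⟨representative X Y q q' n w, representative_mem_cycles X Y q q' n w⟩ := by
  suffices h : kunneth X Y n = Submodule.mkQ _ ∘ₗ (representative X Y q q' n).codRestrict _
      (representative_mem_cycles X Y q q' n) from congrArg (fun f => f w) h
  refine LinearMap.pi_ext' fun e => TensorProduct.ext' fun a b => ?_
  have : kunneth X Y n (Pi.single e (a ⊗ₜ b)) = cross X Y e (a ⊗ₜ b) := by
    rw [kunneth, LinearMap.sum_apply, Finset.sum_eq_single e]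
    · simp
    · intro e' _ h
      simp [Pi.single_eq_of_ne h]
    · simp
  refine this.trans ?_
  conv_lhs => rw [← hq _ a, ← hq' _ b]
  change Submodule.Quotient.mk _ = Submodule.Quotient.mk _
  congr 1
  exact Subtype.ext (representative_single X Y q q' n e a b).symm

lemma exists_homology_section (X : GrComplex.{u, v} k ι) :
    ∃ q : ∀ i, X.Homology i →ₗ[k] X.cycles i, ∀ i c, Submodule.Quotient.mk (q i c) = c := by
  have h : ∀ i, ∃ q : X.Homology i →ₗ[k] X.cycles i, ∀ c, Submodule.Quotient.mk (q c) = c := by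
    intro i
    obtain ⟨q, hq⟩ := ((X.boundaries i).comap (X.cycles i).subtype).mkQ.exists_rightInverse_of_surjective
      (LinearMap.range_eq_top.2 (Submodule.mkQ_surjective _))
    exact ⟨q, fun c => congrArg (fun f => f c) hq⟩
  choose q hq using h
  exact ⟨q, hq⟩

end representatives

lemma boundaries_le_cycles {ι : Type} [GradingIndex ι] (X : GrComplex.{u, v} k ι) (i : ι) :
    X.boundaries i ≤ X.cycles i := by
  rintro _ ⟨x, rfl⟩
  exact mem_cycles.2 fun j h => X.d_d _ _ _ _ _ x

/-- Generalized inverses of linear maps over a field. -/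
lemma exists_pseudoinverse {V W : Type*} [AddCommGroup V] [Module k V] [AddCommGroup W] [Module k W]
    (f : V →ₗ[k] W) : ∃ g : W →ₗ[k] V, ∀ x, f (g (f x)) = f x := by
  obtain ⟨s, hs⟩ := f.rangeRestrict.exists_rightInverse_of_surjective f.range_rangeRestrict
  obtain ⟨g, hg⟩ := s.exists_extend
  refine ⟨g, fun x => ?_⟩
  have h1 : g (f x) = s (f.rangeRestrict x) :=
    congrArg (fun φ => φ (f.rangeRestrict x)) hg
  have h2 := congrArg (fun φ => (φ (f.rangeRestrict x)).1) hs
  rw [h1]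
  exact h2

/-- Homotopy data for a nonnegatively graded complex over a field. -/
structure Contraction (X : GrComplex.{u, v} k ℕ) where
  r : ∀ i, X.X i →ₗ[k] X.Homology i
  q : ∀ i, X.Homology i →ₗ[k] X.cycles i
  h : ∀ i, X.X i →ₗ[k] X.X (i + 1)
  q_mk : ∀ i c, Submodule.Quotient.mk (q i c) = c
  r_mk : ∀ i (x : X.cycles i), r i x.1 = Submodule.Quotient.mk x
  homotopy_zero : ∀ x, X.d 1 0 rfl (h 0 x) = x - (q 0 (r 0 x)).1
  homotopy : ∀ i x, X.d (i + 2) (i + 1) rfl (h (i + 1) x) + h i (X.d (i + 1) i rfl x) =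
    x - (q (i + 1) (r (i + 1) x)).1

lemma exists_contraction (X : GrComplex.{u, v} k ℕ) : Nonempty (Contraction X) := by
  choose s hs using fun i => exists_pseudoinverse (X.d (i + 1) i rfl)
  obtain ⟨q, hq⟩ := exists_homology_section X
  have hmem : ∀ i (x : X.X (i + 1)), x - s i (X.d (i + 1) i rfl x) ∈ X.cycles (i + 1) := by
    intro i x
    refine mem_cycles.2 fun j h => ?_
    obtain rfl : j = i := by omega
    rw [map_sub, hs, sub_self]
  let c : ∀ i, X.X i →ₗ[k] X.cycles i := fun i => match i with
    | 0 => LinearMap.id.codRestrict _ fun x => mem_cycles.2 fun j h => by omega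
    | i + 1 => (LinearMap.id - s i ∘ₗ X.d (i + 1) i rfl).codRestrict _ (hmem i)
  have hc : ∀ i (x : X.cycles i), c i x.1 = x := by
    intro i x
    obtain _ | i := i
    · rfl
    · refine Subtype.ext ?_
      change x.1 - s i (X.d (i + 1) i rfl x.1) = x.1
      rw [mem_cycles.1 x.2, map_zero, sub_zero]
  let r : ∀ i, X.X i →ₗ[k] X.Homology i := fun i => Submodule.mkQ _ ∘ₗ c i
  have hr : ∀ i (x : X.cycles i), r i x.1 = Submodule.Quotient.mk x := fun i x => by
    change Submodule.Quotient.mk (c i x.1) = _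
    rw [hc]
  let h : ∀ i, X.X i →ₗ[k] X.X (i + 1) := fun i =>
    s i ∘ₗ ((X.cycles i).subtype ∘ₗ c i - (X.cycles i).subtype ∘ₗ q i ∘ₗ r i)
  have hdh : ∀ i x, X.d (i + 1) i rfl (h i x) = (c i x).1 - (q i (r i x)).1 := by
    intro i x
    have : (Submodule.Quotient.mk (c i x - q i (r i x)) : X.Homology i) = 0 := by
      rw [Submodule.Quotient.mk_sub, hq]; exact sub_self _
    obtain ⟨y, hy⟩ := (Submodule.Quotient.mk_eq_zero _).1 this
    have hy' : X.d (i + 1) i rfl y = (c i x).1 - (q i (r i x)).1 := hy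
    change X.d (i + 1) i rfl (s i ((c i x).1 - (q i (r i x)).1)) = _
    rw [← hy', hs]
  refine ⟨⟨r, q, h, hq, hr, fun x => hdh 0 x, fun i x => ?_⟩⟩
  have hB : X.d (i + 1) i rfl x ∈ X.boundaries i := ⟨x, rfl⟩
  have hZ := boundaries_le_cycles X i hB
  have h1 : r i (X.d (i + 1) i rfl x) = 0 := by
    rw [hr i ⟨_, hZ⟩]
    exact (Submodule.Quotient.mk_eq_zero _).2 hB
  have h2 : c i (X.d (i + 1) i rfl x) = ⟨_, hZ⟩ := hc i ⟨_, hZ⟩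
  have h3 : h i (X.d (i + 1) i rfl x) = s i (X.d (i + 1) i rfl x) := by
    change s i ((c i _).1 - (q i (r i _)).1) = _
    rw [h1, h2]; simp
  have h4 : (c (i + 1) x).1 = x - s i (X.d (i + 1) i rfl x) := rfl
  rw [show X.d (i + 2) (i + 1) rfl (h (i + 1) x) = _ from hdh (i + 1) x, h3, h4]
  abel

namespace Contraction

variable {X Y : GrComplex.{u, v} k ℕ}

lemma r_d (c : Contraction X) (i : ℕ) : c.r i ∘ₗ X.d (i + 1) i rfl = 0 := by
  ext x
  have hB : X.d (i + 1) i rfl x ∈ X.boundaries i := ⟨x, rfl⟩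
  refine (c.r_mk i ⟨_, boundaries_le_cycles X i hB⟩).trans ?_
  exact (Submodule.Quotient.mk_eq_zero _).2 hB

/-- The idempotent chain map `q r`. -/
def e (c : Contraction X) (i : ℕ) : X.X i →ₗ[k] X.X i := (X.cycles i).subtype ∘ₗ c.q i ∘ₗ c.r i

lemma homotopy_zero' (c : Contraction X) : X.d 1 0 rfl ∘ₗ c.h 0 = LinearMap.id - c.e 0 :=
  LinearMap.ext c.homotopy_zero

lemma homotopy' (c : Contraction X) (i : ℕ) :
    X.d (i + 2) (i + 1) rfl ∘ₗ c.h (i + 1) = LinearMap.id - c.e (i + 1) -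
      c.h i ∘ₗ X.d (i + 1) i rfl :=
  LinearMap.ext fun x => eq_sub_of_add_eq (c.homotopy i x)

lemma left_homotopy (c : Contraction X) {n : ℕ} {z : TensorX X Y n}
    (hz : z ∈ (tensor X Y).cycles n) :
    (fun e => z e - (c.e e.1.1).rTensor _ (z e) : TensorX X Y n) ∈ (tensor X Y).boundaries n := by
  let H : TensorX X Y (n + 1) := fun e => match e with
    | ⟨(0, _), _⟩ => 0
    | ⟨(p + 1, q), h⟩ => (c.h p).rTensor _ (z ⟨(p, q), by dsimp only at h ⊢; omega⟩)
  refine ⟨H, funext fun ⟨⟨p, q⟩, hpq⟩ => ?_⟩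
  rw [tensor_d]
  obtain _ | p := p
  · change (X.d 1 0 rfl).rTensor _ ((c.h 0).rTensor _ (z ⟨(0, q), hpq⟩)) +
      sign k 0 • (Y.d (q + 1) q rfl).lTensor _ (0 : X.X 0 ⊗[k] Y.X (q + 1)) = _
    rw [map_zero, smul_zero, add_zero, MixedComplex.rTensor_rTensor, c.homotopy_zero',
      LinearMap.rTensor_sub, LinearMap.rTensor_id]
    rfl
  · dsimp only at hpq
    obtain rfl : n = p + q + 1 := by omega
    have hd := congrFun (mem_cycles.1 hz (p + q) rfl) ⟨(p, q), rfl⟩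
    rw [tensor_d] at hd
    change (X.d (p + 2) (p + 1) rfl).rTensor _ ((c.h (p + 1)).rTensor _ (z ⟨(p + 1, q), _⟩)) +
      sign k (p + 1) • (Y.d (q + 1) q rfl).lTensor _ ((c.h p).rTensor _ (z ⟨(p, q + 1), _⟩)) = _
    rw [MixedComplex.rTensor_rTensor, c.homotopy', MixedComplex.lTensor_rTensor,
      ← MixedComplex.rTensor_lTensor, LinearMap.rTensor_sub, LinearMap.rTensor_sub,
      LinearMap.rTensor_id, sign_succ, neg_smul, ← map_smul]
    have hd' := congrArg ((c.h p).rTensor (Y.X q)) hd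
    rw [map_add, MixedComplex.rTensor_rTensor] at hd'
    have h0 : ((c.h p).rTensor (Y.X q)) ((0 : TensorX X Y (p + q)) ⟨(p, q), rfl⟩) = 0 :=
      map_zero _
    have hd'' := hd'.trans h0
    simp only [LinearMap.sub_apply, LinearMap.id_apply]
    rw [eq_neg_of_add_eq_zero_left hd'', sub_neg_eq_add, add_neg_cancel_right]

lemma right_homotopy (c : Contraction Y) {n : ℕ} {z : TensorX X Y n}
    (hz : z ∈ (tensor X Y).cycles n) :
    (fun e => z e - (c.e e.1.2).lTensor _ (z e) : TensorX X Y n) ∈ (tensor X Y).boundaries n := by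
  let H : TensorX X Y (n + 1) := fun e => match e with
    | ⟨(_, 0), _⟩ => 0
    | ⟨(p, q + 1), h⟩ => sign k p • (c.h q).lTensor _ (z ⟨(p, q), by dsimp only at h ⊢; omega⟩)
  refine ⟨H, funext fun ⟨⟨p, q⟩, hpq⟩ => ?_⟩
  rw [tensor_d]
  obtain _ | q := q
  · change (X.d (p + 1) p rfl).rTensor _ (0 : X.X (p + 1) ⊗[k] Y.X 0) +
      sign k p • (Y.d 1 0 rfl).lTensor _ (sign k p • (c.h 0).lTensor _ (z ⟨(p, 0), hpq⟩)) = _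
    rw [map_zero, zero_add, map_smul, smul_smul, sign_mul_self, one_smul,
      MixedComplex.lTensor_lTensor, c.homotopy_zero',
      LinearMap.lTensor_sub, LinearMap.lTensor_id]
    rfl
  · dsimp only at hpq
    obtain rfl : n = p + q + 1 := by omega
    have hd := congrFun (mem_cycles.1 hz (p + q) rfl) ⟨(p, q), rfl⟩
    rw [tensor_d] at hd
    change (X.d (p + 1) p rfl).rTensor _
        (sign k (p + 1) • (c.h q).lTensor _ (z ⟨(p + 1, q), _⟩)) +
      sign k p • (Y.d (q + 2) (q + 1) rfl).lTensor _
        (sign k p • (c.h (q + 1)).lTensor _ (z ⟨(p, q + 1), _⟩)) = _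
    rw [map_smul, map_smul, smul_smul, sign_mul_self, one_smul, MixedComplex.lTensor_lTensor,
      c.homotopy', MixedComplex.rTensor_lTensor,
      ← MixedComplex.lTensor_rTensor, LinearMap.lTensor_sub, LinearMap.lTensor_sub,
      LinearMap.lTensor_id, sign_succ]
    have hd' := congrArg (fun y => sign k p • (c.h q).lTensor (X.X p) y) hd
    have h0 : sign k p • ((c.h q).lTensor (X.X p)) ((0 : TensorX X Y (p + q)) ⟨(p, q), rfl⟩) = 0 := by
      rw [Pi.zero_apply, map_zero, smul_zero]
    dsimp only at hd'
    rw [map_add, map_smul, smul_add, smul_smul, sign_mul_self, one_smul,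
      MixedComplex.lTensor_lTensor] at hd'
    have hd'' := hd'.trans h0
    simp only [LinearMap.sub_apply, LinearMap.id_apply]
    rw [eq_neg_of_add_eq_zero_right hd'', neg_smul]
    abel

end Contraction

/-- The Künneth theorem for nonnegatively graded complexes over a field. -/
theorem kunneth_bijective (X Y : GrComplex.{u, v} k ℕ) (n : ℕ) :
    Function.Bijective (kunneth X Y n) := by
  obtain ⟨c⟩ := exists_contraction X
  obtain ⟨c'⟩ := exists_contraction Y
  constructor
  · let R : TensorX X Y n →ₗ[k] ∀ e : TensorIdx n, X.Homology e.1.1 ⊗[k] Y.Homology e.1.2 :=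
      LinearMap.pi fun e => TensorProduct.map (c.r _) (c'.r _) ∘ₗ projTensor X Y e
    have hR : ∀ x ∈ (tensor X Y).boundaries n, R x = 0 := by
      rintro _ ⟨y, rfl⟩
      refine funext fun e => ?_
      change TensorProduct.map (c.r _) (c'.r _) (((tensor X Y).d _ _ rfl y : TensorX X Y n) e) = 0
      rw [tensor_d, map_add, map_smul, LinearMap.rTensor, LinearMap.lTensor,
        ← LinearMap.comp_apply, ← TensorProduct.map_comp, ← LinearMap.comp_apply,
        ← TensorProduct.map_comp, c.r_d, c'.r_d]
      simp
    refine Function.LeftInverse.injective (g := Submodule.liftQ _ (R ∘ₗ ((tensor X Y).cycles n).subtype)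
      fun x hx => LinearMap.mem_ker.2 (hR x.1 hx)) fun w => ?_
    rw [kunneth_eq_mk X Y c.q c.q_mk c'.q c'.q_mk n w]
    refine funext fun e => ?_
    change TensorProduct.map (c.r _) (c'.r _) (TensorProduct.map _ _ (w e)) = w e
    rw [← LinearMap.comp_apply, ← TensorProduct.map_comp]
    have h1 : ∀ i, c.r i ∘ₗ (X.cycles i).subtype ∘ₗ c.q i = LinearMap.id := fun i => by
      refine LinearMap.ext fun a => (c.r_mk i _).trans (c.q_mk i a)
    have h2 : ∀ i, c'.r i ∘ₗ (Y.cycles i).subtype ∘ₗ c'.q i = LinearMap.id := fun i => by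
      refine LinearMap.ext fun a => (c'.r_mk i _).trans (c'.q_mk i a)
    rw [h1, h2, TensorProduct.map_id, LinearMap.id_apply]
  · intro x
    obtain ⟨⟨z, hz⟩, rfl⟩ := Submodule.mkQ_surjective _ x
    refine ⟨fun e => TensorProduct.map (c.r _) (c'.r _) (z e), ?_⟩
    rw [kunneth_eq_mk X Y c.q c.q_mk c'.q c'.q_mk n]
    refine (Submodule.Quotient.eq _).2 ?_
    rw [← neg_mem_iff, neg_sub]
    have h1 := c.left_homotopy hz
    have hz' : (fun e => (c.e e.1.1).rTensor _ (z e) : TensorX X Y n) ∈ (tensor X Y).cycles n := by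
      have := Submodule.sub_mem _ hz (boundaries_le_cycles _ _ h1)
      convert this using 1
      funext e
      exact (sub_sub_cancel _ _).symm
    have h2 := Submodule.add_mem _ h1 (c'.right_homotopy hz')
    change z - _ ∈ (tensor X Y).boundaries n
    convert h2 using 1
    funext e
    change z e - _ = z e - (c.e e.1.1).rTensor _ (z e) + ((c.e e.1.1).rTensor _ (z e) -
      (c'.e e.1.2).lTensor _ ((c.e e.1.1).rTensor _ (z e)))
    rw [sub_add_sub_cancel, MixedComplex.lTensor_rTensor]
    refine congrArg (z e - ·) ?_
    change TensorProduct.map _ _ (TensorProduct.map _ _ (z e)) = _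
    rw [← LinearMap.comp_apply, ← TensorProduct.map_comp]
    rfl

end GrComplex
end HopfCyc

namespace HopfCyc

section kernels

variable {k : Type u} [Field k] {V W V' W' : Type v} [AddCommGroup V] [Module k V]
  [AddCommGroup W] [Module k W] [AddCommGroup V'] [Module k V'] [AddCommGroup W'] [Module k W']

lemma map_map_apply {V'' W'' : Type v} [AddCommGroup V''] [Module k V''] [AddCommGroup W'']
    [Module k W''] (f : V →ₗ[k] V') (g : W →ₗ[k] W') (f' : V' →ₗ[k] V'') (g' : W' →ₗ[k] W'')
    (x : V ⊗[k] W) : TensorProduct.map f' g' (TensorProduct.map f g x) =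
      TensorProduct.map (f' ∘ₗ f) (g' ∘ₗ g) x := by
  rw [TensorProduct.map_comp]; rfl

lemma exists_projection_ker (f : V →ₗ[k] V') :
    ∃ (π : V →ₗ[k] LinearMap.ker f) (g : V' →ₗ[k] V),
      (LinearMap.ker f).subtype ∘ₗ π = LinearMap.id - g ∘ₗ f := by
  obtain ⟨g, hg⟩ := GrComplex.exists_pseudoinverse f
  refine ⟨(LinearMap.id - g ∘ₗ f).codRestrict _ fun x => ?_, g, rfl⟩
  simp [hg]

lemma mem_range_map_ker (f : V →ₗ[k] V') (g : W →ₗ[k] W') (w : V ⊗[k] W)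
    (hf : f.rTensor W w = 0) (hg : g.lTensor V w = 0) :
    w ∈ LinearMap.range (TensorProduct.map (LinearMap.ker f).subtype (LinearMap.ker g).subtype) := by
  obtain ⟨π, s, hπ⟩ := exists_projection_ker f
  obtain ⟨π', s', hπ'⟩ := exists_projection_ker g
  refine ⟨TensorProduct.map π π' w, ?_⟩
  rw [← LinearMap.comp_apply, ← TensorProduct.map_comp, hπ, hπ', ← MixedComplex.rTensor_lTensor,
    LinearMap.lTensor_sub, LinearMap.sub_apply, ← MixedComplex.lTensor_lTensor, hg, map_zero,
    sub_zero, LinearMap.lTensor_id, LinearMap.id_apply, LinearMap.rTensor_sub, LinearMap.sub_apply,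
    ← MixedComplex.rTensor_rTensor, hf, map_zero, sub_zero, LinearMap.rTensor_id,
    LinearMap.id_apply]

lemma map_subtype_injective (p : Submodule k V) (q : Submodule k W) :
    Function.Injective (TensorProduct.map p.subtype q.subtype) := by
  obtain ⟨a, ha⟩ := p.subtype.exists_leftInverse_of_injective p.ker_subtype
  obtain ⟨b, hb⟩ := q.subtype.exists_leftInverse_of_injective q.ker_subtype
  refine Function.LeftInverse.injective (g := TensorProduct.map a b) fun x => ?_
  rw [← LinearMap.comp_apply, ← TensorProduct.map_comp, ha, hb, TensorProduct.map_id,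
    LinearMap.id_apply]

lemma exists_lift_of_injective {Z : Type v} [AddCommGroup Z] [Module k Z] (j : V →ₗ[k] W)
    (hj : Function.Injective j) (f : Z →ₗ[k] W) (h : ∀ z, f z ∈ LinearMap.range j) :
    ∃ l : Z →ₗ[k] V, ∀ z, j (l z) = f z :=
  ⟨(LinearEquiv.ofInjective j hj).symm.toLinearMap ∘ₗ f.codRestrict _ h, fun z =>
    congrArg Subtype.val ((LinearEquiv.ofInjective j hj).apply_symm_apply ⟨f z, h z⟩)⟩

end kernels

open Tens

section phi

variable {k : Type u} [Field k] {H : Type v} [Ring H] [HopfAlgebra k H]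
  {M : Type v} [AddCommGroup M] [Module k M]

lemma comul_comul [Coalgebra.IsCocomm k H] (h : H) :
    TensorProduct.map (Coalgebra.comul (R := k)) (Coalgebra.comul (R := k))
      (Coalgebra.comul (R := k) h) =
    Coalgebra.comul (R := k) (Coalgebra.comul (R := k) h) :=
  congrArg (fun f => f h) (Coalgebra.comulCoalgHom k H).map_comp_comul

lemma PhiT_cns (ψ : M →ₗ[k] M ⊗[k] M) (n : ℕ) (h : H) (y : Tens k H M n) :
    PhiT k H ψ (n + 1) (cns h y) = cns (Coalgebra.comul (R := k) h) (PhiT k H ψ n y) := rfl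

lemma map_PhiT_consL (ψ : M →ₗ[k] M ⊗[k] M) (n : ℕ) (z : H ⊗[k] Tens k H M n) (u : H ⊗[k] H) :
    TensorProduct.map Coalgebra.comul (PhiT k H ψ (n + 1)) (consL n z u) =
      consL n (TensorProduct.map Coalgebra.comul (PhiT k H ψ n) z)
        (TensorProduct.map (Coalgebra.comul (R := k)) (Coalgebra.comul (R := k)) u) := by
  induction z using TensorProduct.induction_on with
  | zero => simp [consL_zero]
  | add x y hx hy => simp only [map_add, hx, hy, consL_add]
  | tmul g y =>
    induction u using TensorProduct.induction_on with
    | zero => simp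
    | add x y hx hy => simp only [map_add, hx, hy]
    | tmul a b =>
      rw [consL_tmul, TensorProduct.map_tmul, TensorProduct.map_tmul, TensorProduct.map_tmul,
        consL_tmul, Bialgebra.comul_mul, PhiT_cns]

lemma coactL_PhiT [Coalgebra.IsCocomm k H] (ψ : M →ₗ[k] M ⊗[k] M) (n : ℕ) (x : Tens k H M n) :
    coactL k (H ⊗[k] H) (M ⊗[k] M) n (PhiT k H ψ n x) =
      TensorProduct.map Coalgebra.comul (PhiT k H ψ n) (coactL k H M n x) := by
  induction n with
  | zero =>
    change (1 : H ⊗[k] H) ⊗ₜ[k] PhiT k H ψ 0 x = TensorProduct.map _ _ ((1 : H) ⊗ₜ[k] x)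
    rw [TensorProduct.map_tmul, Bialgebra.comul_one]
  | succ n ih =>
    induction x using Tens.ind with
    | h0 => simp only [map_zero]
    | hadd x y hx hy => simp only [map_add, hx, hy]
    | h h y => rw [PhiT_cns, coactL_cns, coactL_cns, map_PhiT_consL, ih, comul_comul]

lemma coactR_PhiT (φ : M →ₗ[k] H ⊗[k] M) (ψ : M →ₗ[k] M ⊗[k] M)
    (hψ : ∀ m : M, TensorProduct.map Coalgebra.comul ψ (φ m) = tensorCoact k H φ (ψ m))
    (n : ℕ) (x : Tens k H M n) :
    coactR k (H ⊗[k] H) (tensorCoact k H φ) n (PhiT k H ψ n x) =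
      TensorProduct.map Coalgebra.comul (PhiT k H ψ n) (coactR k H φ n x) := by
  induction n with
  | zero =>
    have h0 : ∀ w : H ⊗[k] M, TensorProduct.map Coalgebra.comul (PhiT k H ψ 0)
        (LinearMap.lTensor H (zeroEquiv k H M).toLinearMap w) =
        LinearMap.lTensor (H ⊗[k] H) (zeroEquiv k (H ⊗[k] H) (M ⊗[k] M)).toLinearMap
          (TensorProduct.map Coalgebra.comul ψ w) := by
      intro w
      induction w using TensorProduct.induction_on with
      | zero => simp
      | add x y hx hy => simp only [map_add, hx, hy]
      | tmul a b => rfl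
    change LinearMap.lTensor _ _ (tensorCoact k H φ (ψ ((zeroEquiv k H M).symm x))) =
      TensorProduct.map Coalgebra.comul (PhiT k H ψ 0)
        (LinearMap.lTensor H (zeroEquiv k H M).toLinearMap (φ ((zeroEquiv k H M).symm x)))
    rw [h0, hψ]
  | succ n ih =>
    induction x using Tens.ind with
    | h0 => simp only [map_zero]
    | hadd x y hx hy => simp only [map_add, hx, hy]
    | h h y =>
      rw [PhiT_cns, coactR_cns, coactR_cns, ih]
      induction coactR k H φ n y using TensorProduct.induction_on with
      | zero => simp
      | add x y hx hy => simp only [map_add, hx, hy]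
      | tmul a b => rfl

lemma PhiT_mem [Coalgebra.IsCocomm k H] (φ : M →ₗ[k] H ⊗[k] M) (ψ : M →ₗ[k] M ⊗[k] M)
    (hψ : ∀ m : M, TensorProduct.map Coalgebra.comul ψ (φ m) = tensorCoact k H φ (ψ m))
    (n : ℕ) (x : Tens k H M (n + 1)) (hx : x ∈ cotensor k H φ n) :
    PhiT k H ψ (n + 1) x ∈ cotensor k (H ⊗[k] H) (tensorCoact k H φ) n := by
  rw [mem_cotensor] at hx ⊢
  rw [coactL_PhiT, coactR_PhiT φ ψ hψ, hx]

/-- The map `(a ⊗ b) ⊗ (y ⊗ z) ↦ (a ⊗ y) ⊗ (b ⊗ z)`. -/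
noncomputable def cnsPair (n : ℕ) (u : H ⊗[k] H) :
    Tens k H M n ⊗[k] Tens k H M n →ₗ[k] Tens k H M (n + 1) ⊗[k] Tens k H M (n + 1) :=
  TensorProduct.map (succEquiv k H M n).toLinearMap (succEquiv k H M n).toLinearMap ∘ₗ
    (TensorProduct.tensorTensorTensorComm k H H (Tens k H M n) (Tens k H M n)).toLinearMap ∘ₗ
    TensorProduct.mk k _ _ u

@[simp] lemma cnsPair_tmul (n : ℕ) (a b : H) (y z : Tens k H M n) :
    cnsPair n (a ⊗ₜ[k] b) (y ⊗ₜ[k] z) = cns a y ⊗ₜ[k] cns b z := rfl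

lemma cnsPair_zero (n : ℕ) (w : Tens k H M n ⊗[k] Tens k H M n) :
    cnsPair n (0 : H ⊗[k] H) w = 0 := by simp [cnsPair]

lemma cnsPair_add (n : ℕ) (u u' : H ⊗[k] H) (w : Tens k H M n ⊗[k] Tens k H M n) :
    cnsPair n (u + u') w = cnsPair n u w + cnsPair n u' w := by
  simp [cnsPair]

lemma OmegaT_cns (n : ℕ) (u : H ⊗[k] H) (y : Tens k (H ⊗[k] H) (M ⊗[k] M) n) :
    OmegaT k H M (n + 1) (cns u y) = cnsPair n u (OmegaT k H M n y) := rfl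

/-- The reordering `(a ⊗ y) ⊗ (b ⊗ z) ↦ (a ⊗ b) ⊗ (y ⊗ z)`. -/
noncomputable abbrev pairComm (n : ℕ) :=
  TensorProduct.tensorTensorTensorComm k H (Tens k H M n) H (Tens k H M n)

/-- The operator `c ⊗ w ↦ u⁽²⁾ c ⊗ (u⁽¹⁾, w)` on `(H ⊗ H) ⊗ (Tens ⊗ Tens)`. -/
noncomputable def consPair (n : ℕ) (z : (H ⊗[k] H) ⊗[k] (Tens k H M n ⊗[k] Tens k H M n)) :
    (H ⊗[k] H) ⊗[k] (H ⊗[k] H) →ₗ[k]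
      (H ⊗[k] H) ⊗[k] (Tens k H M (n + 1) ⊗[k] Tens k H M (n + 1)) :=
  TensorProduct.map (LinearMap.mul' k (H ⊗[k] H))
      (TensorProduct.map (succEquiv k H M n).toLinearMap (succEquiv k H M n).toLinearMap ∘ₗ
        (TensorProduct.tensorTensorTensorComm k H H (Tens k H M n) (Tens k H M n)).toLinearMap) ∘ₗ
    (TensorProduct.tensorTensorTensorComm k (H ⊗[k] H) (H ⊗[k] H) (H ⊗[k] H)
      (Tens k H M n ⊗[k] Tens k H M n)).toLinearMap ∘ₗ
    (TensorProduct.mk k ((H ⊗[k] H) ⊗[k] (H ⊗[k] H))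
      ((H ⊗[k] H) ⊗[k] (Tens k H M n ⊗[k] Tens k H M n))).flip z ∘ₗ
    (TensorProduct.comm k (H ⊗[k] H) (H ⊗[k] H)).toLinearMap

lemma consPair_zero (n : ℕ) (u : (H ⊗[k] H) ⊗[k] (H ⊗[k] H)) :
    consPair (M := M) n 0 u = 0 := by simp [consPair]

lemma consPair_add (n : ℕ) (z z' : (H ⊗[k] H) ⊗[k] (Tens k H M n ⊗[k] Tens k H M n))
    (u : (H ⊗[k] H) ⊗[k] (H ⊗[k] H)) :
    consPair n (z + z') u = consPair n z u + consPair n z' u := by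
  simp [consPair]

lemma consPair_tmul (n : ℕ) (c : H ⊗[k] H) (w : Tens k H M n ⊗[k] Tens k H M n)
    (a b : H ⊗[k] H) : consPair n (c ⊗ₜ[k] w) (a ⊗ₜ[k] b) = (b * c) ⊗ₜ[k] cnsPair n a w := rfl

lemma lTensor_OmegaT_consL (n : ℕ)
    (z : (H ⊗[k] H) ⊗[k] Tens k (H ⊗[k] H) (M ⊗[k] M) n) (u : (H ⊗[k] H) ⊗[k] (H ⊗[k] H)) :
    LinearMap.lTensor (H ⊗[k] H) (OmegaT k H M (n + 1)) (consL n z u) =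
      consPair n (LinearMap.lTensor (H ⊗[k] H) (OmegaT k H M n) z) u := by
  induction z using TensorProduct.induction_on with
  | zero => simp [consL_zero, consPair_zero]
  | add x y hx hy => simp only [map_add, hx, hy, consL_add, consPair_add]
  | tmul g y =>
    induction u using TensorProduct.induction_on with
    | zero => simp
    | add x y hx hy => simp only [map_add, hx, hy]
    | tmul a b => rw [consL_tmul, LinearMap.lTensor_tmul, LinearMap.lTensor_tmul, OmegaT_cns,
        consPair_tmul]

lemma pairComm_consL (n : ℕ) (z z' : H ⊗[k] Tens k H M n) (u u' : H ⊗[k] H) :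
    pairComm (n + 1) (consL n z u ⊗ₜ[k] consL n z' u') =
      consPair n (pairComm n (z ⊗ₜ[k] z'))
        (TensorProduct.tensorTensorTensorComm k H H H H (u ⊗ₜ[k] u')) := by
  induction z using TensorProduct.induction_on with
  | zero => simp [consL_zero, consPair_zero]
  | add x y hx hy => simp only [map_add, TensorProduct.add_tmul, hx, hy, consL_add, consPair_add]
  | tmul g y =>
  induction z' using TensorProduct.induction_on with
  | zero => simp [consL_zero, consPair_zero]
  | add x y hx hy => simp only [map_add, TensorProduct.tmul_add, hx, hy, consL_add, consPair_add]
  | tmul g' y' =>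
  induction u using TensorProduct.induction_on with
  | zero => simp
  | add x y hx hy => simp only [map_add, TensorProduct.add_tmul, hx, hy]
  | tmul a b =>
  induction u' using TensorProduct.induction_on with
  | zero => simp
  | add x y hx hy => simp only [map_add, TensorProduct.tmul_add, hx, hy]
  | tmul a' b' =>
    simp only [consL_tmul, TensorProduct.tensorTensorTensorComm_tmul, consPair_tmul, cnsPair_tmul,
      Algebra.TensorProduct.tmul_mul_tmul]

lemma pairComm_coactL (n : ℕ) (y : Tens k (H ⊗[k] H) (M ⊗[k] M) n) :
    pairComm n (TensorProduct.map (coactL k H M n) (coactL k H M n) (OmegaT k H M n y)) =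
      LinearMap.lTensor (H ⊗[k] H) (OmegaT k H M n) (coactL k (H ⊗[k] H) (M ⊗[k] M) n y) := by
  induction n with
  | zero =>
    have h0 : ∀ w, pairComm 0 (TensorProduct.map (coactL k H M 0) (coactL k H M 0) w) =
        (1 : H ⊗[k] H) ⊗ₜ[k] w := by
      intro w
      induction w using TensorProduct.induction_on with
      | zero => simp
      | add x y hx hy => simp only [map_add, TensorProduct.tmul_add, hx, hy]
      | tmul a b => rfl
    exact h0 _
  | succ n ih =>
    induction y using Tens.ind with
    | h0 => simp only [map_zero]
    | hadd x y hx hy => simp only [map_add, hx, hy]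
    | h u y =>
      rw [OmegaT_cns, coactL_cns, lTensor_OmegaT_consL, ← ih]
      induction u using TensorProduct.induction_on with
      | zero => simp [cnsPair_zero]
      | add x y hx hy => simp only [map_add, hx, hy, cnsPair_add]
      | tmul a b =>
        induction OmegaT k H M n y using TensorProduct.induction_on with
        | zero => simp [consPair_zero]
        | add x y hx hy => simp only [map_add, hx, hy, consPair_add]
        | tmul y z =>
          rw [cnsPair_tmul, TensorProduct.map_tmul, TensorProduct.map_tmul, coactL_cns, coactL_cns,
            pairComm_consL]
          rfl

lemma pairComm_coactR (φ : M →ₗ[k] H ⊗[k] M) (n : ℕ) (y : Tens k (H ⊗[k] H) (M ⊗[k] M) n) :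
    pairComm n (TensorProduct.map (coactR k H φ n) (coactR k H φ n) (OmegaT k H M n y)) =
      LinearMap.lTensor (H ⊗[k] H) (OmegaT k H M n)
        (coactR k (H ⊗[k] H) (tensorCoact k H φ) n y) := by
  induction n with
  | zero =>
    have h0 : ∀ w w' : H ⊗[k] M, pairComm 0
        (LinearMap.lTensor H (zeroEquiv k H M).toLinearMap w ⊗ₜ[k]
          LinearMap.lTensor H (zeroEquiv k H M).toLinearMap w') =
        LinearMap.lTensor (H ⊗[k] H) (OmegaT k H M 0)
          (LinearMap.lTensor (H ⊗[k] H) (zeroEquiv k (H ⊗[k] H) (M ⊗[k] M)).toLinearMap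
            (TensorProduct.tensorTensorTensorComm k H M H M (w ⊗ₜ[k] w'))) := by
      intro w w'
      induction w using TensorProduct.induction_on with
      | zero => simp
      | add x y hx hy => simp only [map_add, TensorProduct.add_tmul, hx, hy]
      | tmul a b =>
        induction w' using TensorProduct.induction_on with
        | zero => simp
        | add x y hx hy => simp only [map_add, TensorProduct.tmul_add, hx, hy]
        | tmul a b => rfl
    obtain ⟨y, rfl⟩ := (zeroEquiv k (H ⊗[k] H) (M ⊗[k] M)).surjective y
    induction y using TensorProduct.induction_on with
    | zero => simp only [map_zero]
    | add x y hx hy => simp only [map_add, hx, hy]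
    | tmul a b => exact h0 (φ a) (φ b)
  | succ n ih =>
    induction y using Tens.ind with
    | h0 => simp only [map_zero]
    | hadd x y hx hy => simp only [map_add, hx, hy]
    | h u y =>
      have h1 : ∀ z, LinearMap.lTensor (H ⊗[k] H) (OmegaT k H M (n + 1)) (consR n u z) =
          LinearMap.lTensor (H ⊗[k] H) (cnsPair n u)
            (LinearMap.lTensor (H ⊗[k] H) (OmegaT k H M n) z) := by
        intro z
        induction z using TensorProduct.induction_on with
        | zero => simp
        | add x y hx hy => simp only [map_add, hx, hy]
        | tmul a b => rfl
      rw [OmegaT_cns, coactR_cns, h1, ← ih]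
      have h2 : ∀ (a b : H) (w w' : H ⊗[k] Tens k H M n),
          pairComm (n + 1) (consR n a w ⊗ₜ[k] consR n b w') =
            LinearMap.lTensor (H ⊗[k] H) (cnsPair n (a ⊗ₜ[k] b)) (pairComm n (w ⊗ₜ[k] w')) := by
        intro a b w w'
        induction w using TensorProduct.induction_on with
        | zero => simp
        | add x y hx hy => simp only [map_add, TensorProduct.add_tmul, hx, hy]
        | tmul c y =>
          induction w' using TensorProduct.induction_on with
          | zero => simp
          | add x y hx hy => simp only [map_add, TensorProduct.tmul_add, hx, hy]
          | tmul c' y' => rfl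
      have h3 : ∀ (u u' : H ⊗[k] H), cnsPair (M := M) n (u + u') = cnsPair n u + cnsPair n u' :=
        fun u u' => LinearMap.ext fun w => cnsPair_add n u u' w
      clear h1
      induction u using TensorProduct.induction_on with
      | zero =>
        have h4 : cnsPair (M := M) n (0 : H ⊗[k] H) = 0 := LinearMap.ext fun w => cnsPair_zero n w
        simp [h4]
      | add x y hx hy => simp only [map_add, hx, hy, h3, LinearMap.add_apply, LinearMap.lTensor_add]
      | tmul a b =>
        induction OmegaT k H M n y using TensorProduct.induction_on with
        | zero => simp
        | add x y hx hy => simp only [map_add, hx, hy]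
        | tmul y z =>
          rw [cnsPair_tmul, TensorProduct.map_tmul, TensorProduct.map_tmul, coactR_cns, coactR_cns,
            h2]

/-- The map `h ⊗ y ↦ ε(h) y`. -/
noncomputable def counitT (n : ℕ) : H ⊗[k] Tens k H M n →ₗ[k] Tens k H M n :=
  (TensorProduct.lid k (Tens k H M n)).toLinearMap ∘ₗ LinearMap.rTensor _ Coalgebra.counit

lemma counitT_tmul (n : ℕ) (h : H) (y : Tens k H M n) :
    counitT n (h ⊗ₜ[k] y) = Coalgebra.counit (R := k) h • y := rfl

lemma counitT_coactL (n : ℕ) : counitT n ∘ₗ coactL k H M n = LinearMap.id := by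
  refine LinearMap.ext fun y => ?_
  rw [LinearMap.comp_apply, LinearMap.id_apply]
  induction n with
  | zero =>
    change counitT 0 ((1 : H) ⊗ₜ[k] y) = y
    rw [counitT_tmul, Bialgebra.counit_one, one_smul]
  | succ n ih =>
    induction y using Tens.ind with
    | h0 => simp only [map_zero]
    | hadd x y hx hy => simp only [map_add, hx, hy]
    | h h y =>
      have h1 : ∀ (z : H ⊗[k] Tens k H M n) (u : H ⊗[k] H), counitT (n + 1) (consL n z u) =
          cns (TensorProduct.rid k H (LinearMap.lTensor H Coalgebra.counit u)) (counitT n z) := by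
        intro z u
        induction z using TensorProduct.induction_on with
        | zero => simp [consL_zero, cns_zero]
        | add x y hx hy => simp only [map_add, hx, hy, consL_add, cns_add]
        | tmul c y =>
          induction u using TensorProduct.induction_on with
          | zero => simp [cns]
          | add x y hx hy =>
            simp only [map_add, hx, hy]
            simp [cns, TensorProduct.add_tmul]
          | tmul a b =>
            rw [consL_tmul, counitT_tmul, counitT_tmul, Bialgebra.counit_mul]
            rw [LinearMap.lTensor_tmul, TensorProduct.rid_tmul, mul_comm, mul_smul, cns, cns,
              TensorProduct.tmul_smul, ← TensorProduct.smul_tmul', map_smul, map_smul, smul_comm]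
      rw [coactL_cns, h1, ih, Coalgebra.lTensor_counit_comul]
      simp

lemma counitT_coactR (φ : M →ₗ[k] H ⊗[k] M)
    (hφ : ∀ m, TensorProduct.lid k M (LinearMap.rTensor M Coalgebra.counit (φ m)) = m) (n : ℕ) :
    counitT n ∘ₗ coactR k H φ n = LinearMap.id := by
  refine LinearMap.ext fun y => ?_
  rw [LinearMap.comp_apply, LinearMap.id_apply]
  induction n with
  | zero =>
    have h0 : ∀ w : H ⊗[k] M, counitT 0 (LinearMap.lTensor H (zeroEquiv k H M).toLinearMap w) =
        zeroEquiv k H M (TensorProduct.lid k M (LinearMap.rTensor M Coalgebra.counit w)) := by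
      intro w
      induction w using TensorProduct.induction_on with
      | zero => simp
      | add x y hx hy => simp only [map_add, hx, hy]
      | tmul a b => rfl
    refine (h0 _).trans ?_
    rw [LinearMap.comp_apply, hφ]
    rfl
  | succ n ih =>
    induction y using Tens.ind with
    | h0 => simp only [map_zero]
    | hadd x y hx hy => simp only [map_add, hx, hy]
    | h h y =>
      have h1 : ∀ (z : H ⊗[k] Tens k H M n), counitT (n + 1) (consR n h z) =
          cns h (counitT n z) := by
        intro z
        induction z using TensorProduct.induction_on with
        | zero => simp [cns_zero]
        | add x y hx hy => simp only [map_add, hx, hy, cns_add]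
        | tmul c y => simp [counitT_tmul, cns]
      rw [coactR_cns, h1, ih]

lemma OmegaT_mem (φ : M →ₗ[k] H ⊗[k] M)
    (hφ : ∀ m, TensorProduct.lid k M (LinearMap.rTensor M Coalgebra.counit (φ m)) = m) (n : ℕ)
    (y : Tens k (H ⊗[k] H) (M ⊗[k] M) (n + 1))
    (hy : y ∈ cotensor k (H ⊗[k] H) (tensorCoact k H φ) n) :
    OmegaT k H M (n + 1) y ∈ LinearMap.range
      (TensorProduct.map (cotensor k H φ n).subtype (cotensor k H φ n).subtype) := by
  rw [mem_cotensor] at hy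
  have h := (pairComm_coactL (M := M) (n + 1) y).trans
    ((congrArg _ hy).trans (pairComm_coactR φ (n + 1) y).symm)
  have h' := (pairComm (n + 1)).injective h
  refine mem_range_map_ker _ _ _ ?_ ?_
  · have := congrArg (LinearMap.lTensor _ (counitT (n + 1))) h'
    rw [LinearMap.lTensor, map_map_apply, map_map_apply, counitT_coactL,
      counitT_coactR φ hφ, LinearMap.id_comp, LinearMap.id_comp] at this
    exact (LinearMap.congr_fun (LinearMap.rTensor_sub _ _) _).trans (sub_eq_zero_of_eq this)
  · have := congrArg (LinearMap.rTensor _ (counitT (n + 1))) h'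
    rw [LinearMap.rTensor, map_map_apply, map_map_apply, counitT_coactL,
      counitT_coactR φ hφ, LinearMap.id_comp, LinearMap.id_comp] at this
    exact (LinearMap.congr_fun (LinearMap.lTensor_sub _ _) _).trans (sub_eq_zero_of_eq this)

end phi

section cyclicMap

variable {k : Type u} [Field k] {H : Type v} [Ring H] [HopfAlgebra k H]
  {M : Type v} [AddCommGroup M] [Module k M]

/-- The composite `Ω Φ`. -/
noncomputable def diagT (ψ : M →ₗ[k] M ⊗[k] M) (n : ℕ) :
    Tens k H M n →ₗ[k] Tens k H M n ⊗[k] Tens k H M n := OmegaT k H M n ∘ₗ PhiT k H ψ n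

lemma diagT_cns (ψ : M →ₗ[k] M ⊗[k] M) (n : ℕ) (h : H) (y : Tens k H M n) :
    diagT ψ (n + 1) (cns h y) = cnsPair n (Coalgebra.comul (R := k) h) (diagT ψ n y) := rfl

lemma map_map_cnsPair {n m : ℕ} (f : Tens k H M n →ₗ[k] Tens k H M m) (u : H ⊗[k] H)
    (w : Tens k H M n ⊗[k] Tens k H M n) :
    TensorProduct.map (Tens.map k H M f) (Tens.map k H M f) (cnsPair n u w) =
      cnsPair m u (TensorProduct.map f f w) := by
  induction u using TensorProduct.induction_on with
  | zero => simp [cnsPair_zero]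
  | add x y hx hy => simp only [map_add, hx, hy, cnsPair_add]
  | tmul a b =>
  induction w using TensorProduct.induction_on with
  | zero => simp
  | add x y hx hy => simp only [map_add, hx, hy]
  | tmul y z => rfl

lemma diagT_map (ψ : M →ₗ[k] M ⊗[k] M) {n m : ℕ} (f : Tens k H M n →ₗ[k] Tens k H M m)
    (hf : ∀ y, diagT ψ m (f y) = TensorProduct.map f f (diagT ψ n y)) (y : Tens k H M (n + 1)) :
    diagT ψ (m + 1) (Tens.map k H M f y) =
      TensorProduct.map (Tens.map k H M f) (Tens.map k H M f) (diagT ψ (n + 1) y) := by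
  induction y using Tens.ind with
  | h0 => simp only [map_zero]
  | hadd x y hx hy => simp only [map_add, hx, hy]
  | h h y => rw [map_cns, diagT_cns, diagT_cns, hf, map_map_cnsPair]

lemma diagT_dT (ψ : M →ₗ[k] M ⊗[k] M) (n i : ℕ) (y : Tens k H M (n + 2)) :
    diagT ψ (n + 1) (dT k H M n i y) =
      TensorProduct.map (dT k H M n i) (dT k H M n i) (diagT ψ (n + 2) y) := by
  have h0 : ∀ n (y : Tens k H M (n + 2)), diagT ψ (n + 1) (dT k H M n 0 y) =
      TensorProduct.map (dT k H M n 0) (dT k H M n 0) (diagT ψ (n + 2) y) := by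
    intro n y
    induction y using Tens.ind with
    | h0 => simp only [map_zero]
    | hadd x y hx hy => simp only [map_add, hx, hy]
    | h h y =>
    induction y using Tens.ind with
    | h0 => simp only [cns_zero, map_zero]
    | hadd x y hx hy => simp only [map_add, cns_add, hx, hy]
    | h g y =>
      rw [dT_zero, diagT_cns, diagT_cns, diagT_cns, Bialgebra.comul_mul]
      generalize Coalgebra.comul (R := k) h = u
      generalize Coalgebra.comul (R := k) g = u'
      induction diagT ψ n y using TensorProduct.induction_on with
      | zero => simp
      | add x y hx hy => simp only [map_add, hx, hy]
      | tmul y z =>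
      induction u using TensorProduct.induction_on with
      | zero => simp [cnsPair_zero]
      | add x y hx hy => simp only [map_add, add_mul, hx, hy, cnsPair_add]
      | tmul a b =>
      induction u' using TensorProduct.induction_on with
      | zero => simp [cnsPair_zero]
      | add x y hx hy => simp only [map_add, mul_add, hx, hy, cnsPair_add]
      | tmul a' b' =>
        simp only [cnsPair_tmul, TensorProduct.map_tmul, dT_zero,
          Algebra.TensorProduct.tmul_mul_tmul]
  induction n generalizing i with
  | zero =>
    obtain _ | i := i
    · exact h0 0 y
    · simp [dT]
  | succ n ih =>
    obtain _ | i := i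
    · exact h0 _ y
    · exact diagT_map ψ _ (ih i) y

lemma diagT_sT (ψ : M →ₗ[k] M ⊗[k] M) (n i : ℕ) (y : Tens k H M (n + 1)) :
    diagT ψ (n + 2) (sT k H M n i y) =
      TensorProduct.map (sT k H M n i) (sT k H M n i) (diagT ψ (n + 1) y) := by
  have h0 : ∀ n (y : Tens k H M (n + 1)), diagT ψ (n + 2) (sT k H M n 0 y) =
      TensorProduct.map (sT k H M n 0) (sT k H M n 0) (diagT ψ (n + 1) y) := by
    intro n y
    rw [sT_zero_eq]
    refine diagT_map ψ _ (fun y => ?_) y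
    rw [ins_zero, diagT_cns, Bialgebra.comul_one, Algebra.TensorProduct.one_def]
    induction diagT ψ n y using TensorProduct.induction_on with
    | zero => simp
    | add x y hx hy => simp only [map_add, hx, hy]
    | tmul y z => rw [cnsPair_tmul, TensorProduct.map_tmul, ins_zero, ins_zero]
  induction n generalizing i with
  | zero =>
    obtain _ | i := i
    · exact h0 0 y
    · simp [sT]
  | succ n ih =>
    obtain _ | i := i
    · exact h0 _ y
    · exact diagT_map ψ _ (ih i) y

lemma diagT_swap (ψ : M →ₗ[k] M ⊗[k] M) (n : ℕ) (y : Tens k H M (n + 2)) :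
    diagT ψ (n + 2) (swap k H M n y) =
      TensorProduct.map (swap k H M n) (swap k H M n) (diagT ψ (n + 2) y) := by
  induction y using Tens.ind with
  | h0 => simp only [map_zero]
  | hadd x y hx hy => simp only [map_add, hx, hy]
  | h h y =>
  induction y using Tens.ind with
  | h0 => simp only [cns_zero, map_zero]
  | hadd x y hx hy => simp only [map_add, cns_add, hx, hy]
  | h g y =>
    rw [swap_cns, diagT_cns, diagT_cns, diagT_cns, diagT_cns]
    generalize Coalgebra.comul (R := k) h = u
    generalize Coalgebra.comul (R := k) g = u'
    induction diagT ψ n y using TensorProduct.induction_on with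
    | zero => simp
    | add x y hx hy => simp only [map_add, hx, hy]
    | tmul y z =>
    induction u using TensorProduct.induction_on with
    | zero => simp [cnsPair_zero]
    | add x y hx hy => simp only [map_add, hx, hy, cnsPair_add]
    | tmul a b =>
    induction u' using TensorProduct.induction_on with
    | zero => simp [cnsPair_zero]
    | add x y hx hy => simp only [map_add, hx, hy, cnsPair_add]
    | tmul a' b' => rfl

variable [Module H M] [IsScalarTower k H M]

/-- The operator `(a ⊗ b) ⊗ (c ⊗ d) ↦ (a ⊗ c y) ⊗ (b ⊗ d z)`, for `w = y ⊗ z`. -/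
noncomputable def spreadPair (w : Tens k H M 0 ⊗[k] Tens k H M 0) :
    (H ⊗[k] H) ⊗[k] (H ⊗[k] H) →ₗ[k] Tens k H M 1 ⊗[k] Tens k H M 1 :=
  TensorProduct.map (succEquiv k H M 0).toLinearMap (succEquiv k H M 0).toLinearMap ∘ₗ
    (TensorProduct.tensorTensorTensorComm k H H (Tens k H M 0) (Tens k H M 0)).toLinearMap ∘ₗ
    LinearMap.lTensor (H ⊗[k] H)
      ((TensorProduct.homTensorHomMap (RingHom.id k) _ _ _ _ ∘ₗ
        TensorProduct.map (actT k H M 0) (actT k H M 0)).flip w)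

lemma spreadPair_zero (u : (H ⊗[k] H) ⊗[k] (H ⊗[k] H)) : spreadPair (M := M) 0 u = 0 := by
  simp [spreadPair]

lemma spreadPair_add (w w' : Tens k H M 0 ⊗[k] Tens k H M 0)
    (u : (H ⊗[k] H) ⊗[k] (H ⊗[k] H)) :
    spreadPair (w + w') u = spreadPair w u + spreadPair w' u := by
  simp [spreadPair, LinearMap.lTensor_add]

lemma diagT_spread (ψ : M →ₗ[k] M ⊗[k] M)
    (hψ : ∀ (h : H) (m : M), ψ (h • m) = tensorAct k H (Coalgebra.comul (R := k) h) (ψ m))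
    (y : Tens k H M 0) (u : H ⊗[k] H) :
    diagT ψ 1 (spread 0 y u) = spreadPair (diagT ψ 0 y)
      (TensorProduct.map (Coalgebra.comul (R := k)) (Coalgebra.comul (R := k)) u) := by
  induction u using TensorProduct.induction_on with
  | zero => simp
  | add x y hx hy => simp only [map_add, hx, hy]
  | tmul a b =>
    have h0 : ∀ (u : H ⊗[k] H) (w : M ⊗[k] M),
        spreadPair (TensorProduct.map (zeroEquiv k H M).toLinearMap (zeroEquiv k H M).toLinearMap w)
          (Coalgebra.comul (R := k) a ⊗ₜ[k] u) = cnsPair 0 (Coalgebra.comul (R := k) a)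
          (TensorProduct.map (zeroEquiv k H M).toLinearMap (zeroEquiv k H M).toLinearMap
            (tensorAct k H u w)) := by
      intro u w
      induction u using TensorProduct.induction_on with
      | zero => simp
      | add x y hx hy => simp only [map_add, TensorProduct.tmul_add, hx, hy, LinearMap.add_apply]
      | tmul c d =>
        induction w using TensorProduct.induction_on with
        | zero => simp [spreadPair_zero]
        | add x y hx hy => simp only [map_add, hx, hy, spreadPair_add]
        | tmul m m' => rfl
    obtain ⟨m, rfl⟩ := (zeroEquiv k H M).surjective y
    rw [spread_tmul, diagT_cns, TensorProduct.map_tmul]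
    refine Eq.trans ?_ (h0 _ _).symm
    change _ = cnsPair 0 _ (TensorProduct.map _ _
      (tensorAct k H (Coalgebra.comul (R := k) b) (ψ m)))
    rw [← hψ]
    rfl

lemma diagT_tT [Coalgebra.IsCocomm k H] (ψ : M →ₗ[k] M ⊗[k] M)
    (hψ : ∀ (h : H) (m : M), ψ (h • m) = tensorAct k H (Coalgebra.comul (R := k) h) (ψ m))
    (n : ℕ) (y : Tens k H M (n + 1)) :
    diagT ψ (n + 1) (tT k H M n y) =
      TensorProduct.map (tT k H M n) (tT k H M n) (diagT ψ (n + 1) y) := by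
  induction n with
  | zero =>
    induction y using Tens.ind with
    | h0 => simp only [map_zero]
    | hadd x y hx hy => simp only [map_add, hx, hy]
    | h h y =>
      rw [tT_zero, diagT_spread ψ hψ, diagT_cns, comul_comul]
      generalize Coalgebra.comul (R := k) h = u
      induction diagT ψ 0 y using TensorProduct.induction_on with
      | zero => simp [spreadPair_zero]
      | add x y hx hy => simp only [map_add, hx, hy, spreadPair_add]
      | tmul y z =>
      induction u using TensorProduct.induction_on with
      | zero => simp [cnsPair_zero]
      | add x y hx hy => simp only [map_add, hx, hy, cnsPair_add]
      | tmul a b =>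
        rw [cnsPair_tmul, TensorProduct.map_tmul, tT_zero, tT_zero, TensorProduct.comul_tmul]
        generalize Coalgebra.comul (R := k) a = u
        generalize Coalgebra.comul (R := k) b = u'
        induction u using TensorProduct.induction_on with
        | zero => simp
        | add x y hx hy => simp only [map_add, TensorProduct.add_tmul, hx, hy]
        | tmul a a' =>
        induction u' using TensorProduct.induction_on with
        | zero => simp
        | add x y hx hy => simp only [map_add, TensorProduct.tmul_add, hx, hy]
        | tmul b b' => rfl
  | succ n ih =>
    change diagT ψ (n + 2) (swap k H M n (Tens.map k H M (tT k H M n) y)) = _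
    rw [diagT_swap, diagT_map ψ _ ih, map_map_apply]
    rfl

lemma diagT_faceT [Coalgebra.IsCocomm k H] (ψ : M →ₗ[k] M ⊗[k] M)
    (hψ : ∀ (h : H) (m : M), ψ (h • m) = tensorAct k H (Coalgebra.comul (R := k) h) (ψ m))
    (n i : ℕ) (y : Tens k H M (n + 2)) :
    diagT ψ (n + 1) (faceT k H M n i y) =
      TensorProduct.map (faceT k H M n i) (faceT k H M n i) (diagT ψ (n + 2) y) := by
  rw [faceT]
  split_ifs with h
  · exact diagT_dT ψ n i y
  · rw [LinearMap.comp_apply, diagT_dT, diagT_tT ψ hψ, map_map_apply]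

end cyclicMap

/-- Morphisms of cyclic modules. -/
structure CyclicModule.Hom {k : Type u} [Field k] (C C' : CyclicModule.{u, v} k) where
  f : ∀ n, C.C n →ₗ[k] C'.C n
  f_d : ∀ n i x, f n (C.d n i x) = C'.d n i (f (n + 1) x)
  f_s : ∀ n i x, f (n + 1) (C.s n i x) = C'.s n i (f n x)
  f_t : ∀ n x, f n (C.t n x) = C'.t n (f n x)

/-- The morphism of cyclic modules induced by `Ω Φ`. -/
theorem exists_hopfCyclic_diagonal {k : Type u} [Field k] {H : Type v} [Ring H] [HopfAlgebra k H]
    [Coalgebra.IsCocomm k H] {hS : Function.Bijective (HopfAlgebra.antipode k (A := H))}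
    {M : Type v} [AddCommGroup M] [Module k M] [Module H M] [IsScalarTower k H M]
    (X : SAYD k H M hS) (ψ : M →ₗ[k] M ⊗[k] M)
    (hψ_act : ∀ (h : H) (m : M), ψ (h • m) = tensorAct k H (Coalgebra.comul (R := k) h) (ψ m))
    (hψ_coact : ∀ m : M, TensorProduct.map Coalgebra.comul ψ (X.coact m) =
      tensorCoact k H X.coact (ψ m)) :
    ∃ ρ : CyclicModule.Hom (hopfCyclic X) ((hopfCyclic X).prod (hopfCyclic X)),
      ∀ n (x : cotensor k H X.coact n),
        TensorProduct.map (cotensor k H X.coact n).subtype (cotensor k H X.coact n).subtype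
          (ρ.f n x) = OmegaT k H M (n + 1) (PhiT k H ψ (n + 1) x) := by
  have hex : ∀ n, ∃ l : cotensor k H X.coact n →ₗ[k]
      cotensor k H X.coact n ⊗[k] cotensor k H X.coact n, ∀ x,
      TensorProduct.map (cotensor k H X.coact n).subtype (cotensor k H X.coact n).subtype (l x) =
        diagT ψ (n + 1) x := fun n =>
    exists_lift_of_injective _ (map_subtype_injective _ _)
      (diagT ψ (n + 1) ∘ₗ (cotensor k H X.coact n).subtype) fun x =>
        OmegaT_mem X.coact X.counit n _ (PhiT_mem X.coact ψ hψ_coact n x.1 x.2)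
  choose l hl using hex
  have hr : ∀ {n m : ℕ} (g : Tens k H M (n + 1) →ₗ[k] Tens k H M (m + 1))
      (g' : cotensor k H X.coact n →ₗ[k] cotensor k H X.coact m)
      (_ : ∀ x, (g' x).1 = g x.1)
      (_ : ∀ y, diagT ψ (m + 1) (g y) = TensorProduct.map g g (diagT ψ (n + 1) y)) x,
      l m (g' x) = TensorProduct.map g' g' (l n x) := by
    intro n m g g' hg hd x
    refine map_subtype_injective _ _ ?_
    have h1 : (cotensor k H X.coact m).subtype ∘ₗ g' = g ∘ₗ (cotensor k H X.coact n).subtype :=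
      LinearMap.ext hg
    rw [hl, hg, hd, ← hl, map_map_apply, map_map_apply, h1]
  exact ⟨⟨l, fun n i x => hr _ _ (fun _ => rfl) (diagT_faceT ψ hψ_act n i) x,
    fun n i x => hr _ _ (fun _ => rfl) (diagT_sT ψ n i) x,
    fun n x => hr _ _ (fun _ => rfl) (diagT_tT ψ hψ_act n) x⟩, fun n x => hl n x⟩

end HopfCyc

namespace HopfCyc

/-- A simplicial module over `k`: the underlying structure of a cyclic module without the cyclic
operators. -/
structure SimplicialModule (k : Type u) [Field k] where
  C : ℕ → Type v
  [acg : ∀ n, AddCommGroup (C n)]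
  [mod : ∀ n, Module k (C n)]
  d : ∀ n (_ : ℕ), C (n + 1) →ₗ[k] C n
  s : ∀ n (_ : ℕ), C n →ₗ[k] C (n + 1)
  d_d : ∀ n i j, i < j → j ≤ n + 2 → ∀ x, d n i (d (n + 1) j x) = d n (j - 1) (d (n + 1) i x)
  s_s : ∀ n i j, i ≤ j → j ≤ n → ∀ x, s (n + 1) i (s n j x) = s (n + 1) (j + 1) (s n i x)
  d_s_lt : ∀ n i j, i < j → j ≤ n + 1 → ∀ x,
    d (n + 1) i (s (n + 1) j x) = s n (j - 1) (d n i x)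
  d_s_self : ∀ n i, i ≤ n → ∀ x, d n i (s n i x) = x
  d_s_succ : ∀ n i, i ≤ n → ∀ x, d n (i + 1) (s n i x) = x
  d_s_gt : ∀ n i j, j + 1 < i → i ≤ n + 2 → ∀ x,
    d (n + 1) i (s (n + 1) j x) = s n j (d n (i - 1) x)

attribute [instance] SimplicialModule.acg SimplicialModule.mod

variable {k : Type u} [Field k]

/-- The simplicial module underlying a cyclic module. -/
abbrev CyclicModule.toSimplicial (C : CyclicModule.{u, v} k) : SimplicialModule.{u, v} k where
  C := C.C
  d := C.d
  s := C.s
  d_d := C.d_d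
  s_s := C.s_s
  d_s_lt := C.d_s_lt
  d_s_self := C.d_s_self
  d_s_succ := C.d_s_succ
  d_s_gt := C.d_s_gt

namespace SimplicialModule

/-- The décalage of a simplicial module. -/
abbrev dec (S : SimplicialModule.{u, v} k) : SimplicialModule.{u, v} k where
  C n := S.C (n + 1)
  d n i := S.d (n + 1) (i + 1)
  s n i := S.s (n + 1) (i + 1)
  d_d n i j h h' x := by
    obtain ⟨j, rfl⟩ : ∃ a, j = a + 1 := ⟨j - 1, by omega⟩
    exact S.d_d (n + 1) (i + 1) (j + 2) (by omega) (by omega) x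
  s_s n i j h h' x := S.s_s (n + 1) (i + 1) (j + 1) (by omega) (by omega) x
  d_s_lt n i j h h' x := by
    obtain ⟨j, rfl⟩ : ∃ a, j = a + 1 := ⟨j - 1, by omega⟩
    exact S.d_s_lt (n + 1) (i + 1) (j + 2) (by omega) (by omega) x
  d_s_self n i h x := S.d_s_self (n + 1) (i + 1) (by omega) x
  d_s_succ n i h x := S.d_s_succ (n + 1) (i + 1) (by omega) x
  d_s_gt n i j h h' x := by
    obtain ⟨i, rfl⟩ : ∃ a, i = a + 1 := ⟨i - 1, by omega⟩
    exact S.d_s_gt (n + 1) (i + 2) (j + 1) (by omega) (by omega) x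

/-- The differential. -/
def b (S : SimplicialModule.{u, v} k) (n : ℕ) : S.C (n + 1) →ₗ[k] S.C n :=
  ∑ i ∈ Finset.range (n + 2), ((-1 : k) ^ i) • S.d n i

/-- The submodule of degenerate chains. -/
def degen (S : SimplicialModule.{u, v} k) : ∀ n, Submodule k (S.C n)
  | 0 => ⊥
  | n + 1 => ⨆ i : Fin (n + 1), LinearMap.range (S.s n i)

section maps

variable {S T : SimplicialModule.{u, v} k}

/-- The family `f` commutes with the degeneracies. -/
def CommS (f : ∀ n, S.C n →ₗ[k] T.C n) : Prop :=
  ∀ n i, i ≤ n → ∀ x, f (n + 1) (S.s n i x) = T.s n i (f n x)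

/-- The family `f` commutes with the faces `d_i`, `i ≥ 1`. -/
def CommD (f : ∀ n, S.C n →ₗ[k] T.C n) : Prop :=
  ∀ n i, i ≤ n → ∀ x, f n (S.d n (i + 1) x) = T.d n (i + 1) (f (n + 1) x)

/-- The family `f` commutes with the face `d_0`. -/
def CommD0 (f : ∀ n, S.C n →ₗ[k] T.C n) : Prop :=
  ∀ n x, f n (S.d n 0 x) = T.d n 0 (f (n + 1) x)

/-- The map induced on the décalage. -/
abbrev decMap (f : ∀ n, S.C n →ₗ[k] T.C n) : ∀ n, S.dec.C n →ₗ[k] T.dec.C n := fun n => f (n + 1)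

variable {f : ∀ n, S.C n →ₗ[k] T.C n}

lemma CommS.dec (h : CommS f) : CommS (decMap f) :=
  fun n i hi x => h (n + 1) (i + 1) (by omega) x

lemma CommD.dec (h : CommD f) : CommD (decMap f) :=
  fun n i hi x => h (n + 1) (i + 1) (by omega) x

lemma CommD.dec0 (h : CommD f) : CommD0 (decMap f) :=
  fun n x => h (n + 1) 0 (by omega) x

lemma map_b (h : CommD f) (h0 : CommD0 f) (n : ℕ) (x : S.C (n + 1)) :
    f n (S.b n x) = T.b n (f (n + 1) x) := by
  simp only [b, LinearMap.sum_apply, map_sum, LinearMap.smul_apply, map_smul]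
  refine Finset.sum_congr rfl fun i hi => ?_
  rw [Finset.mem_range] at hi
  obtain _ | i := i
  · rw [h0]
  · rw [h n i (by omega)]

lemma CommS.map_degen (h : CommS f) (n : ℕ) {x : S.C n} (hx : x ∈ S.degen n) :
    f n x ∈ T.degen n := by
  obtain _ | n := n
  · obtain rfl : x = 0 := hx
    rw [map_zero]; exact Submodule.zero_mem _
  · revert x
    change S.degen (n + 1) ≤ (T.degen (n + 1)).comap (f (n + 1))
    refine iSup_le fun i => ?_
    rintro _ ⟨x, rfl⟩
    rw [Submodule.mem_comap, h n i (by omega)]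
    exact Submodule.mem_iSup_of_mem i ⟨_, rfl⟩

end maps

variable (S : SimplicialModule.{u, v} k) (S' : SimplicialModule.{u, v} k)

lemma s_mem_degen {n i : ℕ} (hi : i ≤ n) (x : S.C n) : S.s n i x ∈ S.degen (n + 1) :=
  Submodule.mem_iSup_of_mem (⟨i, by omega⟩ : Fin (n + 1)) ⟨x, rfl⟩

lemma degen_dec_le (n : ℕ) : S.dec.degen n ≤ S.degen (n + 1) := by
  obtain _ | n := n
  · exact bot_le
  · refine iSup_le fun i => ?_
    rintro _ ⟨x, rfl⟩
    exact S.s_mem_degen (by omega) x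

/-- The face `d_0` as a map from the décalage. -/
abbrev d0Map (n : ℕ) : S.dec.C n →ₗ[k] S.C n := S.d n 0

/-- The degeneracy `s_0` as a map to the décalage. -/
abbrev s0Map (n : ℕ) : S.C n →ₗ[k] S.dec.C n := S.s n 0

lemma d0Map_commS : CommS S.d0Map := fun n i hi x =>
  S.d_s_lt n 0 (i + 1) (by omega) (by omega) x

lemma d0Map_commD : CommD S.d0Map := fun n i hi x =>
  S.d_d n 0 (i + 2) (by omega) (by omega) x

lemma d0Map_commD0 : CommD0 S.d0Map := fun n x =>
  S.d_d n 0 1 (by omega) (by omega) x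

lemma s0Map_commS : CommS S.s0Map := fun n i hi x => S.s_s n 0 i (by omega) hi x

lemma s0Map_commD : CommD S.s0Map := fun n i hi x =>
  (S.d_s_gt n (i + 2) 0 (by omega) (by omega) x).symm

lemma b_succ (n : ℕ) (x : S.C (n + 2)) : S.b (n + 1) x = S.d (n + 1) 0 x - S.dec.b n x := by
  rw [b, Finset.sum_range_succ', add_comm (Finset.sum _ _)]
  simp only [LinearMap.add_apply, LinearMap.sum_apply, LinearMap.smul_apply, pow_zero, one_smul, b,
    sub_eq_add_neg, ← Finset.sum_neg_distrib]
  refine congrArg _ (Finset.sum_congr rfl fun i _ => ?_)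
  rw [pow_succ]; simp

lemma b_zero (x : S.C 1) : S.b 0 x = S.d 0 0 x - S.d 0 1 x := by
  simp [b, Finset.sum_range_succ, sub_eq_add_neg]

/-- The part `∑_{i ≥ 1} (-1)^{i+1} d_i` of the differential. -/
def b₁ (n : ℕ) : S.C (n + 1) →ₗ[k] S.C n := S.d n 0 - S.b n

lemma b_eq (n : ℕ) (x : S.C (n + 1)) : S.b n x = S.d n 0 x - S.b₁ n x := by
  simp [b₁]

lemma b₁_succ (n : ℕ) (x : S.C (n + 2)) : S.b₁ (n + 1) x = S.dec.b n x := by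
  rw [b₁, LinearMap.sub_apply, b_succ, sub_sub_cancel]

lemma b₁_apply (n : ℕ) (x : S.C (n + 1)) :
    S.b₁ n x = ∑ i ∈ Finset.range (n + 1), (-1 : k) ^ i • S.d n (i + 1) x := by
  rw [b₁, LinearMap.sub_apply, b, LinearMap.sum_apply, Finset.sum_range_succ',
    LinearMap.smul_apply, pow_zero, one_smul, sub_add_cancel_right, ← Finset.sum_neg_distrib]
  refine Finset.sum_congr rfl fun i _ => ?_
  rw [LinearMap.smul_apply, pow_succ]; simp

lemma dec_b_s (n : ℕ) (x : S.C (n + 1)) :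
    S.dec.b n (S.s (n + 1) 0 x) = x - S.s n 0 (S.b₁ n x) := by
  have h : S.dec.b n (S.s (n + 1) 0 x) =
      ∑ i ∈ Finset.range (n + 2), (-1 : k) ^ i • S.d (n + 1) (i + 1) (S.s (n + 1) 0 x) := by
    rw [b, LinearMap.sum_apply]; rfl
  rw [h, Finset.sum_range_succ', pow_zero, one_smul, zero_add, S.d_s_succ (n + 1) 0 (by omega),
    add_comm, b₁_apply, map_sum, sub_eq_add_neg, ← Finset.sum_neg_distrib]
  refine congrArg _ (Finset.sum_congr rfl fun i hi => ?_)
  rw [Finset.mem_range] at hi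
  rw [S.d_s_gt n (i + 2) 0 (by omega) (by omega), pow_succ, map_smul]
  simp

/-- The identification of `C_n` and `C_m` for `m = n`, and zero otherwise. -/
def castF (n m : ℕ) : S.C n →ₗ[k] S.C m :=
  if h : n = m then h ▸ LinearMap.id else 0

@[simp] lemma castF_self (n : ℕ) : S.castF n n = LinearMap.id := by simp [castF]

lemma castF_ne {n m : ℕ} (h : n ≠ m) : S.castF n m = 0 := by simp [castF, h]

lemma dec_castF (n m : ℕ) : S.dec.castF n m = S.castF (n + 1) (m + 1) := by
  by_cases h : n = m
  · subst h; rw [castF_self, castF_self]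
  · rw [castF_ne _ h, castF_ne _ (by omega)]

lemma map_castF {S T : SimplicialModule.{u, v} k} (f : ∀ n, S.C n →ₗ[k] T.C n) (n m : ℕ)
    (x : S.C n) : f m (S.castF n m x) = T.castF n m (f n x) := by
  by_cases h : n = m
  · subst h; simp
  · simp [castF_ne _ h]

/-- The front face `C_n → C_p` (zero for `p > n`). -/
def front : ∀ (S : SimplicialModule.{u, v} k) (n p : ℕ), S.C n →ₗ[k] S.C p
  | _, 0, 0 => LinearMap.id
  | _, 0, _ + 1 => 0
  | S, n + 1, 0 => S.d 0 1 ∘ₗ front S.dec n 0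
  | S, n + 1, p + 1 => front S.dec n p

/-- The back face `d_0^p : C_n → C_q` (zero for `p + q ≠ n`). -/
def back : ∀ (p n q : ℕ), S.C n →ₗ[k] S.C q
  | 0, n, q => S.castF n q
  | _ + 1, 0, _ => 0
  | p + 1, n + 1, q => back p n q ∘ₗ S.d n 0

lemma map_front {S T : SimplicialModule.{u, v} k} {f : ∀ n, S.C n →ₗ[k] T.C n} (h : CommD f)
    (n p : ℕ) (x : S.C n) : f p (front S n p x) = front T n p (f n x) := by
  induction n generalizing p S T with
  | zero => obtain _ | p := p <;> simp [front]
  | succ n ih =>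
    obtain _ | p := p
    · refine (h 0 0 le_rfl _).trans (congrArg (T.d 0 1) ?_)
      exact ih h.dec 0 x
    · exact ih h.dec p x

lemma map_back {S T : SimplicialModule.{u, v} k} {f : ∀ n, S.C n →ₗ[k] T.C n} (h : CommD0 f)
    (p n q : ℕ) (x : S.C n) : f q (S.back p n q x) = T.back p n q (f n x) := by
  induction p generalizing n with
  | zero => exact map_castF f n q x
  | succ p ih =>
    obtain _ | n := n
    · simp [back]
    · refine (ih n _).trans (congrArg (T.back p n q) (h n x))

lemma front_self (n : ℕ) (x : S.C n) : front S n n x = x := by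
  induction n generalizing S with
  | zero => rfl
  | succ n ih => exact ih S.dec x

lemma front_zero_d (n i : ℕ) (hi : i ≤ n) (x : S.C (n + 1)) :
    front S n 0 (S.d n (i + 1) x) = front S (n + 1) 0 x := by
  induction n generalizing S i with
  | zero => obtain rfl : i = 0 := by omega
            rfl
  | succ n ih =>
    obtain _ | i := i
    · have h := map_front S.dec.d0Map_commD n 0 x
      refine (congrArg (S.d 0 1) h.symm).trans ?_
      exact (S.d_d 0 1 2 (by omega) (by omega) _).symm
    · exact congrArg (S.d 0 1) (ih S.dec i (by omega) x)

lemma front_succ (n p : ℕ) (hp : p ≤ n) (x : S.C (n + 1)) :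
    front S (n + 1) p x = front S n p (S.d n (n + 1) x) := by
  induction n generalizing S p with
  | zero =>
    obtain rfl : p = 0 := by omega
    rfl
  | succ n ih =>
    obtain _ | p := p
    · exact (S.front_zero_d (n + 1) (n + 1) le_rfl x).symm
    · exact ih S.dec p (by omega) x

lemma front_s (n p i : ℕ) (hi : i ≤ p) (hp : p ≤ n) (x : S.C n) :
    front S (n + 1) (p + 1) (S.s n i x) = S.s p i (front S n p x) := by
  induction n generalizing S p i with
  | zero =>
    obtain rfl : p = 0 := by omega
    obtain rfl : i = 0 := by omega
    exact (map_front S.s0Map_commD 0 0 x).symm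
  | succ n ih =>
    obtain _ | i := i
    · exact (map_front S.s0Map_commD (n + 1) p x).symm
    · obtain ⟨p, rfl⟩ : ∃ a, p = a + 1 := ⟨p - 1, by omega⟩
      exact ih S.dec p i (by omega) (by omega) x

lemma back_s (p n q i : ℕ) (hi : p ≤ i) (hn : i ≤ n) (x : S.C n) :
    S.back p (n + 1) (q + 1) (S.s n i x) = S.s q (i - p) (S.back p n q x) := by
  induction p generalizing n i with
  | zero =>
    by_cases h : n = q
    · subst h; simp [back]
    · simp [back, castF_ne _ h, castF_ne _ (show n + 1 ≠ q + 1 by omega)]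
  | succ p ih =>
    obtain ⟨i, rfl⟩ : ∃ a, i = a + 1 := ⟨i - 1, by omega⟩
    obtain ⟨n, rfl⟩ : ∃ a, n = a + 1 := ⟨n - 1, by omega⟩
    rw [Nat.add_sub_add_right, back, LinearMap.comp_apply, S.d_s_lt _ _ _ (by omega) (by omega),
      Nat.add_sub_cancel, ih n i (by omega) (by omega)]
    rfl

/-- The component `C_n ⊗ C'_n → C_p ⊗ C'_q` of the Alexander-Whitney map. -/
def aw (n p q : ℕ) : S.C n ⊗[k] S'.C n →ₗ[k] S.C p ⊗[k] S'.C q :=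
  TensorProduct.map (front S n p) (S'.back p n q)

/-- The component `C_p ⊗ C'_q → C_n ⊗ C'_n` of the shuffle map, defined by recursion over the first
step of a shuffle. -/
def shuffle : ∀ (S S' : SimplicialModule.{u, v} k) (n p q : ℕ),
    S.C p ⊗[k] S'.C q →ₗ[k] S.C n ⊗[k] S'.C n
  | _, _, 0, 0, 0 => LinearMap.id
  | _, _, 0, _ + 1, _ => 0
  | _, _, 0, 0, _ + 1 => 0
  | _, _, _ + 1, 0, 0 => 0
  | S, S', n + 1, p + 1, 0 => shuffle S.dec S'.dec n p 0 ∘ₗ TensorProduct.map LinearMap.id (S'.s 0 0)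
  | S, S', n + 1, 0, q + 1 => shuffle S.dec S'.dec n 0 q ∘ₗ TensorProduct.map (S.s 0 0) LinearMap.id
  | S, S', n + 1, p + 1, q + 1 =>
      shuffle S.dec S'.dec n p (q + 1) ∘ₗ TensorProduct.map LinearMap.id (S'.s (q + 1) 0) +
      (-1 : k) ^ (p + 1) • shuffle S.dec S'.dec n (p + 1) q ∘ₗ
        TensorProduct.map (S.s (p + 1) 0) LinearMap.id

section

variable {S S'}

lemma shuffle_left (n p : ℕ) (x : S.C (p + 1)) (y : S'.C 0) :
    shuffle S S' (n + 1) (p + 1) 0 (x ⊗ₜ y) =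
      shuffle S.dec S'.dec n p 0 (x ⊗ₜ[k] (S'.s 0 0 y : S'.dec.C 0)) := rfl

lemma shuffle_right (n q : ℕ) (x : S.C 0) (y : S'.C (q + 1)) :
    shuffle S S' (n + 1) 0 (q + 1) (x ⊗ₜ y) =
      shuffle S.dec S'.dec n 0 q ((S.s 0 0 x : S.dec.C 0) ⊗ₜ[k] (y : S'.dec.C q)) := rfl

lemma shuffle_succ (n p q : ℕ) (x : S.C (p + 1)) (y : S'.C (q + 1)) :
    shuffle S S' (n + 1) (p + 1) (q + 1) (x ⊗ₜ y) =
      shuffle S.dec S'.dec n p (q + 1) ((x : S.dec.C p) ⊗ₜ[k] (S'.s (q + 1) 0 y : S'.dec.C (q + 1))) +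
      (-1 : k) ^ (p + 1) • shuffle S.dec S'.dec n (p + 1) q
        ((S.s (p + 1) 0 x : S.dec.C (p + 1)) ⊗ₜ[k] (y : S'.dec.C q)) := rfl

end

lemma map_shuffle {S S' T T' : SimplicialModule.{u, v} k} {f : ∀ n, S.C n →ₗ[k] T.C n}
    {f' : ∀ n, S'.C n →ₗ[k] T'.C n} (h : CommS f) (h' : CommS f') (n p q : ℕ) (x : S.C p)
    (y : S'.C q) :
    TensorProduct.map (f n) (f' n) (shuffle S S' n p q (x ⊗ₜ y)) =
      shuffle T T' n p q (f p x ⊗ₜ f' q y) := by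
  induction n generalizing S S' T T' p q with
  | zero => obtain _ | p := p <;> obtain _ | q := q <;> simp [shuffle]
  | succ n ih =>
    obtain _ | p := p <;> obtain _ | q := q
    · simp [shuffle]
    · rw [shuffle_right, shuffle_right, ← h 0 0 le_rfl]
      exact ih h.dec h'.dec 0 q _ _
    · rw [shuffle_left, shuffle_left, ← h' 0 0 le_rfl]
      exact ih h.dec h'.dec p 0 _ _
    · rw [shuffle_succ, shuffle_succ, ← h _ 0 (by omega), ← h' _ 0 (by omega), map_add, map_smul]
      exact congrArg₂ (fun a b => a + (-1 : k) ^ (p + 1) • b) (ih h.dec h'.dec p (q + 1) _ _)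
        (ih h.dec h'.dec (p + 1) q _ _)

/-- The product of simplicial modules. -/
abbrev prod : SimplicialModule.{u, v} k where
  C n := S.C n ⊗[k] S'.C n
  d n i := TensorProduct.map (S.d n i) (S'.d n i)
  s n i := TensorProduct.map (S.s n i) (S'.s n i)
  d_d n i j h h' x := CyclicModule.map_map_eq (S.d_d n i j h h') (S'.d_d n i j h h') x
  s_s n i j h h' x := CyclicModule.map_map_eq (S.s_s n i j h h') (S'.s_s n i j h h') x
  d_s_lt n i j h h' x := CyclicModule.map_map_eq (S.d_s_lt n i j h h') (S'.d_s_lt n i j h h') x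
  d_s_self n i h x := (CyclicModule.map_eq_of (h₁ := LinearMap.id) (h₂ := LinearMap.id)
    (S.d_s_self n i h) (S'.d_s_self n i h) x).trans (by simp)
  d_s_succ n i h x := (CyclicModule.map_eq_of (h₁ := LinearMap.id) (h₂ := LinearMap.id)
    (S.d_s_succ n i h) (S'.d_s_succ n i h) x).trans (by simp)
  d_s_gt n i j h h' x := CyclicModule.map_map_eq (S.d_s_gt n i j h h') (S'.d_s_gt n i j h h') x

/-- The sum of the shuffles of `d x ⊗ y` and of `± x ⊗ d y`. -/
def shuffleD (n : ℕ) : ∀ p q, S.C p → S'.C q → S.C n ⊗[k] S'.C n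
  | 0, 0, _, _ => 0
  | p + 1, 0, x, y => shuffle S S' n p 0 (S.b p x ⊗ₜ y)
  | 0, q + 1, x, y => shuffle S S' n 0 q (x ⊗ₜ S'.b q y)
  | p + 1, q + 1, x, y => shuffle S S' n p (q + 1) (S.b p x ⊗ₜ y) +
      (-1 : k) ^ (p + 1) • shuffle S S' n (p + 1) q (x ⊗ₜ S'.b q y)

/-- The shuffle map is a chain map. -/
lemma b_shuffle (n p q : ℕ) (x : S.C p) (y : S'.C q) :
    (prod S S').b n (shuffle S S' (n + 1) p q (x ⊗ₜ y)) = shuffleD S S' n p q x y := by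
  induction n generalizing S S' p q with
  | zero =>
    rw [b_zero]
    obtain _ | _ | p := p <;> obtain _ | _ | q := q <;>
      simp [shuffle, shuffleD, b_zero, TensorProduct.sub_tmul, TensorProduct.tmul_sub, S.d_s_self,
        S'.d_s_self, S.d_s_succ 0 0, S'.d_s_succ 0 0]
  | succ n ih =>
    have hd0 : ∀ p q (x : S.dec.C p) (y : S'.dec.C q), TensorProduct.map (S.d (n + 1) 0)
        (S'.d (n + 1) 0) (shuffle S.dec S'.dec (n + 1) p q (x ⊗ₜ[k] y)) =
        shuffle S S' (n + 1) p q (S.d p 0 x ⊗ₜ[k] S'.d q 0 y) :=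
      fun p q x y => map_shuffle S.d0Map_commS S'.d0Map_commS (n + 1) p q x y
    have ih' := ih S.dec S'.dec
    rw [b_succ]
    obtain _ | p := p <;> obtain _ | q := q
    · simp [shuffle, shuffleD]
    · rw [shuffle_right]
      refine (congrArg₂ (· - ·) (hd0 0 q _ _) (ih' 0 q _ _)).trans ?_
      rw [S.d_s_self _ _ le_rfl, shuffleD, S'.b_eq, TensorProduct.tmul_sub, map_sub]
      congr 1
      obtain _ | q := q
      · simp [shuffle, shuffleD]
      · rw [S'.b₁_succ]; rfl
    · rw [shuffle_left]
      refine (congrArg₂ (· - ·) (hd0 p 0 _ _) (ih' p 0 _ _)).trans ?_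
      rw [S'.d_s_self _ _ le_rfl, shuffleD, S.b_eq, TensorProduct.sub_tmul, map_sub]
      congr 1
      obtain _ | p := p
      · simp [shuffle, shuffleD]
      · rw [S.b₁_succ]; rfl
    · rw [shuffle_succ, map_add, map_add, map_smul, map_smul]
      have e1 := hd0 p (q + 1) x (S'.s (q + 1) 0 y)
      have e2 := hd0 (p + 1) q (S.s (p + 1) 0 x) y
      rw [S'.d_s_self _ _ (by omega)] at e1
      rw [S.d_s_self _ _ (by omega)] at e2
      have e3 : (prod S S').dec.b n (shuffle S.dec S'.dec (n + 1) p (q + 1)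
          ((x : S.dec.C p) ⊗ₜ[k] (S'.s (q + 1) 0 y : S'.dec.C (q + 1)))) =
          (shuffle S S' (n + 1) p (q + 1) (S.b₁ p x ⊗ₜ y) -
            (-1 : k) ^ p • shuffle S.dec S'.dec n p q
              ((S.s p 0 (S.b₁ p x) : S.dec.C p) ⊗ₜ[k] (y : S'.dec.C q))) +
          (-1 : k) ^ p • (shuffle S.dec S'.dec n p q ((x : S.dec.C p) ⊗ₜ[k] (y : S'.dec.C q)) -
            shuffle S.dec S'.dec n p q
              ((x : S.dec.C p) ⊗ₜ[k] (S'.s q 0 (S'.b₁ q y) : S'.dec.C q))) := by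
        refine (ih' p (q + 1) _ _).trans ?_
        rw [← map_sub, ← TensorProduct.tmul_sub]
        obtain _ | p := p
        · rw [shuffle_right, shuffleD]
          simp only [pow_zero, one_smul, sub_self, zero_add]
          rw [S'.dec_b_s]
        · rw [shuffleD, shuffle_succ, add_sub_cancel_right, S.b₁_succ, S'.dec_b_s]
      have e4 : (prod S S').dec.b n (shuffle S.dec S'.dec (n + 1) (p + 1) q
          ((S.s (p + 1) 0 x : S.dec.C (p + 1)) ⊗ₜ[k] (y : S'.dec.C q))) =
          (shuffle S.dec S'.dec n p q ((x : S.dec.C p) ⊗ₜ[k] (y : S'.dec.C q)) -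
            shuffle S.dec S'.dec n p q
              ((S.s p 0 (S.b₁ p x) : S.dec.C p) ⊗ₜ[k] (y : S'.dec.C q))) +
          (shuffle S S' (n + 1) (p + 1) q (x ⊗ₜ S'.b₁ q y) -
            shuffle S.dec S'.dec n p q
              ((x : S.dec.C p) ⊗ₜ[k] (S'.s q 0 (S'.b₁ q y) : S'.dec.C q))) := by
        refine (ih' (p + 1) q _ _).trans ?_
        rw [← map_sub, ← TensorProduct.sub_tmul]
        obtain _ | q := q
        · rw [shuffle_left, shuffleD, sub_self, add_zero, S.dec_b_s]
        · rw [shuffleD, shuffle_succ, add_sub_cancel_left, S'.b₁_succ, S.dec_b_s]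
      refine (congrArg₂ (· - ·) (congrArg₂ (fun a b => a + (-1 : k) ^ (p + 1) • b) e1 e2)
        (congrArg₂ (fun a b => a + (-1 : k) ^ (p + 1) • b) e3 e4)).trans ?_
      rw [shuffleD, S.b_eq, S'.b_eq, TensorProduct.sub_tmul, TensorProduct.tmul_sub, map_sub,
        map_sub, pow_succ]
      simp only [mul_neg, mul_one, neg_smul, smul_add, smul_sub]
      abel

lemma back_dec (p n q : ℕ) (x : S.C (n + 1)) :
    S.back (p + 1) (n + 1) q x = S.d q 0 (S.dec.back p n q x) :=
  (map_back S.d0Map_commD0 p n q x).symm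

lemma aw_succ (n p q : ℕ) (z : S.C (n + 1) ⊗[k] S'.C (n + 1)) :
    aw S S' (n + 1) (p + 1) q z =
      TensorProduct.map LinearMap.id (S'.d q 0) (aw S.dec S'.dec n p q z) := by
  rw [aw, aw, map_map_apply, LinearMap.id_comp]
  have : S'.back (p + 1) (n + 1) q = S'.d q 0 ∘ₗ S'.dec.back p n q :=
    LinearMap.ext fun x => S'.back_dec p n q x
  rw [this]
  rfl

/-- The Alexander-Whitney map is a chain map. -/
lemma aw_b (n p q : ℕ) (h : p + q = n) (z : S.C (n + 1) ⊗[k] S'.C (n + 1)) :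
    aw S S' n p q ((prod S S').b n z) =
      (S.b p).rTensor _ (aw S S' (n + 1) (p + 1) q z) +
        (-1 : k) ^ p • (S'.b q).lTensor _ (aw S S' (n + 1) p (q + 1) z) := by
  induction n generalizing S S' p q with
  | zero =>
    obtain rfl : p = 0 := by omega
    obtain rfl : q = 0 := by omega
    induction z using TensorProduct.induction_on with
    | zero => simp
    | add x y hx hy => simp only [map_add, hx, hy, smul_add]; abel
    | tmul x y =>
      rw [(prod S S').b_zero]
      simp [aw, b_zero, front, back, TensorProduct.tmul_sub, TensorProduct.sub_tmul]
  | succ n ih =>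
    obtain _ | p := p
    · obtain rfl : q = n + 1 := by omega
      induction z using TensorProduct.induction_on with
      | zero => simp
      | add x y hx hy => simp only [map_add, hx, hy, smul_add]; abel
      | tmul x y =>
        have h1 : aw S S' (n + 1) 0 (n + 1) ((prod S S').b (n + 1) (x ⊗ₜ[k] y)) =
            front S (n + 1) 0 (S.d (n + 1) 0 x) ⊗ₜ[k] S'.d (n + 1) 0 y -
              front S (n + 2) 0 x ⊗ₜ[k] S'.dec.b n y := by
          rw [b_succ, map_sub]
          simp only [aw, back, castF_self, TensorProduct.map_tmul, LinearMap.id_apply, b,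
            LinearMap.sum_apply, LinearMap.smul_apply, map_sum, map_smul, TensorProduct.tmul_sum,
            TensorProduct.tmul_smul]
          congr 1
          refine Finset.sum_congr rfl fun i hi => ?_
          rw [Finset.mem_range] at hi
          rw [S.front_zero_d (n + 1) i (by omega)]
        have h2 : front S (n + 1) 0 (S.d (n + 1) 0 x) = S.d 0 0 (front S (n + 2) 1 x) :=
          (map_front S.d0Map_commD (n + 1) 0 x).symm
        rw [h1, h2]
        have h3 : front S (n + 2) 0 x = S.d 0 1 (front S (n + 2) 1 x) := rfl
        have h4 : S'.back 1 (n + 2) (n + 1) y = S'.d (n + 1) 0 y := by simp [back]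
        have h5 : S'.back 0 (n + 2) (n + 2) y = y := by simp [back]
        simp only [aw, TensorProduct.map_tmul, LinearMap.rTensor_tmul, LinearMap.lTensor_tmul,
          pow_zero, one_smul, b_zero, S'.b_succ, TensorProduct.tmul_sub, TensorProduct.sub_tmul,
          zero_add, h4, h5, h3]
        abel
    · rw [b_succ, map_sub]
      have h1 : aw S S' (n + 1) (p + 1) q ((prod S S').d (n + 1) 0 z) =
          (S.d (p + 1) 0).rTensor _ (aw S S' (n + 2) (p + 2) q z) := by
        rw [aw, aw, LinearMap.rTensor, map_map_apply, map_map_apply, LinearMap.id_comp]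
        have e : front S (n + 1) (p + 1) ∘ₗ S.d (n + 1) 0 =
            S.d (p + 1) 0 ∘ₗ front S (n + 2) (p + 2) :=
          LinearMap.ext fun x => (map_front S.d0Map_commD (n + 1) (p + 1) x).symm
        rw [e]; rfl
      have h2 := ih S.dec S'.dec p q (by omega) z
      have h3 : aw S S' (n + 1) (p + 1) q ((prod S S').dec.b n z) =
          TensorProduct.map LinearMap.id (S'.d q 0) ((S.dec.b p).rTensor _
            (aw S.dec S'.dec (n + 1) (p + 1) q z) +
          (-1 : k) ^ p • (S'.dec.b q).lTensor _ (aw S.dec S'.dec (n + 1) p (q + 1) z)) :=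
        (S.aw_succ S' n p q _).trans (congrArg _ h2)
      have e1 : S.b (p + 1) = S.d (p + 1) 0 - S.dec.b p := LinearMap.ext fun x => S.b_succ p x
      have e2 : S'.d q 0 ∘ₗ S'.dec.b q = S'.b q ∘ₗ S'.d (q + 1) 0 :=
        LinearMap.ext fun x => map_b S'.d0Map_commD S'.d0Map_commD0 q x
      have h4 : TensorProduct.map LinearMap.id (S'.d q 0) ((S.dec.b p).rTensor _
            (aw S.dec S'.dec (n + 1) (p + 1) q z)) =
          (S.dec.b p).rTensor _ (aw S S' (n + 2) (p + 2) q z) := by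
        rw [aw_succ S S' (n + 1) (p + 1) q, LinearMap.rTensor, LinearMap.rTensor, map_map_apply]
        refine Eq.trans ?_ (map_map_apply _ _ _ _ _).symm
        rw [LinearMap.id_comp, LinearMap.comp_id, LinearMap.comp_id, LinearMap.id_comp]
      have h5 : TensorProduct.map LinearMap.id (S'.d q 0) ((S'.dec.b q).lTensor _
            (aw S.dec S'.dec (n + 1) p (q + 1) z)) =
          (S'.b q).lTensor _ (aw S S' (n + 2) (p + 1) (q + 1) z) := by
        rw [aw_succ S S' (n + 1) p (q + 1), LinearMap.lTensor, LinearMap.lTensor, map_map_apply]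
        refine Eq.trans ?_ (map_map_apply _ _ _ _ _).symm
        rw [e2]
      rw [h1, h3, map_add, map_smul, h4, h5, e1, LinearMap.rTensor_sub, LinearMap.sub_apply,
        pow_succ]
      simp only [mul_neg, mul_one, neg_smul]
      abel

end SimplicialModule
end HopfCyc

namespace HopfCyc
namespace SimplicialModule
variable {k : Type u} [Field k] (S S' : SimplicialModule.{u, v} k)

/-- The composite of the Alexander-Whitney map and the shuffle map. -/
def shuffleAW (n : ℕ) : S.C n ⊗[k] S'.C n →ₗ[k] S.C n ⊗[k] S'.C n :=
  ∑ e ∈ Finset.HasAntidiagonal.antidiagonal n, shuffle S S' n e.1 e.2 ∘ₗ aw S S' n e.1 e.2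

lemma shuffleAW_apply (n : ℕ) (z : S.C n ⊗[k] S'.C n) : shuffleAW S S' n z =
    ∑ e ∈ Finset.HasAntidiagonal.antidiagonal n, shuffle S S' n e.1 e.2 (aw S S' n e.1 e.2 z) := by
  simp [shuffleAW]

lemma b_shuffle_rTensor_lTensor (n p q : ℕ) (w : S.C (p + 1) ⊗[k] S'.C (q + 1)) :
    (prod S S').b n (shuffle S S' (n + 1) (p + 1) (q + 1) w) =
      shuffle S S' n p (q + 1) ((S.b p).rTensor _ w) +
        (-1 : k) ^ (p + 1) • shuffle S S' n (p + 1) q ((S'.b q).lTensor _ w) := by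
  induction w using TensorProduct.induction_on with
  | zero => simp
  | add x y hx hy => simp only [map_add, hx, hy, smul_add]; abel
  | tmul x y => exact b_shuffle S S' n (p + 1) (q + 1) x y

lemma b_shuffle_rTensor (n p : ℕ) (w : S.C (p + 1) ⊗[k] S'.C 0) :
    (prod S S').b n (shuffle S S' (n + 1) (p + 1) 0 w) =
      shuffle S S' n p 0 ((S.b p).rTensor _ w) := by
  induction w using TensorProduct.induction_on with
  | zero => simp
  | add x y hx hy => simp only [map_add, hx, hy]
  | tmul x y => exact b_shuffle S S' n (p + 1) 0 x y

lemma b_shuffle_lTensor (n q : ℕ) (w : S.C 0 ⊗[k] S'.C (q + 1)) :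
    (prod S S').b n (shuffle S S' (n + 1) 0 (q + 1) w) =
      shuffle S S' n 0 q ((S'.b q).lTensor _ w) := by
  induction w using TensorProduct.induction_on with
  | zero => simp
  | add x y hx hy => simp only [map_add, hx, hy]
  | tmul x y => exact b_shuffle S S' n 0 (q + 1) x y

lemma shuffleAW_b (n : ℕ) (z : S.C (n + 1) ⊗[k] S'.C (n + 1)) :
    (prod S S').b n (shuffleAW S S' (n + 1) z) = shuffleAW S S' n ((prod S S').b n z) := by
  rw [shuffleAW_apply, shuffleAW_apply, map_sum]
  have h1 : ∀ e ∈ Finset.HasAntidiagonal.antidiagonal n, shuffle S S' n e.1 e.2 (aw S S' n e.1 e.2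
      ((prod S S').b n z)) =
      shuffle S S' n e.1 e.2 ((S.b e.1).rTensor _ (aw S S' (n + 1) (e.1 + 1) e.2 z)) +
      (-1 : k) ^ e.1 • shuffle S S' n e.1 e.2
        ((S'.b e.2).lTensor _ (aw S S' (n + 1) e.1 (e.2 + 1) z)) := by
    intro e he
    rw [aw_b S S' n e.1 e.2 (by simpa using he), map_add, map_smul]
  rw [Finset.sum_congr rfl h1, Finset.sum_add_distrib]
  let F : ℕ × ℕ → S.C n ⊗[k] S'.C n := fun e => match e with
    | (0, _) => 0
    | (p + 1, q) => shuffle S S' n p q ((S.b p).rTensor _ (aw S S' (n + 1) (p + 1) q z))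
  let G : ℕ × ℕ → S.C n ⊗[k] S'.C n := fun e => match e with
    | (_, 0) => 0
    | (p, q + 1) => (-1 : k) ^ p • shuffle S S' n p q
        ((S'.b q).lTensor _ (aw S S' (n + 1) p (q + 1) z))
  have h2 : ∀ e ∈ Finset.HasAntidiagonal.antidiagonal (n + 1), (prod S S').b n
      (shuffle S S' (n + 1) e.1 e.2 (aw S S' (n + 1) e.1 e.2 z)) = F e + G e := by
    rintro ⟨p, q⟩ he
    obtain _ | p := p <;> obtain _ | q := q
    · simp at he
    · simp only [F, G, zero_add, pow_zero, one_smul]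
      exact b_shuffle_lTensor S S' n q _
    · simp only [F, G, add_zero]
      exact b_shuffle_rTensor S S' n p _
    · exact b_shuffle_rTensor_lTensor S S' n p q _
  rw [Finset.sum_congr rfl h2, Finset.sum_add_distrib, Finset.Nat.sum_antidiagonal_succ,
    Finset.Nat.sum_antidiagonal_succ' (f := G)]
  simp only [F, G, zero_add]

lemma shuffleAW_zero (z : S.C 0 ⊗[k] S'.C 0) : shuffleAW S S' 0 z = z := by
  simp [shuffleAW, shuffle, aw, front, back]

section naturality

variable {S S'} {T T' : SimplicialModule.{u, v} k} {f : ∀ n, S.C n →ₗ[k] T.C n}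
  {f' : ∀ n, S'.C n →ₗ[k] T'.C n}

lemma map_shuffle_apply (h : CommS f) (h' : CommS f') (n p q : ℕ) (w : S.C p ⊗[k] S'.C q) :
    TensorProduct.map (f n) (f' n) (shuffle S S' n p q w) =
      shuffle T T' n p q (TensorProduct.map (f p) (f' q) w) := by
  induction w using TensorProduct.induction_on with
  | zero => simp
  | add x y hx hy => simp only [map_add, hx, hy]
  | tmul x y => exact map_shuffle h h' n p q x y

lemma map_aw (h : CommD f) (h' : CommD0 f') (n p q : ℕ) (z : S.C n ⊗[k] S'.C n) :
    TensorProduct.map (f p) (f' q) (aw S S' n p q z) =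
      aw T T' n p q (TensorProduct.map (f n) (f' n) z) :=
  CyclicModule.map_map_eq (map_front h n p) (map_back h' p n q) z

lemma map_shuffleAW (h : CommS f) (h' : CommS f') (hd : CommD f) (hd' : CommD0 f') (n : ℕ)
    (z : S.C n ⊗[k] S'.C n) :
    TensorProduct.map (f n) (f' n) (shuffleAW S S' n z) =
      shuffleAW T T' n (TensorProduct.map (f n) (f' n) z) := by
  rw [shuffleAW_apply, shuffleAW_apply, map_sum]
  refine Finset.sum_congr rfl fun e _ => ?_
  rw [map_shuffle_apply h h', map_aw hd hd']

end naturality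

/-- The degeneracy `s_0 ⊗ s_0`, as a map to the décalage. -/
abbrev s0s0 (n : ℕ) : S.C n ⊗[k] S'.C n →ₗ[k] S.dec.C n ⊗[k] S'.dec.C n :=
  TensorProduct.map (S.s n 0) (S'.s n 0)

/-- The Eilenberg-Mac Lane homotopy, defined by recursion over the décalage. -/
def homotopy : ∀ (S S' : SimplicialModule.{u, v} k) (n : ℕ),
    S.C n ⊗[k] S'.C n →ₗ[k] S.C (n + 1) ⊗[k] S'.C (n + 1)
  | S, S', 0 => - (shuffleAW S.dec S'.dec 0 ∘ₗ s0s0 S S' 0)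
  | S, S', n + 1 => - homotopy S.dec S'.dec n - shuffleAW S.dec S'.dec (n + 1) ∘ₗ s0s0 S S' (n + 1)

lemma homotopy_zero (z : S.C 0 ⊗[k] S'.C 0) : homotopy S S' 0 z = - s0s0 S S' 0 z :=
  congrArg Neg.neg (shuffleAW_zero S.dec S'.dec _)

lemma homotopy_succ (n : ℕ) (z : S.C (n + 1) ⊗[k] S'.C (n + 1)) :
    homotopy S S' (n + 1) z = - homotopy S.dec S'.dec n z -
      shuffleAW S.dec S'.dec (n + 1) (s0s0 S S' (n + 1) z) := rfl

lemma map_homotopy {S S' T T' : SimplicialModule.{u, v} k} {f : ∀ n, S.C n →ₗ[k] T.C n}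
    {f' : ∀ n, S'.C n →ₗ[k] T'.C n} (h : CommS f) (h' : CommS f') (hd : CommD f) (hd' : CommD f')
    (n : ℕ) (z : S.C n ⊗[k] S'.C n) :
    TensorProduct.map (f (n + 1)) (f' (n + 1)) (homotopy S S' n z) =
      homotopy T T' n (TensorProduct.map (f n) (f' n) z) := by
  have hs : ∀ n (z : S.C n ⊗[k] S'.C n), TensorProduct.map (f (n + 1)) (f' (n + 1)) (s0s0 S S' n z) =
      s0s0 T T' n (TensorProduct.map (f n) (f' n) z) := fun n z =>
    CyclicModule.map_map_eq (h n 0 (by omega)) (h' n 0 (by omega)) z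
  induction n generalizing S S' T T' with
  | zero => rw [homotopy_zero, homotopy_zero, map_neg, hs]
  | succ n ih =>
    rw [homotopy_succ, homotopy_succ, map_sub, map_neg]
    refine congrArg₂ (fun a b => - a - b) (ih h.dec h'.dec hd.dec hd'.dec z (fun n z =>
      CyclicModule.map_map_eq (h.dec n 0 (by omega)) (h'.dec n 0 (by omega)) z)) ?_
    exact (map_shuffleAW h.dec h'.dec hd.dec hd'.dec0 (n + 1) _).trans
      (congrArg _ (hs (n + 1) z))

lemma b_homotopy_zero (z : S.C 0 ⊗[k] S'.C 0) : (prod S S').b 0 (homotopy S S' 0 z) = 0 := by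
  rw [homotopy_zero, map_neg, (prod S S').b_zero, (prod S S').d_s_self 0 0 le_rfl,
    (prod S S').d_s_succ 0 0 le_rfl, sub_self, neg_zero]

/-- The composite of the Alexander-Whitney map and the shuffle map is homotopic to the identity. -/
lemma b_homotopy (n : ℕ) (z : S.C (n + 1) ⊗[k] S'.C (n + 1)) :
    (prod S S').b (n + 1) (homotopy S S' (n + 1) z) + homotopy S S' n ((prod S S').b n z) =
      z - shuffleAW S S' (n + 1) z := by
  induction n generalizing S S' with
  | zero =>
    have h1 : TensorProduct.map (S.d 1 0) (S'.d 1 0) (homotopy S.dec S'.dec 0 z) =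
        homotopy S S' 0 (TensorProduct.map (S.d 0 0) (S'.d 0 0) z) :=
      map_homotopy S.d0Map_commS S'.d0Map_commS S.d0Map_commD S'.d0Map_commD 0 z
    have h2 : TensorProduct.map (S.d 1 0) (S'.d 1 0)
        (shuffleAW S.dec S'.dec 1 (s0s0 S S' 1 z)) = shuffleAW S S' 1 z := by
      refine (map_shuffleAW S.d0Map_commS S'.d0Map_commS S.d0Map_commD S'.d0Map_commD0 1 _).trans ?_
      exact congrArg _ ((prod S S').d_s_self 1 0 (by omega) z)
    have h3 := b_homotopy_zero S.dec S'.dec z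
    have h4 : (prod S S').dec.b 0 (shuffleAW S.dec S'.dec 1 (s0s0 S S' 1 z)) =
        z - s0s0 S S' 0 ((prod S S').b₁ 0 z) :=
      (shuffleAW_b S.dec S'.dec 0 _).trans ((shuffleAW_zero S.dec S'.dec _).trans
        ((prod S S').dec_b_s 0 z))
    have h5 : homotopy S S' 0 ((prod S S').b 0 z) =
        homotopy S S' 0 (TensorProduct.map (S.d 0 0) (S'.d 0 0) z) +
          s0s0 S S' 0 ((prod S S').b₁ 0 z) := by
      rw [(prod S S').b_eq, map_sub, homotopy_zero S S' ((prod S S').b₁ 0 z), sub_neg_eq_add]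
    rw [h5, b_succ, homotopy_succ, map_sub, map_sub, map_neg, map_neg]
    refine (congrArg₂ (· + ·) (congrArg₂ (· - ·) (congrArg₂ (fun a b => - a - b) h1 h2)
      (congrArg₂ (fun a b => - a - b) h3 h4)) rfl).trans ?_
    abel
  | succ n ih =>
    have h1 : TensorProduct.map (S.d (n + 2) 0) (S'.d (n + 2) 0) (homotopy S.dec S'.dec (n + 1) z) =
        homotopy S S' (n + 1) (TensorProduct.map (S.d (n + 1) 0) (S'.d (n + 1) 0) z) :=
      map_homotopy S.d0Map_commS S'.d0Map_commS S.d0Map_commD S'.d0Map_commD (n + 1) z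
    have h2 : TensorProduct.map (S.d (n + 2) 0) (S'.d (n + 2) 0)
        (shuffleAW S.dec S'.dec (n + 2) (s0s0 S S' (n + 2) z)) = shuffleAW S S' (n + 2) z := by
      refine (map_shuffleAW S.d0Map_commS S'.d0Map_commS S.d0Map_commD S'.d0Map_commD0
        (n + 2) _).trans ?_
      exact congrArg _ ((prod S S').d_s_self (n + 2) 0 (by omega) z)
    have h3 : (prod S S').dec.b (n + 1) (homotopy S.dec S'.dec (n + 1) z) =
        z - shuffleAW S.dec S'.dec (n + 1) z -
          homotopy S.dec S'.dec n ((prod S S').dec.b n z) :=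
      eq_sub_of_add_eq (ih S.dec S'.dec z)
    have h4 : (prod S S').dec.b (n + 1) (shuffleAW S.dec S'.dec (n + 2) (s0s0 S S' (n + 2) z)) =
        shuffleAW S.dec S'.dec (n + 1) z -
          shuffleAW S.dec S'.dec (n + 1) (s0s0 S S' (n + 1) ((prod S S').dec.b n z)) := by
      refine (shuffleAW_b S.dec S'.dec (n + 1) _).trans ?_
      refine (congrArg (shuffleAW S.dec S'.dec (n + 1)) ((prod S S').dec_b_s (n + 1) z)).trans ?_
      rw [(prod S S').b₁_succ]
      exact map_sub _ _ _
    have h5 : homotopy S S' (n + 1) ((prod S S').b (n + 1) z) =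
        homotopy S S' (n + 1) (TensorProduct.map (S.d (n + 1) 0) (S'.d (n + 1) 0) z) -
          (- homotopy S.dec S'.dec n ((prod S S').dec.b n z) -
          shuffleAW S.dec S'.dec (n + 1) (s0s0 S S' (n + 1) ((prod S S').dec.b n z))) := by
      rw [(prod S S').b_succ, map_sub]; rfl
    rw [h5, b_succ, homotopy_succ, map_sub, map_sub, map_neg, map_neg]
    refine (congrArg₂ (· + ·) (congrArg₂ (· - ·) (congrArg₂ (fun a b => - a - b) h1 h2)
      (congrArg₂ (fun a b => - a - b) h3 h4)) rfl).trans ?_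
    abel

/-- The shuffle map is symmetric up to sign. -/
lemma shuffle_comm (n p q : ℕ) (x : S.C p) (y : S'.C q) :
    TensorProduct.comm k _ _ (shuffle S S' n p q (x ⊗ₜ y)) =
      (-1 : k) ^ (p * q) • shuffle S' S n q p (y ⊗ₜ x) := by
  induction n generalizing S S' p q with
  | zero => obtain _ | p := p <;> obtain _ | q := q <;> simp [shuffle]
  | succ n ih =>
    obtain _ | p := p <;> obtain _ | q := q
    · simp [shuffle]
    · rw [shuffle_right, shuffle_left]
      exact (ih S.dec S'.dec 0 q _ _).trans (by simp)
    · rw [shuffle_right, shuffle_left]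
      exact (ih S.dec S'.dec p 0 _ _).trans (by simp)
    · rw [shuffle_succ, shuffle_succ, map_add, map_smul]
      refine (congrArg₂ (fun a b => a + (-1 : k) ^ (p + 1) • b) (ih S.dec S'.dec p (q + 1) _ _)
        (ih S.dec S'.dec (p + 1) q _ _)).trans ?_
      rw [smul_add, smul_smul, smul_smul, ← pow_add, ← pow_add,
        show (p + 1) * (q + 1) + (q + 1) = p * (q + 1) + 2 * (q + 1) by ring,
        pow_add _ _ (2 * (q + 1)), pow_mul (-1 : k) 2,
        show p + 1 + (p + 1) * q = (p + 1) * (q + 1) by ring]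
      simp only [even_two, Even.neg_pow, one_pow, mul_one]
      exact add_comm _ _

lemma shuffle_degen_left (n p q i : ℕ) (hi : i ≤ p) (x : S.C p) (y : S'.C q) :
    shuffle S S' n (p + 1) q (S.s p i x ⊗ₜ y) ∈ (prod S S').degen n := by
  induction n generalizing S S' p q i with
  | zero => obtain _ | q := q <;> exact Submodule.zero_mem _
  | succ n ih =>
    have key : ∀ q (y : S'.C q), shuffle S.dec S'.dec n p q
        ((S.s p i x : S.dec.C p) ⊗ₜ[k] (S'.s q 0 y : S'.dec.C q)) ∈ (prod S S').degen (n + 1) := by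
      intro q y
      obtain _ | i := i
      · have := map_shuffle S.s0Map_commS S'.s0Map_commS n p q x y
        refine this ▸ ?_
        exact (prod S S').s_mem_degen (Nat.zero_le n) _
      · obtain ⟨p, rfl⟩ : ∃ a, p = a + 1 := ⟨p - 1, by omega⟩
        exact (prod S S').degen_dec_le n (ih S.dec S'.dec p q i (by omega) x _)
    obtain _ | q := q
    · rw [shuffle_left]
      exact key 0 y
    · rw [shuffle_succ]
      refine Submodule.add_mem _ (key (q + 1) y) (Submodule.smul_mem _ _ ?_)
      rw [S.s_s p 0 i (by omega) hi]
      exact (prod S S').degen_dec_le n (ih S.dec S'.dec p q i hi _ y)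

lemma comm_mem_degen {n : ℕ} {z : S.C n ⊗[k] S'.C n} (hz : z ∈ (prod S S').degen n) :
    TensorProduct.comm k _ _ z ∈ (prod S' S).degen n := by
  refine CommS.map_degen (S := prod S S') (T := prod S' S)
    (f := fun n => (TensorProduct.comm k (S.C n) (S'.C n)).toLinearMap) (fun n i _ x => ?_) n hz
  induction x using TensorProduct.induction_on with
  | zero => simp
  | add x y hx hy => simp only [map_add, hx, hy]
  | tmul x y => simp

lemma shuffle_degen_right (n p q i : ℕ) (hi : i ≤ q) (x : S.C p) (y : S'.C q) :
    shuffle S S' n p (q + 1) (x ⊗ₜ S'.s q i y) ∈ (prod S S').degen n := by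
  have h1 := comm_mem_degen S' S (shuffle_degen_left S' S n q p i hi y x)
  rw [shuffle_comm] at h1
  have h2 := Submodule.smul_mem _ ((-1 : k) ^ ((q + 1) * p)) h1
  rwa [smul_smul, ← mul_pow, neg_one_mul, neg_neg, one_pow, one_smul] at h2

/-- The submodule generated by the tensors with a degenerate factor. -/
def degenTensor (p q : ℕ) : Submodule k (S.C p ⊗[k] S'.C q) :=
  LinearMap.range ((S.degen p).subtype.rTensor (S'.C q)) ⊔
    LinearMap.range ((S'.degen q).subtype.lTensor (S.C p))

variable {S S'} in
lemma tmul_mem_degenTensor_left {p q : ℕ} {x : S.C p} (hx : x ∈ S.degen p) (y : S'.C q) :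
    x ⊗ₜ y ∈ degenTensor S S' p q :=
  Submodule.mem_sup_left ⟨(⟨x, hx⟩ : S.degen p) ⊗ₜ y, rfl⟩

variable {S S'} in
lemma tmul_mem_degenTensor_right {p q : ℕ} (x : S.C p) {y : S'.C q} (hy : y ∈ S'.degen q) :
    x ⊗ₜ y ∈ degenTensor S S' p q :=
  Submodule.mem_sup_right ⟨x ⊗ₜ (⟨y, hy⟩ : S'.degen q), rfl⟩

lemma degenTensor_le {p q : ℕ} {P : Submodule k (S.C p ⊗[k] S'.C q)}
    (h : ∀ x ∈ S.degen p, ∀ y, x ⊗ₜ y ∈ P) (h' : ∀ x, ∀ y ∈ S'.degen q, x ⊗ₜ y ∈ P) :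
    degenTensor S S' p q ≤ P := by
  refine sup_le ?_ ?_
  · rintro _ ⟨w, rfl⟩
    induction w using TensorProduct.induction_on with
    | zero => rw [map_zero]; exact zero_mem _
    | add x y hx hy => rw [map_add]; exact add_mem hx hy
    | tmul x y => exact h x.1 x.2 y
  · rintro _ ⟨w, rfl⟩
    induction w using TensorProduct.induction_on with
    | zero => rw [map_zero]; exact zero_mem _
    | add x y hx hy => rw [map_add]; exact add_mem hx hy
    | tmul x y => exact h' x y.1 y.2

lemma degen_succ_le {n : ℕ} {P : Submodule k (S.C (n + 1))}
    (h : ∀ i ≤ n, ∀ x, S.s n i x ∈ P) : S.degen (n + 1) ≤ P := by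
  refine iSup_le fun i => ?_
  rintro _ ⟨x, rfl⟩
  exact h i (by omega) x

lemma shuffle_mem_degen (n p q : ℕ) {w : S.C p ⊗[k] S'.C q} (hw : w ∈ degenTensor S S' p q) :
    shuffle S S' n p q w ∈ (prod S S').degen n := by
  revert w
  change degenTensor S S' p q ≤ ((prod S S').degen n).comap (shuffle S S' n p q)
  refine degenTensor_le S S' (fun x hx y => ?_) fun x y hy => ?_
  · obtain _ | p := p
    · obtain rfl : x = 0 := hx
      rw [TensorProduct.zero_tmul]; exact zero_mem _
    · revert x
      change S.degen (p + 1) ≤ ((prod S S').degen n).comap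
        (shuffle S S' n (p + 1) q ∘ₗ (TensorProduct.mk k (S.C (p + 1)) (S'.C q)).flip y)
      exact S.degen_succ_le fun i hi x => shuffle_degen_left S S' n p q i hi x y
  · obtain _ | q := q
    · obtain rfl : y = 0 := hy
      rw [TensorProduct.tmul_zero]; exact zero_mem _
    · revert y
      change S'.degen (q + 1) ≤ ((prod S S').degen n).comap
        (shuffle S S' n p (q + 1) ∘ₗ TensorProduct.mk k (S.C p) (S'.C (q + 1)) x)
      exact S'.degen_succ_le fun i hi y => shuffle_degen_right S S' n p q i hi x y

lemma aw_mem_degenTensor (n p q : ℕ) (h : p + q = n) {z : S.C n ⊗[k] S'.C n}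
    (hz : z ∈ (prod S S').degen n) : aw S S' n p q z ∈ degenTensor S S' p q := by
  obtain _ | n := n
  · obtain rfl : z = 0 := hz
    rw [map_zero]; exact zero_mem _
  · revert z
    change (prod S S').degen (n + 1) ≤ (degenTensor S S' p q).comap (aw S S' (n + 1) p q)
    refine (prod S S').degen_succ_le fun i hi z => ?_
    rw [Submodule.mem_comap]
    induction z using TensorProduct.induction_on with
    | zero => simp only [map_zero]; exact zero_mem _
    | add x y hx hy => simp only [map_add]; exact add_mem hx hy
    | tmul x y =>
      change front S (n + 1) p (S.s n i x) ⊗ₜ S'.back p (n + 1) q (S'.s n i y) ∈ _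
      by_cases hip : i < p
      · obtain ⟨p, rfl⟩ : ∃ a, p = a + 1 := ⟨p - 1, by omega⟩
        rw [front_s S n p i (by omega) (by omega)]
        exact tmul_mem_degenTensor_left (S.s_mem_degen (by omega) _) _
      · obtain ⟨q, rfl⟩ : ∃ a, q = a + 1 := ⟨q - 1, by omega⟩
        rw [back_s S' p n q i (by omega) hi]
        exact tmul_mem_degenTensor_right _ (S'.s_mem_degen (by omega) _)

lemma shuffleAW_mem_degen (n : ℕ) {z : S.C n ⊗[k] S'.C n} (hz : z ∈ (prod S S').degen n) :
    shuffleAW S S' n z ∈ (prod S S').degen n := by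
  rw [shuffleAW_apply]
  exact Submodule.sum_mem _ fun e he => shuffle_mem_degen S S' n _ _
    (aw_mem_degenTensor S S' n _ _ (by simpa using he) hz)

lemma homotopy_s_mem_degen (n i : ℕ) (hi : i ≤ n) (w : S.C n ⊗[k] S'.C n) :
    homotopy S S' (n + 1) ((prod S S').s n i w) ∈ (prod S S').degen (n + 2) := by
  induction n generalizing S S' i with
  | zero =>
    obtain rfl : i = 0 := by omega
    rw [homotopy_succ]
    refine Submodule.sub_mem _ (Submodule.neg_mem _ ?_) ?_
    · have := map_homotopy S.s0Map_commS S'.s0Map_commS S.s0Map_commD S'.s0Map_commD 0 w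
      exact this ▸ (prod S S').s_mem_degen (Nat.zero_le 1) _
    · refine (prod S S').degen_dec_le 1 (shuffleAW_mem_degen S.dec S'.dec 1 ?_)
      have := (prod S S').s_s 0 0 0 le_rfl le_rfl w
      exact this ▸ (prod S S').dec.s_mem_degen (le_refl 0) _
  | succ n ih =>
    rw [homotopy_succ]
    refine Submodule.sub_mem _ (Submodule.neg_mem _ ?_) ?_
    · obtain _ | i := i
      · have := map_homotopy S.s0Map_commS S'.s0Map_commS S.s0Map_commD S'.s0Map_commD (n + 1) w
        exact this ▸ (prod S S').s_mem_degen (Nat.zero_le (n + 2)) _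
      · exact (prod S S').degen_dec_le (n + 2) (ih S.dec S'.dec i (by omega) w)
    · refine (prod S S').degen_dec_le (n + 2) (shuffleAW_mem_degen S.dec S'.dec (n + 2) ?_)
      have := (prod S S').s_s (n + 1) 0 i (Nat.zero_le i) hi w
      exact this ▸ (prod S S').dec.s_mem_degen hi _

lemma homotopy_mem_degen (n : ℕ) {z : S.C n ⊗[k] S'.C n} (hz : z ∈ (prod S S').degen n) :
    homotopy S S' n z ∈ (prod S S').degen (n + 1) := by
  obtain _ | n := n
  · obtain rfl : z = 0 := hz
    rw [map_zero]; exact zero_mem _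
  · revert z
    change (prod S S').degen (n + 1) ≤ ((prod S S').degen (n + 2)).comap (homotopy S S' (n + 1))
    exact (prod S S').degen_succ_le fun i hi w => homotopy_s_mem_degen S S' n i hi w

end SimplicialModule
end HopfCyc

namespace HopfCyc

lemma nth_succ_of_not {p : ℕ → Prop} (h0 : ¬ p 0) {i : ℕ}
    (hi : ∀ hf : (Set.ofPred fun j => p (j + 1)).Finite, i < hf.toFinset.card) :
    Nat.nth p i = Nat.nth (fun j => p (j + 1)) i + 1 := by
  classical
  have h1 : p (Nat.nth (fun j => p (j + 1)) i + 1) := Nat.nth_mem (p := fun j => p (j + 1)) i hi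
  have h2 := Nat.count_succ' p (Nat.nth (fun j => p (j + 1)) i)
  rw [Nat.count_nth hi, if_neg h0, add_zero] at h2
  have h3 := Nat.nth_count h1
  rwa [h2] at h3

lemma nth_succ_of {p : ℕ → Prop} (h0 : p 0) {i : ℕ}
    (hi : ∀ hf : (Set.ofPred fun j => p (j + 1)).Finite, i < hf.toFinset.card) :
    Nat.nth p (i + 1) = Nat.nth (fun j => p (j + 1)) i + 1 := by
  classical
  have h1 : p (Nat.nth (fun j => p (j + 1)) i + 1) := Nat.nth_mem (p := fun j => p (j + 1)) i hi
  have h2 := Nat.count_succ' p (Nat.nth (fun j => p (j + 1)) i)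
  rw [Nat.count_nth hi, if_pos h0] at h2
  have h3 := Nat.nth_count h1
  rwa [h2] at h3

lemma nth_zero_of {p : ℕ → Prop} (h0 : p 0) : Nat.nth p 0 = 0 := by
  classical
  simpa using Nat.nth_count h0

namespace SimplicialModule
variable {k : Type u} [Field k] (S S' : SimplicialModule.{u, v} k)

/-- The composite of degeneracies `s_{g (r-1)} ⋯ s_{g 0} : C_m → C_n` (zero for `n ≠ m + r`). -/
def degs (g : ℕ → ℕ) : ∀ (_ m n : ℕ), S.C m →ₗ[k] S.C n
  | 0, m, n => S.castF m n
  | _ + 1, _, 0 => 0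
  | r + 1, m, n + 1 => S.s n (g r) ∘ₗ degs g r m n

/-- The composite of faces `d_{f 0} ⋯ d_{f (r-1)} : C_n → C_m` (zero for `n ≠ m + r`). -/
def facs (f : ℕ → ℕ) : ∀ (_ n m : ℕ), S.C n →ₗ[k] S.C m
  | 0, n, m => S.castF n m
  | _ + 1, 0, _ => 0
  | r + 1, n + 1, m => facs f r n m ∘ₗ S.d n (f r)

variable {S} in
lemma degs_congr {g g' : ℕ → ℕ} {r : ℕ} (h : ∀ i < r, g i = g' i) (m n : ℕ) :
    S.degs g r m n = S.degs g' r m n := by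
  induction r generalizing n with
  | zero => rfl
  | succ r ih =>
    obtain _ | n := n
    · rfl
    · rw [degs, degs, h r (by omega), ih fun i hi => h i (by omega)]

lemma degs_zero (g : ℕ → ℕ) (r m : ℕ) : S.degs g r (m + 1) 0 = 0 := by
  obtain _ | r := r
  · exact S.castF_ne (by omega)
  · rfl

lemma facs_zero (f : ℕ → ℕ) (r m : ℕ) : S.facs f r 0 (m + 1) = 0 := by
  obtain _ | r := r
  · exact S.castF_ne (by omega)
  · rfl

lemma dec_degs (g : ℕ → ℕ) (r m n : ℕ) :
    S.dec.degs g r m n = S.degs (fun i => g i + 1) r (m + 1) (n + 1) := by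
  induction r generalizing n with
  | zero => exact S.dec_castF m n
  | succ r ih =>
    obtain _ | n := n
    · rw [degs, degs, degs_zero, LinearMap.comp_zero]
    · rw [degs, ih]; rfl

lemma dec_facs (f : ℕ → ℕ) (r n m : ℕ) :
    S.dec.facs f r n m = S.facs (fun i => f i + 1) r (n + 1) (m + 1) := by
  induction r generalizing n with
  | zero => exact S.dec_castF n m
  | succ r ih =>
    obtain _ | n := n
    · rw [facs, facs, facs_zero, LinearMap.zero_comp]
    · rw [facs, ih]; rfl

lemma degs_first (g : ℕ → ℕ) (r m n : ℕ) (x : S.C m) :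
    S.degs g (r + 1) m n x = S.degs (fun i => g (i + 1)) r (m + 1) n (S.s m (g 0) x) := by
  induction r generalizing n with
  | zero =>
    obtain _ | n := n
    · simp [degs, castF_ne S (show m + 1 ≠ 0 by omega)]
    · by_cases h : m = n
      · subst h; simp [degs]
      · simp [degs, castF_ne _ h, castF_ne _ (show m + 1 ≠ n + 1 by omega)]
  | succ r ih =>
    obtain _ | n := n
    · rfl
    · rw [degs, LinearMap.comp_apply, ih]; rfl

lemma degs_nth_of_not {p : ℕ → Prop} (h0 : ¬ p 0) {r : ℕ}
    (hr : ∀ hf : (Set.ofPred fun j => p (j + 1)).Finite, r ≤ hf.toFinset.card) (m n : ℕ)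
    (x : S.C (m + 1)) :
    S.degs (Nat.nth p) r (m + 1) (n + 1) x =
      S.dec.degs (Nat.nth fun j => p (j + 1)) r m n x := by
  rw [dec_degs, degs_congr fun i hi => nth_succ_of_not h0 fun hf => hi.trans_le (hr hf)]

lemma degs_nth_of {p : ℕ → Prop} (h0 : p 0) {r : ℕ}
    (hr : ∀ hf : (Set.ofPred fun j => p (j + 1)).Finite, r ≤ hf.toFinset.card) (m n : ℕ)
    (x : S.C m) :
    S.degs (Nat.nth p) (r + 1) m (n + 1) x =
      S.dec.degs (Nat.nth fun j => p (j + 1)) r m n (S.s m 0 x : S.dec.C m) := by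
  rw [dec_degs, degs_first, nth_zero_of h0,
    degs_congr fun i hi => nth_succ_of h0 fun hf => hi.trans_le (hr hf)]

/-- The image of a set of natural numbers under `i ↦ i + 1`. -/
abbrev shift (A : Finset ℕ) : Finset ℕ := A.map ⟨Nat.succ, Nat.succ_injective⟩

lemma mem_shift {A : Finset ℕ} {i : ℕ} : i + 1 ∈ shift A ↔ i ∈ A := by simp

lemma zero_notMem_shift (A : Finset ℕ) : 0 ∉ shift A := by simp

/-- The exponent `∑ (α_i - i)` of the sign of the shuffle given by the set `A = {α_i}`. -/
noncomputable def shuffleExp (p : ℕ) (A : Finset ℕ) : ℕ :=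
  ∑ i ∈ Finset.range p, (Nat.nth (· ∈ A) i - i)

lemma le_card_of_card_eq {A : Finset ℕ} {p : ℕ} (h : A.card = p)
    (hf : (Set.ofPred fun j => j ∈ A).Finite) : p ≤ hf.toFinset.card := by
  rw [← h]
  refine Finset.card_le_card fun i hi => ?_
  rw [Set.Finite.mem_toFinset]; exact hi

lemma infinite_notMem (A : Finset ℕ) : ¬ (Set.ofPred fun j => j ∉ A).Finite := fun h =>
  Set.infinite_univ ((h.union A.finite_toSet).subset fun i _ => by
    by_cases hi : i ∈ A
    · exact Or.inr hi
    · exact Or.inl hi)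

lemma le_nth_of_card {A : Finset ℕ} {p i : ℕ} (h : A.card = p) (hi : i < p) :
    i ≤ Nat.nth (· ∈ A) i := by
  classical
  have := Nat.count_nth (p := (· ∈ A)) fun hf => hi.trans_le (le_card_of_card_eq h hf)
  exact this.symm.le.trans (Nat.count_le _)

lemma shuffleExp_shift {p : ℕ} {A : Finset ℕ} (h : A.card = p) :
    shuffleExp p (shift A) = shuffleExp p A + p := by
  have : ∑ i ∈ Finset.range p, (Nat.nth (· ∈ A) i - i + 1) = shuffleExp p A + p := by
    rw [Finset.sum_add_distrib, shuffleExp]; simp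
  rw [← this, shuffleExp]
  refine Finset.sum_congr rfl fun i hi => ?_
  rw [Finset.mem_range] at hi
  rw [nth_succ_of_not (zero_notMem_shift A) fun hf => ?_]
  · simp only [mem_shift]
    have := le_nth_of_card h hi
    omega
  · simp only [mem_shift] at hf ⊢
    exact hi.trans_le (le_card_of_card_eq h hf)

lemma shuffleExp_insert {p : ℕ} {A : Finset ℕ} (h : A.card = p) :
    shuffleExp (p + 1) (insert 0 (shift A)) = shuffleExp p A := by
  have h0 : 0 ∈ insert 0 (shift A) := by simp
  rw [shuffleExp, Finset.sum_range_succ', shuffleExp, Nat.sub_zero, nth_zero_of h0, add_zero]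
  refine Finset.sum_congr rfl fun i hi => ?_
  rw [Finset.mem_range] at hi
  have hs : ∀ j, j + 1 ∈ insert 0 (shift A) ↔ j ∈ A := fun j => by simp
  rw [nth_succ_of h0 fun hf => ?_]
  · simp only [hs]
    omega
  · simp only [hs] at hf ⊢
    exact hi.trans_le (le_card_of_card_eq h hf)

lemma sum_powersetCard_succ {W : Type*} [AddCommMonoid W] (p n : ℕ) (f : Finset ℕ → W) :
    ∑ A ∈ Finset.powersetCard (p + 1) (Finset.range (n + 1)), f A =
      ∑ A ∈ Finset.powersetCard p (Finset.range n), f (insert 0 (shift A)) +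
      ∑ A ∈ Finset.powersetCard (p + 1) (Finset.range n), f (shift A) := by
  have h1 : Finset.range (n + 1) = insert 0 (shift (Finset.range n)) := by
    ext i
    obtain _ | i := i <;> simp
  rw [h1, Finset.powersetCard_succ_insert (zero_notMem_shift _), Finset.sum_union, add_comm,
    Finset.sum_image, Finset.powersetCard_map, Finset.powersetCard_map, Finset.sum_map,
    Finset.sum_map]
  · rfl
  · intro A hA B hB hAB
    have hA' := (Finset.mem_powersetCard.1 hA).1
    have hB' := (Finset.mem_powersetCard.1 hB).1
    rw [← Finset.erase_insert fun h => zero_notMem_shift _ (hA' h), hAB,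
      Finset.erase_insert fun h => zero_notMem_shift _ (hB' h)]
  · rw [Finset.disjoint_left]
    intro A hA hA'
    obtain ⟨B, _, rfl⟩ := Finset.mem_image.1 hA'
    exact zero_notMem_shift _ ((Finset.mem_powersetCard.1 hA).1 (Finset.mem_insert_self _ _))

/-- The explicit form of the shuffle map. -/
lemma shuffle_eq_sum (n p q : ℕ) (h : p + q = n) (x : S.C p) (y : S'.C q) :
    shuffle S S' n p q (x ⊗ₜ y) = ∑ A ∈ Finset.powersetCard p (Finset.range n),
      (-1 : k) ^ shuffleExp p A • (S.degs (Nat.nth (· ∉ A)) q p n x ⊗ₜ[k]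
        S'.degs (Nat.nth (· ∈ A)) p q n y) := by
  induction n generalizing S S' p q with
  | zero =>
    obtain rfl : p = 0 := by omega
    obtain rfl : q = 0 := by omega
    simp [shuffle, shuffleExp, degs]
  | succ n ih =>
    have hS : ∀ (A : Finset ℕ) q p x, S.degs (Nat.nth (· ∉ shift A)) (q + 1) p (n + 1) x =
        S.dec.degs (Nat.nth (· ∉ A)) q p n (S.s p 0 x : S.dec.C p) := fun A q p x => by
      have := S.degs_nth_of (p := (· ∉ shift A)) (by simp) (r := q)
        (fun hf => by simp only [mem_shift] at hf; exact (infinite_notMem A hf).elim) p n x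
      simp only [mem_shift] at this
      exact this
    have hS0 : ∀ (A : Finset ℕ) q p x, S.degs (Nat.nth (· ∉ insert 0 (shift A))) q (p + 1) (n + 1) x
        = S.dec.degs (Nat.nth (· ∉ A)) q p n x := fun A q p x => by
      have hs : ∀ j, j + 1 ∈ insert 0 (shift A) ↔ j ∈ A := fun j => by simp
      have := S.degs_nth_of_not (p := (· ∉ insert 0 (shift A))) (by simp) (r := q)
        (fun hf => by simp only [hs] at hf; exact (infinite_notMem A hf).elim) p n x
      simp only [hs] at this
      exact this
    have hS' : ∀ (A : Finset ℕ) q p y, A.card = p →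
        S'.degs (Nat.nth (· ∈ shift A)) p (q + 1) (n + 1) y =
        S'.dec.degs (Nat.nth (· ∈ A)) p q n y := fun A q p y hA => by
      have := S'.degs_nth_of_not (p := (· ∈ shift A)) (by simp) (r := p)
        (fun hf => by simp only [mem_shift] at hf ⊢; exact le_card_of_card_eq hA hf) q n y
      simp only [mem_shift] at this
      exact this
    have hS'0 : ∀ (A : Finset ℕ) q p y, A.card = p →
        S'.degs (Nat.nth (· ∈ insert 0 (shift A))) (p + 1) q (n + 1) y =
        S'.dec.degs (Nat.nth (· ∈ A)) p q n (S'.s q 0 y : S'.dec.C q) := fun A q p y hA => by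
      have hs : ∀ j, j + 1 ∈ insert 0 (shift A) ↔ j ∈ A := fun j => by simp
      have := S'.degs_nth_of (p := (· ∈ insert 0 (shift A))) (by simp) (r := p)
        (fun hf => by simp only [hs] at hf ⊢; exact le_card_of_card_eq hA hf) q n y
      simp only [hs] at this
      exact this
    obtain _ | p := p
    · obtain ⟨q, rfl⟩ : ∃ a, q = a + 1 := ⟨q - 1, by omega⟩
      rw [shuffle_right]
      refine (ih S.dec S'.dec 0 q (by omega) _ _).trans ?_
      have e : (∅ : Finset ℕ) = shift ∅ := rfl
      rw [Finset.powersetCard_zero, Finset.powersetCard_zero, Finset.sum_singleton,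
        Finset.sum_singleton]
      have h1 := hS ∅ q 0 x
      have h2 := hS' ∅ q 0 y rfl
      rw [← e] at h1 h2
      rw [h1, h2]
    · rw [sum_powersetCard_succ]
      have h1 : ∑ A ∈ Finset.powersetCard p (Finset.range n),
          (-1 : k) ^ shuffleExp (p + 1) (insert 0 (shift A)) •
            (S.degs (Nat.nth (· ∉ insert 0 (shift A))) q (p + 1) (n + 1) x ⊗ₜ[k]
              S'.degs (Nat.nth (· ∈ insert 0 (shift A))) (p + 1) q (n + 1) y) =
          shuffle S.dec S'.dec n p q ((x : S.dec.C p) ⊗ₜ[k] (S'.s q 0 y : S'.dec.C q)) := by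
        refine Eq.trans (Finset.sum_congr rfl fun A hA => ?_)
          (ih S.dec S'.dec p q (by omega) _ _).symm
        have hA' := (Finset.mem_powersetCard.1 hA).2
        rw [shuffleExp_insert hA', hS0, hS'0 A q p y hA']
      rw [h1]
      obtain _ | q := q
      · rw [shuffle_left, Finset.powersetCard_eq_empty.2 (by simp; omega), Finset.sum_empty,
          add_zero]
      · rw [shuffle_succ]
        refine congrArg₂ (· + ·) rfl ?_
        refine (congrArg _ (ih S.dec S'.dec (p + 1) q (by omega) _ _)).trans ?_
        refine Finset.smul_sum.trans (Finset.sum_congr rfl fun A hA => ?_)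
        have hA' := (Finset.mem_powersetCard.1 hA).2
        rw [shuffleExp_shift hA', hS, hS' A q (p + 1) y hA', smul_smul, ← pow_add, add_comm (p + 1)]


/-- The part of the homotopy that comes from the `(p + 1, q)`-shuffles, in the `r`-th décalage. -/
def homotopyTerm : ∀ (_ : ℕ) (S S' : SimplicialModule.{u, v} k) (n _ _ : ℕ),
    S.C n ⊗[k] S'.C n →ₗ[k] S.C (n + 1) ⊗[k] S'.C (n + 1)
  | 0, S, S', n, p, q => shuffle S.dec S'.dec n (p + 1) q ∘ₗ aw S.dec S'.dec n (p + 1) q ∘ₗ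
      s0s0 S S' n
  | r + 1, S, S', n + 1, p, q => homotopyTerm r S.dec S'.dec n p q
  | _ + 1, _, _, 0, _, _ => 0

lemma shuffleAW_s_sub_mem_degen (n : ℕ) (z : S.C (n + 1) ⊗[k] S'.C (n + 1)) :
    shuffleAW S.dec S'.dec (n + 1) (s0s0 S S' (n + 1) z) -
      ∑ e ∈ Finset.HasAntidiagonal.antidiagonal n, homotopyTerm 0 S S' (n + 1) e.1 e.2 z ∈
      (prod S S').degen (n + 2) := by
  rw [shuffleAW_apply, Finset.Nat.sum_antidiagonal_succ]
  simp only [homotopyTerm, LinearMap.comp_apply, add_sub_cancel_right]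
  have h1 : aw S.dec S'.dec (n + 1) 0 (n + 1) (s0s0 S S' (n + 1) z) =
      TensorProduct.map (S.s 0 0 ∘ₗ front S (n + 1) 0) (S'.s (n + 1) 0) z := by
    rw [aw, map_map_apply]
    congr 1
    · congr 1
      · exact LinearMap.ext fun x => (map_front S.s0Map_commD (n + 1) 0 x).symm
      · exact LinearMap.ext fun x => by simp [back]
  rw [h1]
  have h2 := map_shuffle_apply S.s0Map_commS S'.s0Map_commS (n + 1) 0 (n + 1)
    (TensorProduct.map (front S (n + 1) 0) LinearMap.id z)
  rw [map_map_apply, LinearMap.comp_id] at h2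
  exact h2 ▸ (prod S S').s_mem_degen (Nat.zero_le (n + 1)) _

lemma homotopy_sub_mem_degen (n : ℕ) (z : S.C n ⊗[k] S'.C n) :
    homotopy S S' n z - ∑ m ∈ Finset.range n, ∑ e ∈ Finset.HasAntidiagonal.antidiagonal m,
      (-1 : k) ^ (n - m) • homotopyTerm (n - 1 - m) S S' n e.1 e.2 z ∈
      (prod S S').degen (n + 1) := by
  induction n generalizing S S' with
  | zero =>
    rw [Finset.range_zero, Finset.sum_empty, sub_zero, homotopy_zero]
    exact Submodule.neg_mem _ ((prod S S').s_mem_degen le_rfl z)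
  | succ n ih =>
    have h1 := (prod S S').degen_dec_le (n + 1) (ih S.dec S'.dec z)
    have h2 := shuffleAW_s_sub_mem_degen S S' n z
    rw [homotopy_succ, Finset.sum_range_succ]
    have h3 : ∑ m ∈ Finset.range n, ∑ e ∈ Finset.HasAntidiagonal.antidiagonal m,
        (-1 : k) ^ (n + 1 - m) • homotopyTerm (n + 1 - 1 - m) S S' (n + 1) e.1 e.2 z =
        - ∑ m ∈ Finset.range n, ∑ e ∈ Finset.HasAntidiagonal.antidiagonal m,
          (-1 : k) ^ (n - m) • homotopyTerm (n - 1 - m) S.dec S'.dec n e.1 e.2 z := by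
      rw [← Finset.sum_neg_distrib]
      refine Finset.sum_congr rfl fun m hm => ?_
      rw [← Finset.sum_neg_distrib]
      refine Finset.sum_congr rfl fun e _ => ?_
      rw [Finset.mem_range] at hm
      rw [show n + 1 - m = (n - m) + 1 by omega, show n + 1 - 1 - m = (n - 1 - m) + 1 by omega,
        pow_succ, mul_neg_one, neg_smul]
      rfl
    rw [h3, show n + 1 - n = 1 by omega, show n + 1 - 1 - n = 0 by omega]
    simp only [pow_one, neg_smul, one_smul, Finset.sum_neg_distrib]
    convert Submodule.neg_mem _ (Submodule.add_mem _ h1 h2) using 1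
    abel

lemma back_d (p n q : ℕ) (hp : p ≤ n) (x : S.C (n + 1)) :
    S.back p n q (S.d n p x) = S.back (p + 1) (n + 1) q x := by
  induction p generalizing n with
  | zero => rfl
  | succ p ih =>
    obtain ⟨n, rfl⟩ : ∃ m, n = m + 1 := ⟨n - 1, by omega⟩
    have h : S.back (p + 1) (n + 1) q (S.d (n + 1) (p + 1) x) =
        S.back p n q (S.d n 0 (S.d (n + 1) (p + 1) x)) := rfl
    rw [h, S.d_d n 0 (p + 1) (by omega) (by omega), Nat.add_sub_cancel, ih n (by omega)]
    rfl

lemma back_eq_facs (p n q : ℕ) (h : p + q = n) (x : S.C n) :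
    S.back p n q x = S.facs (fun j => j) p n q x := by
  induction p generalizing n with
  | zero => rfl
  | succ p ih =>
    obtain ⟨n, rfl⟩ : ∃ m, n = m + 1 := ⟨n - 1, by omega⟩
    rw [← S.back_d p n q (by omega), ih n (by omega)]
    rfl

lemma back_eq_facs_zero (p n q : ℕ) (x : S.C n) :
    S.back p n q x = S.facs (fun _ => 0) p n q x := by
  induction p generalizing n with
  | zero => rfl
  | succ p ih =>
    obtain _ | n := n
    · rfl
    · exact ih n _

lemma front_eq_facs (q n p : ℕ) (h : p + q = n) (x : S.C n) :
    front S n p x = S.facs (fun j => p + 1 + j) q n p x := by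
  induction q generalizing n with
  | zero =>
    obtain rfl : p = n := by omega
    simp [front_self, facs]
  | succ q ih =>
    obtain ⟨n, rfl⟩ : ∃ m, n = m + 1 := ⟨n - 1, by omega⟩
    rw [front_succ S n p (by omega), ih n (by omega), facs, LinearMap.comp_apply,
      show p + 1 + q = n + 1 by omega]

/-- The explicit form of the terms of the homotopy. -/
lemma homotopyTerm_eq_sum (r n p q a c : ℕ) (h : p + q + r + 1 = n) (ha : a + q = n)
    (hc : c + p = n) (x : S.C n) (y : S'.C n) :
    homotopyTerm r S S' n p q (x ⊗ₜ y) =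
      ∑ A ∈ Finset.powersetCard (p + 1) (Finset.range (p + q + 1)),
      (-1 : k) ^ shuffleExp (p + 1) A •
        (S.degs (fun j => if j = 0 then r else Nat.nth (· ∉ A) (j - 1) + (r + 1)) (q + 1) a (n + 1)
          (front S n a x) ⊗ₜ[k]
        S'.degs (fun j => Nat.nth (· ∈ A) j + (r + 1)) (p + 1) c (n + 1)
          (S'.facs (fun j => r + 1 + j) p n c y)) := by
  induction r generalizing S S' n a c with
  | zero =>
    obtain ⟨n, rfl⟩ : ∃ m, n = m + 1 := ⟨n - 1, by omega⟩
    obtain rfl : a = p + 1 := by omega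
    obtain rfl : c = q + 1 := by omega
    have h1 : homotopyTerm 0 S S' (n + 1) p q (x ⊗ₜ y) = shuffle S.dec S'.dec (n + 1) (p + 1) q
        (front S.dec (n + 1) (p + 1) (S.s (n + 1) 0 x) ⊗ₜ[k]
          S'.dec.back (p + 1) (n + 1) q (S'.s (n + 1) 0 y)) := rfl
    have h2 : front S.dec (n + 1) (p + 1) (S.s (n + 1) 0 x) =
        S.s (p + 1) 0 (front S (n + 1) (p + 1) x) :=
      (map_front S.s0Map_commD (n + 1) (p + 1) x).symm
    have h3 : S'.dec.back (p + 1) (n + 1) q (S'.s (n + 1) 0 y) =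
        S'.facs (fun j => 0 + 1 + j) p (n + 1) (q + 1) y := by
      have : S'.dec.back (p + 1) (n + 1) q (S'.s (n + 1) 0 y) =
        S'.dec.back p n q (S'.d (n + 1) 1 (S'.s (n + 1) 0 y)) := rfl
      rw [this, S'.d_s_succ _ _ (Nat.zero_le _), back_eq_facs _ p n q (by omega), dec_facs]
      simp only [zero_add, add_comm]
    rw [h1, h2, h3]
    refine (shuffle_eq_sum S.dec S'.dec (n + 1) (p + 1) q (by omega) _ _).trans ?_
    rw [show p + q + 1 = n + 1 by omega]
    refine Finset.sum_congr rfl fun A _ => ?_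
    refine congrArg _ (congrArg₂ (· ⊗ₜ[k] ·) ?_ ?_)
    · rw [dec_degs, degs_first]; rfl
    · rw [dec_degs]
  | succ r ih =>
    obtain ⟨n, rfl⟩ : ∃ m, n = m + 1 := ⟨n - 1, by omega⟩
    obtain ⟨a, rfl⟩ : ∃ m, a = m + 1 := ⟨a - 1, by omega⟩
    obtain ⟨c, rfl⟩ : ∃ m, c = m + 1 := ⟨c - 1, by omega⟩
    refine (ih S.dec S'.dec n a c (by omega) (by omega) (by omega) x y).trans ?_
    refine Finset.sum_congr rfl fun A _ => ?_
    refine congrArg _ (congrArg₂ (· ⊗ₜ[k] ·) ?_ ?_)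
    · rw [dec_degs]
      refine DFunLike.congr_fun (degs_congr (fun i _ => ?_) _ _) _
      split_ifs <;> omega
    · rw [dec_degs, dec_facs]
      have : (fun i => r + 1 + i + 1) = fun j => r + 1 + 1 + j := by ext; omega
      rw [this]; rfl

end SimplicialModule

namespace CyclicModule
variable {k : Type u} [Field k] (C C' : CyclicModule.{u, v} k)

lemma cast_degeneracies (g : ℕ → ℕ) (r m n : ℕ) (h : m + r = n) (x : C.C m) :
    C.cast h (C.degeneracies g m r x) = C.toSimplicial.degs g r m n x := by
  subst h
  change C.degeneracies g m r x = _
  induction r with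
  | zero => simp [degeneracies, SimplicialModule.degs]
  | succ r ih => exact congrArg (C.s (m + r) (g r)) ih

lemma faces_cast (f : ℕ → ℕ) (r n m : ℕ) (h : n = m + r) (x : C.C n) :
    C.faces f m r (C.cast h x) = C.toSimplicial.facs f r n m x := by
  subst h
  change C.faces f m r x = _
  induction r with
  | zero => simp [faces, SimplicialModule.facs]
  | succ r ih => exact ih _

/-- The product cyclic module, in a reducible form. -/
abbrev diag : CyclicModule.{u, v} k where
  C n := C.C n ⊗[k] C'.C n
  d n i := TensorProduct.map (C.d n i) (C'.d n i)
  s n i := TensorProduct.map (C.s n i) (C'.s n i)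
  t n := TensorProduct.map (C.t n) (C'.t n)
  d_d := (C.prod C').d_d
  s_s := (C.prod C').s_s
  d_s_lt := (C.prod C').d_s_lt
  d_s_self := (C.prod C').d_s_self
  d_s_succ := (C.prod C').d_s_succ
  d_s_gt := (C.prod C').d_s_gt
  t_pow := (C.prod C').t_pow
  d_zero_t := (C.prod C').d_zero_t
  d_succ_t := (C.prod C').d_succ_t
  s_zero_t := (C.prod C').s_zero_t
  s_succ_t := (C.prod C').s_succ_t

lemma AW_apply (n : ℕ) (z : C.C n ⊗[k] C'.C n) (e : GrComplex.TensorIdx n) :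
    AW C C' n z e = TensorProduct.map (C.toNormalized e.1.1) (C'.toNormalized e.1.2)
      (SimplicialModule.aw C.toSimplicial C'.toSimplicial n e.1.1 e.1.2 z) := by
  rw [SimplicialModule.aw, map_map_apply]
  have h1 : C.faces (fun j => e.1.1 + 1 + j) e.1.1 e.1.2 ∘ₗ C.cast e.2.symm =
      SimplicialModule.front C.toSimplicial n e.1.1 := LinearMap.ext fun x =>
    (C.faces_cast _ _ _ _ _ x).trans (C.toSimplicial.front_eq_facs _ _ _ e.2 x).symm
  have h2 : C'.faces (fun _ => 0) e.1.2 e.1.1 ∘ₗ C'.cast (e.2.symm.trans (add_comm _ _)) =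
      C'.toSimplicial.back e.1.1 n e.1.2 := LinearMap.ext fun x =>
    (C'.faces_cast _ _ _ _ _ x).trans (C'.toSimplicial.back_eq_facs_zero _ _ _ x).symm
  rw [← h1, ← h2]
  rfl

/-- The homotopy `φ` with explicit source and target. -/
noncomputable def phiMap (n : ℕ) : C.C n ⊗[k] C'.C n →ₗ[k] C.C (n + 1) ⊗[k] C'.C (n + 1) :=
  C.phi C' n

lemma phiMap_eq (n : ℕ) : C.phiMap C' n = ∑ q : Fin n, ∑ p : Fin (n - q),
    ∑ A ∈ Finset.powersetCard (p + 1) (Finset.range (p + q + 1)),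
      ((-1 : k) ^ ((n - p - q) + SimplicialModule.shuffleExp (p + 1) A)) • TensorProduct.map
        (C.cast (by omega) ∘ₗ
          C.degeneracies (fun j => if j = 0 then n - p - q - 1 else
            Nat.nth (· ∉ A) (j - 1) + (n - p - q)) (n - q) (q + 1) ∘ₗ
          C.faces (fun j => n - q + 1 + j) (n - q) q ∘ₗ
          C.cast (by omega))
        (C'.cast (by omega) ∘ₗ
          C'.degeneracies (fun j => Nat.nth (· ∈ A) j + (n - p - q)) (n - p) (p + 1) ∘ₗ
          C'.faces (fun j => (n - p - q) + j) (n - p) p ∘ₗ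
          C'.cast (by omega)) := rfl

lemma phi_apply (n : ℕ) (z : C.C n ⊗[k] C'.C n) : C.phiMap C' n z =
    ∑ m ∈ Finset.range n, ∑ e ∈ Finset.HasAntidiagonal.antidiagonal m,
      (-1 : k) ^ (n - m) • SimplicialModule.homotopyTerm (n - 1 - m) C.toSimplicial C'.toSimplicial
        n e.1 e.2 z := by
  have h1 : ∀ m, ∑ e ∈ Finset.HasAntidiagonal.antidiagonal m, (-1 : k) ^ (n - m) •
        SimplicialModule.homotopyTerm (n - 1 - m) C.toSimplicial C'.toSimplicial n e.1 e.2 z =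
      ∑ q ∈ Finset.range (m + 1), (-1 : k) ^ (n - (m - q) - q) •
        SimplicialModule.homotopyTerm (n - 1 - (m - q) - q) C.toSimplicial C'.toSimplicial
          n (m - q) q z := by
    intro m
    rw [← Finset.Nat.sum_antidiagonal_swap,
      Finset.Nat.sum_antidiagonal_eq_sum_range_succ_mk]
    refine Finset.sum_congr rfl fun q hq => ?_
    rw [Finset.mem_range] at hq
    simp only [Prod.fst_swap, Prod.snd_swap]
    rw [show n - (m - q) - q = n - m by omega, show n - 1 - (m - q) - q = n - 1 - m by omega]
  simp only [h1]
  rw [Finset.sum_range_diag_flip n fun q p => (-1 : k) ^ (n - p - q) •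
        SimplicialModule.homotopyTerm (n - 1 - p - q) C.toSimplicial C'.toSimplicial n p q z,
    ← Fin.sum_univ_eq_sum_range (fun q => ∑ p ∈ Finset.range (n - q), (-1 : k) ^ (n - p - q) •
        SimplicialModule.homotopyTerm (n - 1 - p - q) C.toSimplicial C'.toSimplicial n p q z), phiMap_eq,
    LinearMap.sum_apply]
  refine Finset.sum_congr rfl fun q _ => ?_
  rw [LinearMap.sum_apply, ← Fin.sum_univ_eq_sum_range (fun p => (-1 : k) ^ (n - p - q) •
        SimplicialModule.homotopyTerm (n - 1 - p - q) C.toSimplicial C'.toSimplicial n p q z)]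
  refine Finset.sum_congr rfl fun p _ => ?_
  rw [LinearMap.sum_apply]
  obtain ⟨q, hq⟩ := q
  obtain ⟨p, hp⟩ := p
  dsimp only at hp ⊢
  clear h1
  induction z using TensorProduct.induction_on with
  | zero => simp
  | add x y hx hy => simp only [map_add, smul_add, Finset.sum_add_distrib, hx, hy]
  | tmul x y =>
    rw [SimplicialModule.homotopyTerm_eq_sum C.toSimplicial C'.toSimplicial (n - 1 - p - q) n p q
      (n - q) (n - p) (by omega) (by omega) (by omega), Finset.smul_sum]
    refine Finset.sum_congr rfl fun A _ => ?_
    rw [smul_smul, ← pow_add, LinearMap.smul_apply, TensorProduct.map_tmul]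
    refine congrArg _ (congrArg₂ (· ⊗ₜ[k] ·) ?_ ?_)
    · rw [LinearMap.comp_apply, LinearMap.comp_apply, LinearMap.comp_apply, C.cast_degeneracies,
        C.faces_cast, C.toSimplicial.front_eq_facs q n _ (by omega),
        show n - p - q - 1 = n - 1 - p - q by omega, show n - p - q = n - 1 - p - q + 1 by omega]
    · rw [LinearMap.comp_apply, LinearMap.comp_apply, LinearMap.comp_apply, C'.cast_degeneracies,
        C'.faces_cast, show n - p - q = n - 1 - p - q + 1 by omega]

/-- The explicit homotopy agrees with the recursive one up to degenerate chains. -/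
lemma homotopy_sub_phiMap_mem_degen (n : ℕ) (z : C.C n ⊗[k] C'.C n) :
    SimplicialModule.homotopy C.toSimplicial C'.toSimplicial n z - C.phiMap C' n z ∈
      (C.diag C').degen (n + 1) := by
  rw [phi_apply]
  exact SimplicialModule.homotopy_sub_mem_degen C.toSimplicial C'.toSimplicial n z

end CyclicModule
end HopfCyc

namespace HopfCyc
namespace SimplicialModule
variable {k : Type u} [Field k] (S S' : SimplicialModule.{u, v} k)

/-- The simplicial operators: the composites of faces and degeneracies, and zero. -/
inductive SimpOp : ∀ {a b : ℕ}, (S.C a →ₗ[k] S.C b) → Prop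
  | zero (a b : ℕ) : SimpOp (0 : S.C a →ₗ[k] S.C b)
  | id (a : ℕ) : SimpOp (LinearMap.id : S.C a →ₗ[k] S.C a)
  | d {a b : ℕ} {f : S.C a →ₗ[k] S.C (b + 1)} (i : ℕ) (hi : i ≤ b + 1) (h : SimpOp f) :
      SimpOp (S.d b i ∘ₗ f)
  | s {a b : ℕ} {f : S.C a →ₗ[k] S.C b} (i : ℕ) (hi : i ≤ b) (h : SimpOp f) :
      SimpOp (S.s b i ∘ₗ f)

variable {S S'}

lemma SimpOp.dec {a b : ℕ} {f : S.dec.C a →ₗ[k] S.dec.C b} (h : SimpOp S.dec f) :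
    SimpOp S (a := a + 1) (b := b + 1) f := by
  induction h with
  | zero b => exact .zero _ _
  | id => exact .id _
  | d i hi _ ih => exact .d (i + 1) (by omega) ih
  | s i hi _ ih => exact .s (i + 1) (by omega) ih

lemma SimpOp.comp {a b c : ℕ} {g : S.C b →ₗ[k] S.C c} (hg : SimpOp S g) {f : S.C a →ₗ[k] S.C b}
    (hf : SimpOp S f) : SimpOp S (g ∘ₗ f) := by
  induction hg with
  | zero b => rw [LinearMap.zero_comp]; exact .zero _ _
  | id => exact hf
  | d i hi _ ih => rw [LinearMap.comp_assoc]; exact .d i hi ih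
  | s i hi _ ih => rw [LinearMap.comp_assoc]; exact .s i hi ih

variable (S S')

lemma simpOp_d (n i : ℕ) (hi : i ≤ n + 1) : SimpOp S (S.d n i) := .d i hi (.id _)

lemma simpOp_s (n i : ℕ) (hi : i ≤ n) : SimpOp S (S.s n i) := .s i hi (.id _)

lemma simpOp_castF (n m : ℕ) : SimpOp S (S.castF n m) := by
  by_cases h : n = m
  · subst h; rw [castF_self]; exact .id _
  · rw [castF_ne _ h]; exact .zero _ _

lemma simpOp_front (n p : ℕ) : SimpOp S (front S n p) := by
  induction n generalizing S p with
  | zero =>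
    obtain _ | p := p
    · exact .id _
    · exact .zero _ _
  | succ n ih =>
    obtain _ | p := p
    · exact .d 1 (by omega) (ih S.dec 0).dec
    · exact (ih S.dec p).dec

lemma simpOp_back (p n q : ℕ) : SimpOp S (S.back p n q) := by
  induction p generalizing n with
  | zero => exact S.simpOp_castF n q
  | succ p ih =>
    obtain _ | n := n
    · exact .zero _ _
    · exact (ih n).comp (S.simpOp_d n 0 (by omega))

/-- The chains that are at least `j`-fold degenerate. -/
def filt : ∀ (_ m : ℕ), Submodule k (S.C m)
  | 0, _ => ⊤
  | _ + 1, 0 => ⊥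
  | j + 1, m + 1 => ⨆ i : Fin (m + 1), (filt j m).map (S.s m i)

variable {S} in
lemma s_mem_filt {j m i : ℕ} (hi : i ≤ m) {x : S.C m} (hx : x ∈ S.filt j m) :
    S.s m i x ∈ S.filt (j + 1) (m + 1) :=
  Submodule.mem_iSup_of_mem (⟨i, by omega⟩ : Fin (m + 1)) ⟨x, hx, rfl⟩

variable {S} in
lemma filt_succ_le {j m : ℕ} {P : Submodule k (S.C (m + 1))}
    (h : ∀ i ≤ m, ∀ x ∈ S.filt j m, S.s m i x ∈ P) : S.filt (j + 1) (m + 1) ≤ P := by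
  refine iSup_le fun i => ?_
  rintro _ ⟨x, hx, rfl⟩
  exact h i (by omega) x hx

lemma filt_antitone_succ (j m : ℕ) : S.filt (j + 1) m ≤ S.filt j m := by
  induction j generalizing m with
  | zero => exact le_top
  | succ j ih =>
    obtain _ | m := m
    · exact bot_le
    · exact filt_succ_le fun i hi x hx => s_mem_filt hi (ih m hx)

lemma filt_le_degen (j m : ℕ) : S.filt (j + 1) m ≤ S.degen m := by
  induction j with
  | zero =>
    obtain _ | m := m
    · exact bot_le
    · exact filt_succ_le fun i hi x _ => S.s_mem_degen hi x
  | succ j ih => exact (S.filt_antitone_succ _ _).trans ih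

lemma d_mem_filt (j m i : ℕ) (hi : i ≤ m + 1) {x : S.C (m + 1)} (hx : x ∈ S.filt (j + 1) (m + 1)) :
    S.d m i x ∈ S.filt j m := by
  revert x
  change S.filt (j + 1) (m + 1) ≤ (S.filt j m).comap (S.d m i)
  induction j generalizing m i with
  | zero => exact fun _ _ => Submodule.mem_top
  | succ j ih =>
    refine filt_succ_le fun l hl x hx => ?_
    rw [Submodule.mem_comap]
    rcases lt_trichotomy i l with h | rfl | h
    · obtain ⟨m, rfl⟩ : ∃ a, m = a + 1 := ⟨m - 1, by omega⟩
      rw [S.d_s_lt m i l h hl]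
      exact s_mem_filt (by omega) (ih m i (by omega) hx)
    · rwa [S.d_s_self m i hl]
    · rcases (show i = l + 1 ∨ l + 1 < i by omega) with rfl | h'
      · rwa [S.d_s_succ m l hl]
      · obtain ⟨m, rfl⟩ : ∃ a, m = a + 1 := ⟨m - 1, by omega⟩
        rw [S.d_s_gt m i l h' hi]
        exact s_mem_filt (by omega) (ih m (i - 1) (by omega) hx)

variable {S} in
lemma SimpOp.mem_filt {a b : ℕ} {f : S.C a →ₗ[k] S.C b} (h : SimpOp S f) (x : S.C a) :
    f x ∈ S.filt (b - a) b := by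
  induction h with
  | zero b => exact Submodule.zero_mem _
  | id => rw [Nat.sub_self]; exact Submodule.mem_top
  | @d b f i hi _ ih =>
    by_cases h : a ≤ b
    · have := ih
      rw [show b + 1 - a = (b - a) + 1 by omega] at this
      exact S.d_mem_filt _ _ i hi this
    · rw [show b - a = 0 by omega]; exact Submodule.mem_top
  | @s b f i hi _ ih =>
    have h1 := s_mem_filt hi ih
    by_cases h : a ≤ b
    · rwa [show b + 1 - a = (b - a) + 1 by omega]
    · rw [show b + 1 - a = 0 by omega]; exact Submodule.mem_top

variable {S} in
/-- A simplicial operator that raises the degree has degenerate values. -/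
lemma SimpOp.mem_degen {a b : ℕ} {f : S.C a →ₗ[k] S.C b} (h : SimpOp S f) (hab : a < b)
    (x : S.C a) : f x ∈ S.degen b := by
  obtain ⟨c, rfl⟩ : ∃ c, b = a + (c + 1) := ⟨b - a - 1, by omega⟩
  have := h.mem_filt x
  rw [Nat.add_sub_cancel_left] at this
  exact S.filt_le_degen _ _ this

/-- The span of the tensor products of simplicial operators. -/
def simpSpan (a a' b b' : ℕ) : Submodule k (S.C a ⊗[k] S'.C a' →ₗ[k] S.C b ⊗[k] S'.C b') :=
  Submodule.span k {h | ∃ f g, SimpOp S f ∧ SimpOp S' g ∧ h = TensorProduct.map f g}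

variable {S S'}

lemma map_mem_simpSpan {a a' b b' : ℕ} {f : S.C a →ₗ[k] S.C b} {g : S'.C a' →ₗ[k] S'.C b'}
    (hf : SimpOp S f) (hg : SimpOp S' g) : TensorProduct.map f g ∈ simpSpan S S' a a' b b' :=
  Submodule.subset_span ⟨f, g, hf, hg, rfl⟩

lemma comp_mem_simpSpan {a a' b b' c c' : ℕ} {h : S.C b ⊗[k] S'.C b' →ₗ[k] S.C c ⊗[k] S'.C c'}
    (hh : h ∈ simpSpan S S' b b' c c') {l : S.C a ⊗[k] S'.C a' →ₗ[k] S.C b ⊗[k] S'.C b'}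
    (hl : l ∈ simpSpan S S' a a' b b') : h ∘ₗ l ∈ simpSpan S S' a a' c c' := by
  induction hh using Submodule.span_induction with
  | zero => rw [LinearMap.zero_comp]; exact Submodule.zero_mem _
  | add x y _ _ hx hy => rw [LinearMap.add_comp]; exact Submodule.add_mem _ hx hy
  | smul r x _ hx => rw [LinearMap.smul_comp]; exact Submodule.smul_mem _ _ hx
  | mem h hh =>
    obtain ⟨f, g, hf, hg, rfl⟩ := hh
    induction hl using Submodule.span_induction with
    | zero => rw [LinearMap.comp_zero]; exact Submodule.zero_mem _
    | add x y _ _ hx hy => rw [LinearMap.comp_add]; exact Submodule.add_mem _ hx hy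
    | smul r x _ hx => rw [LinearMap.comp_smul]; exact Submodule.smul_mem _ _ hx
    | mem l hl =>
      obtain ⟨f', g', hf', hg', rfl⟩ := hl
      rw [← TensorProduct.map_comp]
      exact map_mem_simpSpan (hf.comp hf') (hg.comp hg')

lemma simpSpan_dec {a a' b b' : ℕ}
    {h : S.dec.C a ⊗[k] S'.dec.C a' →ₗ[k] S.dec.C b ⊗[k] S'.dec.C b'}
    (hh : h ∈ simpSpan S.dec S'.dec a a' b b') :
    h ∈ simpSpan S S' (a + 1) (a' + 1) (b + 1) (b' + 1) := by
  refine Submodule.span_le.2 ?_ hh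
  rintro _ ⟨f, g, hf, hg, rfl⟩
  exact map_mem_simpSpan hf.dec hg.dec

variable (S S')

lemma shuffle_mem_simpSpan (n p q : ℕ) : shuffle S S' n p q ∈ simpSpan S S' p q n n := by
  induction n generalizing S S' p q with
  | zero =>
    obtain _ | p := p <;> obtain _ | q := q
    · have := map_mem_simpSpan (SimpOp.id (S := S) 0) (SimpOp.id (S := S') 0)
      rwa [TensorProduct.map_id] at this
    all_goals exact Submodule.zero_mem _
  | succ n ih =>
    have h1 : ∀ p q, shuffle S.dec S'.dec n p q ∘ₗ TensorProduct.map LinearMap.id (S'.s q 0) ∈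
        simpSpan S S' (p + 1) q (n + 1) (n + 1) := fun p q =>
      comp_mem_simpSpan (simpSpan_dec (ih S.dec S'.dec p q))
        (map_mem_simpSpan (.id _) (S'.simpOp_s q 0 (Nat.zero_le q)))
    have h2 : ∀ p q, shuffle S.dec S'.dec n p q ∘ₗ TensorProduct.map (S.s p 0) LinearMap.id ∈
        simpSpan S S' p (q + 1) (n + 1) (n + 1) := fun p q =>
      comp_mem_simpSpan (simpSpan_dec (ih S.dec S'.dec p q))
        (map_mem_simpSpan (S.simpOp_s p 0 (Nat.zero_le p)) (.id _))
    obtain _ | p := p <;> obtain _ | q := q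
    · exact Submodule.zero_mem _
    · exact h2 0 q
    · exact h1 p 0
    · exact Submodule.add_mem _ (h1 p (q + 1)) (Submodule.smul_mem _ _ (h2 (p + 1) q))

lemma aw_mem_simpSpan (n p q : ℕ) : aw S S' n p q ∈ simpSpan S S' n n p q :=
  map_mem_simpSpan (S.simpOp_front n p) (S'.simpOp_back p n q)

lemma shuffleAW_mem_simpSpan (n : ℕ) : shuffleAW S S' n ∈ simpSpan S S' n n n n :=
  Submodule.sum_mem _ fun e _ =>
    comp_mem_simpSpan (shuffle_mem_simpSpan S S' n e.1 e.2) (aw_mem_simpSpan S S' n e.1 e.2)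

lemma homotopy_mem_simpSpan (n : ℕ) :
    homotopy S S' n ∈ simpSpan S S' n n (n + 1) (n + 1) := by
  have h : ∀ n, s0s0 S S' n ∈ simpSpan S S' n n (n + 1) (n + 1) := fun n =>
    map_mem_simpSpan (S.simpOp_s n 0 (Nat.zero_le n)) (S'.simpOp_s n 0 (Nat.zero_le n))
  induction n generalizing S S' with
  | zero =>
    exact Submodule.neg_mem _ (comp_mem_simpSpan
      (simpSpan_dec (shuffleAW_mem_simpSpan S.dec S'.dec 0)) (h 0))
  | succ n ih =>
    refine Submodule.sub_mem _ (Submodule.neg_mem _ (simpSpan_dec (ih S.dec S'.dec ?_)))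
      (comp_mem_simpSpan (simpSpan_dec (shuffleAW_mem_simpSpan S.dec S'.dec (n + 1))) (h (n + 1)))
    exact fun n => map_mem_simpSpan (S.dec.simpOp_s n 0 (Nat.zero_le n))
      (S'.dec.simpOp_s n 0 (Nat.zero_le n))

/-- A simplicial operator on the right factor that raises the degree. -/
lemma map_simpSpan_right {a a' b b' c' : ℕ} {h : S.C a ⊗[k] S'.C a' →ₗ[k] S.C b ⊗[k] S'.C b'}
    (hh : h ∈ simpSpan S S' a a' b b') {r : S'.C b' →ₗ[k] S'.C c'} (hr : SimpOp S' r)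
    (hlt : a' < c') {V W : Type v} [AddCommGroup W] [Module k W] [AddCommGroup V] [Module k V]
    (l : S.C b →ₗ[k] V) {ρ : S'.C c' →ₗ[k] W} (hρ : ∀ y ∈ S'.degen c', ρ y = 0)
    (w : S.C a ⊗[k] S'.C a') : TensorProduct.map l (ρ ∘ₗ r) (h w) = 0 := by
  induction hh using Submodule.span_induction with
  | zero => simp
  | add x y _ _ hx hy => rw [LinearMap.add_apply, map_add, hx, hy, add_zero]
  | smul c x _ hx => rw [LinearMap.smul_apply, map_smul, hx, smul_zero]
  | mem h hh =>
    obtain ⟨f, g, hf, hg, rfl⟩ := hh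
    rw [map_map_apply]
    have : (ρ ∘ₗ r) ∘ₗ g = 0 := LinearMap.ext fun y => hρ _ ((hr.comp hg).mem_degen hlt y)
    rw [this, TensorProduct.map_zero_right, LinearMap.zero_apply]

/-- A simplicial operator on the left factor that raises the degree. -/
lemma map_simpSpan_left {a a' b b' c : ℕ} {h : S.C a ⊗[k] S'.C a' →ₗ[k] S.C b ⊗[k] S'.C b'}
    (hh : h ∈ simpSpan S S' a a' b b') {r : S.C b →ₗ[k] S.C c} (hr : SimpOp S r)
    (hlt : a < c) {V W : Type v} [AddCommGroup W] [Module k W] [AddCommGroup V] [Module k V]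
    (l : S'.C b' →ₗ[k] V) {ρ : S.C c →ₗ[k] W} (hρ : ∀ y ∈ S.degen c, ρ y = 0)
    (w : S.C a ⊗[k] S'.C a') : TensorProduct.map (ρ ∘ₗ r) l (h w) = 0 := by
  induction hh using Submodule.span_induction with
  | zero => simp
  | add x y _ _ hx hy => rw [LinearMap.add_apply, map_add, hx, hy, add_zero]
  | smul c x _ hx => rw [LinearMap.smul_apply, map_smul, hx, smul_zero]
  | mem h hh =>
    obtain ⟨f, g, hf, hg, rfl⟩ := hh
    rw [map_map_apply]
    have : (ρ ∘ₗ r) ∘ₗ f = 0 := LinearMap.ext fun y => hρ _ ((hr.comp hf).mem_degen hlt y)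
    rw [this, TensorProduct.map_zero_left, LinearMap.zero_apply]

/-- The restriction of an `n`-simplex to the vertices `c, …, c + q`. -/
def window (n c q : ℕ) : S.C n →ₗ[k] S.C q := S.back c (c + q) q ∘ₗ front S n (c + q)

lemma window_zero (n q : ℕ) : S.window n 0 q = front S n q := by
  rw [window]
  have : ∀ m, m = q → S.back 0 m q ∘ₗ front S n m = front S n q := by
    rintro m rfl
    rw [back, castF_self, LinearMap.id_comp]
  exact this _ (Nat.zero_add q)

lemma window_succ (n c q : ℕ) : S.window (n + 1) (c + 1) q = S.d q 0 ∘ₗ S.dec.window n c q := by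
  rw [window]
  have : ∀ m, m = c + q + 1 → S.back (c + 1) m q ∘ₗ front S (n + 1) m =
      S.d q 0 ∘ₗ S.dec.window n c q := by
    rintro m rfl
    exact LinearMap.ext fun x => S.back_dec c (c + q) q _
  exact this _ (by omega)

lemma simpOp_window (n c q : ℕ) : SimpOp S (S.window n c q) :=
  (S.simpOp_back _ _ _).comp (S.simpOp_front _ _)

lemma front_back (i n m p : ℕ) (h : i + m = n) (x : S.C n) :
    front S m p (S.back i n m x) = S.window n i p x := by
  induction i generalizing n with
  | zero =>
    obtain rfl : m = n := by omega
    rw [window_zero, back, castF_self, LinearMap.id_apply]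
  | succ i ih =>
    obtain ⟨n, rfl⟩ : ∃ a, n = a + 1 := ⟨n - 1, by omega⟩
    have h1 : S.back (i + 1) (n + 1) m x = S.back i n m (S.d n 0 x) := rfl
    rw [h1, ih n (by omega), window_succ, window, window, LinearMap.comp_apply,
      LinearMap.comp_apply, LinearMap.comp_apply]
    rw [← map_front S.d0Map_commD n (i + p) x]
    exact (map_back S.d0Map_commD0 i (i + p) p _).symm

/-- The restriction of the right factor of a shuffle to `c, …, c + q`, up to degenerate chains. -/
lemma map_window_shuffle (n p q c : ℕ) (h : p + q = n) (hc : c ≤ p) {W : Type v}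
    [AddCommGroup W] [Module k W] {ρ : S'.C q →ₗ[k] W} (hρ : ∀ y ∈ S'.degen q, ρ y = 0)
    (x : S.C p) (y : S'.C q) :
    TensorProduct.map LinearMap.id (ρ ∘ₗ S'.window n c q) (shuffle S S' n p q (x ⊗ₜ y)) =
      (-1 : k) ^ (q * (p - c)) • (S.degs (fun j => c + j) q p n x ⊗ₜ[k] ρ y) := by
  induction n generalizing S S' p q c with
  | zero =>
    obtain rfl : p = 0 := by omega
    obtain rfl : q = 0 := by omega
    obtain rfl : c = 0 := by omega
    simp [window_zero, shuffle, degs, front]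
  | succ n ih =>
    obtain _ | c := c
    · rw [window_zero, Nat.sub_zero]
      obtain _ | q := q
      · obtain rfl : p = n + 1 := by omega
        have h1 := ih S.dec S'.dec n 0 0 (by omega) (by omega) (ρ := ρ ∘ₗ S'.d 0 1)
          (fun y hy => by obtain rfl : y = 0 := hy; exact map_zero _) x (S'.s 0 0 y)
        rw [window_zero] at h1
        refine h1.trans ?_
        rw [LinearMap.comp_apply, S'.d_s_succ 0 0 le_rfl, dec_degs, Nat.zero_mul, Nat.zero_mul]
        rfl
      · have h2 : ∀ p, p + q = n → ∀ x : S.C p, TensorProduct.map LinearMap.id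
            (ρ ∘ₗ front S' (n + 1) (q + 1)) (shuffle S.dec S'.dec n p q
              ((S.s p 0 x : S.dec.C p) ⊗ₜ[k] (y : S'.dec.C q))) =
            (-1 : k) ^ (q * p) • (S.degs (fun j => 0 + j) (q + 1) p (n + 1) x ⊗ₜ[k] ρ y) := by
          intro p hp x
          have h1 := ih S.dec S'.dec p q 0 hp (Nat.zero_le p) (ρ := ρ)
            (fun y hy => hρ y (S'.degen_dec_le q hy)) (S.s p 0 x) y
          rw [window_zero] at h1
          refine h1.trans ?_
          rw [dec_degs, degs_first, Nat.sub_zero]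
          rfl
        obtain _ | p := p
        · rw [shuffle_right]
          refine (h2 0 (by omega) x).trans ?_
          rw [Nat.mul_zero, Nat.mul_zero]
        · rw [shuffle_succ, map_add, map_smul]
          have h3 : TensorProduct.map LinearMap.id (ρ ∘ₗ front S' (n + 1) (q + 1))
              (shuffle S.dec S'.dec n p (q + 1)
                ((x : S.dec.C p) ⊗ₜ[k] (S'.s (q + 1) 0 y : S'.dec.C (q + 1)))) = 0 := by
            have e1 := map_shuffle (S := S.dec) (T := S.dec) (f := fun _ => LinearMap.id)
              (fun _ _ _ _ => rfl) S'.s0Map_commS n p (q + 1) x y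
            rw [LinearMap.id_apply] at e1
            have e2 : (ρ ∘ₗ front S' (n + 1) (q + 1)) ∘ₗ S'.s n 0 = 0 :=
              LinearMap.ext fun z => hρ _ (by
                have e3 : front S' (n + 1) (q + 1) (S'.s n 0 z) = S'.s q 0 (front S' n q z) :=
                  (map_front S'.s0Map_commD n q z).symm
                rw [e3]
                exact S'.s_mem_degen (Nat.zero_le q) _)
            refine (congrArg _ e1.symm).trans ?_
            refine (map_map_apply _ _ _ _ _).trans ?_
            refine (congrArg (fun g => TensorProduct.map _ g _) e2).trans ?_
            rw [TensorProduct.map_zero_right, LinearMap.zero_apply]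
          refine (congrArg₂ (fun a b => a + (-1 : k) ^ (p + 1) • b) h3
            (h2 (p + 1) (by omega) x)).trans ?_
          rw [zero_add, smul_smul, ← pow_add, show p + 1 + q * (p + 1) = (q + 1) * (p + 1) by ring]
    · obtain ⟨p, rfl⟩ : ∃ a, p = a + 1 := ⟨p - 1, by omega⟩
      rw [window_succ]
      have h1 := ih S.dec S'.dec p q c (by omega) (by omega) (ρ := ρ ∘ₗ S'.d q 0)
        (fun y hy => hρ _ (S'.d0Map_commS.map_degen q hy)) x (S'.s q 0 y)
      have h1' : TensorProduct.map LinearMap.id (ρ ∘ₗ S'.d q 0 ∘ₗ S'.dec.window n c q)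
          (shuffle S.dec S'.dec n p q ((x : S.dec.C p) ⊗ₜ[k] (S'.s q 0 y : S'.dec.C q))) =
          (-1 : k) ^ (q * (p + 1 - (c + 1))) • (S.degs (fun j => c + 1 + j) q (p + 1) (n + 1) x ⊗ₜ[k]
            ρ y) := by
        refine h1.trans ?_
        rw [LinearMap.comp_apply, S'.d_s_self q 0 (Nat.zero_le q), dec_degs,
          Nat.add_sub_add_right]
        simp only [add_right_comm]
      obtain _ | q := q
      · exact h1'
      · rw [shuffle_succ, map_add, map_smul]
        have h3 := map_simpSpan_right S.dec S'.dec (shuffle_mem_simpSpan S.dec S'.dec n (p + 1) q)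
          (S'.dec.simpOp_window n c (q + 1)) (Nat.lt_succ_self q) LinearMap.id
          (ρ := ρ ∘ₗ S'.d (q + 1) 0) (fun y hy => hρ _ (S'.d0Map_commS.map_degen (q + 1) hy))
          ((S.s (p + 1) 0 x : S.dec.C (p + 1)) ⊗ₜ[k] (y : S'.dec.C q))
        refine (congrArg₂ (fun a b => a + (-1 : k) ^ (p + 1) • b) h1' h3).trans ?_
        rw [smul_zero, add_zero]

/-- The restriction of the left factor of a shuffle to `i, …, i + p`, up to degenerate chains. -/
lemma map_window_shuffle_left (n p q i : ℕ) (h : p + q = n) (hi : i ≤ q) {W : Type v}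
    [AddCommGroup W] [Module k W] {ρ : S.C p →ₗ[k] W} (hρ : ∀ y ∈ S.degen p, ρ y = 0)
    (x : S.C p) (y : S'.C q) :
    TensorProduct.map (ρ ∘ₗ S.window n i p) LinearMap.id (shuffle S S' n p q (x ⊗ₜ y)) =
      (-1 : k) ^ (p * i) • (ρ x ⊗ₜ[k] S'.degs (fun j => i + j) p q n y) := by
  have h1 := shuffle_comm S' S n q p y x
  have h2 := map_window_shuffle S' S n q p i (by omega) hi hρ y x
  have h3 : shuffle S S' n p q (x ⊗ₜ y) = (-1 : k) ^ (q * p) •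
      TensorProduct.comm k _ _ (shuffle S' S n q p (y ⊗ₜ x)) := by
    rw [h1, smul_smul, ← mul_pow, neg_one_mul, neg_neg, one_pow, one_smul]
  have h4 : ∀ z, TensorProduct.map (ρ ∘ₗ S.window n i p) LinearMap.id
      (TensorProduct.comm k (S'.C n) (S.C n) z) = TensorProduct.comm k _ _
        (TensorProduct.map LinearMap.id (ρ ∘ₗ S.window n i p) z) := by
    intro z
    induction z using TensorProduct.induction_on with
    | zero => simp
    | add x y hx hy => simp only [map_add, hx, hy]
    | tmul x y => rfl
  rw [h3, map_smul, h4, h2, map_smul, smul_smul, TensorProduct.comm_tmul, ← pow_add]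
  congr 1
  obtain ⟨l, rfl⟩ := Nat.exists_eq_add_of_le hi
  rw [Nat.add_sub_cancel_left, show (i + l) * p + p * l = p * i + 2 * (p * l) by ring, pow_add,
    pow_mul (-1 : k) 2]
  simp

lemma back_succ' (p n q : ℕ) (x : S.C n) : S.back (p + 1) n q x = S.d q 0 (S.back p n (q + 1) x) := by
  induction p generalizing n with
  | zero =>
    obtain _ | n := n
    · simp [back, castF_ne S (show 0 ≠ q + 1 by omega)]
    · by_cases h : n = q
      · subst h; simp [back]
      · simp [back, castF_ne _ h, castF_ne S (show n + 1 ≠ q + 1 by omega)]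
  | succ p ih =>
    obtain _ | n := n
    · simp [back]
    · exact ih n _

lemma back_add (c l n m q : ℕ) (h : l + m = n) (x : S.C n) :
    S.back (c + l) n q x = S.back c m q (S.back l n m x) := by
  induction l generalizing n with
  | zero =>
    obtain rfl : m = n := by omega
    simp [back]
  | succ l ih =>
    obtain ⟨n, rfl⟩ : ∃ a, n = a + 1 := ⟨n - 1, by omega⟩
    exact ih n (by omega) _

lemma front_front (n m p : ℕ) (hp : p ≤ m) (hm : m ≤ n) (x : S.C n) :
    front S m p (front S n m x) = front S n p x := by
  induction n with
  | zero =>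
    obtain rfl : m = 0 := by omega
    rfl
  | succ n ih =>
    rcases hm.lt_or_eq with hm | rfl
    · rw [front_succ S n m (by omega), front_succ S n p (by omega), ih (by omega)]
    · rw [front_self]

lemma front_s_last (n i : ℕ) (hi : i ≤ n) (x : S.C n) :
    front S (n + 1) i (S.s n i x) = front S n i x := by
  rw [← front_front S (n + 1) (i + 1) i (by omega) (by omega), front_s S n i i le_rfl hi,
    front_succ S i i le_rfl, S.d_s_succ i i le_rfl, front_self]

lemma s_degs (r m n i : ℕ) (h : m + r = n) (hi : i ≤ m) (x : S.C m) :
    S.s n i (S.degs (fun j => i + j) r m n x) = S.degs (fun j => i + j) (r + 1) m (n + 1) x := by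
  induction r generalizing n with
  | zero => rfl
  | succ r ih =>
    obtain ⟨n, rfl⟩ : ∃ a, n = a + 1 := ⟨n - 1, by omega⟩
    rw [degs, LinearMap.comp_apply, S.s_s n i (i + r) (by omega) (by omega), ih n (by omega)]
    rfl

end SimplicialModule

namespace CyclicModule
variable {k : Type u} [Field k] (C C' : CyclicModule.{u, v} k)

open SimplicialModule

lemma d_t_pow (n i m : ℕ) (h : i + m ≤ n + 1) (x : C.C (n + 1)) :
    C.d n (i + m) ((C.t (n + 1) ^ m) x) = (C.t n ^ m) (C.d n i x) := by
  induction m with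
  | zero => rfl
  | succ m ih =>
    rw [pow_succ', Module.End.mul_apply, ← add_assoc, C.d_succ_t n (i + m) (by omega),
      ih (by omega), pow_succ', Module.End.mul_apply]

lemma d_zero_t_pow (n i m : ℕ) (h : i + m = n + 1) (x : C.C (n + 1)) :
    C.d n 0 ((C.t (n + 1) ^ (m + 1)) x) = (C.t n ^ m) (C.d n i x) := by
  rw [pow_succ', Module.End.mul_apply, C.d_zero_t]
  have h1 := C.d_t_pow n i m h.le x
  rw [h] at h1
  exact h1

lemma s_t_pow (n i m : ℕ) (h : i + m ≤ n) (x : C.C n) :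
    C.s n (i + m) ((C.t n ^ m) x) = (C.t (n + 1) ^ m) (C.s n i x) := by
  induction m with
  | zero => rfl
  | succ m ih =>
    rw [pow_succ', Module.End.mul_apply, ← add_assoc, C.s_succ_t n (i + m) (by omega),
      ih (by omega), pow_succ', Module.End.mul_apply]

lemma front_t_pow (r n j : ℕ) (h : j + r = n) (x : C.C n) :
    front C.toSimplicial n j ((C.t n ^ (j + 1)) x) = C.toSimplicial.back r n j x := by
  induction r generalizing n with
  | zero =>
    obtain rfl : j = n := by omega
    rw [C.t_pow, front_self]
    simp [back]
  | succ r ih =>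
    obtain ⟨n, rfl⟩ : ∃ a, n = a + 1 := ⟨n - 1, by omega⟩
    rw [front_succ _ n j (by omega), ← C.toSimplicial.back_d r n j (by omega),
      ← ih n (by omega), ← C.d_t_pow n r (j + 1) (by omega), show r + (j + 1) = n + 1 by omega]

lemma back_t_pow (l n m : ℕ) (h : l + m = n) (x : C.C n) :
    C.toSimplicial.back l n m ((C.t n ^ l) x) = front C.toSimplicial n m x := by
  induction l generalizing n m x with
  | zero =>
    obtain rfl : m = n := by omega
    rw [front_self]
    simp [back]
  | succ l ih =>
    obtain ⟨n, rfl⟩ : ∃ a, n = a + 1 := ⟨n - 1, by omega⟩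
    rw [back_succ', pow_succ, Module.End.mul_apply, ih (n + 1) (m + 1) (by omega)]
    have h1 : C.d m 0 (front C.toSimplicial (n + 1) (m + 1) (C.t (n + 1) x)) =
        front C.toSimplicial n m (C.d n 0 (C.t (n + 1) x)) :=
      map_front C.toSimplicial.d0Map_commD n m _
    rw [h1, C.d_zero_t, front_succ _ n m (by omega)]

/-- The front face of a rotated degeneracy, if it does not wrap around. -/
lemma front_t_pow_s (n i j p : ℕ) (h : i + j = n) (hp : p ≤ j) (x : C.C n) :
    front C.toSimplicial (n + 1) p ((C.t (n + 1) ^ (j + 1)) (C.s n i x)) =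
      C.toSimplicial.window n i p x := by
  rw [← front_front _ (n + 1) j p hp (by omega), C.front_t_pow (i + 1) (n + 1) j (by omega),
    ← C.toSimplicial.back_d i n j (by omega), C.d_s_self n i (by omega),
    front_back _ i n j p h]

/-- The back face of a rotated degeneracy, if it does not wrap around. -/
lemma back_t_pow_s (n j c q : ℕ) (h : c + q + j = n) (x : C.C n) :
    C.toSimplicial.back (c + (j + 1)) (n + 1) q ((C.t (n + 1) ^ (j + 1)) (C.s n (c + q) x)) =
      C.toSimplicial.window n c q x := by
  rw [C.toSimplicial.back_add c (j + 1) (n + 1) (c + q) q (by omega),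
    C.back_t_pow (j + 1) (n + 1) (c + q) (by omega), front_s_last _ n (c + q) (by omega)]
  rfl

lemma front_t_pow_degs (q n p c j : ℕ) (hn : p + 1 + q = n) (h : c + j = p) (x : C.C p) :
    front C.toSimplicial n (p + 1)
      ((C.t n ^ (j + 1)) (C.toSimplicial.degs (fun l => c + l) (q + 1) p n x)) =
      (C.t (p + 1) ^ (j + 1)) (C.s p c x) := by
  induction q generalizing n with
  | zero =>
    subst hn
    rw [add_zero, front_self]
    simp [degs]
  | succ q ih =>
    obtain ⟨n, rfl⟩ : ∃ a, n = a + 1 := ⟨n - 1, by omega⟩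
    have h1 := C.d_t_pow n (c + (q + 1)) (j + 1) (by omega)
      (C.toSimplicial.degs (fun l => c + l) (q + 1 + 1) p (n + 1) x)
    rw [show c + (q + 1) + (j + 1) = n + 1 by omega] at h1
    rw [front_succ _ n (p + 1) (by omega)]
    refine (congrArg _ h1).trans ?_
    rw [degs, LinearMap.comp_apply]
    refine (congrArg (fun z => front C.toSimplicial n (p + 1) ((C.t n ^ (j + 1)) z))
      (C.d_s_self n (c + (q + 1)) (by omega) _)).trans (ih n (by omega))

lemma back_t_pow_degs (p n q i l : ℕ) (hn : p + q + 1 = n) (h : i + l = q) (y : C.C q) :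
    C.toSimplicial.back p n (q + 1)
      ((C.t n ^ (p + l + 1)) (C.toSimplicial.degs (fun j => i + j) (p + 1) q n y)) =
      (C.t (q + 1) ^ (l + 1)) (C.s q i y) := by
  induction p generalizing n with
  | zero =>
    obtain rfl : n = q + 1 := by omega
    simp [degs, back]
  | succ p ih =>
    obtain ⟨n, rfl⟩ : ∃ a, n = a + 1 := ⟨n - 1, by omega⟩
    have h1 := C.d_zero_t_pow n (i + 1) (p + l + 1) (by omega)
      (C.toSimplicial.degs (fun j => i + j) (p + 1 + 1) q (n + 1) y)
    rw [show p + 1 + l + 1 = p + l + 1 + 1 by omega]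
    refine (congrArg (C.toSimplicial.back p n (q + 1)) h1).trans ?_
    rw [← s_degs _ (p + 1) q n i (by omega) (by omega)]
    refine (congrArg (fun z => C.toSimplicial.back p n (q + 1) ((C.t n ^ (p + l + 1)) z))
      (C.d_s_succ n i (by omega) _)).trans (ih n (by omega))

/-- Connes' operator up to degenerate chains. -/
lemma B_sub_mem_degen (n : ℕ) (x : C.C n) :
    C.B n x - ∑ j ∈ Finset.range (n + 1), (-1 : k) ^ (n * j) •
      (C.t (n + 1) ^ (j + 1)) (C.s n (n - j) x) ∈ C.degen (n + 1) := by
  have h1 : C.extra n (C.norm n x) = ∑ j ∈ Finset.range (n + 1), (-1 : k) ^ (n * j) •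
      (C.t (n + 1) ^ (j + 1)) (C.s n (n - j) x) := by
    rw [norm_apply, map_sum]
    refine Finset.sum_congr rfl fun j hj => ?_
    rw [Finset.mem_range] at hj
    have h2 := C.s_t_pow n (n - j) j (by omega) x
    rw [Nat.sub_add_cancel (by omega)] at h2
    rw [τ, smul_pow, LinearMap.smul_apply, map_smul, extra_apply, h2, pow_succ',
      Module.End.mul_apply, ← pow_mul]
  rw [B_apply, h1, sub_sub_cancel_left, ← h1, τ_apply, t_extra]
  exact Submodule.neg_mem _ (Submodule.smul_mem _ _ (C.s_mem_degen (Nat.zero_le n) _))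

end CyclicModule
end HopfCyc

namespace HopfCyc
namespace CyclicModule
variable {k : Type u} [Field k] (C C' : CyclicModule.{u, v} k)

open SimplicialModule

/-- The cyclic operators: the composites of faces, degeneracies and cyclic permutations, and
zero. -/
inductive CycOp : ∀ {a b : ℕ}, (C.C a →ₗ[k] C.C b) → Prop
  | zero (a b : ℕ) : CycOp (0 : C.C a →ₗ[k] C.C b)
  | id (a : ℕ) : CycOp (LinearMap.id : C.C a →ₗ[k] C.C a)
  | d {a b : ℕ} {f : C.C a →ₗ[k] C.C (b + 1)} (i : ℕ) (hi : i ≤ b + 1) (h : CycOp f) :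
      CycOp (C.d b i ∘ₗ f)
  | s {a b : ℕ} {f : C.C a →ₗ[k] C.C b} (i : ℕ) (hi : i ≤ b) (h : CycOp f) :
      CycOp (C.s b i ∘ₗ f)
  | t {a b : ℕ} {f : C.C a →ₗ[k] C.C b} (h : CycOp f) : CycOp (C.t b ∘ₗ f)

/-- The chains that are at least `j`-fold degenerate, the extra degeneracy being included. -/
def filt : ∀ (_ m : ℕ), Submodule k (C.C m)
  | 0, _ => ⊤
  | _ + 1, 0 => ⊥
  | j + 1, m + 1 => (⨆ i : Fin (m + 1), (filt j m).map (C.s m i)) ⊔ (filt j m).map (C.extra m)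

variable {C C'}

lemma s_mem_filt {j m i : ℕ} (hi : i ≤ m) {x : C.C m} (hx : x ∈ C.filt j m) :
    C.s m i x ∈ C.filt (j + 1) (m + 1) :=
  Submodule.mem_sup_left (Submodule.mem_iSup_of_mem (⟨i, by omega⟩ : Fin (m + 1)) ⟨x, hx, rfl⟩)

lemma extra_mem_filt {j m : ℕ} {x : C.C m} (hx : x ∈ C.filt j m) :
    C.extra m x ∈ C.filt (j + 1) (m + 1) :=
  Submodule.mem_sup_right ⟨x, hx, rfl⟩

lemma filt_succ_le {j m : ℕ} {P : Submodule k (C.C (m + 1))}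
    (h : ∀ i ≤ m, ∀ x ∈ C.filt j m, C.s m i x ∈ P) (h' : ∀ x ∈ C.filt j m, C.extra m x ∈ P) :
    C.filt (j + 1) (m + 1) ≤ P := by
  refine sup_le (iSup_le fun i => ?_) ?_
  · rintro _ ⟨x, hx, rfl⟩
    exact h i (by omega) x hx
  · rintro _ ⟨x, hx, rfl⟩
    exact h' x hx

lemma filt_antitone_succ (j m : ℕ) : C.filt (j + 1) m ≤ C.filt j m := by
  induction j generalizing m with
  | zero => exact le_top
  | succ j ih =>
    obtain _ | m := m
    · exact bot_le
    · exact filt_succ_le (fun i hi x hx => s_mem_filt hi (ih m hx))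
        fun x hx => extra_mem_filt (ih m hx)

lemma t_mem_filt (j m : ℕ) {x : C.C m} (hx : x ∈ C.filt j m) : C.t m x ∈ C.filt j m := by
  revert x
  change C.filt j m ≤ (C.filt j m).comap (C.t m)
  induction j generalizing m with
  | zero => exact fun _ _ => Submodule.mem_top
  | succ j ih =>
    obtain _ | m := m
    · exact bot_le
    · refine filt_succ_le (fun i hi x hx => ?_) fun x hx => ?_
      · rw [Submodule.mem_comap]
        rcases hi.lt_or_eq with hi | rfl
        · rw [← C.s_succ_t m i hi]
          exact s_mem_filt hi (ih m hx)
        · exact extra_mem_filt hx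
      · rw [Submodule.mem_comap, t_extra]
        exact s_mem_filt (Nat.zero_le m) (ih m hx)

lemma d_mem_filt (j m i : ℕ) (hi : i ≤ m + 1) {x : C.C (m + 1)} (hx : x ∈ C.filt (j + 1) (m + 1)) :
    C.d m i x ∈ C.filt j m := by
  revert x
  change C.filt (j + 1) (m + 1) ≤ (C.filt j m).comap (C.d m i)
  induction j generalizing m i with
  | zero => exact fun _ _ => Submodule.mem_top
  | succ j ih =>
    refine filt_succ_le (fun l hl x hx => ?_) fun x hx => ?_
    · rw [Submodule.mem_comap]
      rcases lt_trichotomy i l with h | rfl | h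
      · obtain ⟨m, rfl⟩ : ∃ a, m = a + 1 := ⟨m - 1, by omega⟩
        rw [C.d_s_lt m i l h hl]
        exact s_mem_filt (by omega) (ih m i (by omega) hx)
      · rwa [C.d_s_self m i hl]
      · rcases (show i = l + 1 ∨ l + 1 < i by omega) with rfl | h'
        · rwa [C.d_s_succ m l hl]
        · obtain ⟨m, rfl⟩ : ∃ a, m = a + 1 := ⟨m - 1, by omega⟩
          rw [C.d_s_gt m i l h' hi]
          exact s_mem_filt (by omega) (ih m (i - 1) (by omega) hx)
    · rw [Submodule.mem_comap, extra_apply]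
      obtain _ | i := i
      · rwa [C.d_zero_t, C.d_s_succ m m le_rfl]
      · rw [C.d_succ_t m i (by omega)]
        rcases (show i < m ∨ i = m by omega) with h | rfl
        · obtain ⟨m, rfl⟩ : ∃ a, m = a + 1 := ⟨m - 1, by omega⟩
          rw [C.d_s_lt m i (m + 1) h le_rfl]
          exact extra_mem_filt (ih m i (by omega) hx)
        · rw [C.d_s_self i i le_rfl]
          exact t_mem_filt _ _ hx

lemma filt_one_le (m : ℕ) : C.filt 1 (m + 1) ≤ C.degen' m :=
  filt_succ_le (fun _ hi x _ => Submodule.mem_sup_left (C.s_mem_degen hi x))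
    fun x _ => Submodule.mem_sup_right ⟨x, rfl⟩

lemma filt_le_degen (j m : ℕ) : C.filt (j + 2) m ≤ C.degen m := by
  induction j with
  | zero =>
    obtain _ | m := m
    · exact bot_le
    · refine filt_succ_le (fun i hi x _ => C.s_mem_degen hi x) fun x hx => ?_
      obtain _ | m := m
      · obtain rfl : x = 0 := hx
        rw [map_zero]
        exact Submodule.zero_mem _
      · exact C.extra_degen' m (filt_one_le m hx)
  | succ j ih => exact (filt_antitone_succ _ _).trans ih

lemma CycOp.mem_filt {a b : ℕ} {f : C.C a →ₗ[k] C.C b} (h : CycOp C f) (x : C.C a) :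
    f x ∈ C.filt (b - a) b := by
  induction h with
  | zero b => exact Submodule.zero_mem _
  | id => rw [Nat.sub_self]; exact Submodule.mem_top
  | @d b f i hi _ ih =>
    by_cases h : a ≤ b
    · have := ih
      rw [show b + 1 - a = (b - a) + 1 by omega] at this
      exact d_mem_filt _ _ i hi this
    · rw [show b - a = 0 by omega]; exact Submodule.mem_top
  | @s b f i hi _ ih =>
    have h1 := s_mem_filt hi ih
    by_cases h : a ≤ b
    · rwa [show b + 1 - a = (b - a) + 1 by omega]
    · rw [show b + 1 - a = 0 by omega]; exact Submodule.mem_top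
  | t _ ih => exact t_mem_filt _ _ ih

/-- A cyclic operator that raises the degree by at least two has degenerate values. -/
lemma CycOp.mem_degen {a b : ℕ} {f : C.C a →ₗ[k] C.C b} (h : CycOp C f) (hab : a + 2 ≤ b)
    (x : C.C a) : f x ∈ C.degen b := by
  obtain ⟨c, rfl⟩ : ∃ c, b = a + (c + 2) := ⟨b - a - 2, by omega⟩
  have := h.mem_filt x
  rw [Nat.add_sub_cancel_left] at this
  exact filt_le_degen _ _ this

lemma CycOp.comp {a b c : ℕ} {g : C.C b →ₗ[k] C.C c} (hg : CycOp C g) {f : C.C a →ₗ[k] C.C b}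
    (hf : CycOp C f) : CycOp C (g ∘ₗ f) := by
  induction hg with
  | zero b => rw [LinearMap.zero_comp]; exact .zero _ _
  | id => exact hf
  | d i hi _ ih => rw [LinearMap.comp_assoc]; exact .d i hi ih
  | s i hi _ ih => rw [LinearMap.comp_assoc]; exact .s i hi ih
  | t _ ih => rw [LinearMap.comp_assoc]; exact .t ih

lemma _root_.HopfCyc.SimplicialModule.SimpOp.cycOp {a b : ℕ}
    {f : C.toSimplicial.C a →ₗ[k] C.toSimplicial.C b} (h : SimpOp C.toSimplicial f) :
    CycOp C f := by
  induction h with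
  | zero b => exact .zero _ _
  | id => exact .id _
  | d i hi _ ih => exact .d i hi ih
  | s i hi _ ih => exact .s i hi ih

variable (C C') in
/-- The span of the tensor products of cyclic operators. -/
def cycSpan (a a' b b' : ℕ) : Submodule k (C.C a ⊗[k] C'.C a' →ₗ[k] C.C b ⊗[k] C'.C b') :=
  Submodule.span k {h | ∃ f g, CycOp C f ∧ CycOp C' g ∧ h = TensorProduct.map f g}

lemma map_mem_cycSpan {a a' b b' : ℕ} {f : C.C a →ₗ[k] C.C b} {g : C'.C a' →ₗ[k] C'.C b'}
    (hf : CycOp C f) (hg : CycOp C' g) : TensorProduct.map f g ∈ cycSpan C C' a a' b b' :=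
  Submodule.subset_span ⟨f, g, hf, hg, rfl⟩

lemma id_mem_cycSpan (a a' : ℕ) : LinearMap.id ∈ cycSpan C C' a a' a a' := by
  have := map_mem_cycSpan (CycOp.id (C := C) a) (CycOp.id (C := C') a')
  rwa [TensorProduct.map_id] at this

lemma comp_mem_cycSpan {a a' b b' c c' : ℕ} {h : C.C b ⊗[k] C'.C b' →ₗ[k] C.C c ⊗[k] C'.C c'}
    (hh : h ∈ cycSpan C C' b b' c c') {l : C.C a ⊗[k] C'.C a' →ₗ[k] C.C b ⊗[k] C'.C b'}
    (hl : l ∈ cycSpan C C' a a' b b') : h ∘ₗ l ∈ cycSpan C C' a a' c c' := by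
  induction hh using Submodule.span_induction with
  | zero => rw [LinearMap.zero_comp]; exact Submodule.zero_mem _
  | add x y _ _ hx hy => rw [LinearMap.add_comp]; exact Submodule.add_mem _ hx hy
  | smul r x _ hx => rw [LinearMap.smul_comp]; exact Submodule.smul_mem _ _ hx
  | mem h hh =>
    obtain ⟨f, g, hf, hg, rfl⟩ := hh
    induction hl using Submodule.span_induction with
    | zero => rw [LinearMap.comp_zero]; exact Submodule.zero_mem _
    | add x y _ _ hx hy => rw [LinearMap.comp_add]; exact Submodule.add_mem _ hx hy
    | smul r x _ hx => rw [LinearMap.comp_smul]; exact Submodule.smul_mem _ _ hx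
    | mem l hl =>
      obtain ⟨f', g', hf', hg', rfl⟩ := hl
      rw [← TensorProduct.map_comp]
      exact map_mem_cycSpan (hf.comp hf') (hg.comp hg')

lemma simpSpan_le_cycSpan (a a' b b' : ℕ) :
    simpSpan C.toSimplicial C'.toSimplicial a a' b b' ≤ cycSpan C C' a a' b b' := by
  refine Submodule.span_le.2 ?_
  rintro _ ⟨f, g, hf, hg, rfl⟩
  exact map_mem_cycSpan hf.cycOp hg.cycOp

lemma B_diag_mem_cycSpan (n : ℕ) : (C.diag C').B n ∈ cycSpan C C' n n (n + 1) (n + 1) := by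
  have ht : ∀ m, (C.diag C').τ m ∈ cycSpan C C' m m m m := fun m =>
    Submodule.smul_mem _ _ (map_mem_cycSpan (.t (.id m)) (.t (.id m)))
  have hp : ∀ m j, (C.diag C').τ m ^ j ∈ cycSpan C C' m m m m := fun m j => by
    induction j with
    | zero => exact id_mem_cycSpan m m
    | succ j ih => rw [pow_succ']; exact comp_mem_cycSpan (ht m) ih
  refine comp_mem_cycSpan (Submodule.sub_mem _ (id_mem_cycSpan _ _) (ht _))
    (comp_mem_cycSpan (comp_mem_cycSpan (map_mem_cycSpan (.t (.id _)) (.t (.id _)))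
      (map_mem_cycSpan (.s n le_rfl (.id _)) (.s n le_rfl (.id _)))) ?_)
  exact Submodule.sum_mem _ fun j _ => hp n j

/-- A combination of cyclic operators that raises one of the degrees by at least two has values in
the degenerate chains. -/
lemma map_toNormalized_cycSpan {a a' b b' : ℕ} {h : C.C a ⊗[k] C'.C a' →ₗ[k] C.C b ⊗[k] C'.C b'}
    (hh : h ∈ cycSpan C C' a a' b b') (hab : a + 2 ≤ b ∨ a' + 2 ≤ b') (w : C.C a ⊗[k] C'.C a') :
    TensorProduct.map (C.toNormalized b) (C'.toNormalized b') (h w) = 0 := by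
  have h0 : ∀ (C : CyclicModule.{u, v} k) {a b : ℕ} {f : C.C a →ₗ[k] C.C b}, CycOp C f →
      a + 2 ≤ b → C.toNormalized b ∘ₗ f = 0 := fun C a b f hf hab =>
    LinearMap.ext fun x => (Submodule.Quotient.mk_eq_zero _).2 (hf.mem_degen hab x)
  induction hh using Submodule.span_induction with
  | zero => simp
  | add x y _ _ hx hy => rw [LinearMap.add_apply, map_add, hx, hy, add_zero]
  | smul c x _ hx => rw [LinearMap.smul_apply, map_smul, hx, smul_zero]
  | mem h hh =>
    obtain ⟨f, g, hf, hg, rfl⟩ := hh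
    rw [map_map_apply]
    rcases hab with hab | hab
    · rw [h0 C hf hab, TensorProduct.map_zero_left, LinearMap.zero_apply]
    · rw [h0 C' hg hab, TensorProduct.map_zero_right, LinearMap.zero_apply]

variable (C C')

/-- A component of the Alexander-Whitney map, read in the normalized chains. -/
def awN (n p q : ℕ) : C.C n ⊗[k] C'.C n →ₗ[k] C.normalized.X p ⊗[k] C'.normalized.X q :=
  TensorProduct.map (C.toNormalized p) (C'.toNormalized q) ∘ₗ
    aw C.toSimplicial C'.toSimplicial n p q

lemma map_toNormalized_degenTensor (p q : ℕ) {z : C.C p ⊗[k] C'.C q}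
    (hz : z ∈ degenTensor C.toSimplicial C'.toSimplicial p q) :
    TensorProduct.map (C.toNormalized p) (C'.toNormalized q) z = 0 := by
  refine degenTensor_le C.toSimplicial C'.toSimplicial (P := LinearMap.ker
    (TensorProduct.map (C.toNormalized p) (C'.toNormalized q))) ?_ ?_ hz
  · intro x hx y
    have : C.toNormalized p x = 0 := (Submodule.Quotient.mk_eq_zero _).2 hx
    rw [LinearMap.mem_ker, TensorProduct.map_tmul, this, TensorProduct.zero_tmul]
  · intro x y hy
    have : C'.toNormalized q y = 0 := (Submodule.Quotient.mk_eq_zero _).2 hy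
    rw [LinearMap.mem_ker, TensorProduct.map_tmul, this, TensorProduct.tmul_zero]

lemma awN_degen (n p q : ℕ) (h : p + q = n) {z : C.C n ⊗[k] C'.C n}
    (hz : z ∈ (C.diag C').degen n) : awN C C' n p q z = 0 :=
  map_toNormalized_degenTensor C C' p q
    (aw_mem_degenTensor C.toSimplicial C'.toSimplicial n p q h hz)

lemma awN_t_pow_s (n p q i j : ℕ) (z : C.C n ⊗[k] C'.C n) :
    awN C C' (n + 1) p q (((C.diag C').t (n + 1) ^ (j + 1)) ((C.diag C').s n i z)) =
      TensorProduct.map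
        (C.toNormalized p ∘ₗ front C.toSimplicial (n + 1) p ∘ₗ (C.t (n + 1) ^ (j + 1)) ∘ₗ C.s n i)
        (C'.toNormalized q ∘ₗ C'.toSimplicial.back p (n + 1) q ∘ₗ (C'.t (n + 1) ^ (j + 1)) ∘ₗ
          C'.s n i) z := by
  have h : (C.diag C').t (n + 1) ^ (j + 1) =
      TensorProduct.map (C.t (n + 1) ^ (j + 1)) (C'.t (n + 1) ^ (j + 1)) :=
    TensorProduct.map_pow _ _ _
  rw [h]
  simp only [awN, aw, LinearMap.comp_apply, TensorProduct.map_comp]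

lemma awN_B (n p q : ℕ) (h : p + q = n + 1) (z : C.C n ⊗[k] C'.C n) :
    awN C C' (n + 1) p q ((C.diag C').B n z) = ∑ j ∈ Finset.range (n + 1), (-1 : k) ^ (n * j) •
      TensorProduct.map
        (C.toNormalized p ∘ₗ front C.toSimplicial (n + 1) p ∘ₗ (C.t (n + 1) ^ (j + 1)) ∘ₗ
          C.s n (n - j))
        (C'.toNormalized q ∘ₗ C'.toSimplicial.back p (n + 1) q ∘ₗ (C'.t (n + 1) ^ (j + 1)) ∘ₗ
          C'.s n (n - j)) z := by
  have h1 := awN_degen C C' (n + 1) p q h ((C.diag C').B_sub_mem_degen n z)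
  rw [map_sub, sub_eq_zero, map_sum] at h1
  rw [h1]
  refine Finset.sum_congr rfl fun j _ => ?_
  rw [map_smul, awN_t_pow_s]

lemma toNormalized_B (n : ℕ) (x : C.C n) : C.toNormalized (n + 1) (C.B n x) =
    ∑ j ∈ Finset.range (n + 1), (-1 : k) ^ (n * j) •
      C.toNormalized (n + 1) ((C.t (n + 1) ^ (j + 1)) (C.s n (n - j) x)) := by
  have := (Submodule.Quotient.mk_eq_zero _).2 (C.B_sub_mem_degen n x)
  change C.toNormalized (n + 1) _ = 0 at this
  rw [map_sub, sub_eq_zero, map_sum] at this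
  rw [this]
  simp only [map_smul]

lemma toNormalized_eq_zero (n : ℕ) (x : C.C n) (hx : x ∈ C.degen n) : C.toNormalized n x = 0 :=
  (Submodule.Quotient.mk_eq_zero _).2 hx

lemma awN_B_shuffle_left (n p q : ℕ) (h : p + q = n) (x : C.C p) (y : C'.C q) :
    awN C C' (n + 1) (p + 1) q ((C.diag C').B n
      (shuffle C.toSimplicial C'.toSimplicial n p q (x ⊗ₜ y))) =
      C.toNormalized (p + 1) (C.B p x) ⊗ₜ C'.toNormalized q y := by
  rw [awN_B C C' n (p + 1) q (by omega), show Finset.range (n + 1) = Finset.range (p + 1 + q) from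
    congrArg _ (by omega),
    Finset.sum_range_add, toNormalized_B, TensorProduct.sum_tmul]
  have h2 : ∑ l ∈ Finset.range q, (-1 : k) ^ (n * (p + 1 + l)) •
      TensorProduct.map
        (C.toNormalized (p + 1) ∘ₗ front C.toSimplicial (n + 1) (p + 1) ∘ₗ
          (C.t (n + 1) ^ (p + 1 + l + 1)) ∘ₗ C.s n (n - (p + 1 + l)))
        (C'.toNormalized q ∘ₗ C'.toSimplicial.back (p + 1) (n + 1) q ∘ₗ
          (C'.t (n + 1) ^ (p + 1 + l + 1)) ∘ₗ C'.s n (n - (p + 1 + l)))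
        (shuffle C.toSimplicial C'.toSimplicial n p q (x ⊗ₜ y)) = 0 := by
    refine Finset.sum_eq_zero fun l hl => ?_
    rw [Finset.mem_range] at hl
    have e : front C.toSimplicial (n + 1) (p + 1) ∘ₗ (C.t (n + 1) ^ (p + 1 + l + 1)) ∘ₗ
        C.s n (n - (p + 1 + l)) = C.toSimplicial.window n (n - (p + 1 + l)) (p + 1) :=
      LinearMap.ext fun z => C.front_t_pow_s n _ _ _ (by omega) (by omega) z
    rw [e]
    refine (congrArg _ ?_).trans (smul_zero _)
    exact map_simpSpan_left _ _ (shuffle_mem_simpSpan C.toSimplicial C'.toSimplicial n p q)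
      (C.toSimplicial.simpOp_window _ _ _) (Nat.lt_succ_self p) _ (C.toNormalized_eq_zero _) _
  rw [h2, add_zero]
  refine Finset.sum_congr rfl fun j hj => ?_
  rw [Finset.mem_range] at hj
  have e : C'.toSimplicial.back (p + 1) (n + 1) q ∘ₗ (C'.t (n + 1) ^ (j + 1)) ∘ₗ
      C'.s n (n - j) = C'.toSimplicial.window n (p - j) q := LinearMap.ext fun z => by
    have := C'.back_t_pow_s n j (p - j) q (by omega) z
    rwa [show p - j + (j + 1) = p + 1 by omega, show p - j + q = n - j by omega] at this
  have e2 : ∀ z : C.C n ⊗[k] C'.C n, TensorProduct.map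
        (C.toNormalized (p + 1) ∘ₗ front C.toSimplicial (n + 1) (p + 1) ∘ₗ
          (C.t (n + 1) ^ (j + 1)) ∘ₗ C.s n (n - j))
        (C'.toNormalized q ∘ₗ C'.toSimplicial.window n (p - j) q) z =
      TensorProduct.map (C.toNormalized (p + 1) ∘ₗ front C.toSimplicial (n + 1) (p + 1) ∘ₗ
          (C.t (n + 1) ^ (j + 1)) ∘ₗ C.s n (n - j)) LinearMap.id
        (TensorProduct.map LinearMap.id
          (C'.toNormalized q ∘ₗ C'.toSimplicial.window n (p - j) q) z) := fun z => by
    rw [map_map_apply]; rfl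
  rw [e, e2]
  refine (congrArg _ (congrArg _ (map_window_shuffle C.toSimplicial C'.toSimplicial n p q (p - j) h
    (by omega) (C'.toNormalized_eq_zero q) x y))).trans ?_
  have e3 : front C.toSimplicial (n + 1) (p + 1) ((C.t (n + 1) ^ (j + 1))
      (C.s n (n - j) (C.toSimplicial.degs (fun l => p - j + l) q p n x))) =
      (C.t (p + 1) ^ (j + 1)) (C.s p (p - j) x) := by
    rw [show n - j = p - j + q by omega]
    exact C.front_t_pow_degs q (n + 1) p (p - j) j (by omega) (by omega) x
  rw [map_smul, smul_smul, TensorProduct.map_tmul, LinearMap.comp_apply, LinearMap.comp_apply,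
    LinearMap.comp_apply, e3, TensorProduct.smul_tmul', LinearMap.id_apply]
  congr 2
  rw [← pow_add, show p - (p - j) = j by omega, ← h,
    show (p + q) * j + q * j = p * j + 2 * (q * j) by ring, pow_add, pow_mul (-1 : k) 2]
  simp

lemma awN_B_shuffle_right (n p q : ℕ) (h : p + q = n) (x : C.C p) (y : C'.C q) :
    awN C C' (n + 1) p (q + 1) ((C.diag C').B n
      (shuffle C.toSimplicial C'.toSimplicial n p q (x ⊗ₜ y))) =
      (-1 : k) ^ p • (C.toNormalized p x ⊗ₜ C'.toNormalized (q + 1) (C'.B q y)) := by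
  rw [awN_B C C' n p (q + 1) (by omega), show Finset.range (n + 1) = Finset.range (p + (q + 1)) from
    congrArg _ (by omega),
    Finset.sum_range_add, toNormalized_B, TensorProduct.tmul_sum, Finset.smul_sum]
  have h2 : ∑ j ∈ Finset.range p, (-1 : k) ^ (n * j) •
      TensorProduct.map
        (C.toNormalized p ∘ₗ front C.toSimplicial (n + 1) p ∘ₗ
          (C.t (n + 1) ^ (j + 1)) ∘ₗ C.s n (n - j))
        (C'.toNormalized (q + 1) ∘ₗ C'.toSimplicial.back p (n + 1) (q + 1) ∘ₗ
          (C'.t (n + 1) ^ (j + 1)) ∘ₗ C'.s n (n - j))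
        (shuffle C.toSimplicial C'.toSimplicial n p q (x ⊗ₜ y)) = 0 := by
    refine Finset.sum_eq_zero fun j hj => ?_
    rw [Finset.mem_range] at hj
    have e : C'.toSimplicial.back p (n + 1) (q + 1) ∘ₗ (C'.t (n + 1) ^ (j + 1)) ∘ₗ
        C'.s n (n - j) = C'.toSimplicial.window n (p - (j + 1)) (q + 1) :=
      LinearMap.ext fun z => by
        have := C'.back_t_pow_s n j (p - (j + 1)) (q + 1) (by omega) z
        rwa [show p - (j + 1) + (j + 1) = p by omega,
          show p - (j + 1) + (q + 1) = n - j by omega] at this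
    rw [e]
    refine (congrArg _ ?_).trans (smul_zero _)
    exact map_simpSpan_right _ _ (shuffle_mem_simpSpan C.toSimplicial C'.toSimplicial n p q)
      (C'.toSimplicial.simpOp_window _ _ _) (Nat.lt_succ_self q) _ (C'.toNormalized_eq_zero _) _
  rw [h2, zero_add]
  refine Finset.sum_congr rfl fun l hl => ?_
  rw [Finset.mem_range] at hl
  have e : front C.toSimplicial (n + 1) p ∘ₗ (C.t (n + 1) ^ (p + l + 1)) ∘ₗ
      C.s n (n - (p + l)) = C.toSimplicial.window n (n - (p + l)) p := LinearMap.ext fun z =>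
    C.front_t_pow_s n _ _ _ (by omega) (by omega) z
  have e2 : ∀ z : C.C n ⊗[k] C'.C n, TensorProduct.map
        (C.toNormalized p ∘ₗ C.toSimplicial.window n (n - (p + l)) p)
        (C'.toNormalized (q + 1) ∘ₗ C'.toSimplicial.back p (n + 1) (q + 1) ∘ₗ
          (C'.t (n + 1) ^ (p + l + 1)) ∘ₗ C'.s n (n - (p + l))) z =
      TensorProduct.map LinearMap.id (C'.toNormalized (q + 1) ∘ₗ
          C'.toSimplicial.back p (n + 1) (q + 1) ∘ₗ
          (C'.t (n + 1) ^ (p + l + 1)) ∘ₗ C'.s n (n - (p + l)))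
        (TensorProduct.map (C.toNormalized p ∘ₗ C.toSimplicial.window n (n - (p + l)) p)
          LinearMap.id z) := fun z => by
    rw [map_map_apply]; rfl
  rw [e, e2]
  refine (congrArg _ (congrArg _ (map_window_shuffle_left C.toSimplicial C'.toSimplicial n p q
    (n - (p + l)) h (by omega) (C.toNormalized_eq_zero p) x y))).trans ?_
  have e3 : C'.toSimplicial.back p (n + 1) (q + 1) ((C'.t (n + 1) ^ (p + l + 1))
      (C'.s n (n - (p + l)) (C'.toSimplicial.degs (fun j => n - (p + l) + j) p q n y))) =
      (C'.t (q + 1) ^ (l + 1)) (C'.s q (q - l) y) := by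
    rw [show n - (p + l) = q - l by omega]
    exact (congrArg (fun z => C'.toSimplicial.back p (n + 1) (q + 1)
      ((C'.t (n + 1) ^ (p + l + 1)) z))
      (s_degs C'.toSimplicial p q n (q - l) (by omega) (by omega) y)).trans
      (C'.back_t_pow_degs p (n + 1) q (q - l) l (by omega) (by omega) y)
  rw [map_smul, smul_smul, TensorProduct.map_tmul, LinearMap.comp_apply, LinearMap.comp_apply,
    LinearMap.comp_apply, e3, LinearMap.id_apply, TensorProduct.tmul_smul, smul_smul]
  congr 1
  rw [← pow_add, ← pow_add]
  obtain ⟨m, rfl⟩ : ∃ m, q = l + m := ⟨q - l, by omega⟩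
  rw [← h, show p + (l + m) - (p + l) = m by omega,
    show (p + (l + m)) * (p + l) + p * m = p * p + (l + m) * l + 2 * (p * l + p * m) by ring,
    pow_add, pow_mul (-1 : k) 2, neg_one_sq, one_pow, mul_one, pow_add, pow_add,
    show (-1 : k) ^ (p * p) = (-1) ^ p from ?_]
  rcases Nat.even_or_odd p with hp | hp
  · rw [(hp.mul_right p).neg_one_pow, hp.neg_one_pow]
  · rw [(hp.mul hp).neg_one_pow, hp.neg_one_pow]

lemma awN_B_shuffle_ne (n p q p' q' : ℕ) (h : p + q = n) (h' : p' + q' = n + 1) (h1 : p' ≠ p)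
    (h2 : p' ≠ p + 1) (z : C.C p ⊗[k] C'.C q) :
    awN C C' (n + 1) p' q' ((C.diag C').B n
      (shuffle C.toSimplicial C'.toSimplicial n p q z)) = 0 := by
  refine map_toNormalized_cycSpan (comp_mem_cycSpan
    (simpSpan_le_cycSpan _ _ _ _ (aw_mem_simpSpan C.toSimplicial C'.toSimplicial (n + 1) p' q'))
    (comp_mem_cycSpan (B_diag_mem_cycSpan n) (simpSpan_le_cycSpan _ _ _ _
      (shuffle_mem_simpSpan C.toSimplicial C'.toSimplicial n p q)))) ?_ z
  omega

end CyclicModule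
end HopfCyc

namespace HopfCyc

lemma GrComplex.sign_nat (k : Type u) [Field k] (p : ℕ) : GrComplex.sign k p = (-1 : k) ^ p := by
  simp [GrComplex.sign, GradingIndex.sgn]

namespace CyclicModule
variable {k : Type u} [Field k] (C C' : CyclicModule.{u, v} k)

open SimplicialModule

/-- The Alexander-Whitney map with explicit source and target. -/
def awTensor (n : ℕ) :
    C.C n ⊗[k] C'.C n →ₗ[k] GrComplex.TensorX C.normalized.hochschild C'.normalized.hochschild n :=
  LinearMap.pi fun e => awN C C' n e.1.1 e.1.2

lemma AW_eq_awTensor (n : ℕ) (z : C.C n ⊗[k] C'.C n) : C.AW C' n z = C.awTensor C' n z :=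
  funext fun e => C.AW_apply C' n z e

lemma awTensor_degen (n : ℕ) {z : C.C n ⊗[k] C'.C n} (hz : z ∈ (C.diag C').degen n) :
    C.awTensor C' n z = 0 :=
  funext fun e => awN_degen C C' n e.1.1 e.1.2 e.2 hz

lemma awTensor_b (n : ℕ) (z : C.C (n + 1) ⊗[k] C'.C (n + 1)) :
    C.awTensor C' n ((C.diag C').b n z) =
      (C.normalized.tensor C'.normalized).b n (C.awTensor C' (n + 1) z) := by
  refine funext fun ⟨⟨p, q⟩, h⟩ => ?_
  have h1 := aw_b C.toSimplicial C'.toSimplicial n p q h z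
  have hL : ∀ w : C.C (p + 1) ⊗[k] C'.C q,
      TensorProduct.map (C.toNormalized p) (C'.toNormalized q) ((C.b p).rTensor _ w) =
      (C.normalized.b p).rTensor _
        (TensorProduct.map (C.toNormalized (p + 1)) (C'.toNormalized q) w) := fun w => by
    rw [LinearMap.rTensor, LinearMap.rTensor, map_map_apply, map_map_apply]; rfl
  have hR : ∀ w : C.C p ⊗[k] C'.C (q + 1),
      TensorProduct.map (C.toNormalized p) (C'.toNormalized q) ((C'.b q).lTensor _ w) =
      (C'.normalized.b q).lTensor _
        (TensorProduct.map (C.toNormalized p) (C'.toNormalized (q + 1)) w) := fun w => by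
    rw [LinearMap.lTensor, LinearMap.lTensor, map_map_apply, map_map_apply]; rfl
  refine (congrArg (TensorProduct.map (C.toNormalized p) (C'.toNormalized q)) h1).trans ?_
  rw [map_add, map_smul, ← GrComplex.sign_nat]
  exact congrArg₂ (fun a b => a + GrComplex.sign k p • b) (hL _) (hR _)

lemma awN_B_shuffle_rTensor (n p q : ℕ) (h : p + q = n) (w : C.C p ⊗[k] C'.C q) :
    awN C C' (n + 1) (p + 1) q ((C.diag C').B n
      (shuffle C.toSimplicial C'.toSimplicial n p q w)) =
      (C.normalized.B p).rTensor _
        (TensorProduct.map (C.toNormalized p) (C'.toNormalized q) w) := by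
  induction w using TensorProduct.induction_on with
  | zero => simp only [map_zero]
  | add x y hx hy => simp only [map_add, hx, hy]
  | tmul x y => exact awN_B_shuffle_left C C' n p q h x y

lemma awN_B_shuffle_lTensor (n p q : ℕ) (h : p + q = n) (w : C.C p ⊗[k] C'.C q) :
    awN C C' (n + 1) p (q + 1) ((C.diag C').B n
      (shuffle C.toSimplicial C'.toSimplicial n p q w)) =
      GrComplex.sign k p • (C'.normalized.B q).lTensor _
        (TensorProduct.map (C.toNormalized p) (C'.toNormalized q) w) := by
  induction w using TensorProduct.induction_on with
  | zero => simp only [map_zero, smul_zero]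
  | add x y hx hy => simp only [map_add, smul_add, hx, hy]
  | tmul x y =>
    rw [GrComplex.sign_nat]
    exact awN_B_shuffle_right C C' n p q h x y

/-- The Alexander-Whitney map intertwines `B` and `B ⊗ 1 ± 1 ⊗ B` on the image of the shuffle
map. -/
lemma awTensor_B_shuffleAW (n : ℕ) (z : C.C n ⊗[k] C'.C n) :
    C.awTensor C' (n + 1) ((C.diag C').B n (shuffleAW C.toSimplicial C'.toSimplicial n z)) =
      C.normalized.tensorB C'.normalized n (C.awTensor C' n z) := by
  have h0 : ∀ p q, p + q = n + 1 → ∀ e ∈ Finset.HasAntidiagonal.antidiagonal n, p ≠ e.1 →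
      p ≠ e.1 + 1 → awN C C' (n + 1) p q ((C.diag C').B n
        (shuffle C.toSimplicial C'.toSimplicial n e.1 e.2
          (aw C.toSimplicial C'.toSimplicial n e.1 e.2 z))) = 0 := fun p q h e he h1 h2 =>
    awN_B_shuffle_ne C C' n e.1 e.2 p q (by simpa using he) h h1 h2 _
  refine funext fun ⟨⟨p, q⟩, h⟩ => ?_
  dsimp only at h
  rw [shuffleAW_apply, map_sum, map_sum, Finset.sum_apply, MixedComplex.tensorB_apply]
  change ∑ e ∈ Finset.HasAntidiagonal.antidiagonal n, awN C C' (n + 1) p q _ = _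
  obtain _ | p := p <;> obtain _ | q := q
  · omega
  · obtain rfl : q = n := by omega
    rw [Finset.sum_eq_single (0, q)]
    · refine (awN_B_shuffle_lTensor C C' q 0 q (by omega) _).trans ?_
      change _ = 0 + _
      rw [zero_add]; rfl
    · intro e he hne
      refine h0 0 (q + 1) (by omega) e he ?_ (by omega)
      rintro h1
      rw [Finset.HasAntidiagonal.mem_antidiagonal] at he
      exact hne (Prod.ext h1.symm (by dsimp only; omega))
    · intro h1; simp at h1
  · obtain rfl : p = n := by omega
    rw [Finset.sum_eq_single (p, 0)]
    · refine (awN_B_shuffle_rTensor C C' p p 0 (by omega) _).trans ?_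
      change _ = _ + 0
      rw [add_zero]; rfl
    · intro e he hne
      rw [Finset.HasAntidiagonal.mem_antidiagonal] at he
      refine h0 (p + 1) 0 (by omega) e (by simpa using he) (by omega) ?_
      rintro h1
      exact hne (Prod.ext (by dsimp only; omega) (by dsimp only; omega))
    · intro h1; simp at h1
  · rw [Finset.sum_eq_add (p, q + 1) (p + 1, q)]
    · refine congrArg₂ (· + ·) ?_ ?_
      · exact awN_B_shuffle_rTensor C C' n p (q + 1) (by omega) _
      · exact awN_B_shuffle_lTensor C C' n (p + 1) q (by omega) _
    · intro h1; simp at h1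
    · rintro e he ⟨h1, h2⟩
      refine h0 (p + 1) (q + 1) h e he (fun h3 => ?_) fun h3 => ?_
      all_goals rw [Finset.HasAntidiagonal.mem_antidiagonal] at he
      · exact h2 (Prod.ext (by dsimp only; omega) (by dsimp only; omega))
      · exact h1 (Prod.ext (by dsimp only; omega) (by dsimp only; omega))
    · intro h1
      exact absurd (Finset.HasAntidiagonal.mem_antidiagonal.2 (by omega)) h1
    · intro h1
      exact absurd (Finset.HasAntidiagonal.mem_antidiagonal.2 (by omega)) h1

/-- The operator `-B φ`, with the recursive form of `φ`. -/
def negBHomotopy (n : ℕ) : C.C n ⊗[k] C'.C n →ₗ[k] C.C (n + 2) ⊗[k] C'.C (n + 2) :=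
  - ((C.diag C').B (n + 1) ∘ₗ homotopy C.toSimplicial C'.toSimplicial n)

lemma negBHomotopy_apply (n : ℕ) (z : C.C n ⊗[k] C'.C n) : C.negBHomotopy C' n z =
    - (C.diag C').B (n + 1) (homotopy C.toSimplicial C'.toSimplicial n z) := rfl

/-- The iterate `(-B φ)^a : (C × C')_n → (C × C')_m` for `m = n + 2 a`, and zero otherwise. -/
def negBHomotopyPow : ∀ (_ n m : ℕ), C.C n ⊗[k] C'.C n →ₗ[k] C.C m ⊗[k] C'.C m
  | 0, n, m => (SimplicialModule.prod C.toSimplicial C'.toSimplicial).castF n m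
  | _ + 1, _, 0 => 0
  | _ + 1, _, 1 => 0
  | a + 1, n, m + 2 => C.negBHomotopy C' m ∘ₗ negBHomotopyPow a n m

lemma negBHomotopyPow_zero (n : ℕ) (z : C.C n ⊗[k] C'.C n) : C.negBHomotopyPow C' 0 n n z = z := by
  rw [negBHomotopyPow, castF_self, LinearMap.id_apply]

lemma negBHomotopyPow_succ (a n m : ℕ) (z : C.C n ⊗[k] C'.C n) :
    C.negBHomotopyPow C' (a + 1) n (m + 2) z =
      C.negBHomotopy C' m (C.negBHomotopyPow C' a n m z) := rfl

lemma negBHomotopyPow_ne (a n m : ℕ) (h : n + 2 * a ≠ m) : C.negBHomotopyPow C' a n m = 0 := by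
  induction a generalizing m with
  | zero => exact castF_ne _ (by omega)
  | succ a ih =>
    obtain _ | _ | m := m
    · rfl
    · rfl
    · rw [negBHomotopyPow, ih m (by omega), LinearMap.comp_zero]

/-- The chains that are degenerate or obtained from a degree smaller by at least three. -/
def awKill (m : ℕ) : Submodule k (C.C m ⊗[k] C'.C m) :=
  (C.diag C').degen m ⊔ Submodule.span k {z | ∃ (p q : ℕ) (_ : p + q + 3 ≤ m),
    ∃ h ∈ cycSpan C C' p q m m, ∃ w, z = h w}

lemma awTensor_awKill (m : ℕ) : C.awKill C' m ≤ LinearMap.ker (C.awTensor C' m) := by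
  refine sup_le (fun z hz => C.awTensor_degen C' m hz) (Submodule.span_le.2 ?_)
  rintro _ ⟨p, q, hpq, h, hh, w, rfl⟩
  refine funext fun ⟨⟨p', q'⟩, h'⟩ => ?_
  dsimp only at h'
  refine map_toNormalized_cycSpan (comp_mem_cycSpan
    (simpSpan_le_cycSpan _ _ _ _ (aw_mem_simpSpan C.toSimplicial C'.toSimplicial m p' q')) hh) ?_ w
  omega

lemma negBHomotopy_mem_cycSpan (n : ℕ) :
    C.negBHomotopy C' n ∈ cycSpan C C' n n (n + 2) (n + 2) :=
  Submodule.neg_mem _ (comp_mem_cycSpan (B_diag_mem_cycSpan (n + 1))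
    (simpSpan_le_cycSpan _ _ _ _ (homotopy_mem_simpSpan C.toSimplicial C'.toSimplicial n)))

lemma negBHomotopy_mem_degen (n : ℕ) {z : C.C n ⊗[k] C'.C n} (hz : z ∈ (C.diag C').degen n) :
    C.negBHomotopy C' n z ∈ (C.diag C').degen (n + 2) :=
  Submodule.neg_mem _ ((C.diag C').B_degen (n + 1)
    (homotopy_mem_degen C.toSimplicial C'.toSimplicial n hz))

lemma negBHomotopy_awKill (m : ℕ) :
    C.awKill C' m ≤ (C.awKill C' (m + 2)).comap (C.negBHomotopy C' m) := by
  refine sup_le (fun z hz => Submodule.mem_sup_left (C.negBHomotopy_mem_degen C' m hz))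
    (Submodule.span_le.2 ?_)
  rintro _ ⟨p, q, hpq, h, hh, w, rfl⟩
  exact Submodule.mem_sup_right (Submodule.subset_span ⟨p, q, by omega, _,
    comp_mem_cycSpan (C.negBHomotopy_mem_cycSpan C' m) hh, w, rfl⟩)

lemma negBHomotopy_B_shuffleAW_mem (n : ℕ) (z : C.C n ⊗[k] C'.C n) :
    C.negBHomotopy C' (n + 1) ((C.diag C').B n
      (shuffleAW C.toSimplicial C'.toSimplicial n z)) ∈ C.awKill C' (n + 3) := by
  rw [shuffleAW_apply, map_sum, map_sum]
  refine Submodule.sum_mem _ fun e he => Submodule.mem_sup_right (Submodule.subset_span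
    ⟨e.1, e.2, ?_, _, comp_mem_cycSpan (C.negBHomotopy_mem_cycSpan C' (n + 1))
      (comp_mem_cycSpan (B_diag_mem_cycSpan n) (simpSpan_le_cycSpan _ _ _ _
        (shuffle_mem_simpSpan C.toSimplicial C'.toSimplicial n e.1 e.2))), _, rfl⟩)
  rw [Finset.HasAntidiagonal.mem_antidiagonal] at he
  omega

lemma b_negBHomotopy_zero (y : C.C 0 ⊗[k] C'.C 0) :
    (C.diag C').b 1 (C.negBHomotopy C' 0 y) = (C.diag C').B 0 y -
      (C.diag C').B 0 (shuffleAW C.toSimplicial C'.toSimplicial 0 y) := by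
  have h1 := (C.diag C').b_B 0 (homotopy C.toSimplicial C'.toSimplicial 0 y)
  have h2 : (C.diag C').b 0 (homotopy C.toSimplicial C'.toSimplicial 0 y) = 0 :=
    b_homotopy_zero C.toSimplicial C'.toSimplicial y
  rw [h2, map_zero, add_zero] at h1
  rw [negBHomotopy_apply, map_neg, h1, shuffleAW_zero, sub_self, neg_zero]

lemma b_negBHomotopy (l : ℕ) (y : C.C (l + 1) ⊗[k] C'.C (l + 1)) :
    (C.diag C').b (l + 2) (C.negBHomotopy C' (l + 1) y) = (C.diag C').B (l + 1) y -
      (C.diag C').B (l + 1) (shuffleAW C.toSimplicial C'.toSimplicial (l + 1) y) +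
      C.negBHomotopy C' l ((C.diag C').b l y) := by
  have h1 := (C.diag C').b_B (l + 1) (homotopy C.toSimplicial C'.toSimplicial (l + 1) y)
  have h2 : (C.diag C').b (l + 1) (homotopy C.toSimplicial C'.toSimplicial (l + 1) y) =
      y - shuffleAW C.toSimplicial C'.toSimplicial (l + 1) y -
        homotopy C.toSimplicial C'.toSimplicial l ((C.diag C').b l y) :=
    eq_sub_of_add_eq (b_homotopy C.toSimplicial C'.toSimplicial l y)
  rw [h2, map_sub, map_sub] at h1
  rw [negBHomotopy_apply, negBHomotopy_apply, map_neg, eq_neg_of_add_eq_zero_left h1]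
  abel

lemma B_negBHomotopy (l : ℕ) (y : C.C l ⊗[k] C'.C l) :
    (C.diag C').B (l + 2) (C.negBHomotopy C' l y) = 0 := by
  rw [negBHomotopy_apply, map_neg, (C.diag C').B_B, neg_zero]

/-- The Hochschild differential, extended by zero to degree zero. -/
def bPred : ∀ n, C.C n →ₗ[k] C.C (n - 1)
  | 0 => 0
  | n + 1 => C.b n

lemma b_negBHomotopyPow (a n l : ℕ) (h : n + 2 * a = l) (x : C.C n ⊗[k] C'.C n) :
    (C.diag C').b (l + 1) (C.negBHomotopyPow C' (a + 1) n (l + 2) x) +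
      (C.diag C').B l (shuffleAW C.toSimplicial C'.toSimplicial l
        (C.negBHomotopyPow C' a n l x)) -
      C.negBHomotopyPow C' a (n + 1) (l + 1) ((C.diag C').B n x) -
      C.negBHomotopyPow C' (a + 1) (n - 1) (l + 1) ((C.diag C').bPred n x) ∈
        C.awKill C' (l + 1) := by
  induction a generalizing l with
  | zero =>
    subst h
    rw [mul_zero, add_zero, negBHomotopyPow_succ, negBHomotopyPow_zero, negBHomotopyPow_zero]
    obtain _ | n := n
    · rw [b_negBHomotopy_zero]
      have : C.negBHomotopyPow C' (0 + 1) (0 - 1) (0 + 1) ((C.diag C').bPred 0 x) = 0 := map_zero _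
      rw [this]
      simp
    · have : C.negBHomotopyPow C' (0 + 1) (n + 1 - 1) (n + 1 + 1) ((C.diag C').bPred (n + 1) x) =
          C.negBHomotopy C' n ((C.diag C').b n x) := by
        refine (C.negBHomotopyPow_succ C' 0 n n _).trans (congrArg _ ?_)
        exact C.negBHomotopyPow_zero C' n _
      rw [this, b_negBHomotopy]
      have e : ∀ u v w : C.C (n + 2) ⊗[k] C'.C (n + 2), u - v + w + v - u - w = 0 :=
        fun u v w => by abel
      rw [e]
      exact Submodule.zero_mem _
  | succ a ih =>
    obtain ⟨l, rfl⟩ : ∃ m, l = m + 2 := ⟨l - 2, by omega⟩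
    have h1 := C.negBHomotopy_awKill C' (l + 1) (ih l (by omega))
    rw [Submodule.mem_comap, map_sub, map_sub, map_add] at h1
    have h2 := C.negBHomotopy_B_shuffleAW_mem C' l (C.negBHomotopyPow C' a n l x)
    have h3 := Submodule.sub_mem _ h1 h2
    rw [negBHomotopyPow_succ C C' (a + 1) n (l + 2), b_negBHomotopy]
    have h4 : (C.diag C').B (l + 1 + 1) (C.negBHomotopyPow C' (a + 1) n (l + 2) x) = 0 :=
      C.B_negBHomotopy C' l _
    rw [h4]
    refine (congrArg (· ∈ C.awKill C' (l + 3)) ?_).mp h3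
    change _ = _ + _ - C.negBHomotopy C' (l + 1) (C.negBHomotopyPow C' a (n + 1) (l + 1) _) -
      C.negBHomotopy C' (l + 1) (C.negBHomotopyPow C' (a + 1) (n - 1) (l + 1) _)
    have e : ∀ u v w r s : C.C (l + 3) ⊗[k] C'.C (l + 3),
        u + v - w - r - v = 0 - s + u + s - w - r := fun u v w r s => by abel
    exact e _ _ _ _ _

/-- The component `AW (-B φ)^a` of the cyclic Alexander-Whitney map for `m = n + 2 a`, and zero
otherwise. -/
def awPow (a n m : ℕ) :
    C.C n ⊗[k] C'.C n →ₗ[k] GrComplex.TensorX C.normalized.hochschild C'.normalized.hochschild m :=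
  C.awTensor C' m ∘ₗ C.negBHomotopyPow C' a n m

lemma awPow_ne (a n m : ℕ) (h : n + 2 * a ≠ m) : C.awPow C' a n m = 0 := by
  rw [awPow, negBHomotopyPow_ne C C' a n m h, LinearMap.comp_zero]

lemma b_awPow (a n l : ℕ) (h : n + 2 * a = l) (x : C.C n ⊗[k] C'.C n) :
    (C.normalized.tensor C'.normalized).b (l + 1) (C.awPow C' (a + 1) n (l + 2) x) +
      C.normalized.tensorB C'.normalized l (C.awPow C' a n l x) =
      C.awPow C' a (n + 1) (l + 1) ((C.diag C').B n x) +
      C.awPow C' (a + 1) (n - 1) (l + 1) ((C.diag C').bPred n x) := by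
  have h1 := C.awTensor_awKill C' (l + 1) (C.b_negBHomotopyPow C' a n l h x)
  rw [LinearMap.mem_ker, map_sub, map_sub, map_add, awTensor_b, awTensor_B_shuffleAW, sub_sub,
    sub_eq_zero] at h1
  exact h1

lemma negBHomotopyPow_mem_degen (a n m : ℕ) {z : C.C n ⊗[k] C'.C n}
    (hz : z ∈ (C.diag C').degen n) : C.negBHomotopyPow C' a n m z ∈ (C.diag C').degen m := by
  induction a generalizing m with
  | zero =>
    by_cases h : n = m
    · subst h; rwa [negBHomotopyPow_zero]
    · rw [C.negBHomotopyPow_ne C' 0 n m (by omega)]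
      exact Submodule.zero_mem _
  | succ a ih =>
    obtain _ | _ | m := m
    · exact Submodule.zero_mem _
    · exact Submodule.zero_mem _
    · exact C.negBHomotopy_mem_degen C' m (ih m)

/-- The map induced by `awPow` on the normalized chains. -/
def awPowN (a n m : ℕ) : (C.diag C').normalized.X n →ₗ[k]
    GrComplex.TensorX C.normalized.hochschild C'.normalized.hochschild m :=
  ((C.diag C').degen n).liftQ (C.awPow C' a n m) fun _ hz =>
    C.awTensor_degen C' m (C.negBHomotopyPow_mem_degen C' a n m hz)

lemma awPowN_toNormalized (a n m : ℕ) (z : C.C n ⊗[k] C'.C n) :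
    C.awPowN C' a n m ((C.diag C').toNormalized n z) = C.awPow C' a n m z := rfl

lemma toNormalized_surjective (n : ℕ) : Function.Surjective (C.toNormalized n) :=
  Submodule.mkQ_surjective _

lemma awPowN_ne (a n m : ℕ) (h : n + 2 * a ≠ m) (x : (C.diag C').normalized.X n) :
    C.awPowN C' a n m x = 0 := by
  obtain ⟨x, rfl⟩ := (C.diag C').toNormalized_surjective n x
  rw [awPowN_toNormalized, C.awPow_ne C' a n m h, LinearMap.zero_apply]

end CyclicModule

/-- The differential of a mixed complex, extended by zero to degree zero. -/
def MixedComplex.bPred {k : Type u} [Field k] (M : MixedComplex.{u, v} k) :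
    ∀ n, M.X n →ₗ[k] M.X (n - 1)
  | 0 => 0
  | n + 1 => M.b n

namespace CyclicModule
variable {k : Type u} [Field k] (C C' : CyclicModule.{u, v} k)

open SimplicialModule

lemma b_awPowN_zero (n : ℕ) (x : (C.diag C').normalized.X (n + 1)) :
    (C.normalized.tensor C'.normalized).b n (C.awPowN C' 0 (n + 1) (n + 1) x) =
      C.awPowN C' 0 n n ((C.diag C').normalized.b n x) := by
  obtain ⟨x, rfl⟩ := (C.diag C').toNormalized_surjective _ x
  have h1 := C.awTensor_b C' n x
  rw [← C.negBHomotopyPow_zero C' n ((C.diag C').b n x)] at h1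
  rw [awPowN_toNormalized, awPow, LinearMap.comp_apply, negBHomotopyPow_zero]
  exact h1.symm

lemma b_awPowN (a n l : ℕ) (h : n + 2 * a = l ∨ n = 0 ∧ l < 2 * a)
    (x : (C.diag C').normalized.X n) :
    (C.normalized.tensor C'.normalized).b (l + 1) (C.awPowN C' (a + 1) n (l + 2) x) +
      C.normalized.tensorB C'.normalized l (C.awPowN C' a n l x) =
      C.awPowN C' a (n + 1) (l + 1) ((C.diag C').normalized.B n x) +
      C.awPowN C' (a + 1) (n - 1) (l + 1) ((C.diag C').normalized.bPred n x) := by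
  rcases h with h | ⟨rfl, h⟩
  · obtain ⟨x, rfl⟩ := (C.diag C').toNormalized_surjective _ x
    refine (C.b_awPow C' a n l h x).trans (congrArg (fun y => _ + y) ?_)
    obtain _ | n := n <;> rfl
  · rw [C.awPowN_ne C' _ _ _ (by omega), C.awPowN_ne C' _ _ _ (by omega),
      C.awPowN_ne C' _ _ _ (by omega), C.awPowN_ne C' _ _ _ (by omega), map_zero, map_zero]

end CyclicModule
end HopfCyc

namespace HopfCyc

/-- The composition of maps of complexes. -/
def GrComplex.Hom.comp {k : Type u} [Field k] {ι : Type} [GradingIndex ι]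
    {X Y Z : GrComplex.{u, v} k ι} (G : GrComplex.Hom Y Z) (F : GrComplex.Hom X Y) :
    GrComplex.Hom X Z where
  f i := G.f i ∘ₗ F.f i
  comm i j h x := by rw [LinearMap.comp_apply, F.comm, G.comm]; rfl

namespace MixedComplex
variable {k : Type u} [Field k] {M N : MixedComplex.{u, v} k}

/-- The map of Hochschild complexes given by a map that commutes with `b`. -/
def hochschildMap (f : ∀ n, M.X n →ₗ[k] N.X n) (hb : ∀ n x, f n (M.b n x) = N.b n (f (n + 1) x)) :
    GrComplex.Hom M.hochschild N.hochschild where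
  f := f
  comm i j h x := by subst h; exact hb j x

variable {ι : Type} [GradingIndex ι]

/-- The map of total complexes given by a map of mixed complexes. -/
def totalMap (f : ∀ n, M.X n →ₗ[k] N.X n) (hb : ∀ n x, f n (M.b n x) = N.b n (f (n + 1) x))
    (hB : ∀ n x, f (n + 1) (M.B n x) = N.B n (f n x)) (S : TotalShape ι) :
    GrComplex.Hom (M.total S) (N.total S) where
  f i := LinearMap.pi fun m => f m.1 ∘ₗ M.projTot S m.1 m.2
  comm i j h x := by
    refine funext fun ⟨m, hm⟩ => ?_
    change f m (M.b m (x ⟨m + 1, S.up h hm⟩) + M.BPart S h m hm x) =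
      N.b m (f (m + 1) (x ⟨m + 1, S.up h hm⟩)) + N.BPart S h m hm _
    rw [map_add, hb]
    congr 1
    obtain _ | m := m
    · exact map_zero _
    · exact hB m _

variable (M) in
/-- The families of chains of all degrees. -/
abbrev Full : Type v := ∀ n, M.X n

open Classical in
/-- The extension of an element of the total complex by zero. -/
noncomputable def extend (S : TotalShape ι) {i : ι} : M.TotX S i →ₗ[k] M.Full :=
  LinearMap.pi fun n => if h : S.mem i n then M.projTot S n h else 0

lemma extend_mem (S : TotalShape ι) {i : ι} (x : M.TotX S i) {n : ℕ} (h : S.mem i n) :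
    extend S x n = x ⟨n, h⟩ := by
  rw [extend, LinearMap.pi_apply, dif_pos h]; rfl

lemma extend_not_mem (S : TotalShape ι) {i : ι} (x : M.TotX S i) {n : ℕ} (h : ¬ S.mem i n) :
    extend S x n = 0 := by
  rw [extend, LinearMap.pi_apply, dif_neg h]; rfl

/-- The component `B x_{n-1}`. -/
def shiftB (x : ∀ n, M.X n) : ∀ n, M.X n
  | 0 => 0
  | n + 1 => M.B n (x n)

lemma total_d_apply (S : TotalShape ι) {i j : ι} (h : j + 1 = i) (x : M.TotX S i) {m : ℕ}
    (hm : S.mem j m) : (M.total S).d i j h x ⟨m, hm⟩ =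
      M.b m (extend S x (m + 1)) + shiftB (extend S x) m := by
  change M.b m (x ⟨m + 1, S.up h hm⟩) + M.BPart S h m hm x = _
  rw [extend_mem S x (S.up h hm)]
  congr 1
  obtain _ | m := m
  · rfl
  · rw [shiftB, extend_mem S x (S.down h hm)]; rfl

end MixedComplex

namespace CyclicModule
variable {k : Type u} [Field k] (C C' : CyclicModule.{u, v} k)

open SimplicialModule MixedComplex

/-- The degree `m` component of the cyclic Alexander-Whitney map. -/
def awSum (x : ∀ n, (C.diag C').normalized.X n) (m : ℕ) :
    GrComplex.TensorX C.normalized.hochschild C'.normalized.hochschild m :=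
  ∑ a ∈ Finset.range (m + 1), C.awPowN C' a (m - 2 * a) m (x (m - 2 * a))

lemma awSum_eq (x : ∀ n, (C.diag C').normalized.X n) (m r : ℕ) (h : m + 1 ≤ r) :
    C.awSum C' x m = ∑ a ∈ Finset.range r, C.awPowN C' a (m - 2 * a) m (x (m - 2 * a)) := by
  refine Finset.sum_subset (Finset.range_mono h) fun a _ ha => ?_
  rw [Finset.mem_range] at ha
  exact C.awPowN_ne C' _ _ _ (by omega) _

/-- The cyclic Alexander-Whitney map commutes with `b + B`. -/
lemma awSum_d (x : ∀ n, (C.diag C').normalized.X n) (m : ℕ) :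
    C.awSum C' (fun n => (C.diag C').normalized.b n (x (n + 1)) + shiftB x n) m =
      (C.normalized.tensor C'.normalized).b m (C.awSum C' x (m + 1)) +
        shiftB (M := C.normalized.tensor C'.normalized) (C.awSum C' x) m := by
  obtain _ | l := m
  · have h1 := C.b_awPowN_zero C' 0 (x 1)
    have h2 : C.awSum C' x 1 = C.awPowN C' 0 1 1 (x 1) := by
      rw [awSum, Finset.sum_range_succ, Finset.sum_range_one]
      refine (congrArg (fun y => _ + y) (C.awPowN_ne C' 1 _ 1 (by omega) _)).trans (add_zero _)
    rw [h2]
    refine Eq.trans ?_ ((congrArg (fun y => y + 0) h1).trans rfl).symm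
    rw [awSum, Finset.sum_range_one, add_zero]
    exact congrArg _ (add_zero _)
  · have hB : ∀ a, C.awPowN C' a (l + 1 - 2 * a) (l + 1) (shiftB x (l + 1 - 2 * a)) =
        C.awPowN C' a (l - 2 * a + 1) (l + 1)
          ((C.diag C').normalized.B (l - 2 * a) (x (l - 2 * a))) := by
      intro a
      rcases (show 2 * a ≤ l ∨ 2 * a = l + 1 ∨ l + 1 < 2 * a by omega) with h | h | h
      · rw [show l + 1 - 2 * a = l - 2 * a + 1 by omega]; rfl
      · rw [C.awPowN_ne C' a (l - 2 * a + 1) (l + 1) (by omega),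
          show l + 1 - 2 * a = 0 by omega]
        exact map_zero _
      · rw [C.awPowN_ne C' _ _ _ (by omega), C.awPowN_ne C' _ _ _ (by omega)]
    have hb : ∀ a, C.awPowN C' (a + 1) (l + 1 - 2 * (a + 1)) (l + 1)
        ((C.diag C').normalized.b _ (x (l + 1 - 2 * (a + 1) + 1))) =
        C.awPowN C' (a + 1) (l - 2 * a - 1) (l + 1)
          ((C.diag C').normalized.bPred (l - 2 * a) (x (l - 2 * a))) := by
      intro a
      by_cases h : 2 * a + 1 ≤ l
      · obtain ⟨n, hn⟩ : ∃ n, l - 2 * a = n + 1 := ⟨l - 2 * a - 1, by omega⟩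
        rw [hn, show l + 1 - 2 * (a + 1) = n by omega]; rfl
      · rw [C.awPowN_ne C' _ _ _ (by omega), C.awPowN_ne C' _ _ _ (by omega)]
    have hkey : ∀ a, (C.normalized.tensor C'.normalized).b (l + 1)
          (C.awPowN C' (a + 1) (l + 2 - 2 * (a + 1)) (l + 2) (x (l + 2 - 2 * (a + 1)))) +
        C.normalized.tensorB C'.normalized l (C.awPowN C' a (l - 2 * a) l (x (l - 2 * a))) =
        C.awPowN C' a (l - 2 * a + 1) (l + 1)
          ((C.diag C').normalized.B (l - 2 * a) (x (l - 2 * a))) +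
        C.awPowN C' (a + 1) (l - 2 * a - 1) (l + 1)
          ((C.diag C').normalized.bPred (l - 2 * a) (x (l - 2 * a))) := by
      intro a
      rw [show l + 2 - 2 * (a + 1) = l - 2 * a by omega]
      exact C.b_awPowN C' a (l - 2 * a) l (by omega) _
    have hT : shiftB (M := C.normalized.tensor C'.normalized) (C.awSum C' x) (l + 1) =
        ∑ a ∈ Finset.range (l + 2), C.normalized.tensorB C'.normalized l
          (C.awPowN C' a (l - 2 * a) l (x (l - 2 * a))) := by
      rw [← map_sum, ← C.awSum_eq C' x l (l + 2) (by omega)]; rfl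
    have hL : C.awSum C' x (l + 2) = ∑ a ∈ Finset.range (l + 2),
        C.awPowN C' (a + 1) (l + 2 - 2 * (a + 1)) (l + 2) (x (l + 2 - 2 * (a + 1))) +
        C.awPowN C' 0 (l + 2) (l + 2) (x (l + 2)) := by
      rw [awSum, Finset.sum_range_succ']; rfl
    have hR : ∑ a ∈ Finset.range (l + 2), C.awPowN C' a (l + 1 - 2 * a) (l + 1)
        ((C.diag C').normalized.b _ (x (l + 1 - 2 * a + 1))) =
        ∑ a ∈ Finset.range (l + 2), C.awPowN C' (a + 1) (l - 2 * a - 1) (l + 1)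
          ((C.diag C').normalized.bPred (l - 2 * a) (x (l - 2 * a))) +
        C.awPowN C' 0 (l + 1) (l + 1) ((C.diag C').normalized.b _ (x (l + 2))) := by
      rw [Finset.sum_range_succ', Finset.sum_congr rfl fun a _ => hb a]
      refine congrArg₂ (· + ·) ?_ rfl
      rw [Finset.sum_range_succ _ (l + 1)]
      exact (add_zero _).symm.trans (congrArg _ (C.awPowN_ne C' _ _ _ (by omega) _).symm)
    rw [hT, hL, map_add, map_sum, add_right_comm, ← Finset.sum_add_distrib,
      Finset.sum_congr rfl fun a _ => hkey a, awSum]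
    simp only [map_add]
    rw [Finset.sum_add_distrib, Finset.sum_add_distrib, hR, Finset.sum_congr rfl fun a _ => hB a,
      b_awPowN_zero]
    abel

variable {ι : Type} [GradingIndex ι]

/-- The cyclic Alexander-Whitney map on the total complexes of the normalized chains. -/
noncomputable def awHom (S : TotalShape ι) : GrComplex.Hom ((C.diag C').normalized.total S)
    ((C.normalized.tensor C'.normalized).total S) where
  f i := LinearMap.pi fun m => ∑ a : Fin (m.1 / 2 + 1),
    C.awPowN C' a (m.1 - 2 * a) m.1 ∘ₗ (C.diag C').normalized.projTot S (m.1 - 2 * a) (mem_sub S a (by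
        rw [Nat.sub_add_cancel (by omega)]; exact m.2))
  comm i j h x := by
    have h1 : ∀ (i : ι) (x : (C.diag C').normalized.TotX S i) (m : ℕ) (hm : S.mem i m)
        (y : ∀ n, (C.diag C').normalized.X n) (hy : ∀ n hn, x ⟨n, hn⟩ = y n),
        (∑ a : Fin (m / 2 + 1), C.awPowN C' a (m - 2 * a) m ∘ₗ
          (C.diag C').normalized.projTot S (m - 2 * a) (mem_sub S a (by
            rw [Nat.sub_add_cancel (by omega)]; exact hm))) x = C.awSum C' y m := by
      intro i x m hm y hy
      rw [LinearMap.sum_apply]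
      refine (Finset.sum_congr rfl fun a _ => ?_).trans (Eq.trans (Fin.sum_univ_eq_sum_range
        (fun a => C.awPowN C' a (m - 2 * a) m (y (m - 2 * a))) (m / 2 + 1)) ?_)
      · rw [LinearMap.comp_apply, ← hy]; rfl
      · refine Finset.sum_subset (Finset.range_mono (by omega)) fun a _ ha => ?_
        rw [Finset.mem_range] at ha
        exact C.awPowN_ne C' _ _ _ (by omega) _
    refine funext fun ⟨m, hm⟩ => ?_
    rw [total_d_apply S h _ hm]
    refine (h1 j _ m hm (fun n => (C.diag C').normalized.b n (extend S x (n + 1)) +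
      shiftB (extend S x) n) fun n hn => total_d_apply S h x hn).trans ?_
    rw [awSum_d]
    have h2 : ∀ m (hm : S.mem i m), extend (M := C.normalized.tensor C'.normalized) S
        ((LinearMap.pi fun m : {m : ℕ // S.mem i m} => ∑ a : Fin (m.1 / 2 + 1),
          C.awPowN C' a (m.1 - 2 * a) m.1 ∘ₗ (C.diag C').normalized.projTot S (m.1 - 2 * a)
            (mem_sub S a (by rw [Nat.sub_add_cancel (by omega)]; exact m.2))) x) m =
        C.awSum C' (extend S x) m := fun m hm =>
      (extend_mem S _ hm).trans
        (h1 i x m hm (extend S x) fun n hn => (extend_mem S x hn).symm)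
    rw [h2 (m + 1) (S.up h hm)]
    congr 1
    obtain _ | m := m
    · rfl
    · exact congrArg (C.normalized.tensorB C'.normalized m) (h2 m (S.down h hm)).symm

/-- The iterate of `-B φ` with explicit source and target. -/
noncomputable def negBphiPowMap (n a : ℕ) :
    C.C n ⊗[k] C'.C n →ₗ[k] C.C (n + 2 * a) ⊗[k] C'.C (n + 2 * a) := C.negBphiPow C' n a

lemma negBphiPow_sub_mem_degen (n a : ℕ) (z : C.C n ⊗[k] C'.C n) :
    C.negBphiPowMap C' n a z - C.negBHomotopyPow C' a n (n + 2 * a) z ∈ (C.diag C').degen (n + 2 * a) := by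
  induction a with
  | zero =>
    have : C.negBHomotopyPow C' 0 n (n + 2 * 0) z = z := C.negBHomotopyPow_zero C' n z
    rw [this]
    exact (sub_self z).symm ▸ Submodule.zero_mem _
  | succ a ih =>
    have h1 := C.negBHomotopy_mem_degen C' _ ih
    rw [map_sub] at h1
    have h2 := (C.diag C').B_degen _
      (C.homotopy_sub_phiMap_mem_degen C' (n + 2 * a) (C.negBphiPowMap C' n a z))
    rw [Submodule.mem_comap, map_sub] at h2
    have h3 := Submodule.add_mem _ h1 h2
    refine (congrArg (· ∈ (C.diag C').degen (n + 2 * a + 2)) ?_).mp h3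
    change _ = - (C.diag C').B _ (C.phiMap C' (n + 2 * a) (C.negBphiPowMap C' n a z)) -
      C.negBHomotopy C' (n + 2 * a) (C.negBHomotopyPow C' a n (n + 2 * a) z)
    rw [negBHomotopy_apply C C' _ (C.negBphiPowMap C' n a z)]
    abel

lemma castX_AWComponent (n a m : ℕ) (h : n + 2 * a = m) (z : C.C n ⊗[k] C'.C n) :
    (C.normalized.tensor C'.normalized).castX h (C.AWComponent C' n a z) =
      C.awPow C' a n m z := by
  subst h
  refine (C.AW_eq_awTensor C' (n + 2 * a) (C.negBphiPowMap C' n a z)).trans ?_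
  rw [awPow, LinearMap.comp_apply, ← sub_eq_zero, ← map_sub]
  exact C.awTensor_degen C' _ (C.negBphiPow_sub_mem_degen C' n a z)

lemma awHom_toNormalized (S : TotalShape ι) (i : ι)
    (x : ∀ m : {m : ℕ // S.mem i m}, C.C m.1 ⊗[k] C'.C m.1) :
    (C.awHom C' S).f i (fun m => (C.diag C').toNormalized m.1 (x m)) = C.AWTotal C' S i x := by
  refine funext fun m => ?_
  refine (LinearMap.sum_apply _ _ _).trans (Eq.trans ?_ (LinearMap.sum_apply _ _ _).symm)
  refine Finset.sum_congr rfl fun a _ => ?_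
  exact (C.castX_AWComponent C' _ a _ (by omega) _).symm

variable {C C'}
variable {D : CyclicModule.{u, v} k}

namespace Hom

lemma map_degen (ρ : Hom C D) (n : ℕ) : C.degen n ≤ (D.degen n).comap (ρ.f n) := by
  obtain _ | n := n
  · intro x hx
    obtain rfl : x = 0 := hx
    exact Submodule.zero_mem _
  · refine C.degen_succ_le fun i hi x => ?_
    rw [Submodule.mem_comap, ρ.f_s]
    exact D.s_mem_degen hi _

/-- The map induced on the normalized chains. -/
def normalized (ρ : Hom C D) (n : ℕ) : C.normalized.X n →ₗ[k] D.normalized.X n :=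
  Submodule.mapQ _ _ (ρ.f n) (ρ.map_degen n)

lemma map_b (ρ : Hom C D) (n : ℕ) (x : C.C (n + 1)) : ρ.f n (C.b n x) = D.b n (ρ.f (n + 1) x) := by
  simp only [b, LinearMap.sum_apply, LinearMap.smul_apply, map_sum, map_smul]
  refine Finset.sum_congr rfl fun i hi => ?_
  rw [Finset.mem_range] at hi
  rw [ρ.f_d]

lemma map_τ (ρ : Hom C D) (n : ℕ) (x : C.C n) : ρ.f n (C.τ n x) = D.τ n (ρ.f n x) := by
  rw [τ_apply, τ_apply, map_smul, ρ.f_t]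

lemma map_B (ρ : Hom C D) (n : ℕ) (x : C.C n) : ρ.f (n + 1) (C.B n x) = D.B n (ρ.f n x) := by
  have h1 : ∀ j x, ρ.f n ((C.τ n ^ j) x) = (D.τ n ^ j) (ρ.f n x) := fun j x => by
    induction j with
    | zero => rfl
    | succ j ih => rw [pow_succ', Module.End.mul_apply, map_τ, ih, pow_succ', Module.End.mul_apply]
  have h2 : ρ.f (n + 1) (C.extra n (C.norm n x)) = D.extra n (D.norm n (ρ.f n x)) := by
    rw [extra_apply, extra_apply, ρ.f_t, ρ.f_s, norm_apply, norm_apply, map_sum]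
    simp only [h1]
  rw [B_apply, B_apply, map_sub, map_τ, h2]

lemma normalized_b (ρ : Hom C D) (n : ℕ) (x : C.normalized.X (n + 1)) :
    ρ.normalized n (C.normalized.b n x) = D.normalized.b n (ρ.normalized (n + 1) x) := by
  obtain ⟨x, rfl⟩ := C.toNormalized_surjective _ x
  exact congrArg (D.toNormalized n) (ρ.map_b n x)

lemma normalized_B (ρ : Hom C D) (n : ℕ) (x : C.normalized.X n) :
    ρ.normalized (n + 1) (C.normalized.B n x) = D.normalized.B n (ρ.normalized n x) := by
  obtain ⟨x, rfl⟩ := C.toNormalized_surjective _ x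
  exact congrArg (D.toNormalized (n + 1)) (ρ.map_B n x)

end Hom

/-- The map of Hochschild complexes induced by a diagonal and the Alexander-Whitney map. -/
lemma exists_hochschild_hom (ρ : Hom C (C.prod C)) :
    ∃ F : GrComplex.Hom C.normalized.hochschild
      (GrComplex.tensor C.normalized.hochschild C.normalized.hochschild),
      ∀ n x, F.f n (C.toNormalized n x) = C.AW C n (ρ.f n x) := by
  let ρ' : Hom C (C.diag C) := ρ
  let G : GrComplex.Hom (C.diag C).normalized.hochschild
      (C.normalized.tensor C.normalized).hochschild :=
    hochschildMap (fun n => C.awPowN C 0 n n) fun n x => (C.b_awPowN_zero C n x).symm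
  let P : GrComplex.Hom C.normalized.hochschild (C.diag C).normalized.hochschild :=
    hochschildMap ρ'.normalized ρ'.normalized_b
  refine ⟨⟨(G.comp P).f, ?_⟩, fun n x => ?_⟩
  · rintro i j rfl x
    exact (G.comp P).comm (j + 1) j rfl x
  · refine Eq.trans ?_ (C.AW_eq_awTensor C n (ρ.f n x)).symm
    exact congrArg (C.awTensor C n) (C.negBHomotopyPow_zero C n (ρ.f n x))

/-- The map of total complexes induced by a diagonal and the cyclic Alexander-Whitney map. -/
lemma exists_total_hom (ρ : Hom C (C.prod C)) (S : TotalShape ι) :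
    ∃ F : GrComplex.Hom (C.normalized.total S) ((C.normalized.tensor C.normalized).total S),
      ∀ i (x : ∀ m : {m : ℕ // S.mem i m}, C.C m.1),
        F.f i (fun m => C.toNormalized m.1 (x m)) = C.AWTotal C S i (fun m => ρ.f m.1 (x m)) := by
  let ρ' : Hom C (C.diag C) := ρ
  exact ⟨(C.awHom C S).comp (totalMap ρ'.normalized ρ'.normalized_b ρ'.normalized_B S),
    fun i x => C.awHom_toNormalized C S i fun m => ρ.f m.1 (x m)⟩

end CyclicModule
end HopfCyc

namespace HopfCyc

namespace MixedComplex
variable {k : Type u} [Field k] {M : MixedComplex.{u, v} k} {ι : Type} [GradingIndex ι]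

/-- The linear map `x ↦ B x_{n-1}`. -/
def shiftBMap : ∀ n, M.Full →ₗ[k] M.X n
  | 0 => 0
  | n + 1 => M.B n ∘ₗ LinearMap.proj n

variable (M) in
/-- The differential `b + B` on the families of chains of all degrees. -/
def fullD : M.Full →ₗ[k] M.Full :=
  LinearMap.pi fun n => M.b n ∘ₗ LinearMap.proj (n + 1) + shiftBMap n

lemma fullD_apply (x : M.Full) (n : ℕ) : M.fullD x n = M.b n (x (n + 1)) + shiftB x n := by
  obtain _ | n := n <;> rfl

lemma fullD_congr {x y : M.Full} {n : ℕ} (h : ∀ m ≤ n + 1, x m = y m) :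
    M.fullD x n = M.fullD y n := by
  rw [fullD_apply, fullD_apply, h _ le_rfl]
  obtain _ | n := n
  · rfl
  · rw [shiftB, shiftB, h n (by omega)]

lemma fullD_fullD (x : M.Full) : M.fullD (M.fullD x) = 0 := by
  refine funext fun n => ?_
  obtain _ | _ | n := n
  · simp [fullD_apply, shiftB, M.b_b, M.b_B_zero]
  · simp [fullD_apply, shiftB, M.b_b, M.b_B]
  · simp [fullD_apply, shiftB, M.b_b, M.b_B, M.B_B]

/-- The restriction of a family to the degrees of a total complex. -/
def restrict (S : TotalShape ι) (i : ι) : M.Full →ₗ[k] M.TotX S i :=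
  LinearMap.pi fun m => LinearMap.proj m.1

lemma restrict_apply (S : TotalShape ι) (i : ι) (x : M.Full) (m : {m : ℕ // S.mem i m}) :
    restrict S i x m = x m.1 := rfl

lemma restrict_extend (S : TotalShape ι) {i : ι} (x : M.TotX S i) :
    restrict S i (extend S x) = x :=
  funext fun m => extend_mem S x m.2

lemma total_d_restrict (S : TotalShape ι) {i j : ι} (h : j + 1 = i) (x : M.Full) :
    (M.total S).d i j h (restrict S i x) = restrict S j (M.fullD x) := by
  refine funext fun ⟨m, hm⟩ => ?_
  obtain _ | m := m <;> rfl

lemma restrict_fullD_mem_cycles (S : TotalShape ι) (i : ι) (x : M.Full) :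
    restrict S i (M.fullD x) ∈ (M.total S).cycles i := by
  rw [← total_d_restrict S (rfl : i + 1 = i + 1) x]
  exact GrComplex.boundaries_le_cycles _ _ ⟨_, rfl⟩

lemma restrict_mem_cycles_iff (n : ℕ) (x : M.Full) :
    restrict cyclicShape n x ∈ (M.total cyclicShape).cycles n ↔
      ∀ m < n, m % 2 ≠ n % 2 → M.fullD x m = 0 := by
  rw [GrComplex.mem_cycles]
  constructor
  · intro h m hm hm'
    obtain ⟨j, rfl⟩ : ∃ j, n = j + 1 := ⟨n - 1, by omega⟩
    have h1 := h j rfl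
    rw [total_d_restrict] at h1
    exact congrFun h1 ⟨m, by omega, by omega⟩
  · rintro h j rfl
    rw [total_d_restrict]
    refine funext fun ⟨m, hm1, hm2⟩ => ?_
    exact h m (by omega) (by omega)

lemma MittagLeffler.exists_extension (hM : M.MittagLeffler) (n : ℕ) : ∃ a₀, ∀ a ≥ a₀,
    ∀ x : M.Full, (∀ m < n + 2 * a₀, m % 2 ≠ n % 2 → M.fullD x m = 0) →
    ∃ x' : M.Full, (∀ m < n + 2 * a, m % 2 ≠ n % 2 → M.fullD x' m = 0) ∧
      ∀ m ≤ n, m % 2 = n % 2 → x' m = x m := by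
  obtain ⟨a₀, h⟩ := hM n
  refine ⟨a₀, fun a ha x hx => ?_⟩
  have hx' : restrict cyclicShape (n + 2 * a₀) x ∈ (M.total cyclicShape).cycles (n + 2 * a₀) :=
    (restrict_mem_cycles_iff _ x).2 fun m hm hm' => hx m hm (by omega)
  have h1 : M.periodicity n a₀ (Submodule.Quotient.mk ⟨_, hx'⟩) ∈
      LinearMap.range (M.periodicity n a) := by
    rw [h a ha]
    exact ⟨_, rfl⟩
  obtain ⟨c, hc⟩ := h1
  obtain ⟨y, rfl⟩ := Submodule.Quotient.mk_surjective _ c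
  obtain ⟨u, hu⟩ := (Submodule.Quotient.eq _).1 hc
  have hu' : (M.total cyclicShape).d (n + 1) n rfl u =
      M.periodicityChain n a y.1 - restrict cyclicShape n x := hu
  refine ⟨extend cyclicShape y.1 - M.fullD (extend cyclicShape u), ?_, fun m hm hm' => ?_⟩
  · have h2 : restrict cyclicShape (n + 2 * a)
        (extend cyclicShape y.1 - M.fullD (extend cyclicShape u)) ∈
        (M.total cyclicShape).cycles (n + 2 * a) := by
      rw [map_sub, restrict_extend]
      exact Submodule.sub_mem _ y.2 (restrict_fullD_mem_cycles _ _ _)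
    intro m hm hm'
    exact (restrict_mem_cycles_iff _ _).1 h2 m hm (by omega)
  · have h3 := total_d_restrict cyclicShape (rfl : n + 1 = n + 1) (extend cyclicShape u)
    rw [restrict_extend, hu'] at h3
    have h4 := congrFun h3 ⟨m, hm, hm'⟩
    rw [restrict_apply] at h4
    have h5 : extend cyclicShape y.1 m = M.periodicityChain n a y.1 ⟨m, hm, hm'⟩ :=
      extend_mem cyclicShape y.1 (cyclicShape_mem_add a ⟨hm, hm'⟩)
    rw [Pi.sub_apply, ← h4, h5, Pi.sub_apply, sub_sub_cancel]
    rfl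

/-- Under the Mittag-Leffler condition the truncation of a chain that is a cycle up to a high degree
lifts to a cycle of the periodic complex. -/
lemma MittagLeffler.exists_cycle (hM : M.MittagLeffler) (n : ℕ) : ∃ N, ∀ x : M.Full,
    (∀ m < N, M.fullD x m = 0) → ∃ z : M.Full, M.fullD z = 0 ∧
      (∀ m ≤ n, m % 2 = n % 2 → z m = x m) ∧ ∀ m, m % 2 ≠ n % 2 → z m = 0 := by
  choose a₀ h using hM.exists_extension
  have step : ∀ l (x : {x : M.Full // ∀ m < l + 2 * a₀ l, m % 2 ≠ l % 2 → M.fullD x m = 0}),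
      ∃ x' : {x : M.Full // ∀ m < l + 2 + 2 * a₀ (l + 2), m % 2 ≠ (l + 2) % 2 → M.fullD x m = 0},
        ∀ m ≤ l, m % 2 = l % 2 → x'.1 m = x.1 m := by
    intro l x
    obtain ⟨x', h1, h2⟩ := h l (max (a₀ l) (1 + a₀ (l + 2))) (le_max_left _ _) x.1 x.2
    exact ⟨⟨x', fun m hm hm' => h1 m (by omega) (by omega)⟩, h2⟩
  choose f hf using step
  refine ⟨n + 2 * a₀ n, fun x hx => ?_⟩
  let X : ∀ i, {x : M.Full // ∀ m < n + 2 * i + 2 * a₀ (n + 2 * i),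
      m % 2 ≠ (n + 2 * i) % 2 → M.fullD x m = 0} := fun i =>
    Nat.rec ⟨x, fun m hm _ => hx m hm⟩ (fun i y => f (n + 2 * i) y) i
  have hX : ∀ i j, i ≤ j → ∀ m ≤ n + 2 * i, m % 2 = n % 2 → (X j).1 m = (X i).1 m := by
    intro i j hij
    induction j, hij using Nat.le_induction with
    | base => intros; rfl
    | succ j hij ih =>
      intro m hm hm'
      rw [← ih m hm hm']
      exact hf (n + 2 * j) (X j) m (by omega) (by omega)
  have hX' : ∀ i m, m ≤ n + 2 * i → m % 2 = n % 2 → (X m).1 m = (X i).1 m := by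
    intro i m hm hm'
    rcases le_total i m with h1 | h1
    · exact hX i m h1 m hm hm'
    · exact (hX m i h1 m (by omega) hm').symm
  refine ⟨fun m => if m % 2 = n % 2 then (X m).1 m else 0, funext fun m => ?_, fun m hm hm' => ?_,
    fun m hm => if_neg hm⟩
  · change _ = (0 : M.X m)
    rw [fullD_apply]
    by_cases hm : m % 2 = n % 2
    · rw [if_neg (by omega), map_zero, zero_add]
      obtain _ | m := m
      · rfl
      · rw [shiftB, if_neg (by omega), map_zero]
    · have h1 := (X (m + 1)).2 m (by omega) (by omega)
      rw [fullD_apply] at h1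
      rw [if_pos (by omega), ← h1]
      congr 1
      obtain _ | m := m
      · rfl
      · rw [shiftB, shiftB, if_pos (by omega), hX' (m + 1 + 1) m (by omega) (by omega)]
  · change (if m % 2 = n % 2 then (X m).1 m else 0) = x m
    rw [if_pos hm']
    exact hX' 0 m (by omega) hm'

variable (M) in
/-- The families that vanish in degrees less than `j`. -/
def low (j : ℕ) : Submodule k M.Full where
  carrier := {x | ∀ m < j, x m = 0}
  add_mem' hx hy m hm := by rw [Pi.add_apply, hx m hm, hy m hm, add_zero]
  zero_mem' _ _ := rfl
  smul_mem' c x hx m hm := by rw [Pi.smul_apply, hx m hm, smul_zero]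

lemma low_antitone {i j : ℕ} (h : i ≤ j) : M.low j ≤ M.low i :=
  fun _ hx m hm => hx m (by omega)

lemma fullD_mem_low {j : ℕ} {x : M.Full} (hx : x ∈ M.low (j + 1)) : M.fullD x ∈ M.low j := by
  intro m hm
  rw [fullD_congr (y := 0) fun m' hm' => hx m' (by omega), map_zero]
  rfl

/-- Boundaries of high degree are boundaries of chains of high degree. -/
lemma MittagLeffler.exists_low (hM : M.MittagLeffler) (i : ℕ) : ∃ j, ∀ w : M.Full,
    M.fullD w ∈ M.low j → ∃ w' ∈ M.low i, M.fullD w' = M.fullD w := by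
  obtain ⟨N, hN⟩ := hM.exists_cycle i
  obtain ⟨N', hN'⟩ := hM.exists_cycle (i + 1)
  refine ⟨max N N', fun w hw => ?_⟩
  obtain ⟨z, h1, h2, h3⟩ := hN w fun m hm => hw m (by omega)
  obtain ⟨z', h1', h2', h3'⟩ := hN' w fun m hm => hw m (by omega)
  refine ⟨w - z - z', fun m hm => ?_, by rw [map_sub, map_sub, h1, h1', sub_zero, sub_zero]⟩
  rw [Pi.sub_apply, Pi.sub_apply]
  by_cases h : m % 2 = i % 2
  · rw [h2 m (by omega) h, h3' m (by omega), sub_self, sub_zero]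
  · rw [h3 m h, h2' m (by omega) (by omega), sub_zero, sub_self]

lemma fullD_extend {i j : ZMod 2} (h : j + 1 = i) (x : M.TotX periodicShape i) :
    M.fullD (extend periodicShape x) =
      extend periodicShape ((M.total periodicShape).d i j h x) := by
  refine funext fun m => ?_
  have h0 : ∀ m : ℕ, periodicShape.mem i (m + 1) ↔ periodicShape.mem j m := fun m => by
    change ((m + 1 : ℕ) : ZMod 2) = i ↔ (m : ZMod 2) = j
    rw [← h, Nat.cast_add, Nat.cast_one, add_left_inj]
  by_cases hm : periodicShape.mem j m
  · rw [extend_mem _ _ hm, total_d_apply, fullD_apply]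
  · rw [extend_not_mem _ _ hm, fullD_apply, extend_not_mem _ _ (mt (h0 m).1 hm), map_zero, zero_add]
    obtain _ | m := m
    · rfl
    · rw [shiftB, extend_not_mem, map_zero]
      intro h1
      refine hm ?_
      change ((m + 1 : ℕ) : ZMod 2) = j
      have h2 : (m : ZMod 2) = i := h1
      rw [Nat.cast_add, Nat.cast_one, h2, ← h, add_assoc]
      exact add_zero j

lemma sum_extend_restrict (x : M.Full) :
    ∑ ε : ZMod 2, extend periodicShape (restrict periodicShape ε x) = x := by
  refine funext fun m => ?_
  rw [Finset.sum_apply, Finset.sum_eq_single (m : ZMod 2)]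
  · exact extend_mem _ _ (rfl : periodicShape.mem (m : ZMod 2) m)
  · intro ε _ hε
    exact extend_not_mem _ _ fun h => hε h.symm
  · intro h; exact absurd (Finset.mem_univ _) h

lemma restrict_mem_cycles (ε : ZMod 2) {x : M.Full} (hx : M.fullD x = 0) :
    restrict periodicShape ε x ∈ (M.total periodicShape).cycles ε := by
  refine GrComplex.mem_cycles.2 fun j h => ?_
  rw [total_d_restrict, hx, map_zero]

variable (M) in
/-- The periodic homology class of a cycle. -/
def classMap (ε : ZMod 2) : LinearMap.ker M.fullD →ₗ[k] M.HP ε :=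
  Submodule.mkQ _ ∘ₗ ((restrict periodicShape ε).domRestrict _).codRestrict _
    fun x => restrict_mem_cycles ε x.2

lemma classMap_fullD (ε : ZMod 2) (x : M.Full) :
    M.classMap ε ⟨M.fullD x, M.fullD_fullD x⟩ = 0 := by
  refine (Submodule.Quotient.mk_eq_zero _).2 ⟨restrict periodicShape (ε + 1) x, ?_⟩
  exact total_d_restrict periodicShape rfl x

lemma exists_fullD_eq {z : M.Full} (hz : M.fullD z = 0) (h : ∀ ε, M.classMap ε ⟨z, hz⟩ = 0) :
    ∃ w, M.fullD w = z := by
  have h1 : ∀ ε, ∃ u, (M.total periodicShape).d (ε + 1) ε rfl u = restrict periodicShape ε z :=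
    fun ε => (Submodule.Quotient.mk_eq_zero _).1 (h ε)
  choose u hu using h1
  refine ⟨∑ ε, extend periodicShape (u ε), ?_⟩
  rw [map_sum]
  simp only [fullD_extend rfl, hu]
  exact sum_extend_restrict z

/-- The sum of a sequence of families that vanish in higher and higher degrees. -/
def lowSum (w : ℕ → M.Full) : M.Full := fun m => ∑ l ∈ Finset.range (m + 1), w l m

lemma lowSum_eq {w : ℕ → M.Full} (hw : ∀ l, w l ∈ M.low l) {m r : ℕ} (h : m + 1 ≤ r) :
    lowSum w m = ∑ l ∈ Finset.range r, w l m := by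
  refine Finset.sum_subset (Finset.range_mono h) fun l _ hl => ?_
  rw [Finset.mem_range] at hl
  exact hw l m (by omega)

lemma fullD_lowSum {w : ℕ → M.Full} (hw : ∀ l, w l ∈ M.low l) {m r : ℕ} (h : m + 2 ≤ r) :
    M.fullD (lowSum w) m = ∑ l ∈ Finset.range r, M.fullD (w l) m := by
  rw [fullD_congr (y := ∑ l ∈ Finset.range r, w l), map_sum, Finset.sum_apply]
  intro m' hm'
  rw [Finset.sum_apply]
  exact lowSum_eq hw (by omega)

/-- If moreover the periodic homology is finite dimensional, then cycles of high degree are boundaries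
of chains of high degree. -/
lemma MittagLeffler.exists_boundary (hM : M.MittagLeffler)
    (hf : ∀ ε, FiniteDimensional k (M.HP ε)) (i : ℕ) : ∃ j, ∀ z ∈ M.low j, M.fullD z = 0 →
      ∃ w ∈ M.low i, M.fullD w = z := by
  let c : LinearMap.ker M.fullD →ₗ[k] ∀ ε, M.HP ε := LinearMap.pi M.classMap
  let V : ℕ →o (Submodule k (∀ ε, M.HP ε))ᵒᵈ :=
    ⟨fun j => OrderDual.toDual (((M.low j).comap (LinearMap.ker M.fullD).subtype).map c),
      fun i j h => Submodule.map_mono (Submodule.comap_mono (low_antitone h))⟩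
  obtain ⟨j₀, hj₀⟩ := monotone_stabilizes_iff_artinian.2 inferInstance V
  have h1 : ∀ j ≥ j₀, ∀ j', ∀ z ∈ M.low j, M.fullD z = 0 → ∃ z' ∈ M.low j', M.fullD z' = 0 ∧
      ∃ w, M.fullD w = z - z' := by
    intro j hj j' z hz hz'
    have h2 : c ⟨z, hz'⟩ ∈ OrderDual.ofDual (V (max j j')) := by
      rw [← hj₀ _ (hj.le.trans (le_max_left _ _)), hj₀ j hj]
      exact ⟨⟨z, hz'⟩, hz, rfl⟩
    obtain ⟨⟨z', hz2⟩, hz1, h3⟩ := h2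
    refine ⟨z', low_antitone (le_max_right j j') hz1, hz2, exists_fullD_eq
      (by rw [map_sub, hz', LinearMap.mem_ker.1 hz2, sub_zero]) fun ε => ?_⟩
    have h4 := congrFun h3 ε
    have h5 : M.classMap ε (⟨z, hz'⟩ - ⟨z', hz2⟩) = 0 := by
      rw [map_sub, sub_eq_zero]; exact h4.symm
    exact h5
  choose J hJ using hM.exists_low
  let J' : ℕ → ℕ := fun l => max (J l) (max j₀ l)
  have step : ∀ l (z : {z : M.Full // z ∈ M.low (J' l) ∧ M.fullD z = 0}),
      ∃ z' : {z : M.Full // z ∈ M.low (J' (l + 1)) ∧ M.fullD z = 0}, ∃ w ∈ M.low l,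
        M.fullD w = z.1 - z'.1 := by
    rintro l ⟨z, hz, hz'⟩
    obtain ⟨z', h2, h3, w, hw⟩ := h1 (J' l) (by simp [J']) (max (J' l) (J' (l + 1))) z hz hz'
    obtain ⟨w', hw', h4⟩ := hJ l w (by
      rw [hw]
      exact Submodule.sub_mem _ (low_antitone (le_max_left _ _) hz)
        (low_antitone ((le_max_left _ _).trans (le_max_left _ _)) h2))
    exact ⟨⟨z', low_antitone (le_max_right _ _) h2, h3⟩, w', hw', h4.trans hw⟩
  choose f g hg hg' using step
  refine ⟨J' i, fun z hz hz' => ?_⟩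
  let Z : ∀ l, {z : M.Full // z ∈ M.low (J' (i + l)) ∧ M.fullD z = 0} := fun l =>
    Nat.rec ⟨z, hz, hz'⟩ (fun l y => f (i + l) y) l
  let w : ℕ → M.Full := fun l => g (i + l) (Z l)
  have hw : ∀ l, w l ∈ M.low (i + l) := fun l => hg (i + l) (Z l)
  have hw' : ∀ l, w l ∈ M.low l := fun l => low_antitone (by omega) (hw l)
  have hwD : ∀ l, M.fullD (w l) = (Z l).1 - (Z (l + 1)).1 := fun l => hg' (i + l) (Z l)
  refine ⟨lowSum w, fun m hm => Finset.sum_eq_zero fun l _ => hw l m (by omega),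
    funext fun m => ?_⟩
  rw [fullD_lowSum hw' le_rfl]
  simp only [hwD, Pi.sub_apply]
  rw [Finset.sum_range_sub' (fun l => (Z l).1 m)]
  have : (Z (m + 2)).1 m = 0 := (Z (m + 2)).2.1 m (by
    have : i + (m + 2) ≤ J' (i + (m + 2)) := (le_max_right _ _).trans (le_max_right _ _)
    omega)
  rw [this, sub_zero]
  rfl

end MixedComplex
end HopfCyc

namespace HopfCyc
namespace MixedComplex

variable {k : Type u} [Field k] {M : MixedComplex.{u, v} k}

variable (M) in
/-- The sign operator `(-1)^m` on the component of degree `m`. -/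
def parity : M.Full →ₗ[k] M.Full :=
  LinearMap.pi fun m => GrComplex.sign k m • LinearMap.proj m

lemma parity_apply (x : M.Full) (m : ℕ) : M.parity x m = GrComplex.sign k m • x m := rfl

lemma parity_parity (x : M.Full) : M.parity (M.parity x) = x := by
  refine funext fun m => ?_
  rw [parity_apply, parity_apply, smul_smul, GrComplex.sign_mul_self, one_smul]

lemma parity_fullD (x : M.Full) : M.parity (M.fullD x) = - M.fullD (M.parity x) := by
  refine funext fun m => ?_
  rw [parity_apply, Pi.neg_apply, fullD_apply, fullD_apply, parity_apply, GrComplex.sign_succ]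
  obtain _ | m := m
  · simp [shiftB]
  · simp [shiftB, parity_apply, GrComplex.sign_succ]
    abel

lemma parity_mem_low {j : ℕ} {x : M.Full} (hx : x ∈ M.low j) : M.parity x ∈ M.low j := by
  intro m hm
  rw [parity_apply, hx m hm, smul_zero]

lemma mem_low_zero (x : M.Full) : x ∈ M.low 0 := fun m hm => absurd hm (Nat.not_lt_zero m)

lemma restrict_parity (ε : ZMod 2) (x : M.Full) :
    restrict periodicShape ε (M.parity x) = GrComplex.sign k ε • restrict periodicShape ε x := by
  refine funext fun ⟨m, hm⟩ => ?_
  cases hm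
  rw [Pi.smul_apply, sign_natCast]
  rfl

lemma parity_extend {ε : ZMod 2} (x : M.TotX periodicShape ε) :
    M.parity (extend periodicShape x) = GrComplex.sign k ε • extend periodicShape x := by
  refine funext fun m => ?_
  rw [parity_apply, Pi.smul_apply]
  by_cases hm : periodicShape.mem ε m
  · cases hm
    rw [sign_natCast]
  · rw [extend_not_mem _ _ hm, smul_zero, smul_zero]

lemma restrict_extend_of_ne {ε ε' : ZMod 2} (h : ε ≠ ε') (x : M.TotX periodicShape ε') :
    restrict periodicShape ε (extend periodicShape x) = 0 := by
  refine funext fun ⟨m, hm⟩ => extend_not_mem _ _ fun hm' => h ?_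
  exact hm.symm.trans hm'

/-- A linear section of the differential on its image, which is continuous there as soon as cycles of
high degree are boundaries of chains of high degree. -/
lemma exists_fullD_section (h : ∀ i, ∃ j, ∀ z ∈ M.low j, M.fullD z = 0 →
      ∃ w ∈ M.low i, M.fullD w = z) :
    ∃ s : M.Full →ₗ[k] M.Full, (∀ x, M.fullD (s (M.fullD x)) = M.fullD x) ∧
      ∀ i, ∃ j, ∀ x, M.fullD x ∈ M.low j → s (M.fullD x) ∈ M.low i := by
  let G : ℕ → Submodule k M.Full := fun i => (M.low i).map M.fullD
  have hG : ∀ {i j}, i ≤ j → G j ≤ G i := fun h => Submodule.map_mono (low_antitone h)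
  choose g hg using fun i => GrComplex.exists_pseudoinverse (M.fullD ∘ₗ (M.low i).subtype)
  choose p hp using fun i => GrComplex.exists_pseudoinverse (G (i + 1)).mkQ
  let q : ℕ → M.Full →ₗ[k] M.Full := fun i => p i ∘ₗ (G (i + 1)).mkQ
  have hq0 : ∀ i, ∀ x ∈ G (i + 1), q i x = 0 := fun i x hx => by
    change p i ((G (i + 1)).mkQ x) = 0
    rw [Submodule.mkQ_apply, (Submodule.Quotient.mk_eq_zero _).2 hx, map_zero]
  have hq1 : ∀ i x, x - q i x ∈ G (i + 1) := fun i x =>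
    (Submodule.Quotient.eq _).1 (hp i x).symm
  have hg1 : ∀ i, ∀ x ∈ G i, M.fullD (g i x).1 = x := by
    rintro i _ ⟨x, hx, rfl⟩
    exact hg i ⟨x, hx⟩
  let r : ℕ → M.Full →ₗ[k] M.Full := fun i =>
    Nat.rec LinearMap.id (fun i r => r - q i ∘ₗ r) i
  have hr : ∀ i x, r (i + 1) x = r i x - q i (r i x) := fun i x => rfl
  have hr1 : ∀ x ∈ G 0, ∀ i, r i x ∈ G i := by
    intro x hx i
    obtain _ | i := i
    · exact hx
    · exact hq1 i _
  have hr2 : ∀ i, ∀ x ∈ G i, ∀ l ≤ i, r l x = x := by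
    intro i x hx l hl
    induction l with
    | zero => rfl
    | succ l ih => rw [hr, ih (by omega), hq0 l x (hG hl hx), sub_zero]
  let t : ℕ → M.Full →ₗ[k] M.Full := fun i => (M.low i).subtype ∘ₗ g i ∘ₗ q i ∘ₗ r i
  have ht : ∀ i x, t i x ∈ M.low i := fun i x => (g i (q i (r i x))).2
  have htD : ∀ x ∈ G 0, ∀ i, M.fullD (t i x) = r i x - r (i + 1) x := by
    intro x hx i
    rw [hr, sub_sub_cancel]
    refine hg1 i _ ?_
    have := Submodule.sub_mem _ (hr1 x hx i) (hG (Nat.le_succ i) (hq1 i (r i x)))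
    rwa [sub_sub_cancel] at this
  have ht0 : ∀ i, ∀ x ∈ G i, ∀ l < i, t l x = 0 := by
    intro i x hx l hl
    change ((g l (q l (r l x))).1 : M.Full) = 0
    rw [hr2 i x hx l hl.le, hq0 l x (hG hl hx), map_zero]
    rfl
  let s : M.Full →ₗ[k] M.Full := LinearMap.pi fun m =>
    ∑ l ∈ Finset.range (m + 1), LinearMap.proj m ∘ₗ t l
  have hs : ∀ x, s x = lowSum fun l => t l x := by
    intro x
    refine funext fun m => ?_
    change (∑ l ∈ Finset.range (m + 1), LinearMap.proj m ∘ₗ t l) x = _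
    rw [LinearMap.sum_apply]
    rfl
  refine ⟨s, fun x => funext fun m => ?_, fun i => ?_⟩
  · have hx : M.fullD x ∈ G 0 := ⟨x, mem_low_zero x, rfl⟩
    rw [hs, fullD_lowSum (fun l => ht l _) le_rfl]
    simp only [htD _ hx, Pi.sub_apply]
    rw [Finset.sum_range_sub' (fun l => r l (M.fullD x) m)]
    obtain ⟨y, hy, h4⟩ := hr1 _ hx (m + 2)
    have h5 : r (m + 2) (M.fullD x) m = 0 := by
      rw [← h4]
      exact fullD_mem_low hy m (by omega)
    rw [h5, sub_zero]
    rfl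
  · obtain ⟨j, hj⟩ := h i
    refine ⟨j, fun x hx => ?_⟩
    have hx' : M.fullD x ∈ G i := hj _ hx (fullD_fullD x)
    rw [hs]
    intro m hm
    refine Finset.sum_eq_zero fun l hl => ?_
    rw [Finset.mem_range] at hl
    exact congrFun (ht0 i _ hx' l (by omega)) m

lemma exists_fullD_section_parity [CharZero k] (h : ∀ i, ∃ j, ∀ z ∈ M.low j, M.fullD z = 0 →
      ∃ w ∈ M.low i, M.fullD w = z) :
    ∃ s : M.Full →ₗ[k] M.Full, (∀ x, M.fullD (s (M.fullD x)) = M.fullD x) ∧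
      (∀ i, ∃ j, ∀ x, M.fullD x ∈ M.low j → s (M.fullD x) ∈ M.low i) ∧
      ∀ x, s (M.parity x) = - M.parity (s x) := by
  obtain ⟨s, hs, hs'⟩ := exists_fullD_section h
  have h2 : ∀ x, M.parity (M.fullD x) = M.fullD (- M.parity x) := fun x => by
    rw [parity_fullD, map_neg]
  refine ⟨(2⁻¹ : k) • (s - M.parity ∘ₗ s ∘ₗ M.parity), fun x => ?_, fun i => ?_, fun x => ?_⟩
  · simp only [LinearMap.smul_apply, LinearMap.sub_apply, LinearMap.comp_apply, map_smul, map_sub, hs]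
    have h3 : M.fullD (M.parity (s (M.parity (M.fullD x)))) = - M.fullD x := by
      have h4 := parity_fullD (s (M.parity (M.fullD x)))
      rw [h2 x, hs, ← h2, parity_parity] at h4
      exact (neg_neg _).symm.trans (congrArg Neg.neg h4.symm)
    rw [h3, sub_neg_eq_add, ← two_smul k (M.fullD x), smul_smul, inv_mul_cancel₀ two_ne_zero, one_smul]
  · obtain ⟨j, hj⟩ := hs' i
    refine ⟨j, fun x hx => Submodule.smul_mem _ _ (Submodule.sub_mem _ (hj x hx) ?_)⟩
    refine parity_mem_low ?_
    rw [LinearMap.comp_apply, h2]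
    refine hj _ ?_
    rw [← h2]
    exact parity_mem_low hx
  · simp only [LinearMap.smul_apply, LinearMap.sub_apply, LinearMap.comp_apply, map_smul, map_sub,
      parity_parity, smul_sub]
    abel

variable (M) in
/-- A continuous contraction of the periodic complex to its homology. -/
structure PeriodicContraction where
  /-- Representatives of the homology classes. -/
  rep : ∀ ε, M.HP ε →ₗ[k] (M.total periodicShape).cycles ε
  mk_rep : ∀ ε c, Submodule.Quotient.mk (rep ε c) = c
  /-- The projection to the homology. -/
  r : ∀ ε, M.Full →ₗ[k] M.HP ε
  /-- The contracting homotopy. -/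
  h : M.Full →ₗ[k] M.Full
  fullD_h : ∀ x, M.fullD (h x) + h (M.fullD x) =
    x - ∑ ε, extend periodicShape (rep ε (r ε x)).1
  h_parity : ∀ x, h (M.parity x) = - M.parity (h x)
  r_fullD : ∀ ε x, r ε (M.fullD x) = 0
  r_rep : ∀ ε c, r ε (extend periodicShape (rep ε c).1) = c
  r_rep_of_ne : ∀ ε ε' c, ε ≠ ε' → r ε (extend periodicShape (rep ε' c).1) = 0
  r_parity : ∀ ε x, r ε (M.parity x) = GrComplex.sign k ε • r ε x
  h_low : ∀ i, ∃ j, ∀ x ∈ M.low j, h x ∈ M.low i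
  r_low : ∃ j, ∀ x ∈ M.low j, ∀ ε, r ε x = 0

lemma fullD_extend_cycle {ε : ZMod 2} (y : (M.total periodicShape).cycles ε) :
    M.fullD (extend periodicShape y.1) = 0 := by
  rw [fullD_extend (j := ε + 1) (by rw [add_assoc]; exact add_zero ε),
    GrComplex.mem_cycles.1 y.2, map_zero]

lemma classMap_extend {ε : ZMod 2} (y : (M.total periodicShape).cycles ε) :
    M.classMap ε ⟨_, fullD_extend_cycle y⟩ = Submodule.Quotient.mk y := by
  change Submodule.Quotient.mk _ = _
  congr 1
  exact Subtype.ext (restrict_extend _ _)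

lemma classMap_extend_of_ne {ε ε' : ZMod 2} (h : ε ≠ ε') (y : (M.total periodicShape).cycles ε') :
    M.classMap ε ⟨_, fullD_extend_cycle y⟩ = 0 := by
  change Submodule.Quotient.mk _ = _
  rw [Submodule.Quotient.mk_eq_zero, Submodule.mem_comap]
  change restrict periodicShape ε (extend periodicShape y.1) ∈ _
  rw [restrict_extend_of_ne h]
  exact zero_mem _

lemma classMap_congr {ε : ZMod 2} {x y : M.Full} (h : x = y) (hx : M.fullD x = 0) :
    M.classMap ε ⟨x, hx⟩ = M.classMap ε ⟨y, h ▸ hx⟩ := by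
  subst h; rfl

lemma exists_periodicContraction [CharZero k] (h : ∀ i, ∃ j, ∀ z ∈ M.low j, M.fullD z = 0 →
      ∃ w ∈ M.low i, M.fullD w = z) : Nonempty M.PeriodicContraction := by
  obtain ⟨s, hs, hs', hsp⟩ := exists_fullD_section_parity h
  obtain ⟨rep, hrep⟩ := GrComplex.exists_homology_section (M.total periodicShape)
  let c : M.Full →ₗ[k] LinearMap.ker M.fullD :=
    (LinearMap.id - s ∘ₗ M.fullD).codRestrict _ fun x => by
      rw [LinearMap.mem_ker]
      change M.fullD (x - s (M.fullD x)) = 0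
      rw [map_sub, hs, sub_self]
  have hc : ∀ x, (c x).1 = x - s (M.fullD x) := fun x => rfl
  let r : ∀ ε, M.Full →ₗ[k] M.HP ε := fun ε => M.classMap ε ∘ₗ c
  let e : M.Full →ₗ[k] M.Full := ∑ ε, extend periodicShape ∘ₗ Submodule.subtype _ ∘ₗ rep ε ∘ₗ r ε
  have he : ∀ x, e x = ∑ ε, extend periodicShape (rep ε (r ε x)).1 := fun x =>
    LinearMap.sum_apply _ _ _
  have heD : ∀ x, M.fullD (e x) = 0 := fun x => by
    rw [he, map_sum]
    exact Finset.sum_eq_zero fun ε _ => fullD_extend_cycle _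
  have hcD : ∀ x, M.fullD x = 0 → ∀ ε (hx : M.fullD x = 0), r ε x = M.classMap ε ⟨x, hx⟩ := by
    intro x _ ε hx
    change M.classMap ε (c x) = _
    congr 1
    refine Subtype.ext ?_
    rw [hc, hx, map_zero, sub_zero]
  have hrD : ∀ ε x, r ε (M.fullD x) = 0 := fun ε x => by
    rw [hcD _ (fullD_fullD x) ε (fullD_fullD x), classMap_fullD]
  have hr1 : ∀ ε c, r ε (extend periodicShape (rep ε c).1) = c := fun ε c => by
    rw [hcD _ (fullD_extend_cycle _) ε (fullD_extend_cycle _), classMap_extend, hrep]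
  have hr2 : ∀ ε ε' c, ε ≠ ε' → r ε (extend periodicShape (rep ε' c).1) = 0 :=
    fun ε ε' c h => by
      rw [hcD _ (fullD_extend_cycle _) ε (fullD_extend_cycle _), classMap_extend_of_ne h]
  have hre : ∀ ε x, r ε (e x) = r ε x := fun ε x => by
    rw [he, map_sum, Finset.sum_eq_single ε, hr1]
    · exact fun ε' _ h => hr2 _ _ _ h.symm
    · exact fun h => absurd (Finset.mem_univ _) h
  have heq : ∀ x, e (M.fullD x) = 0 := fun x => by
    rw [he]
    exact Finset.sum_eq_zero fun ε _ => by rw [hrD, map_zero]; exact map_zero _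
  have hrange : ∀ x, ∃ w, M.fullD w = x - s (M.fullD x) - e x := by
    intro x
    have h1 : M.fullD (x - s (M.fullD x) - e x) = 0 := by
      rw [map_sub, heD, sub_zero]; exact (c x).2
    refine exists_fullD_eq h1 fun ε => ?_
    have h2 := hcD _ h1 ε h1
    rw [← h2, map_sub, hre, sub_eq_zero]
    change M.classMap ε (c _) = M.classMap ε (c x)
    congr 1
    refine Subtype.ext ?_
    rw [hc, hc, map_sub, hs, sub_self, map_zero, sub_zero]
  have hsD : ∀ x, s (M.fullD (M.parity x)) = M.parity (s (M.fullD x)) := fun x => by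
    rw [← neg_neg (M.fullD _), ← parity_fullD, map_neg, hsp, neg_neg]
  have hrp : ∀ ε x, r ε (M.parity x) = GrComplex.sign k ε • r ε x := by
    intro ε x
    change Submodule.Quotient.mk _ = GrComplex.sign k ε • Submodule.Quotient.mk _
    rw [← Submodule.Quotient.mk_smul]
    congr 1
    refine Subtype.ext ?_
    change restrict periodicShape ε (M.parity x - s (M.fullD (M.parity x))) =
      GrComplex.sign k ε • restrict periodicShape ε (x - s (M.fullD x))
    rw [hsD, ← map_sub, restrict_parity]
  have hep : ∀ x, e (M.parity x) = M.parity (e x) := by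
    intro x
    rw [he, he, map_sum]
    refine Finset.sum_congr rfl fun ε _ => ?_
    rw [parity_extend, hrp, map_smul, Submodule.coe_smul, map_smul]
  have hrl : ∃ j, ∀ x ∈ M.low j, ∀ ε, r ε x = 0 := by
    obtain ⟨j₁, h1⟩ := h 0
    obtain ⟨j₂, h2⟩ := hs' j₁
    refine ⟨max j₁ (j₂ + 1), fun x hx ε => ?_⟩
    have h3 : (c x).1 ∈ M.low j₁ := Submodule.sub_mem _ (low_antitone (le_max_left _ _) hx)
      (h2 x (fullD_mem_low (low_antitone (le_max_right _ _) hx)))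
    obtain ⟨w, -, hw⟩ := h1 _ h3 (c x).2
    exact (classMap_congr hw.symm (c x).2).trans (classMap_fullD ε w)
  refine ⟨⟨rep, hrep, r, s ∘ₗ (LinearMap.id - s ∘ₗ M.fullD - e), fun x => ?_, fun x => ?_, hrD,
    hr1, hr2, hrp, fun i => ?_, hrl⟩⟩
  · obtain ⟨w, hw⟩ := hrange x
    simp only [LinearMap.comp_apply, LinearMap.sub_apply, LinearMap.id_apply, fullD_fullD, heq,
      map_zero, sub_zero]
    rw [← hw, hs, hw, he]
    abel
  · simp only [LinearMap.comp_apply, LinearMap.sub_apply, LinearMap.id_apply]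
    rw [hsD, hep, ← map_sub, ← map_sub, hsp]
  · obtain ⟨j₁, h1⟩ := hs' i
    obtain ⟨j₂, h2⟩ := hs' j₁
    obtain ⟨j₃, h3⟩ := hrl
    refine ⟨max (max j₁ j₃) (j₂ + 1), fun x hx => ?_⟩
    obtain ⟨w, hw⟩ := hrange x
    simp only [LinearMap.comp_apply, LinearMap.sub_apply, LinearMap.id_apply]
    rw [← hw]
    refine h1 w ?_
    rw [hw, he, Finset.sum_eq_zero, sub_zero]
    · exact Submodule.sub_mem _
        (low_antitone ((le_max_left _ _).trans (le_max_left _ _)) hx)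
        (h2 x (fullD_mem_low (low_antitone (le_max_right _ _) hx)))
    · intro ε _
      rw [h3 x (low_antitone ((le_max_right _ _).trans (le_max_left _ _)) hx), map_zero]
      exact map_zero _

end MixedComplex
end HopfCyc

namespace HopfCyc
namespace MixedComplex

variable {k : Type u} [Field k]

/-- Families of elements of `M_p ⊗ N_q` for all `p`, `q`: the completed tensor product of the products of
the components of `M` and `N`. -/
abbrev Grid (M N : MixedComplex.{u, v} k) : Type v := ∀ p q : ℕ, M.X p ⊗[k] N.X q

variable {M N : MixedComplex.{u, v} k}

/-- The family of the elements `y_p ⊗ z_q`. -/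
def box : M.Full →ₗ[k] N.Full →ₗ[k] Grid M N :=
  LinearMap.mk₂ k (fun y z p q => y p ⊗ₜ z q)
    (fun _ _ _ => funext fun _ => funext fun _ => TensorProduct.add_tmul _ _ _)
    (fun _ _ _ => funext fun _ => funext fun _ => rfl)
    (fun _ _ _ => funext fun _ => funext fun _ => TensorProduct.tmul_add _ _ _)
    (fun _ _ _ => funext fun _ => funext fun _ => TensorProduct.tmul_smul _ _ _)

lemma box_apply (y : M.Full) (z : N.Full) (p q : ℕ) : box y z p q = y p ⊗ₜ z q := rfl

variable (M N) in
/-- The families that vanish for `p, q < j`. -/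
def gridLow (j : ℕ) : Submodule k (Grid M N) where
  carrier := {x | ∀ p < j, ∀ q < j, x p q = 0}
  add_mem' hx hy p hp q hq := by
    rw [Pi.add_apply, Pi.add_apply, hx p hp q hq, hy p hp q hq, add_zero]
  zero_mem' _ _ _ _ := rfl
  smul_mem' c x hx p hp q hq := by
    rw [Pi.smul_apply, Pi.smul_apply, hx p hp q hq, smul_zero]

lemma gridLow_antitone {i j : ℕ} (h : i ≤ j) : gridLow M N j ≤ gridLow M N i :=
  fun _ hx p hp q hq => hx p (by omega) q (by omega)

/-- The inclusion of the component `M_m`. -/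
abbrev fullSingle (m : ℕ) : M.X m →ₗ[k] M.Full := LinearMap.single k M.X m

/-- The inclusion of the component `M_p ⊗ N_q`. -/
def gridSingle (p q : ℕ) : M.X p ⊗[k] N.X q →ₗ[k] Grid M N :=
  LinearMap.single k (fun p => ∀ q, M.X p ⊗[k] N.X q) p ∘ₗ
    LinearMap.single k (fun q => M.X p ⊗[k] N.X q) q

lemma gridSingle_tmul (p q : ℕ) (a : M.X p) (b : N.X q) :
    gridSingle p q (a ⊗ₜ b) = box (fullSingle p a) (fullSingle q b) := by
  refine funext fun p' => funext fun q' => ?_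
  rw [box_apply]
  by_cases hp : p' = p
  · subst hp
    by_cases hq : q' = q
    · subst hq
      simp [gridSingle]
    · simp [gridSingle, hq]
  · simp [gridSingle, hp]

lemma sub_sum_gridSingle_mem (j : ℕ) (x : Grid M N) :
    x - ∑ p ∈ Finset.range j, ∑ q ∈ Finset.range j, gridSingle p q (x p q) ∈ gridLow M N j := by
  intro p hp q hq
  rw [Pi.sub_apply, Pi.sub_apply, Finset.sum_apply, Finset.sum_apply, Finset.sum_eq_single p,
    Finset.sum_apply, Finset.sum_apply, Finset.sum_eq_single q]
  · simp [gridSingle]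
  · intro q' _ h
    simp [gridSingle, h.symm]
  · intro h
    exact absurd (Finset.mem_range.2 hq) h
  · intro p' _ h
    rw [Finset.sum_apply, Finset.sum_apply]
    exact Finset.sum_eq_zero fun q' _ => by simp [gridSingle, h.symm]
  · intro h
    exact absurd (Finset.mem_range.2 hp) h

/-- Linear maps that depend on finitely many components only are determined by the values on the
families `y_p ⊗ z_q`. -/
lemma grid_ext {V : Type*} [AddCommGroup V] [Module k V] {T : Grid M N →ₗ[k] V}
    (hT : ∃ j, ∀ x ∈ gridLow M N j, T x = 0) (h : ∀ y z, T (box y z) = 0) (x : Grid M N) :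
    T x = 0 := by
  obtain ⟨j, hj⟩ := hT
  have h1 := hj _ (sub_sum_gridSingle_mem j x)
  rw [map_sub, sub_eq_zero] at h1
  rw [h1, map_sum]
  refine Finset.sum_eq_zero fun p _ => ?_
  rw [map_sum]
  refine Finset.sum_eq_zero fun q _ => ?_
  induction x p q using TensorProduct.induction_on with
  | zero => rw [map_zero, map_zero]
  | add a b ha hb => rw [map_add, map_add, ha, hb, add_zero]
  | tmul a b => rw [gridSingle_tmul, h]

lemma map_eq_sum_single {V : Type*} [AddCommGroup V] [Module k V] {A : M.Full →ₗ[k] V} {j : ℕ}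
    (hA : ∀ x ∈ M.low j, A x = 0) (x : M.Full) :
    A x = ∑ p ∈ Finset.range j, A (fullSingle p (x p)) := by
  rw [← map_sum, ← sub_eq_zero, ← map_sub]
  refine hA _ fun p hp => ?_
  rw [Pi.sub_apply, Finset.sum_apply, Finset.sum_eq_single p]
  · simp
  · intro p' _ h
    simp [h.symm]
  · intro h
    exact absurd (Finset.mem_range.2 hp) h

lemma exists_gridMap {V W : Type*} [AddCommGroup V] [Module k V] [AddCommGroup W] [Module k W]
    {A : M.Full →ₗ[k] V} (hA : ∃ j, ∀ x ∈ M.low j, A x = 0)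
    {B : N.Full →ₗ[k] W} (hB : ∃ j, ∀ x ∈ N.low j, B x = 0) :
    ∃ T : Grid M N →ₗ[k] V ⊗[k] W, (∀ y z, T (box y z) = A y ⊗ₜ B z) ∧
      ∃ j, ∀ x ∈ gridLow M N j, T x = 0 := by
  obtain ⟨j, hj⟩ := hA
  obtain ⟨l, hl⟩ := hB
  refine ⟨∑ p ∈ Finset.range j, ∑ q ∈ Finset.range l,
    TensorProduct.map (A ∘ₗ fullSingle p) (B ∘ₗ fullSingle q) ∘ₗ LinearMap.proj q ∘ₗ
      LinearMap.proj (φ := fun p => ∀ q, M.X p ⊗[k] N.X q) p, fun y z => ?_, max j l, fun x hx => ?_⟩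
  · simp only [LinearMap.sum_apply, LinearMap.comp_apply, LinearMap.proj_apply, box_apply,
      TensorProduct.map_tmul, ← TensorProduct.tmul_sum, ← TensorProduct.sum_tmul]
    rw [map_eq_sum_single hj, map_eq_sum_single hl]
  · simp only [LinearMap.sum_apply, LinearMap.comp_apply, LinearMap.proj_apply]
    refine Finset.sum_eq_zero fun p hp => Finset.sum_eq_zero fun q hq => ?_
    rw [Finset.mem_range] at hp hq
    rw [hx p (by omega) q (by omega), map_zero]

lemma exists_gridEnd {A : M.Full →ₗ[k] M.Full} (hA : ∀ i, ∃ j, ∀ x ∈ M.low j, A x ∈ M.low i)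
    {B : N.Full →ₗ[k] N.Full} (hB : ∀ i, ∃ j, ∀ x ∈ N.low j, B x ∈ N.low i) :
    ∃ T : Grid M N →ₗ[k] Grid M N, (∀ y z, T (box y z) = box (A y) (B z)) ∧
      ∀ i, ∃ j, ∀ x ∈ gridLow M N j, T x ∈ gridLow M N i := by
  have h : ∀ p q, ∃ T : Grid M N →ₗ[k] M.X p ⊗[k] N.X q, (∀ y z, T (box y z) = A y p ⊗ₜ B z q) ∧
      ∃ j, ∀ x ∈ gridLow M N j, T x = 0 := by
    intro p q
    obtain ⟨j, hj⟩ := hA (p + 1)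
    obtain ⟨l, hl⟩ := hB (q + 1)
    exact exists_gridMap (A := LinearMap.proj p ∘ₗ A) (B := LinearMap.proj q ∘ₗ B)
      ⟨j, fun x hx => hj x hx p (by omega)⟩ ⟨l, fun x hx => hl x hx q (by omega)⟩
  choose T hT J hJ using h
  refine ⟨LinearMap.pi fun p => LinearMap.pi fun q => T p q, fun y z =>
    funext fun p => funext fun q => hT p q y z, fun i => ?_⟩
  refine ⟨(Finset.range i).sup fun p => (Finset.range i).sup fun q => J p q,
    fun x hx p hp q hq => hJ p q x (gridLow_antitone ?_ hx)⟩
  exact (Finset.le_sup (f := fun q => J p q) (Finset.mem_range.2 hq)).trans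
    (Finset.le_sup (f := fun p => (Finset.range i).sup fun q => J p q) (Finset.mem_range.2 hp))

variable (M N) in
/-- The projection to the component `M_p ⊗ N_q`. -/
def gridProj (p q : ℕ) : Grid M N →ₗ[k] M.X p ⊗[k] N.X q :=
  LinearMap.proj q ∘ₗ LinearMap.proj (φ := fun p => ∀ q, M.X p ⊗[k] N.X q) p

variable (M N) in
/-- The component of `B ⊗ 1`. -/
def gridBLeft : ∀ p q, Grid M N →ₗ[k] M.X p ⊗[k] N.X q
  | 0, _ => 0
  | p + 1, q => (M.B p).rTensor _ ∘ₗ gridProj M N p q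

variable (M N) in
/-- The component of `1 ⊗ B`. -/
def gridBRight : ∀ p q, Grid M N →ₗ[k] M.X p ⊗[k] N.X q
  | _, 0 => 0
  | p, q + 1 => (N.B q).lTensor _ ∘ₗ gridProj M N p q

variable (M N) in
/-- The differential of the completed tensor product. -/
def gridD : Grid M N →ₗ[k] Grid M N := LinearMap.pi fun p => LinearMap.pi fun q =>
  (M.b p).rTensor _ ∘ₗ gridProj M N (p + 1) q +
    GrComplex.sign k p • (N.b q).lTensor _ ∘ₗ gridProj M N p (q + 1) +
    (gridBLeft M N p q + GrComplex.sign k p • gridBRight M N p q)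

lemma gridD_apply (x : Grid M N) (p q : ℕ) : gridD M N x p q =
    (M.b p).rTensor _ (x (p + 1) q) + GrComplex.sign k p • (N.b q).lTensor _ (x p (q + 1)) +
      (gridBLeft M N p q x + GrComplex.sign k p • gridBRight M N p q x) := rfl

lemma gridD_box (y : M.Full) (z : N.Full) :
    gridD M N (box y z) = box (M.fullD y) z + box (M.parity y) (N.fullD z) := by
  refine funext fun p => funext fun q => ?_
  rw [gridD_apply, Pi.add_apply, Pi.add_apply, box_apply, box_apply, box_apply, box_apply,
    LinearMap.rTensor_tmul, LinearMap.lTensor_tmul, fullD_apply, fullD_apply, parity_apply,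
    TensorProduct.add_tmul, TensorProduct.tmul_add, ← TensorProduct.smul_tmul',
    ← TensorProduct.smul_tmul']
  have h1 : gridBLeft M N p q (box y z) = shiftB y p ⊗ₜ z q := by
    obtain _ | p := p
    · exact (TensorProduct.zero_tmul _ _).symm
    · rfl
  have h2 : gridBRight M N p q (box y z) = y p ⊗ₜ shiftB z q := by
    obtain _ | q := q
    · obtain _ | p := p <;> exact (TensorProduct.tmul_zero _ _).symm
    · obtain _ | p := p <;> rfl
  rw [h1, h2]
  abel

lemma gridD_mem_gridLow {j : ℕ} {x : Grid M N} (hx : x ∈ gridLow M N (j + 1)) :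
    gridD M N x ∈ gridLow M N j := by
  intro p hp q hq
  rw [gridD_apply, hx (p + 1) (by omega) q (by omega), hx p (by omega) (q + 1) (by omega)]
  have h1 : gridBLeft M N p q x = 0 := by
    obtain _ | p := p
    · rfl
    · change (M.B p).rTensor _ (x p q) = 0
      rw [hx p (by omega) q (by omega), map_zero]
  have h2 : gridBRight M N p q x = 0 := by
    obtain _ | q := q
    · obtain _ | p := p <;> rfl
    · obtain _ | p := p
      · change (N.B q).lTensor _ (x 0 q) = 0
        rw [hx 0 (by omega) q (by omega), map_zero]
      · change (N.B q).lTensor _ (x (p + 1) q) = 0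
        rw [hx (p + 1) (by omega) q (by omega), map_zero]
  rw [h1, h2]
  simp

variable (M N) in
/-- The projection to the periodic complex of the tensor product. -/
def gridRestrict (ε : ZMod 2) : Grid M N →ₗ[k] (M.tensor N).TotX periodicShape ε :=
  LinearMap.pi fun _ => LinearMap.pi fun e => gridProj M N e.1.1 e.1.2

lemma total_ext {ε : ZMod 2} {x y : (M.tensor N).TotX periodicShape ε}
    (h : ∀ p q hm, M.comp N periodicShape p q hm x = M.comp N periodicShape p q hm y) : x = y := by
  refine funext fun ⟨m, hm⟩ => funext fun ⟨⟨p, q⟩, e⟩ => ?_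
  rw [comp_eq M N periodicShape p q m e hm x, comp_eq M N periodicShape p q m e hm y, h]

lemma comp_gridRestrict {ε : ZMod 2} (p q : ℕ) (hm : periodicShape.mem ε (p + q)) (x : Grid M N) :
    M.comp N periodicShape p q hm (gridRestrict M N ε x) = x p q := rfl

lemma total_d_gridRestrict {i j : ZMod 2} (h : j + 1 = i) (x : Grid M N) :
    ((M.tensor N).total periodicShape).d i j h (gridRestrict M N i x) =
      gridRestrict M N j (gridD M N x) := by
  refine total_ext fun p q hm => ?_
  rw [total_tensor_d, comp_gridRestrict, comp_gridRestrict, comp_gridRestrict, gridD_apply]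
  obtain _ | p := p <;> obtain _ | q := q <;> rfl

open Classical in
variable (M N) in
/-- The extension of an element of the periodic complex of the tensor product by zero. -/
noncomputable def gridExtend (ε : ZMod 2) : (M.tensor N).TotX periodicShape ε →ₗ[k] Grid M N :=
  LinearMap.pi fun p => LinearMap.pi fun q =>
    if h : periodicShape.mem ε (p + q) then M.comp N periodicShape p q h else 0

lemma gridExtend_mem {ε : ZMod 2} (x : (M.tensor N).TotX periodicShape ε) {p q : ℕ}
    (h : periodicShape.mem ε (p + q)) : gridExtend M N ε x p q = M.comp N periodicShape p q h x := by
  rw [gridExtend, LinearMap.pi_apply, LinearMap.pi_apply, dif_pos h]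

lemma gridExtend_not_mem {ε : ZMod 2} (x : (M.tensor N).TotX periodicShape ε) {p q : ℕ}
    (h : ¬ periodicShape.mem ε (p + q)) : gridExtend M N ε x p q = 0 := by
  rw [gridExtend, LinearMap.pi_apply, LinearMap.pi_apply, dif_neg h]
  rfl

lemma gridRestrict_gridExtend {ε : ZMod 2} (x : (M.tensor N).TotX periodicShape ε) :
    gridRestrict M N ε (gridExtend M N ε x) = x :=
  total_ext fun p q hm => by rw [comp_gridRestrict, gridExtend_mem]

lemma gridExtend_gridRestrict {ε : ZMod 2} {x : Grid M N}
    (hx : ∀ p q, ¬ periodicShape.mem ε (p + q) → x p q = 0) :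
    gridExtend M N ε (gridRestrict M N ε x) = x := by
  refine funext fun p => funext fun q => ?_
  by_cases h : periodicShape.mem ε (p + q)
  · rw [gridExtend_mem _ h, comp_gridRestrict]
  · rw [gridExtend_not_mem _ h, hx p q h]

lemma gridD_gridExtend {i j : ZMod 2} (h : j + 1 = i) (x : (M.tensor N).TotX periodicShape i) :
    gridD M N (gridExtend M N i x) =
      gridExtend M N j (((M.tensor N).total periodicShape).d i j h x) := by
  conv_rhs => rw [← gridRestrict_gridExtend x, total_d_gridRestrict]
  refine (gridExtend_gridRestrict fun p q hpq => ?_).symm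
  have h0 : ∀ m : ℕ, periodicShape.mem i (m + 1) → periodicShape.mem j m := fun m hm => by
    have h2 : ((m + 1 : ℕ) : ZMod 2) = i := hm
    change (m : ZMod 2) = j
    rw [← h, Nat.cast_add, Nat.cast_one] at h2
    exact add_right_cancel h2
  have h1 : ∀ m : ℕ, m + 1 = p + q → ¬ periodicShape.mem i m := fun m hm hm' => hpq (by
    rw [← hm]
    change ((m + 1 : ℕ) : ZMod 2) = j
    have h2 : (m : ZMod 2) = i := hm'
    rw [Nat.cast_add, Nat.cast_one, h2, ← h, add_assoc]
    exact add_zero j)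
  rw [gridD_apply, gridExtend_not_mem, gridExtend_not_mem]
  · have h2 : gridBLeft M N p q (gridExtend M N i x) = 0 := by
      obtain _ | p := p
      · rfl
      · change (M.B p).rTensor _ (gridExtend M N i x p q) = 0
        rw [gridExtend_not_mem x (h1 _ (by omega)), map_zero]
    have h3 : gridBRight M N p q (gridExtend M N i x) = 0 := by
      obtain _ | q := q
      · obtain _ | p := p <;> rfl
      · have h4 : gridBRight M N p (q + 1) (gridExtend M N i x) =
            (N.B q).lTensor _ (gridExtend M N i x p q) := by
          obtain _ | p := p <;> rfl
        rw [h4, gridExtend_not_mem x (h1 _ (by omega)), map_zero]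
    rw [h2, h3]
    simp
  · exact fun h2 => hpq (h0 _ h2)
  · exact fun h2 => hpq (h0 _ (by rwa [add_right_comm] at h2))

end MixedComplex
end HopfCyc

namespace HopfCyc
variable {k : Type u} [Field k]

/-- Maps lift uniquely along bijective linear maps. -/
lemma existsUnique_lift {V W Z : Type*} [AddCommMonoid V] [Module k V] [AddCommMonoid W] [Module k W]
    [AddCommMonoid Z] [Module k Z] (f : W →ₗ[k] Z) (hf : Function.Bijective f) (g : V →ₗ[k] Z) :
    ∃! l : V →ₗ[k] W, ∀ z, f (l z) = g z := by
  refine ⟨(LinearEquiv.ofBijective f hf).symm.toLinearMap ∘ₗ g, fun z => ?_, fun l hl => ?_⟩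
  · exact (LinearEquiv.ofBijective f hf).apply_symm_apply (g z)
  · refine LinearMap.ext fun z => hf.1 ((hl z).trans ?_)
    exact ((LinearEquiv.ofBijective f hf).apply_symm_apply (g z)).symm

namespace MixedComplex

variable {M N : MixedComplex.{u, v} k}

namespace PeriodicContraction

/-- The family of chains that represents a homology class. -/
noncomputable def inc (P : M.PeriodicContraction) (ε : ZMod 2) : M.HP ε →ₗ[k] M.Full :=
  extend periodicShape ∘ₗ Submodule.subtype _ ∘ₗ P.rep ε

lemma fullD_inc (P : M.PeriodicContraction) (ε : ZMod 2) (c : M.HP ε) : M.fullD (P.inc ε c) = 0 :=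
  fullD_extend_cycle _

/-- The projection to the representatives of the homology. -/
noncomputable def e (P : M.PeriodicContraction) : M.Full →ₗ[k] M.Full := ∑ ε, P.inc ε ∘ₗ P.r ε

lemma e_apply (P : M.PeriodicContraction) (x : M.Full) : P.e x = ∑ ε, P.inc ε (P.r ε x) :=
  LinearMap.sum_apply _ _ _

lemma fullD_e (P : M.PeriodicContraction) (x : M.Full) : M.fullD (P.e x) = 0 := by
  rw [e_apply, map_sum]
  exact Finset.sum_eq_zero fun ε _ => P.fullD_inc ε _

lemma e_fullD (P : M.PeriodicContraction) (x : M.Full) : P.e (M.fullD x) = 0 := by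
  rw [e_apply]
  exact Finset.sum_eq_zero fun ε _ => by rw [P.r_fullD, map_zero]

lemma e_parity (P : M.PeriodicContraction) (x : M.Full) : P.e (M.parity x) = M.parity (P.e x) := by
  rw [e_apply, e_apply, map_sum]
  refine Finset.sum_congr rfl fun ε _ => ?_
  rw [P.r_parity, map_smul]
  exact (parity_extend _).symm

lemma fullD_h_add (P : M.PeriodicContraction) (x : M.Full) :
    M.fullD (P.h x) + P.h (M.fullD x) = x - P.e x := by
  rw [e_apply]
  exact P.fullD_h x

lemma e_low (P : M.PeriodicContraction) (i : ℕ) : ∃ j, ∀ x ∈ M.low j, P.e x ∈ M.low i := by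
  obtain ⟨j, hj⟩ := P.r_low
  refine ⟨j, fun x hx => ?_⟩
  rw [e_apply, Finset.sum_eq_zero fun ε _ => by rw [hj x hx, map_zero]]
  exact zero_mem _

variable (P : M.PeriodicContraction) (Q : N.PeriodicContraction)

/-- The family of chains that represents a tensor product of homology classes. -/
noncomputable def incTensor (a b : ZMod 2) : M.HP a ⊗[k] N.HP b →ₗ[k] Grid M N :=
  TensorProduct.lift (box.compl₁₂ (P.inc a) (Q.inc b))

lemma incTensor_tmul (a b : ZMod 2) (α : M.HP a) (β : N.HP b) :
    incTensor P Q a b (α ⊗ₜ β) = box (P.inc a α) (Q.inc b β) := rfl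

/-- The family of chains that represents a sum of tensor products of homology classes. -/
noncomputable def incSum : (∀ a b : ZMod 2, M.HP a ⊗[k] N.HP b) →ₗ[k] Grid M N :=
  ∑ a, ∑ b, incTensor P Q a b ∘ₗ LinearMap.proj b ∘ₗ
    LinearMap.proj (φ := fun a => ∀ b : ZMod 2, M.HP a ⊗[k] N.HP b) a

lemma incSum_apply (w : ∀ a b : ZMod 2, M.HP a ⊗[k] N.HP b) :
    incSum P Q w = ∑ a, ∑ b, incTensor P Q a b (w a b) := by
  simp only [incSum, LinearMap.sum_apply]
  rfl

lemma incTensor_apply (a b : ZMod 2) (t : M.HP a ⊗[k] N.HP b) (p q : ℕ) :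
    incTensor P Q a b t p q =
      TensorProduct.map (LinearMap.proj p ∘ₗ P.inc a) (LinearMap.proj q ∘ₗ Q.inc b) t := by
  induction t using TensorProduct.induction_on with
  | zero => rw [map_zero, map_zero]; rfl
  | add x y hx hy => rw [map_add, map_add, ← hx, ← hy]; rfl
  | tmul α β => rfl

lemma proj_inc_of_ne {ε : ZMod 2} {m : ℕ} (h : ε ≠ (m : ZMod 2)) :
    LinearMap.proj m ∘ₗ P.inc ε = 0 :=
  LinearMap.ext fun _ => extend_not_mem _ _ fun hm => h (Eq.symm hm)

lemma proj_inc (m : ℕ) : LinearMap.proj m ∘ₗ P.inc (m : ZMod 2) =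
    M.projTot periodicShape m rfl ∘ₗ Submodule.subtype _ ∘ₗ P.rep (m : ZMod 2) :=
  LinearMap.ext fun _ => extend_mem _ _ (rfl : periodicShape.mem (m : ZMod 2) m)

lemma incSum_comp (w : ∀ a b : ZMod 2, M.HP a ⊗[k] N.HP b) (p q : ℕ) :
    incSum P Q w p q = TensorProduct.map (LinearMap.proj p ∘ₗ P.inc (p : ZMod 2))
      (LinearMap.proj q ∘ₗ Q.inc (q : ZMod 2)) (w (p : ZMod 2) (q : ZMod 2)) := by
  rw [incSum_apply, Finset.sum_apply, Finset.sum_apply, Finset.sum_eq_single (p : ZMod 2),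
    Finset.sum_apply, Finset.sum_apply, Finset.sum_eq_single (q : ZMod 2), incTensor_apply]
  · intro b _ h
    rw [incTensor_apply, proj_inc_of_ne Q h, TensorProduct.map_zero_right]; rfl
  · exact fun h => absurd (Finset.mem_univ _) h
  · intro a _ h
    rw [Finset.sum_apply, Finset.sum_apply]
    refine Finset.sum_eq_zero fun b _ => ?_
    rw [incTensor_apply, proj_inc_of_ne P h, TensorProduct.map_zero_left]; rfl
  · exact fun h => absurd (Finset.mem_univ _) h

/-- The map `∇` on the representatives of the homology classes. -/
lemma nablaMap_representative (ε : ZMod 2) (w : ∀ a b : ZMod 2, M.HP a ⊗[k] N.HP b) :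
    M.nablaMap N ε (GrComplex.representative (M.total periodicShape) (N.total periodicShape)
      P.rep Q.rep ε fun e => w e.1.1 e.1.2) = gridRestrict M N ε (incSum P Q w) := by
  refine total_ext fun p q hm => ?_
  have h : (p : ZMod 2) + (q : ZMod 2) = ε := by
    rw [← Nat.cast_add]; exact hm
  rw [comp_nablaMap M N h p q rfl rfl, comp_gridRestrict, incSum_comp, proj_inc, proj_inc,
    TensorProduct.map_comp]
  rfl

lemma exists_gridContraction : ∃ L : Grid M N →ₗ[k] (∀ a b : ZMod 2, M.HP a ⊗[k] N.HP b),
    (∀ x, ∃ y y' : Grid M N, x = gridD M N y + y' + incSum P Q (L x) ∧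
      (gridD M N x = 0 → y' = 0)) ∧
    (∀ x, L (gridD M N x) = 0) ∧ ∀ w, L (incSum P Q w) = w := by
  have hid : ∀ i, ∃ j, ∀ x ∈ N.low j, (LinearMap.id : N.Full →ₗ[k] N.Full) x ∈ N.low i :=
    fun i => ⟨i, fun x hx => hx⟩
  have hep : ∀ i, ∃ j, ∀ x ∈ M.low j, (P.e ∘ₗ M.parity) x ∈ M.low i := fun i => by
    obtain ⟨j, hj⟩ := P.e_low i
    exact ⟨j, fun x hx => hj _ (parity_mem_low hx)⟩
  obtain ⟨T₁, hT₁, hc₁⟩ := exists_gridEnd P.h_low hid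
  obtain ⟨T₂, hT₂, hc₂⟩ := exists_gridEnd hep Q.h_low
  have hr : ∀ a b, ∃ T : Grid M N →ₗ[k] M.HP a ⊗[k] N.HP b,
      (∀ y z, T (box y z) = P.r a y ⊗ₜ Q.r b z) ∧ ∃ j, ∀ x ∈ gridLow M N j, T x = 0 := by
    intro a b
    obtain ⟨j, hj⟩ := P.r_low
    obtain ⟨l, hl⟩ := Q.r_low
    exact exists_gridMap ⟨j, fun x hx => hj x hx a⟩ ⟨l, fun x hx => hl x hx b⟩
  choose R hR J hJ using hr
  let L : Grid M N →ₗ[k] (∀ a b : ZMod 2, M.HP a ⊗[k] N.HP b) :=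
    LinearMap.pi fun a => LinearMap.pi fun b => R a b
  have hLbox : ∀ y z, incSum P Q (L (box y z)) = box (P.e y) (Q.e z) := by
    intro y z
    rw [incSum_apply, e_apply, e_apply, map_sum box, LinearMap.sum_apply]
    refine Finset.sum_congr rfl fun a _ => ?_
    rw [map_sum]
    refine Finset.sum_congr rfl fun b _ => ?_
    exact (congrArg _ (hR a b y z)).trans (incTensor_tmul P Q a b _ _)
  have hLlow : ∃ j, ∀ x ∈ gridLow M N j, L x = 0 := by
    refine ⟨Finset.univ.sup fun a => Finset.univ.sup fun b => J a b, fun x hx =>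
      funext fun a => funext fun b => hJ a b x (gridLow_antitone ?_ hx)⟩
    exact (Finset.le_sup (f := fun b => J a b) (Finset.mem_univ b)).trans
      (Finset.le_sup (f := fun a => Finset.univ.sup fun b => J a b) (Finset.mem_univ a))
  let H := T₁ + T₂
  have hH : ∀ i, ∃ j, ∀ x ∈ gridLow M N j, H x ∈ gridLow M N i := by
    intro i
    obtain ⟨j, hj⟩ := hc₁ i
    obtain ⟨l, hl⟩ := hc₂ i
    exact ⟨max j l, fun x hx => Submodule.add_mem _
      (hj x (gridLow_antitone (le_max_left _ _) hx)) (hl x (gridLow_antitone (le_max_right _ _) hx))⟩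
  have hHbox : ∀ y z, H (box y z) = box (P.h y) z + box (P.e (M.parity y)) (Q.h z) := fun y z => by
    change T₁ _ + T₂ _ = _
    rw [hT₁, hT₂]
    rfl
  let F : Grid M N →ₗ[k] Grid M N := gridD M N ∘ₗ H + H ∘ₗ gridD M N + incSum P Q ∘ₗ L - LinearMap.id
  have hF : ∀ x, F x = gridD M N (H x) + H (gridD M N x) + incSum P Q (L x) - x := fun x => rfl
  have key : ∀ x, F x = 0 := by
    intro x
    refine funext fun p => funext fun q => ?_
    refine grid_ext (T := gridProj M N p q ∘ₗ F) ?_ (fun y z => ?_) x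
    · obtain ⟨j₁, h1⟩ := hH (max p q + 1 + 1)
      obtain ⟨j₂, h2⟩ := hLlow
      refine ⟨max (max (max p q + 1) (j₁ + 1)) j₂, fun x hx => ?_⟩
      have hx1 : x ∈ gridLow M N (max p q + 1) :=
        gridLow_antitone ((le_max_left _ _).trans (le_max_left _ _)) hx
      have hx2 : x ∈ gridLow M N (j₁ + 1) :=
        gridLow_antitone ((le_max_right _ _).trans (le_max_left _ _)) hx
      have hx3 := h2 x (gridLow_antitone (le_max_right _ _) hx)
      have h3 : F x ∈ gridLow M N (max p q + 1) := by
        rw [hF, hx3, map_zero, add_zero]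
        exact Submodule.sub_mem _ (Submodule.add_mem _
          (gridD_mem_gridLow (h1 x (gridLow_antitone (Nat.le_succ _) hx2)))
          (gridLow_antitone (Nat.le_succ _) (h1 _ (gridD_mem_gridLow hx2)))) hx1
      exact h3 p (by omega) q (by omega)
    · have h0 : F (box y z) = 0 := by
        rw [hF, hLbox, hHbox, gridD_box, map_add, map_add, hHbox, hHbox, gridD_box, gridD_box,
          fullD_e, parity_parity, P.e_parity, P.e_parity, parity_parity, e_fullD, P.h_parity]
        have h1 := congrArg (fun t => box t z) (P.fullD_h_add y)
        have h2 := congrArg (box (P.e y)) (Q.fullD_h_add z)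
        simp only [map_add, map_sub, LinearMap.add_apply, LinearMap.sub_apply] at h1 h2
        simp only [map_neg, map_zero, LinearMap.neg_apply, LinearMap.zero_apply]
        rw [eq_sub_of_add_eq h1, eq_sub_of_add_eq h2]
        abel
      change gridProj M N p q (F (box y z)) = 0
      rw [h0, map_zero]
  refine ⟨L, fun x => ⟨H x, H (gridD M N x), ?_, fun h => by rw [h, map_zero]⟩, fun x => ?_,
    fun w => ?_⟩
  · have := key x
    rw [hF, sub_eq_zero] at this
    exact this.symm
  · refine grid_ext (V := ∀ a b : ZMod 2, M.HP a ⊗[k] N.HP b)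
      (T := L ∘ₗ gridD M N) ?_ (fun y z => ?_) x
    · obtain ⟨j, hj⟩ := hLlow
      exact ⟨j + 1, fun x hx => hj _ (gridD_mem_gridLow hx)⟩
    · refine funext fun a => funext fun b => ?_
      change R a b (gridD M N (box y z)) = 0
      rw [gridD_box, map_add, hR, hR, P.r_fullD, Q.r_fullD, TensorProduct.zero_tmul,
        TensorProduct.tmul_zero, add_zero]
  · refine funext fun a => funext fun b => ?_
    change R a b (incSum P Q w) = w a b
    have h1 : ∀ a' b' (t : M.HP a' ⊗[k] N.HP b'), (a' ≠ a ∨ b' ≠ b) →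
        R a b (incTensor P Q a' b' t) = 0 := by
      intro a' b' t h
      induction t using TensorProduct.induction_on with
      | zero => rw [map_zero, map_zero]
      | add x y hx hy => rw [map_add, map_add, hx, hy, add_zero]
      | tmul α β =>
        rw [incTensor_tmul, hR]
        rcases h with h | h
        · have := P.r_rep_of_ne a a' α h.symm
          exact (congrArg (· ⊗ₜ[k] _) this).trans (TensorProduct.zero_tmul _ _)
        · have := Q.r_rep_of_ne b b' β h.symm
          exact (congrArg (_ ⊗ₜ[k] ·) this).trans (TensorProduct.tmul_zero _ _)
    have h2 : ∀ t : M.HP a ⊗[k] N.HP b, R a b (incTensor P Q a b t) = t := by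
      intro t
      induction t using TensorProduct.induction_on with
      | zero => rw [map_zero, map_zero]
      | add x y hx hy => rw [map_add, map_add, hx, hy]
      | tmul α β =>
        rw [incTensor_tmul, hR]
        exact congrArg₂ (· ⊗ₜ[k] ·) (P.r_rep a α) (Q.r_rep b β)
    rw [incSum_apply, map_sum, Finset.sum_eq_single a, map_sum, Finset.sum_eq_single b, h2]
    · exact fun b' _ h => h1 _ _ _ (Or.inr h)
    · exact fun h => absurd (Finset.mem_univ _) h
    · intro a' _ h
      rw [map_sum]
      exact Finset.sum_eq_zero fun b' _ => h1 _ _ _ (Or.inl h)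
    · exact fun h => absurd (Finset.mem_univ _) h

end PeriodicContraction

/-- The Künneth theorem for periodic homology. -/
theorem periodic_kunneth_bijective (P : M.PeriodicContraction) (Q : N.PeriodicContraction)
    (ε : ZMod 2) : Function.Bijective ((M.nabla N).onHomology ε ∘ₗ
      GrComplex.kunneth (M.total periodicShape) (N.total periodicShape) ε) := by
  obtain ⟨L, hL, hLD, hLinc⟩ := PeriodicContraction.exists_gridContraction P Q
  have hmem : ∀ w, M.nablaMap N ε (GrComplex.representative (M.total periodicShape)
      (N.total periodicShape) P.rep Q.rep ε w) ∈ ((M.tensor N).total periodicShape).cycles ε :=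
    fun w => GrComplex.mem_cycles.2 fun j h => ((M.nabla N).comm _ _ h _).symm.trans (by
      rw [GrComplex.mem_cycles.1 (GrComplex.representative_mem_cycles _ _ P.rep Q.rep ε w), map_zero])
  have hmk : ∀ w, ((M.nabla N).onHomology ε ∘ₗ
      GrComplex.kunneth (M.total periodicShape) (N.total periodicShape) ε) w =
      Submodule.Quotient.mk ⟨_, hmem w⟩ := by
    intro w
    rw [LinearMap.comp_apply, GrComplex.kunneth_eq_mk _ _ P.rep P.mk_rep Q.rep Q.mk_rep]
    rfl
  have hε : ε + 1 + 1 = ε := by rw [add_assoc]; exact add_zero ε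
  constructor
  · refine fun w₁ w₂ h12 => sub_eq_zero.1 ?_
    have hw := (map_sub _ w₁ w₂).trans (sub_eq_zero.2 h12)
    generalize w₁ - w₂ = w at hw ⊢
    rw [hmk, Submodule.Quotient.mk_eq_zero] at hw
    obtain ⟨y, hy⟩ := hw
    let w' : ∀ a b : ZMod 2, M.HP a ⊗[k] N.HP b := fun a b =>
      if h : a + b = ε then w ⟨(a, b), h⟩ else 0
    have hw' : (fun e : GrComplex.TensorIdx ε => w' e.1.1 e.1.2) = w :=
      funext fun e => dif_pos e.2
    have h1 := PeriodicContraction.nablaMap_representative P Q ε w'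
    rw [hw'] at h1
    have h2 : gridD M N (gridExtend M N (ε + 1) y) = PeriodicContraction.incSum P Q w' := by
      rw [gridD_gridExtend rfl]
      refine (congrArg _ (hy.trans h1)).trans (gridExtend_gridRestrict fun p q hpq => ?_)
      rw [PeriodicContraction.incSum_comp]
      have h3 : w' (p : ZMod 2) (q : ZMod 2) = 0 := dif_neg fun h => hpq (by
        rw [← Nat.cast_add] at h; exact h)
      rw [h3, map_zero]
    have h4 : w' = 0 := by rw [← hLinc w', ← h2, hLD]
    rw [← hw', h4]
    rfl
  · intro c
    obtain ⟨⟨x, hx⟩, rfl⟩ := Submodule.Quotient.mk_surjective _ c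
    have hx' : gridD M N (gridExtend M N ε x) = 0 := by
      rw [gridD_gridExtend hε, GrComplex.mem_cycles.1 hx, map_zero]
    obtain ⟨y, y', h1, h2⟩ := hL (gridExtend M N ε x)
    rw [h2 hx', add_zero] at h1
    refine ⟨fun e => L (gridExtend M N ε x) e.1.1 e.1.2, ?_⟩
    rw [hmk, Submodule.Quotient.eq]
    refine ⟨- gridRestrict M N (ε + 1) y, ?_⟩
    rw [map_neg, total_d_gridRestrict]
    have h3 := PeriodicContraction.nablaMap_representative P Q ε (L (gridExtend M N ε x))
    have h4 := congrArg (gridRestrict M N ε) h1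
    rw [gridRestrict_gridExtend, map_add] at h4
    change _ = M.nablaMap N ε _ - x
    rw [h3, eq_sub_iff_add_eq, neg_add_eq_iff_eq_add]
    exact h4

lemma existsUnique_coproduct_cyclic {Y : GrComplex.{u, v} k ℕ}
    (F : GrComplex.Hom Y ((M.tensor N).total cyclicShape)) (n : ℕ) :
    ∃! cop : Y.Homology n →ₗ[k] (∀ e : GrComplex.TensorIdx n, M.HC e.1.1 ⊗[k] N.HC e.1.2),
      ∀ z, GrComplex.kunneth (M.total cyclicShape) (N.total cyclicShape) n (cop z) =
        (M.kunnethCyclic N).onHomology n (F.onHomology n z) :=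
  existsUnique_lift (GrComplex.kunneth (M.total cyclicShape) (N.total cyclicShape) n)
    (GrComplex.kunneth_bijective _ _ n) ((M.kunnethCyclic N).onHomology n ∘ₗ F.onHomology n)

lemma existsUnique_coproduct_periodic (P : M.PeriodicContraction) (Q : N.PeriodicContraction)
    {Y : GrComplex.{u, v} k (ZMod 2)} (F : GrComplex.Hom Y ((M.tensor N).total periodicShape))
    (ε : ZMod 2) :
    ∃! cop : Y.Homology ε →ₗ[k] (∀ e : GrComplex.TensorIdx ε, M.HP e.1.1 ⊗[k] N.HP e.1.2),
      ∀ z, (M.nabla N).onHomology ε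
        (GrComplex.kunneth (M.total periodicShape) (N.total periodicShape) ε (cop z)) =
          F.onHomology ε z :=
  existsUnique_lift ((M.nabla N).onHomology ε ∘ₗ
    GrComplex.kunneth (M.total periodicShape) (N.total periodicShape) ε) (periodic_kunneth_bijective P Q ε) (F.onHomology ε)

end MixedComplex
end HopfCyc

theorem mainTheorem9 {k : Type u} [Field k] [CharZero k] {H : Type v} [Ring H] [HopfAlgebra k H]
    [Coalgebra.IsCocomm k H] (hS : Function.Bijective (HopfAlgebra.antipode k (A := H)))
    {M : Type v} [AddCommGroup M] [Module k M] [Module H M] [IsScalarTower k H M]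
    (X : SAYD k H M hS) (ψ : M →ₗ[k] M ⊗[k] M)
    (hψ_act : ∀ (h : H) (m : M), ψ (h • m) = tensorAct k H (Coalgebra.comul (R := k) h) (ψ m))
    (hψ_coact : ∀ m : M, TensorProduct.map Coalgebra.comul ψ (X.coact m) =
      tensorCoact k H X.coact (ψ m)) :
    (∀ n, ∀ x ∈ cotensor k H X.coact n,
      PhiT k H ψ (n + 1) x ∈ cotensor k (H ⊗[k] H) (tensorCoact k H X.coact) n) ∧
    ∃ ρ : ∀ n, (hopfCyclic X).C n →ₗ[k] ((hopfCyclic X).prod (hopfCyclic X)).C n,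
      (∀ n (x : cotensor k H X.coact n),
        TensorProduct.map (cotensor k H X.coact n).subtype (cotensor k H X.coact n).subtype
          (ρ n x) = OmegaT k H M (n + 1) (PhiT k H ψ (n + 1) x)) ∧
      (∃ F : GrComplex.Hom (hopfCyclic X).normalized.hochschild
          (GrComplex.tensor (hopfCyclic X).normalized.hochschild
            (hopfCyclic X).normalized.hochschild),
        (∀ n x, F.f n ((hopfCyclic X).toNormalized n x) =
          (hopfCyclic X).AW (hopfCyclic X) n (ρ n x)) ∧
        ∀ n, Function.Bijective (GrComplex.kunneth (hopfCyclic X).normalized.hochschild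
            (hopfCyclic X).normalized.hochschild n) ∧
          ∃! cop : (hopfCyclic X).normalized.HH n →ₗ[k]
              (∀ e : GrComplex.TensorIdx n,
                (hopfCyclic X).normalized.HH e.1.1 ⊗[k] (hopfCyclic X).normalized.HH e.1.2),
            ∀ z, GrComplex.kunneth (hopfCyclic X).normalized.hochschild
              (hopfCyclic X).normalized.hochschild n (cop z) = F.onHomology n z) ∧
      (∃ F : GrComplex.Hom ((hopfCyclic X).normalized.total cyclicShape)
          (((hopfCyclic X).normalized.tensor (hopfCyclic X).normalized).total cyclicShape),
        (∀ n (x : ∀ m : {m : ℕ // cyclicShape.mem n m}, (hopfCyclic X).C m.1),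
          F.f n (fun m => (hopfCyclic X).toNormalized m.1 (x m)) =
            (hopfCyclic X).AWTotal (hopfCyclic X) cyclicShape n (fun m => ρ m.1 (x m))) ∧
        ∀ n, Function.Bijective (GrComplex.kunneth ((hopfCyclic X).normalized.total cyclicShape)
            ((hopfCyclic X).normalized.total cyclicShape) n) ∧
          ∃! cop : (hopfCyclic X).normalized.HC n →ₗ[k]
              (∀ e : GrComplex.TensorIdx n,
                (hopfCyclic X).normalized.HC e.1.1 ⊗[k] (hopfCyclic X).normalized.HC e.1.2),
            ∀ z, GrComplex.kunneth ((hopfCyclic X).normalized.total cyclicShape)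
              ((hopfCyclic X).normalized.total cyclicShape) n (cop z) =
                (MixedComplex.kunnethCyclic (hopfCyclic X).normalized
                  (hopfCyclic X).normalized).onHomology n (F.onHomology n z)) ∧
      ((hopfCyclic X).normalized.MittagLeffler →
        (∀ ε, FiniteDimensional k ((hopfCyclic X).normalized.HP ε)) →
        ∃ F : GrComplex.Hom ((hopfCyclic X).normalized.total periodicShape)
            (((hopfCyclic X).normalized.tensor (hopfCyclic X).normalized).total periodicShape),
          (∀ ε (x : ∀ m : {m : ℕ // periodicShape.mem ε m}, (hopfCyclic X).C m.1),
            F.f ε (fun m => (hopfCyclic X).toNormalized m.1 (x m)) =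
              (hopfCyclic X).AWTotal (hopfCyclic X) periodicShape ε (fun m => ρ m.1 (x m))) ∧
          ∀ ε, Function.Bijective (fun w =>
              (MixedComplex.nabla (hopfCyclic X).normalized
                (hopfCyclic X).normalized).onHomology ε
                (GrComplex.kunneth ((hopfCyclic X).normalized.total periodicShape)
                  ((hopfCyclic X).normalized.total periodicShape) ε w)) ∧
            ∃! cop : (hopfCyclic X).normalized.HP ε →ₗ[k]
                (∀ e : GrComplex.TensorIdx ε,
                  (hopfCyclic X).normalized.HP e.1.1 ⊗[k] (hopfCyclic X).normalized.HP e.1.2),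
              ∀ z, (MixedComplex.nabla (hopfCyclic X).normalized
                (hopfCyclic X).normalized).onHomology ε
                (GrComplex.kunneth ((hopfCyclic X).normalized.total periodicShape)
                  ((hopfCyclic X).normalized.total periodicShape) ε (cop z)) =
                    F.onHomology ε z) := by
  obtain ⟨ρ, hρ⟩ := exists_hopfCyclic_diagonal X ψ hψ_act hψ_coact
  refine ⟨fun n x hx => PhiT_mem _ ψ hψ_coact n x hx, ρ.f, hρ, ?_, ?_, fun hML hfin => ?_⟩
  · obtain ⟨F, hF⟩ := CyclicModule.exists_hochschild_hom ρ
    exact ⟨F, hF, fun n => ⟨GrComplex.kunneth_bijective _ _ n,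
      existsUnique_lift _ (GrComplex.kunneth_bijective _ _ n) (F.onHomology n)⟩⟩
  · obtain ⟨F, hF⟩ := CyclicModule.exists_total_hom ρ cyclicShape
    exact ⟨F, hF, fun n => ⟨GrComplex.kunneth_bijective _ _ n,
      MixedComplex.existsUnique_coproduct_cyclic F n⟩⟩
  · obtain ⟨F, hF⟩ := CyclicModule.exists_total_hom ρ periodicShape
    obtain ⟨P⟩ := MixedComplex.exists_periodicContraction (hML.exists_boundary hfin)
    exact ⟨F, hF, fun ε => ⟨MixedComplex.periodic_kunneth_bijective P P ε,
      MixedComplex.existsUnique_coproduct_periodic P P F ε⟩⟩
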